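/- Let $T>0$, let $\Omega\subset\mathbb R^3$ be open, and for $t\in[0,T]$ let $X(t):\Omega\to\Omega(t):=X(t)(\Omega)\subset\mathbb R^3$ be a $C^\infty$ diffeomorphism with inverse $Y(t)$ that is volume-preserving ($|\det\nabla X|=1$) and such that all derivatives $\partial_t^i\partial_y^\alpha X$ ($i=0,1$, $\alpha\in\mathbb N_0^3$) are bounded on $[0,T]\times\Omega$; for $i=1$ this means that $t\mapsto\partial_y^\alpha X(t,y)$ is Lipschitz on $[0,T]$ uniformly in $y\in\Omega$, so that $\partial_t\partial_y^\alpha X$ exists for a.e. $t$. For $0<t\le T$ put $Q_t=\bigcup_{0<\tau<t}\{\tau\}\times\Omega(\tau)$. Let $u,v\in L^2(0,T;H^1(\Omega(t)))$ be vector fields with values in $\mathbb R^3$ (that is, $u,v$ and their weak spatial gradients are in $L^2(Q_T)$), with $u(t),v(t)\in L^2(\Omega(t))$ for every $t\in[0,T]$. *Regularization.* Let $\xi\in C_c^\infty(\mathbb R)$ with $\xi=1$ in a neighbourhood of $[0,T]$, and let $(j_h)_{h>0}\subset C_c^\infty(\mathbb R)$ be even and nonnegative with support in $(-h,h)$, $\int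 j_h=1$ and $|j_h'|\le Ch^{-2}$ with $C$ independent of $h$ (for instance $j_h(s)=h^{-1}j(s/h)$). For $w\in\{u,v\}$ let $\bar w(t,y)=\nabla Y(t,X(t,y))\,w(t,X(t,y))$ for $t\in[0,T]$, extend it to all $t\in\mathbb R$ by $\xi(t)\bar w(0,y)$ for $t\le0$, $\xi(t)\bar w(t,y)$ for $0<t<T$ and $\xi(t)\bar w(T,y)$ for $t\ge T$, and put $$\bar w^h(t,y)=\int_{\mathbb R}j_h(t-s)\,\bar w(s,y)\,ds,\qquad w^h(t,x)=\nabla X(t,Y(t,x))\,\bar w^h(t,Y(t,x)).$$ Assume that $u(0)$ and $v(0)$ are the initial values of $u$ and $v$ in the following weak sense: for $w\in\{u,v\}$ and every $\varphi\in L^2(\Omega;\mathbb R^3)$, $$\frac1h\int_0^h\int_\Omega\bar w(\tau,y)\cdot\varphi(y)\,dy\,d\tau\to\int_\Omega\bar w(0,y)\cdot\varphi(y)\,dy\qquad(h\to0^+)$$ (this holds, for example, if $t\mapsto w(t)$ is weakly continuous at $t=0$ with values in $L^2$). Below, $\partial_t w^h$ is the weak time derivative on the space-time domain. 1. If $w\in\{u,v\}$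 and $w(0)\in H^1(\Omega(0))$, then for all $t\in(0,T)$ and $0<h<T-t$ the weak derivative $\partial_tw^h$ exists in $L^2(Q_t)$. 2. For a.e. $\tau\in(0,T)$ the function $v(\tau)\cdot u(\tau)$ has a weak gradient $\nabla(v\cdot u)(\tau)$ on $\Omega(\tau)$, and $\nabla(v\cdot u)$ and $\nabla(v\cdot u)\cdot\partial_tX$ are in $L^1(Q_T)$, where $\partial_tX$ is evaluated at $(\tau,Y(\tau,x))$. For almost every $t\in(0,T)$, if $\partial_tu^h$ and $\partial_tv^h$ exist in $L^2(Q_t)$ for all sufficiently small $h>0$ (so that the left-hand side below is well defined), then $$\int_0^t\!\!\int_{\Omega(\tau)}\big(u\cdot\partial_tv^h+v\cdot\partial_tu^h\big)\,dx\,d\tau\;\longrightarrow\;-\int_0^t\!\!\int_{\Omega(\tau)}\nabla(v\cdot u)\cdot\partial_tX\,dx\,d\tau+\int_{\Omega(t)}v(t)\cdot u(t)\,dx-\int_{\Omega(0)}v(0)\cdot u(0)\,dx\qquad(h\to0^+).$$ -/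

import Mathlib

open MeasureTheory Set Filter Topology
open scoped ContDiff RealInnerProductSpace

noncomputable section

namespace MovingDomain

/-- The space `ℝ³` with its Euclidean norm. -/
abbrev R3 : Type := EuclideanSpace ℝ (Fin 3)

/-! ### Weak derivatives and Sobolev classes -/

section Weak

variable {V F : Type*} [NormedAddCommGroup V] [NormedSpace ℝ V] [MeasureSpace V]
  [NormedAddCommGroup F] [NormedSpace ℝ F]

/-- `g` is the weak (distributional) derivative of `f` in the constant direction `e` on the open
set `U`: both are locally integrable on `U`, and `∫_U (∂_e φ) f = - ∫_U φ g` for every test function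
`φ ∈ C_c^∞(U)`. -/
def HasWeakDerivAlong (U : Set V) (f : V → F) (e : V) (g : V → F) : Prop :=
  LocallyIntegrableOn f U ∧ LocallyIntegrableOn g U ∧
    ∀ φ : V → ℝ, ContDiff ℝ ∞ φ → HasCompactSupport φ → tsupport φ ⊆ U →
      ∫ x in U, (fderiv ℝ φ x e) • f x = - ∫ x in U, φ x • g x

/-- `G` is the weak gradient of `f` on the open set `U`: `x ↦ G x e` is the weak derivative of `f`
in every direction `e`. -/
def HasWeakGradient (U : Set V) (f : V → F) (G : V → V →L[ℝ] F) : Prop :=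
  ∀ e : V, HasWeakDerivAlong U f e (fun x => G x e)

/-- `f ∈ H¹(U)`. -/
def MemH1 (U : Set V) (f : V → F) : Prop :=
  MemLp f 2 (volume.restrict U) ∧
    ∃ G : V → V →L[ℝ] F, MemLp G 2 (volume.restrict U) ∧ HasWeakGradient U f G

end Weak

/-! ### Moving domains -/

/-- The moving domain `Ω(t) = X(t)(Ω)`. -/
def domainAt (Ω : Set R3) (X : ℝ → R3 → R3) (t : ℝ) : Set R3 := X t '' Ω

/-- The space-time domain `⋃_{0 < τ < t} {τ} × Ω(τ)`. -/
def spaceTime (Ω : Set R3) (X : ℝ → R3 → R3) (t : ℝ) : Set (ℝ × R3) :=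
  {p | p.1 ∈ Ioo 0 t ∧ p.2 ∈ domainAt Ω X p.1}

/-- The inverse transformation `Y(t, ·) = X(t, ·)⁻¹ : Ω(t) → Ω`. -/
def inverseMap (Ω : Set R3) (X : ℝ → R3 → R3) (t : ℝ) : R3 → R3 :=
  Function.invFunOn (X t) Ω

/-- `X(t) : Ω → Ω(t)`, `t ∈ [0,T]`, is a volume-preserving `C^∞` diffeomorphism for which all the
derivatives `∂_t^i ∂_y^α X`, `i = 0, 1`, are bounded on `[0,T] × Ω`. For `i = 1` this is expressed
by saying that `t ↦ D_y^k X(t, y)` is Lipschitz on `[0,T]`, uniformly in `y ∈ Ω`; that is, it is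
absolutely continuous and its derivative, which exists for almost every `t`, is bounded
(`X ∈ W^{1,∞}(0,T; C^k)` for every `k`). -/
structure IsVolumePreservingTransformation
    (T : ℝ) (Ω : Set R3) (X : ℝ → R3 → R3) : Prop where
  smooth : ∀ t ∈ Icc 0 T, ContDiffOn ℝ ∞ (X t) Ω
  injective : ∀ t ∈ Icc 0 T, InjOn (X t) Ω
  smooth_inverse : ∀ t ∈ Icc 0 T, ContDiffOn ℝ ∞ (inverseMap Ω X t) (domainAt Ω X t)
  volume_preserving : ∀ t ∈ Icc 0 T, ∀ y ∈ Ω, |(fderiv ℝ (X t) y).det| = 1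
  bounded : ∀ k : ℕ, ∃ C : ℝ, ∀ t ∈ Icc 0 T, ∀ y ∈ Ω, ‖iteratedFDeriv ℝ k (X t) y‖ ≤ C
  bounded_time : ∀ k : ℕ, ∃ C : ℝ, ∀ t ∈ Icc 0 T, ∀ s ∈ Icc 0 T, ∀ y ∈ Ω,
    ‖iteratedFDeriv ℝ k (X t) y - iteratedFDeriv ℝ k (X s) y‖ ≤ C * |t - s|

/-- `u ∈ L²(0,T; H¹(Ω(t)))`: `u` is square integrable on the space-time domain, and so is its weak
spatial gradient. -/
def MemL2H1 (T : ℝ) (Ω : Set R3) (X : ℝ → R3 → R3) (u : ℝ → R3 → R3) : Prop :=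
  MemLp (fun p : ℝ × R3 => u p.1 p.2) 2 (volume.restrict (spaceTime Ω X T)) ∧
    ∃ G : ℝ → R3 → R3 →L[ℝ] R3,
      MemLp (fun p : ℝ × R3 => G p.1 p.2) 2 (volume.restrict (spaceTime Ω X T)) ∧
      ∀ᵐ t ∂(volume.restrict (Ioo 0 T)), HasWeakGradient (domainAt Ω X t) (u t) (G t)

/-! ### The regularization in time -/

/-- The Lagrangian velocity `ū(t,y) = ∇Y(t, X(t,y)) u(t, X(t,y))`. -/
def lagrangian (Ω : Set R3) (X : ℝ → R3 → R3) (u : ℝ → R3 → R3) (t : ℝ) (y : R3) : R3 :=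
  fderiv ℝ (inverseMap Ω X t) (X t y) (u t (X t y))

/-- Extension of a function of `t ∈ [0,T]` to `t ∈ ℝ`, with the cut-off function `ξ`. -/
def extendTime (T : ℝ) (ξ : ℝ → ℝ) (w : ℝ → R3 → R3) (t : ℝ) (y : R3) : R3 :=
  if t ≤ 0 then ξ t • w 0 y else if t < T then ξ t • w t y else ξ t • w T y

/-- `ū^h(t,y) = ∫_ℝ j_h(t - s) ū(s,y) ds`, for the extended `ū`. -/
def lagrangianReg (T : ℝ) (Ω : Set R3) (X : ℝ → R3 → R3) (ξ : ℝ → ℝ) (j : ℝ → ℝ → ℝ)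
    (u : ℝ → R3 → R3) (h t : ℝ) (y : R3) : R3 :=
  ∫ s : ℝ, j h (t - s) • extendTime T ξ (lagrangian Ω X u) s y

/-- `u^h(t,x) = ∇X(t, Y(t,x)) ū^h(t, Y(t,x))`. -/
def reg (T : ℝ) (Ω : Set R3) (X : ℝ → R3 → R3) (ξ : ℝ → ℝ) (j : ℝ → ℝ → ℝ)
    (u : ℝ → R3 → R3) (h t : ℝ) (x : R3) : R3 :=
  fderiv ℝ (X t) (inverseMap Ω X t x) (lagrangianReg T Ω X ξ j u h t (inverseMap Ω X t x))

/-- A cut-off function: `ξ ∈ C_c^∞(ℝ)`, `ξ = 1` in a neighbourhood of `[0,T]` (bounds on the range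
of `ξ` play no role and are not imposed). -/
structure IsCutoff (T : ℝ) (ξ : ℝ → ℝ) : Prop where
  smooth : ContDiff ℝ ∞ ξ
  compact : HasCompactSupport ξ
  eq_one : ∀ᶠ s in 𝓝ˢ (Icc 0 T), ξ s = 1

/-- A family of mollifiers `(j_h)_{h > 0}`: smooth, even, nonnegative, supported in `(-h,h)`, with
integral one, and with `|j_h'| ≤ C h⁻²` for a constant `C` independent of `h`, as is the case for
`j_h(s) = h⁻¹ j(s/h)` with a fixed profile `j`. -/
structure IsMollifierFamily (j : ℝ → ℝ → ℝ) : Prop where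
  smooth : ∀ h > 0, ContDiff ℝ ∞ (j h)
  even : ∀ h > 0, ∀ s, j h (-s) = j h s
  nonneg : ∀ h > 0, ∀ s, 0 ≤ j h s
  support : ∀ h > 0, Function.support (j h) ⊆ Ioo (-h) h
  integral : ∀ h > 0, ∫ s, j h s = 1
  deriv_bound : ∃ C : ℝ, ∀ h > 0, ∀ s, |deriv (j h) s| ≤ C / h ^ 2

/-- `u(0)` is the initial value of `u`, in the sense of weak time averages: for every
`w ∈ L²(Ω)`, `h⁻¹ ∫_0^h ∫_Ω ū(τ)·w dy dτ → ∫_Ω ū(0)·w dy` as `h → 0⁺`. This holds in particular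
if `t ↦ u(t)` is weakly continuous at `t = 0` with values in `L²`. -/
def AttainsInitialValue (Ω : Set R3) (X : ℝ → R3 → R3) (u : ℝ → R3 → R3) : Prop :=
  ∀ w : R3 → R3, MemLp w 2 (volume.restrict Ω) →
    Tendsto (fun h : ℝ => h⁻¹ * ∫ τ in (0 : ℝ)..h, ∫ y in Ω, ⟪lagrangian Ω X u τ y, w y⟫)
      (𝓝[>] 0) (𝓝 (∫ y in Ω, ⟪lagrangian Ω X u 0 y, w y⟫))

/-- `D = ∂_t f ∈ L²` in the weak sense on the space-time domain up to time `t`. -/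
def HasL2TimeDeriv (Ω : Set R3) (X : ℝ → R3 → R3) (t : ℝ) (f D : ℝ → R3 → R3) : Prop :=
  HasWeakDerivAlong (spaceTime Ω X t) (fun p : ℝ × R3 => f p.1 p.2) ((1 : ℝ), (0 : R3))
      (fun p => D p.1 p.2) ∧
    MemLp (fun p : ℝ × R3 => D p.1 p.2) 2 (volume.restrict (spaceTime Ω X t))

/-- `∂_t X` as a function of the Eulerian variables, `(∂_t X)(t, Y(t,x))`. -/
def timeDerivX (Ω : Set R3) (X : ℝ → R3 → R3) (t : ℝ) (x : R3) : R3 :=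
  deriv (fun s => X s (inverseMap Ω X t x)) t

end MovingDomain

end

set_option linter.unusedSectionVars false
set_option linter.style.haveILetI false

namespace MovingDomain

/-! ### Square means -/

open scoped ENNReal

/-! In the Lagrangian coordinates y everything lives on the fixed cylinder (0,T) × Ω. With ū =
(∇X)⁻¹ u∘X, and with no Jacobians because X preserves volume, ∫ v·u dx becomes ∫ ⟨M ū, v̄⟩ dy, where
M = (∇X)ᵀ∇X is bounded and Lipschitz in time.

The Eulerian time derivative of a push-forward (∇X w)∘Y is its derivative along trajectories minus
the transport term. Read at (t, y) this is `timeRate`, an expression linear in w and its space-time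
gradient. That it is the weak derivative (`hasL2TimeDeriv_push`) combines two null integrals: the
derivative along trajectories of a compactly supported quantity integrates to zero over the
cylinder, and the transport term integrates to zero at almost every time because the velocity of a
volume-preserving flow is divergence free. Both are shown for smooth w and pass to the limit by
mollification.

Statement 1: if h < T - t, the mollification on (0,t) only sees times below T. There the extended ū
has an L² spatial gradient because the initial value is in H¹, and j_h supplies the time derivative.

Statement 2: in ∂_t v^h, the terms in which no time derivative falls on the field converge strongly
in L². What remains is ∫ ⟨M ū, j_h' * v̄⟩ plus the same with u and v exchanged. By Fubini each such
integral is ∫ j_h'(r) κ(r) dr with a correlation function κ. If κ(r)/r has one-sided limits a and b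
at 0, this tends to -(a + b)/2, since j_h is even and |j_h'| ≤ C/h² (`tendsto_integral_deriv_mul`).
The extended v̄ is cut into three pieces. - On (0,t), symmetrization turns κ into a difference
quotient of M and yields -∫ ⟨∂_t M ū, v̄⟩ (`tendsto_integral_symmetric`); no time regularity of u or
v is used. - After t, κ vanishes for r > 0 and has a slope for r < 0 if t is a Lebesgue point with
values in L². This gives half of ∫ v(t)·u(t), once for each ordering
(`tendsto_integral_deriv_mul_cross`). - Before 0, the weak initial averages give minus half of ∫
v(0)·u(0), again twice (`tendsto_integral_deriv_mul_initial`). The term with ∂_t M and the strongly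
convergent terms combine to -∫ ∇(v·u)·∂_t X by the identity `extGradRate_sub_spaceRate`.

Statement 2 does not assume u(0) in H¹, so the part m_h(t) ζ of u^h that stems from the initial
value (m_h the tail mass of j_h, ζ the push-forward of ū(0)) has no explicit derivative. Its L²
derivative exists by assumption; comparing two values of h shows that it equals -j_h ζ plus an error
supported near t = 0 that tends weakly to zero (`exists_weakDeriv_tail`). -/

theorem eLpNorm_two_sq {α E : Type*} [MeasurableSpace α] {μ : Measure α} [NormedAddCommGroup E]
    (f : α → E) : eLpNorm f 2 μ ^ 2 = ∫⁻ x, ‖f x‖ₑ ^ 2 ∂μ := by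
  have := eLpNorm_nnreal_pow_eq_lintegral (f := f) (μ := μ) (p := 2) two_ne_zero
  simpa using this

/-- Cauchy–Schwarz for k G = k^(1/2) · (k^(1/2) G). For a probability density k it is Jensen's
inequality for the square. -/
theorem lintegral_mul_sq_le {Z : Type*} [MeasurableSpace Z] {ν : Measure Z} {k G : Z → ℝ≥0∞}
    (hk : AEMeasurable k ν) (hG : AEMeasurable G ν) :
    (∫⁻ z, k z * G z ∂ν) ^ 2 ≤ (∫⁻ z, k z ∂ν) * ∫⁻ z, k z * G z ^ 2 ∂ν := by
  have h2 : (2 : ℝ).HolderConjugate 2 := by constructor <;> norm_num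
  have h := ENNReal.lintegral_mul_le_Lp_mul_Lq ν h2 (f := fun z => k z ^ (1 / 2 : ℝ))
    (g := fun z => k z ^ (1 / 2 : ℝ) * G z) (hk.pow_const _) ((hk.pow_const _).mul hG)
  have e1 : ∀ z, k z ^ (1 / 2 : ℝ) * (k z ^ (1 / 2 : ℝ) * G z) = k z * G z := fun z => by
    rw [← mul_assoc, ← ENNReal.rpow_add_of_nonneg _ _ (by norm_num) (by norm_num)]
    norm_num
  have e2 : ∀ z, (k z ^ (1 / 2 : ℝ)) ^ (2 : ℝ) = k z := fun z => by
    rw [← ENNReal.rpow_mul]; norm_num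
  have e3 : ∀ z, (k z ^ (1 / 2 : ℝ) * G z) ^ (2 : ℝ) = k z * G z ^ 2 := fun z => by
    rw [ENNReal.mul_rpow_of_nonneg _ _ (by norm_num), e2]; norm_num
  simp only [Pi.mul_apply, e1, e2, e3] at h
  calc (∫⁻ z, k z * G z ∂ν) ^ 2 ≤ _ := pow_le_pow_left' h 2
    _ = _ := by
      rw [mul_pow, ← ENNReal.rpow_natCast, ← ENNReal.rpow_natCast, ← ENNReal.rpow_mul,
        ← ENNReal.rpow_mul]
      norm_num

/-- Weighted Minkowski inequality for square means. -/
theorem lintegral_enorm_integral_sq_le {α Z E : Type*} [MeasurableSpace α] [MeasurableSpace Z]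
    [NormedAddCommGroup E] [NormedSpace ℝ E]
    {μ : Measure α} {ν : Measure Z} [SFinite μ] [SFinite ν] {F : α × Z → E} {k : Z → ℝ}
    (hF : AEStronglyMeasurable F (μ.prod ν)) (hk : Measurable k) :
    ∫⁻ x, ‖∫ z, k z • F (x, z) ∂ν‖ₑ ^ 2 ∂μ ≤
      (∫⁻ z, ‖k z‖ₑ ∂ν) * ∫⁻ z, ‖k z‖ₑ * ∫⁻ x, ‖F (x, z)‖ₑ ^ 2 ∂μ ∂ν := by
  have hm : AEMeasurable (fun p : α × Z => ‖k p.2‖ₑ * ‖F p‖ₑ ^ 2) (μ.prod ν) :=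
    (hk.comp measurable_snd).enorm.aemeasurable.mul (hF.enorm.pow_const _)
  calc ∫⁻ x, ‖∫ z, k z • F (x, z) ∂ν‖ₑ ^ 2 ∂μ
      ≤ ∫⁻ x, (∫⁻ z, ‖k z‖ₑ ∂ν) * ∫⁻ z, ‖k z‖ₑ * ‖F (x, z)‖ₑ ^ 2 ∂ν ∂μ := by
        apply lintegral_mono_ae
        filter_upwards [hF.prodMk_left] with x hx
        refine le_trans (pow_le_pow_left' (enorm_integral_le_lintegral_enorm _) 2) ?_
        simp_rw [enorm_smul]
        exact lintegral_mul_sq_le hk.enorm.aemeasurable hx.enorm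
    _ = (∫⁻ z, ‖k z‖ₑ ∂ν) * ∫⁻ x, ∫⁻ z, ‖k z‖ₑ * ‖F (x, z)‖ₑ ^ 2 ∂ν ∂μ :=
        lintegral_const_mul'' _ hm.lintegral_prod_right'
    _ = (∫⁻ z, ‖k z‖ₑ ∂ν) * ∫⁻ z, ∫⁻ x, ‖k z‖ₑ * ‖F (x, z)‖ₑ ^ 2 ∂μ ∂ν := by
        rw [lintegral_lintegral_swap hm]
    _ = _ := by
        congr 1
        apply lintegral_congr_ae
        have := hF.prod_swap.prodMk_left
        filter_upwards [this] with z hz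
        exact lintegral_const_mul'' _ (hz.enorm.pow_const _)

section Translation

variable {V E : Type*} [NormedAddCommGroup V] [NormedSpace ℝ V] [FiniteDimensional ℝ V]
  [MeasureSpace V] [BorelSpace V] [(volume : Measure V).IsAddHaarMeasure]
  [NormedAddCommGroup E] [NormedSpace ℝ E]

theorem memLp_translate {f : V → E} (hf : MemLp f 2) (z : V) : MemLp (fun x => f (x - z)) 2 :=
  hf.comp_measurePreserving (measurePreserving_sub_right volume z)

/-- Translations act continuously on L². This is the only source of strong convergence of
mollifications. -/
theorem lintegral_translate_sub_tendsto {f : V → E} (hf : MemLp f 2) :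
    Tendsto (fun z : V => ∫⁻ x, ‖f (x - z) - f x‖ₑ ^ 2) (𝓝 0) (𝓝 0) := by
  haveI : Fact ((1 : ℝ≥0∞) ≤ 2) := ⟨by norm_num⟩
  let sh : C(V, C(V, V)) := ContinuousMap.curry ⟨fun p : V × V => p.2 - p.1, by fun_prop⟩
  have hmp : ∀ z, MeasurePreserving (sh z) (volume : Measure V) volume := fun z =>
    measurePreserving_sub_right volume z
  have h := (continuous_const (y := hf.toLp f)).compMeasurePreservingLp sh.continuous hmp
    (by norm_num)
  have h0 := (h.tendsto 0)
  rw [tendsto_iff_edist_tendsto_0] at h0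
  have e : ∀ z, (edist (Lp.compMeasurePreserving (sh z) (hmp z) (hf.toLp f))
      (Lp.compMeasurePreserving (sh 0) (hmp 0) (hf.toLp f))) ^ 2 =
      ∫⁻ x, ‖f (x - z) - f x‖ₑ ^ 2 := fun z => by
    rw [← eLpNorm_two_sq, Lp.edist_def]
    congr 1
    apply eLpNorm_congr_ae
    have h1 := Lp.coeFn_compMeasurePreserving (hf.toLp f) (hmp z)
    have h2 := Lp.coeFn_compMeasurePreserving (hf.toLp f) (hmp 0)
    have h3 := (hmp z).quasiMeasurePreserving.ae_eq_comp hf.coeFn_toLp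
    have h4 := (hmp 0).quasiMeasurePreserving.ae_eq_comp hf.coeFn_toLp
    filter_upwards [h1, h2, h3, h4] with x h1 h2 h3 h4
    have e0 : sh 0 x = x := by simp [sh]
    have ez : sh z x = x - z := rfl
    simp only [Function.comp, e0, ez, Pi.sub_apply] at *
    rw [h1, h2, h3, h4]
  simp_rw [← e]
  simpa using ENNReal.Tendsto.pow (n := 2) h0

/-- The shear (z, x) ↦ (z, x - θ z) preserves the product measure, so composition with it respects
almost everywhere classes. -/
theorem aestronglyMeasurable_comp_sub {Z : Type*} [MeasurableSpace Z] {ν : Measure Z} [SFinite ν]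
    {f : V → E} (hf : AEStronglyMeasurable f) {θ : Z → V} (hθ : Measurable θ) :
    AEStronglyMeasurable (fun p : V × Z => f (p.1 - θ p.2)) ((volume : Measure V).prod ν) := by
  have hm : MeasurePreserving (fun p : Z × V => (p.1, p.2 - θ p.1)) (ν.prod volume)
      (ν.prod volume) :=
    (MeasurePreserving.id ν).skew_product (by fun_prop)
      (ae_of_all _ fun z => (measurePreserving_sub_right volume (θ z)).map_eq)
  have h := (hf.comp_snd (μ := ν)).comp_measurePreserving hm
  exact h.prod_swap

/-- The parameter space Z and the shift θ are left free so that one statement covers mollification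
in all variables (θ the identity) and in time alone (θ r = (r, 0)). -/
theorem lintegral_enorm_average_sq_le {Z : Type*} [MeasurableSpace Z] {ν : Measure Z} [SFinite ν]
    {f : V → E} (hf : AEStronglyMeasurable f) {θ : Z → V} (hθ : Measurable θ) {k : Z → ℝ}
    (hk : Measurable k) :
    ∫⁻ x, ‖∫ z, k z • f (x - θ z) ∂ν‖ₑ ^ 2 ≤
      (∫⁻ z, ‖k z‖ₑ ∂ν) ^ 2 * ∫⁻ x, ‖f x‖ₑ ^ 2 := by
  refine (lintegral_enorm_integral_sq_le (aestronglyMeasurable_comp_sub hf hθ) hk).trans ?_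
  have : ∀ z, ∫⁻ x, ‖f (x - θ z)‖ₑ ^ 2 = ∫⁻ x, ‖f x‖ₑ ^ 2 := fun z =>
    lintegral_sub_right_eq_self (μ := volume) (fun x => ‖f x‖ₑ ^ 2) (θ z)
  simp only [this]
  rw [lintegral_mul_const _ hk.enorm, sq, mul_assoc]

theorem memLp_average {Z : Type*} [MeasurableSpace Z] {ν : Measure Z} [SFinite ν]
    {f : V → E} (hf : MemLp f 2) {θ : Z → V} (hθ : Measurable θ) {k : Z → ℝ}
    (hk : Measurable k) (hk' : Integrable k ν) :
    MemLp (fun x => ∫ z, k z • f (x - θ z) ∂ν) 2 := by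
  refine ⟨?_, ?_⟩
  · exact ((hk.comp measurable_snd).aestronglyMeasurable.smul
      (aestronglyMeasurable_comp_sub hf.1 hθ)).integral_prod_right'
  · have h := lintegral_enorm_average_sq_le (ν := ν) hf.1 hθ hk
    rw [← eLpNorm_two_sq, ← eLpNorm_two_sq] at h
    have : eLpNorm (fun x => ∫ z, k z • f (x - θ z) ∂ν) 2 volume ^ 2 < ⊤ :=
      h.trans_lt (ENNReal.mul_lt_top (ENNReal.pow_lt_top hk'.2) (ENNReal.pow_lt_top hf.2))
    exact (ENNReal.pow_lt_top_iff.1 this).resolve_right two_ne_zero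

/-- Averages against probability densities concentrating at the origin converge in `L²`. -/
theorem tendsto_eLpNorm_average_sub [CompleteSpace E] {ι Z : Type*} {l : Filter ι} [MeasurableSpace Z]
    {ν : Measure Z}
    [SFinite ν] {f : V → E} (hf : MemLp f 2) {θ : Z → V} (hθ : Measurable θ) {k : ι → Z → ℝ}
    (hk : ∀ᶠ n in l, Measurable (k n) ∧ (∀ z, 0 ≤ k n z) ∧ Integrable (k n) ν ∧ ∫ z, k n z ∂ν = 1)
    (hs : ∀ ε > 0, ∀ᶠ n in l, ∀ z, k n z ≠ 0 → ‖θ z‖ < ε) :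
    Tendsto (fun n => eLpNorm (fun x => (∫ z, k n z • f (x - θ z) ∂ν) - f x) 2) l (𝓝 0) := by
  have key : Tendsto (fun n => ∫⁻ x, ‖(∫ z, k n z • f (x - θ z) ∂ν) - f x‖ₑ ^ 2) l (𝓝 0) := by
    rw [ENNReal.tendsto_nhds_zero]
    intro ε hε
    have h0 := (ENNReal.tendsto_nhds_zero.1 (lintegral_translate_sub_tendsto hf)) ε hε
    obtain ⟨δ, hδ, h0⟩ := Metric.eventually_nhds_iff.1 h0
    filter_upwards [hk, hs δ hδ] with n ⟨hm, hnn, hi, h1⟩ hz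
    have hk1 : ∫⁻ z, ‖k n z‖ₑ ∂ν = 1 := by
      rw [← ofReal_integral_norm_eq_lintegral_enorm hi]
      simp [Real.norm_of_nonneg (hnn _), h1]
    have hae : ∀ᵐ x, (∫ z, k n z • f (x - θ z) ∂ν) - f x =
        ∫ z, k n z • (f (x - θ z) - f x) ∂ν := by
      -- The term f x may be moved under the integral only where the average converges absolutely. A
      -- finite weighted square mean suffices, because k n has total mass one.
      have hfin : ∀ᵐ x, ∫⁻ z, ‖k n z‖ₑ * ‖f (x - θ z)‖ₑ ^ 2 ∂ν < ⊤ := by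
        have hmeas : AEMeasurable (fun p : V × Z => ‖k n p.2‖ₑ * ‖f (p.1 - θ p.2)‖ₑ ^ 2)
            ((volume : Measure V).prod ν) :=
          (hm.comp measurable_snd).enorm.aemeasurable.mul
            ((aestronglyMeasurable_comp_sub hf.1 hθ).enorm.pow_const _)
        refine ae_lt_top' hmeas.lintegral_prod_right' ?_
        rw [lintegral_lintegral_swap hmeas]
        have : ∀ z, ∫⁻ x, ‖k n z‖ₑ * ‖f (x - θ z)‖ₑ ^ 2 = ‖k n z‖ₑ * ∫⁻ x, ‖f x‖ₑ ^ 2 := by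
          intro z
          rw [lintegral_const_mul' _ _ (by simp),
            lintegral_sub_right_eq_self (μ := volume) (fun x => ‖f x‖ₑ ^ 2) (θ z)]
        simp only [this]
        rw [lintegral_mul_const _ hm.enorm, hk1, one_mul, ← eLpNorm_two_sq]
        exact (ENNReal.pow_lt_top hf.2).ne
      filter_upwards [hfin, (aestronglyMeasurable_comp_sub (ν := ν) hf.1 hθ).prodMk_left] with x hx hmx
      have hint : Integrable (fun z => k n z • f (x - θ z)) ν := by
        refine ⟨hm.aestronglyMeasurable.smul hmx, ?_⟩
        have := lintegral_mul_sq_le (ν := ν) hm.enorm.aemeasurable hmx.enorm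
        rw [hk1, one_mul] at this
        have h2 := this.trans_lt hx
        simp only [HasFiniteIntegral, enorm_smul]
        exact (ENNReal.pow_lt_top_iff.1 h2).resolve_right two_ne_zero
      simp_rw [smul_sub]
      rw [integral_sub hint (hi.smul_const _), integral_smul_const, h1, one_smul]
    have hae' : ∫⁻ x, ‖(∫ z, k n z • f (x - θ z) ∂ν) - f x‖ₑ ^ 2 =
        ∫⁻ x, ‖∫ z, k n z • (f (x - θ z) - f x) ∂ν‖ₑ ^ 2 :=
      lintegral_congr_ae (hae.mono fun x hx => by simp only [hx])
    rw [hae']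
    have hF : AEStronglyMeasurable (fun p : V × Z => f (p.1 - θ p.2) - f p.1)
        ((volume : Measure V).prod ν) :=
      (aestronglyMeasurable_comp_sub hf.1 hθ).sub hf.1.comp_fst
    refine (lintegral_enorm_integral_sq_le hF hm).trans ?_
    rw [hk1, one_mul]
    calc ∫⁻ z, ‖k n z‖ₑ * (∫⁻ x, ‖f (x - θ z) - f x‖ₑ ^ 2) ∂ν ≤ ∫⁻ z, ‖k n z‖ₑ * ε ∂ν := by
          apply lintegral_mono
          intro z
          by_cases h : k n z = 0
          · simp [h]
          · have := h0 (y := θ z) (by simpa using hz z h)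
            dsimp only
            gcongr
      _ = ε := by rw [lintegral_mul_const _ hm.enorm, hk1, one_mul]
  simp_rw [← eLpNorm_two_sq] at key
  rw [ENNReal.tendsto_nhds_zero] at key ⊢
  intro ε hε
  filter_upwards [key (ε ^ 2) (by positivity)] with n hn
  exact (ENNReal.pow_le_pow_left_iff two_ne_zero).1 hn
  
end Translation

end MovingDomain

namespace MovingDomain

/-! ### Smooth approximation of weakly differentiable functions -/

theorem contDiff_of_tsupport_subset {V F : Type*} [NormedAddCommGroup V] [NormedSpace ℝ V]
    [NormedAddCommGroup F] [NormedSpace ℝ F] {f : V → F} {U : Set V} {n : ℕ∞ω} (hU : IsOpen U)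
    (hf : ContDiffOn ℝ n f U) (hs : tsupport f ⊆ U) : ContDiff ℝ n f := by
  rw [contDiff_iff_contDiffAt]
  intro x
  by_cases hx : x ∈ tsupport f
  · exact hf.contDiffAt (hU.mem_nhds (hs hx))
  · have := notMem_tsupport_iff_eventuallyEq.1 hx
    exact contDiffAt_const.congr_of_eventuallyEq this

section Mollify

variable {V E : Type*} [NormedAddCommGroup V] [NormedSpace ℝ V] [FiniteDimensional ℝ V]
  [MeasureSpace V] [BorelSpace V] [(volume : Measure V).IsAddHaarMeasure]
  [NormedAddCommGroup E] [NormedSpace ℝ E]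

theorem integral_fderiv_eq_zero_of_hasCompactSupport {f : V → E} (hf : ContDiff ℝ 1 f)
    (hs : HasCompactSupport f) (e : V) : ∫ x, fderiv ℝ f x e = 0 := by
  have hc : Continuous fun x => fderiv ℝ f x e :=
    (hf.continuous_fderiv (by norm_num)).clm_apply continuous_const
  have hi : Integrable (fun x => fderiv ℝ f x e) :=
    hc.integrable_of_hasCompactSupport (hs.fderiv_apply ℝ e)
  have h := integral_smul_fderiv_eq_neg_fderiv_smul_of_integrable (μ := (volume : Measure V))
    (f := fun _ => (1 : ℝ)) (g := f) (v := e)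
    (by simp) (by simpa using hi) (by simpa using hf.continuous.integrable_of_hasCompactSupport hs)
    (by intro x _; fun_prop) (by intro x _; exact hf.differentiable (by norm_num) x)
  simpa using h

/-- Test functions see the smooth mollification of a weakly differentiable function as the
mollification of its weak derivative. -/
theorem fderiv_convolution_eq [CompleteSpace E] {U K' : Set V} (hK' : IsCompact K') (hKU : K' ⊆ U)
    {f g : V → E} (hf : MemLp f 2 (volume.restrict U))
    {e : V} (hfg : HasWeakDerivAlong U f e g) {ρ : V → ℝ} (hρ : ContDiff ℝ ∞ ρ)
    (hc : HasCompactSupport ρ) {x : V} (hx : ∀ z, x - z ∈ tsupport ρ → z ∈ K') :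
    fderiv ℝ (convolution ρ (K'.indicator f) (ContinuousLinearMap.lsmul ℝ ℝ) volume) x e =
      ∫ z, ρ z • K'.indicator g (x - z) := by
  have hKm : MeasurableSet K' := hK'.measurableSet
  have hloc : LocallyIntegrable (K'.indicator f) := by
    have : MemLp (K'.indicator f) 2 :=
      (memLp_indicator_iff_restrict hKm).2 (hf.mono_measure (Measure.restrict_mono hKU le_rfl))
    exact this.locallyIntegrable (by norm_num)
  have h1 : ContDiff ℝ 1 ρ := hρ.of_le (by exact_mod_cast le_top)
  have hd := hc.hasFDerivAt_convolution_left (ContinuousLinearMap.lsmul ℝ ℝ) h1 hloc x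
  have hex := (hc.fderiv ℝ).convolutionExists_left
    (ContinuousLinearMap.precompL V (ContinuousLinearMap.lsmul ℝ ℝ : ℝ →L[ℝ] E →L[ℝ] E))
    (h1.continuous_fderiv (by norm_num)) hloc x
  rw [hd.fderiv, convolution_def, ContinuousLinearMap.integral_apply hex]
  simp only [ContinuousLinearMap.precompL_apply, ContinuousLinearMap.lsmul_apply]
  -- The reflected kernel z ↦ ρ (x - z) is used as test function. By `hx` its support lies in K', so
  -- the truncation by the indicator is invisible at x.
  have hφ : ContDiff ℝ ∞ (fun z => ρ (x - z)) := hρ.comp (by fun_prop)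
  have hφc : HasCompactSupport (fun z => ρ (x - z)) := hc.comp_homeomorph (Homeomorph.subLeft x)
  have hts : tsupport (fun z => ρ (x - z)) ⊆ K' := by
    intro z hz
    apply hx
    have := tsupport_comp_subset_preimage ρ (f := fun z => x - z) (by fun_prop) hz
    exact this
  have h := hfg.2.2 (fun z => ρ (x - z)) hφ hφc (hts.trans hKU)
  have hfd : ∀ z, fderiv ℝ (fun z => ρ (x - z)) z e = - fderiv ℝ ρ (x - z) e := fun z => by
    have h1 : HasFDerivAt (fun z => ρ (x - z)) ((fderiv ℝ ρ (x - z)).comp (-ContinuousLinearMap.id ℝ V)) z :=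
      (h1.differentiable (by norm_num) (x - z)).hasFDerivAt.comp z ((hasFDerivAt_id z).const_sub x)
    rw [h1.fderiv]; simp
  have hzero : ∀ z, z ∉ K' → fderiv ℝ ρ (x - z) = 0 := fun z hz => by
    by_contra hne
    exact hz (hx z (tsupport_fderiv_subset ℝ (subset_tsupport _ hne)))
  have hzero' : ∀ z, z ∉ K' → ρ (x - z) = 0 := fun z hz => by
    by_contra hne
    exact hz (hx z (subset_tsupport _ hne))
  rw [← integral_sub_left_eq_self (fun t => fderiv ℝ ρ t e • K'.indicator f (x - t)) volume x,
    ← integral_sub_left_eq_self (fun t => ρ t • K'.indicator g (x - t)) volume x]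
  simp only [sub_sub_cancel]
  have e1 : ∀ z, fderiv ℝ ρ (x - z) e • K'.indicator f z =
      K'.indicator (fun z => fderiv ℝ ρ (x - z) e • f z) z := fun z => by
    by_cases hz : z ∈ K' <;> simp [hz]
  have e2 : ∀ z, ρ (x - z) • K'.indicator g z = K'.indicator (fun z => ρ (x - z) • g z) z :=
    fun z => by by_cases hz : z ∈ K' <;> simp [hz]
  simp only [e1, e2]
  rw [integral_indicator hKm, integral_indicator hKm,
    setIntegral_eq_integral_of_forall_compl_eq_zero (fun z hz => by simp [hzero z hz]),
    setIntegral_eq_integral_of_forall_compl_eq_zero (fun z hz => by simp [hzero' z hz])]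
  rw [setIntegral_eq_integral_of_forall_compl_eq_zero
      (fun z hz => by simp [hfd, hzero z (fun h => hz (hKU h))]),
    setIntegral_eq_integral_of_forall_compl_eq_zero
      (fun z hz => by simp [hzero' z (fun h => hz (hKU h))])] at h
  simp only [hfd, neg_smul, integral_neg, neg_inj] at h
  exact h

/-- A single sequence approximates f together with all its square integrable weak derivatives.
Truncating f to a compact K' creates jumps at the boundary of K', but kernels of radius smaller than
the distance from K to that boundary never reach them from points of K. -/
theorem exists_smooth_approx [CompleteSpace E] {U K : Set V} (hU : IsOpen U) (hK : IsCompact K) (hKU : K ⊆ U)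
    {f : V → E} (hf : MemLp f 2 (volume.restrict U)) :
    ∃ F : ℕ → V → E, (∀ n, ContDiff ℝ ∞ (F n)) ∧ (∀ n, HasCompactSupport (F n)) ∧
      Tendsto (fun n => eLpNorm (fun x => F n x - f x) 2 (volume.restrict K)) atTop (𝓝 0) ∧
      ∀ e g, MemLp g 2 (volume.restrict U) → HasWeakDerivAlong U f e g →
        Tendsto (fun n => eLpNorm (fun x => fderiv ℝ (F n) x e - g x) 2 (volume.restrict K))
          atTop (𝓝 0) := by
  obtain ⟨K', hK', hKK', hK'U⟩ := exists_compact_between hK hU hKU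
  obtain ⟨δ, hδ, hδK⟩ := hK.exists_cthickening_subset_open isOpen_interior hKK'
  have hKm : MeasurableSet K := hK.measurableSet
  have hKm' : MeasurableSet K' := hK'.measurableSet
  have hL : ∀ {g : V → E}, MemLp g 2 (volume.restrict U) → MemLp (K'.indicator g) 2 := fun hg =>
    (memLp_indicator_iff_restrict hKm').2 (hg.mono_measure (Measure.restrict_mono hK'U le_rfl))
  -- The outer radius δ/(n+1) never exceeds δ, so every term of the sequence stays inside K' when
  -- evaluated on K.
  let b : ℕ → ContDiffBump (0 : V) := fun n =>
    ⟨δ / (2 * (n + 1)), δ / (n + 1), by positivity, by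
      have : (0 : ℝ) < n + 1 := by positivity
      exact div_lt_div_of_pos_left hδ this (by linarith)⟩
  let ρ : ℕ → V → ℝ := fun n => (b n).normed volume
  have hρs : ∀ n, ContDiff ℝ ∞ (ρ n) := fun n => (b n).contDiff_normed
  have hρc : ∀ n, HasCompactSupport (ρ n) := fun n => (b n).hasCompactSupport_normed
  have hρt : ∀ n z, z ∈ tsupport (ρ n) → ‖z‖ ≤ δ / (n + 1) := fun n z hz => by
    have := (b n).tsupport_normed_eq (μ := volume) ▸ hz
    simpa using this
  have hk : ∀ᶠ n in atTop, Measurable (ρ n) ∧ (∀ z, 0 ≤ ρ n z) ∧ Integrable (ρ n) ∧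
      ∫ z, ρ n z = 1 := Eventually.of_forall fun n =>
    ⟨(hρs n).continuous.measurable, fun z => (b n).nonneg_normed z,
      (hρs n).continuous.integrable_of_hasCompactSupport (hρc n), (b n).integral_normed⟩
  have hs : ∀ ε > 0, ∀ᶠ n in atTop, ∀ z, ρ n z ≠ 0 → ‖z‖ < ε := by
    intro ε hε
    have : Tendsto (fun n : ℕ => δ / ((n : ℝ) + 1)) atTop (𝓝 0) :=
      (tendsto_natCast_atTop_atTop.atTop_add tendsto_const_nhds).const_div_atTop δ
    filter_upwards [this.eventually (gt_mem_nhds hε)] with n hn z hz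
    exact (hρt n z (subset_tsupport _ hz)).trans_lt hn
  have conv : ∀ {g : V → E}, MemLp g 2 (volume.restrict U) →
      Tendsto (fun n => eLpNorm (fun x => (∫ z, ρ n z • K'.indicator g (x - z)) -
        K'.indicator g x) 2 (volume.restrict K)) atTop (𝓝 0) := fun hg =>
    tendsto_of_tendsto_of_tendsto_of_le_of_le tendsto_const_nhds
      (tendsto_eLpNorm_average_sub (hL hg) measurable_id hk hs) (fun _ => zero_le)
      (fun n => eLpNorm_mono_measure _ Measure.restrict_le_self)
  have hind : ∀ (g : V → E) x, x ∈ K → K'.indicator g x = g x := fun g x hx =>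
    indicator_of_mem (interior_subset (hKK' hx)) g
  refine ⟨fun n => convolution (ρ n) (K'.indicator f) (ContinuousLinearMap.lsmul ℝ ℝ) volume,
    fun n => ?_, fun n => ?_, ?_, ?_⟩
  · exact (hρc n).contDiff_convolution_left _ (hρs n) ((hL hf).locallyIntegrable (by norm_num))
  · exact (hρc n).convolution _ (HasCompactSupport.intro hK' fun x hx => indicator_of_notMem hx _)
  · refine (conv hf).congr fun n => eLpNorm_congr_ae ?_
    filter_upwards [ae_restrict_mem hKm] with x hx
    simp [convolution_def, hind f x hx]
  · intro e g hg hfg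
    refine (conv hg).congr fun n => eLpNorm_congr_ae ?_
    filter_upwards [ae_restrict_mem hKm] with x hx
    rw [fderiv_convolution_eq hK' hK'U hf hfg (hρs n) (hρc n), hind g x hx]
    intro z hz
    have h1 := hρt n _ hz
    apply interior_subset (hδK _)
    refine Metric.mem_cthickening_of_dist_le z x δ K hx ?_
    rw [dist_comm, dist_eq_norm]
    refine h1.trans (div_le_self hδ.le ?_)
    have : (0 : ℝ) ≤ n := by positivity
    linarith

end Mollify

end MovingDomain

namespace MovingDomain

/-! ### Pairings of square integrable functions -/

section Pairing

open scoped ENNReal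

variable {α E₁ E₂ E₃ : Type*} [MeasurableSpace α] {μ : Measure α}
  [NormedAddCommGroup E₁] [NormedSpace ℝ E₁] [NormedAddCommGroup E₂] [NormedSpace ℝ E₂]
  [NormedAddCommGroup E₃] [NormedSpace ℝ E₃]

theorem aestronglyMeasurable_clm_apply {A : α → E₁ →L[ℝ] E₂} {f : α → E₁}
    (hA : AEStronglyMeasurable A μ) (hf : AEStronglyMeasurable f μ) :
    AEStronglyMeasurable (fun x => A x (f x)) μ :=
  (ContinuousLinearMap.id ℝ (E₁ →L[ℝ] E₂)).aestronglyMeasurable_comp₂ hA hf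

theorem eLpNorm_one_bilin_le {B : α → E₁ →L[ℝ] E₂ →L[ℝ] E₃} {C : ℝ}
    (hBC : ∀ x, ‖B x‖ ≤ C) {f : α → E₁} {g : α → E₂} (hf : AEStronglyMeasurable f μ)
    (hg : AEStronglyMeasurable g μ) :
    eLpNorm (fun x => B x (f x) (g x)) 1 μ ≤ ENNReal.ofReal C * (eLpNorm f 2 μ * eLpNorm g 2 μ) := by
  have h := eLpNorm_le_eLpNorm_mul_eLpNorm_of_nnnorm (p := 2) (q := 2) (r := 1)
    hf.norm hg.norm (fun a b => a * b) 1 (μ := μ) (ae_of_all _ fun x => by simp)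
  calc eLpNorm (fun x => B x (f x) (g x)) 1 μ
      ≤ ENNReal.ofReal C * eLpNorm (fun x => ‖f x‖ * ‖g x‖) 1 μ := by
        refine eLpNorm_le_mul_eLpNorm_of_ae_le_mul (ae_of_all _ fun x => ?_) 1
        rw [Real.norm_of_nonneg (by positivity), ← mul_assoc]
        exact ((B x).le_opNorm₂ _ _).trans (by gcongr; exact hBC x)
    _ ≤ _ := by
        gcongr
        simpa using h

theorem aestronglyMeasurable_bilin {B : α → E₁ →L[ℝ] E₂ →L[ℝ] E₃} {f : α → E₁} {g : α → E₂}
    (hB : AEStronglyMeasurable B μ) (hf : AEStronglyMeasurable f μ)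
    (hg : AEStronglyMeasurable g μ) : AEStronglyMeasurable (fun x => B x (f x) (g x)) μ :=
  aestronglyMeasurable_clm_apply (aestronglyMeasurable_clm_apply hB hf) hg

theorem integrable_bilin {B : α → E₁ →L[ℝ] E₂ →L[ℝ] E₃} {C : ℝ} (hB : AEStronglyMeasurable B μ)
    (hBC : ∀ x, ‖B x‖ ≤ C) {f : α → E₁} {g : α → E₂} (hf : MemLp f 2 μ) (hg : MemLp g 2 μ) :
    Integrable (fun x => B x (f x) (g x)) μ := by
  rw [← memLp_one_iff_integrable]
  refine ⟨aestronglyMeasurable_bilin hB hf.1 hg.1, ?_⟩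
  refine (eLpNorm_one_bilin_le (C := max C 0)
    (fun x => (hBC x).trans (le_max_left _ _)) hf.1 hg.1).trans_lt ?_
  exact ENNReal.mul_lt_top (by simp) (ENNReal.mul_lt_top hf.2 hg.2)

/-- The bounded coefficient B carries test functions and geometric factors, so that every passage to
the limit in the file reduces to strong L² convergence of the two arguments. -/
theorem tendsto_integral_bilin {ι : Type*} {l : Filter ι} {B : α → E₁ →L[ℝ] E₂ →L[ℝ] E₃}
    {C : ℝ} (hB : AEStronglyMeasurable B μ) (hBC : ∀ x, ‖B x‖ ≤ C)
    {F : ι → α → E₁} {G : ι → α → E₂} {f : α → E₁} {g : α → E₂}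
    (hF : ∀ᶠ n in l, MemLp (F n) 2 μ) (hG : ∀ᶠ n in l, MemLp (G n) 2 μ) (hf : MemLp f 2 μ)
    (hg : MemLp g 2 μ)
    (hFf : Tendsto (fun n => eLpNorm (fun x => F n x - f x) 2 μ) l (𝓝 0))
    (hGg : Tendsto (fun n => eLpNorm (fun x => G n x - g x) 2 μ) l (𝓝 0)) :
    Tendsto (fun n => ∫ x, B x (F n x) (G n x) ∂μ) l (𝓝 (∫ x, B x (f x) (g x) ∂μ)) := by
  have hint := integrable_bilin hB hBC hf hg
  refine tendsto_integral_of_L1' _ hint.aestronglyMeasurable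
    ((hF.and hG).mono fun n hn => integrable_bilin hB hBC hn.1 hn.2) ?_
  set C' := max C 0
  have hC' : ∀ x, ‖B x‖ ≤ C' := fun x => (hBC x).trans (le_max_left _ _)
  have hC0 : 0 ≤ C' := le_max_right _ _
  have lim : Tendsto (fun n => ENNReal.ofReal C' * (eLpNorm (fun x => F n x - f x) 2 μ *
      (eLpNorm (fun x => G n x - g x) 2 μ + eLpNorm g 2 μ)) +
      ENNReal.ofReal C' * (eLpNorm f 2 μ * eLpNorm (fun x => G n x - g x) 2 μ)) l (𝓝 0) := by
    have h1 : Tendsto (fun n => eLpNorm (fun x => F n x - f x) 2 μ *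
      (eLpNorm (fun x => G n x - g x) 2 μ + eLpNorm g 2 μ)) l (𝓝 (0 * (0 + eLpNorm g 2 μ))) :=
      ENNReal.Tendsto.mul hFf (Or.inr (by simpa using hg.2.ne)) (hGg.add_const _)
        (Or.inr (by simp))
    have h2 : Tendsto (fun n => eLpNorm f 2 μ * eLpNorm (fun x => G n x - g x) 2 μ) l
        (𝓝 (eLpNorm f 2 μ * 0)) := ENNReal.Tendsto.const_mul hGg (Or.inr hf.2.ne)
    have := (ENNReal.Tendsto.const_mul (a := ENNReal.ofReal C') h1 (Or.inr (by simp))).add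
      (ENNReal.Tendsto.const_mul (a := ENNReal.ofReal C') h2 (Or.inr (by simp)))
    simpa using this
  refine tendsto_of_tendsto_of_tendsto_of_le_of_le' tendsto_const_nhds lim
    (Eventually.of_forall fun _ => zero_le) ?_
  filter_upwards [hF, hG] with n hFn hGn
  have e : (fun x => B x (F n x) (G n x)) - (fun x => B x (f x) (g x)) =
      (fun x => B x (F n x - f x) (G n x)) + fun x => B x (f x) (G n x - g x) := by
    funext x; simp
  rw [e]
  have hd1 := (hFn.1.sub hf.1)
  have hd2 := (hGn.1.sub hg.1)
  refine (eLpNorm_add_le (aestronglyMeasurable_bilin hB hd1 hGn.1)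
    (aestronglyMeasurable_bilin hB hf.1 hd2) le_rfl).trans ?_
  refine add_le_add ((eLpNorm_one_bilin_le hC' hd1 hGn.1).trans ?_)
    (eLpNorm_one_bilin_le hC' hf.1 hd2)
  have : eLpNorm (G n) 2 μ ≤ eLpNorm (fun x => G n x - g x) 2 μ + eLpNorm g 2 μ := by
    calc eLpNorm (G n) 2 μ = eLpNorm ((fun x => G n x - g x) + g) 2 μ := by
          congr 1; funext x; simp
      _ ≤ _ := eLpNorm_add_le hd2 hg.1 (by norm_num)
  gcongr
  rfl

theorem eLpNorm_zero_fun {α E : Type*} [MeasurableSpace α] [NormedAddCommGroup E] (μ : Measure α) :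
    eLpNorm (fun _ => (0 : E)) 2 μ = 0 := eLpNorm_zero' ..

/-- The evaluation pairing (ℓ, x) ↦ ℓ x is itself bilinear, so a fixed L² family ℓ is one of the two
factors. -/
theorem tendsto_integral_clm_apply {ι : Type*} {l : Filter ι} {ℓ : α → E₁ →L[ℝ] E₂}
    (hℓ : MemLp ℓ 2 μ) {F : ι → α → E₁} {f : α → E₁}
    (hF : ∀ᶠ n in l, MemLp (F n) 2 μ) (hf : MemLp f 2 μ)
    (hFf : Tendsto (fun n => eLpNorm (fun x => F n x - f x) 2 μ) l (𝓝 0)) :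
    Tendsto (fun n => ∫ x, ℓ x (F n x) ∂μ) l (𝓝 (∫ x, ℓ x (f x) ∂μ)) :=
  tendsto_integral_bilin (B := fun _ => ContinuousLinearMap.id ℝ (E₁ →L[ℝ] E₂))
    (C := 1) aestronglyMeasurable_const (fun _ => ContinuousLinearMap.norm_id_le)
    (Eventually.of_forall fun _ => hℓ) hF hℓ hf
    (by simp only [sub_self, eLpNorm_zero_fun, tendsto_const_nhds]) hFf

theorem integrable_clm_apply {ℓ : α → E₁ →L[ℝ] E₂}
    (hℓ : MemLp ℓ 2 μ) {f : α → E₁} (hf : MemLp f 2 μ) : Integrable (fun x => ℓ x (f x)) μ :=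
  integrable_bilin (B := fun _ => ContinuousLinearMap.id ℝ (E₁ →L[ℝ] E₂))
    (C := 1) aestronglyMeasurable_const (fun _ => ContinuousLinearMap.norm_id_le) hℓ hf

theorem memLp_clm_apply_of_bound {A : α → E₁ →L[ℝ] E₂} {C : ℝ} (hA : AEStronglyMeasurable A μ)
    (hAC : ∀ x, ‖A x‖ ≤ C) {f : α → E₁} {p : ℝ≥0∞} (hf : MemLp f p μ) :
    MemLp (fun x => A x (f x)) p μ :=
  hf.of_le_mul (c := C) (aestronglyMeasurable_clm_apply hA hf.1) (ae_of_all _ fun x =>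
    ((A x).le_opNorm _).trans (by gcongr; exact hAC x))

end Pairing

/-- The real inner product as a continuous bilinear map. -/
noncomputable def innerBilin (H : Type*) [NormedAddCommGroup H] [InnerProductSpace ℝ H] : H →L[ℝ] H →L[ℝ] ℝ :=
  innerSL ℝ

@[simp]
theorem innerBilin_apply {H : Type*} [NormedAddCommGroup H] [InnerProductSpace ℝ H] (a b : H) :
    innerBilin H a b = ⟪a, b⟫ := rfl

/-! ### Product rule for inner products of weakly differentiable functions. -/

section ProductRule

variable {V H : Type*} [NormedAddCommGroup V] [NormedSpace ℝ V] [FiniteDimensional ℝ V]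
  [MeasureSpace V] [BorelSpace V] [(volume : Measure V).IsAddHaarMeasure]
  [NormedAddCommGroup H] [InnerProductSpace ℝ H] [CompleteSpace H]

theorem memLp_of_continuous_hasCompactSupport {E : Type*} [NormedAddCommGroup E] {f : V → E}
    (hf : Continuous f) (hs : HasCompactSupport f) (s : Set V) :
    MemLp f 2 (volume.restrict s) :=
  (hf.memLp_of_hasCompactSupport hs).restrict s

/-- Product rule for inner products of weakly differentiable functions. -/
theorem HasWeakDerivAlong.inner {U : Set V} (hU : IsOpen U) {u v gu gv : V → H} {e : V}
    (hu : MemLp u 2 (volume.restrict U)) (hv : MemLp v 2 (volume.restrict U))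
    (hgu : MemLp gu 2 (volume.restrict U)) (hgv : MemLp gv 2 (volume.restrict U))
    (hwu : HasWeakDerivAlong U u e gu) (hwv : HasWeakDerivAlong U v e gv) :
    HasWeakDerivAlong U (fun x => ⟪v x, u x⟫) e (fun x => ⟪gv x, u x⟫ + ⟪v x, gu x⟫) := by
  have hint : ∀ {a b : V → H}, MemLp a 2 (volume.restrict U) → MemLp b 2 (volume.restrict U) →
      IntegrableOn (fun x => ⟪a x, b x⟫) U := fun ha hb =>
    integrable_bilin (B := fun _ => innerBilin H) (C := ‖innerBilin H‖)
      aestronglyMeasurable_const (fun _ => le_rfl) ha hb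
  refine ⟨(hint hv hu).locallyIntegrableOn, ((hint hgv hu).add (hint hv hgu)).locallyIntegrableOn,
    fun φ hφ hφc hφU => ?_⟩
  set K := tsupport φ
  have hK : IsCompact K := hφc
  have hr : ∀ {a : V → H}, MemLp a 2 (volume.restrict U) → MemLp a 2 (volume.restrict K) :=
    fun ha => ha.mono_measure (Measure.restrict_mono hφU le_rfl)
  -- Only the support K of the test function matters, so approximation on this compact set is
  -- enough.
  obtain ⟨Fu, hFu, hFuc, hFul, hFud⟩ := exists_smooth_approx hU hK hφU hu
  obtain ⟨Fv, hFv, hFvc, hFvl, hFvd⟩ := exists_smooth_approx hU hK hφU hv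
  have hφ' : Continuous fun x => fderiv ℝ φ x e :=
    (hφ.continuous_fderiv (by norm_num)).clm_apply continuous_const
  obtain ⟨C₁, hC₁⟩ := hφ'.bounded_above_of_compact_support (hφc.fderiv_apply ℝ e)
  obtain ⟨C₂, hC₂⟩ := hφ.continuous.bounded_above_of_compact_support hφc
  set M := ‖innerBilin H‖
  have lim : ∀ {m : V → ℝ} {C : ℝ}, Continuous m → (∀ x, ‖m x‖ ≤ C) →
      ∀ {F G : ℕ → V → H} {f g : V → H}, (∀ n, MemLp (F n) 2 (volume.restrict K)) →
      (∀ n, MemLp (G n) 2 (volume.restrict K)) → MemLp f 2 (volume.restrict U) →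
      MemLp g 2 (volume.restrict U) →
      Tendsto (fun n => eLpNorm (fun x => F n x - f x) 2 (volume.restrict K)) atTop (𝓝 0) →
      Tendsto (fun n => eLpNorm (fun x => G n x - g x) 2 (volume.restrict K)) atTop (𝓝 0) →
      Tendsto (fun n => ∫ x in K, m x * ⟪F n x, G n x⟫) atTop (𝓝 (∫ x in K, m x * ⟪f x, g x⟫)) :=
    fun {m C} hm hmC {F G f g} hF hG hf hg hFf hGg =>
      tendsto_integral_bilin (B := fun x => m x • innerBilin H) (C := C * M)
        (hm.aestronglyMeasurable.smul_const _)
        (fun x => (ContinuousLinearMap.opNorm_smul_le _ _).trans 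
          (mul_le_mul_of_nonneg_right (hmC x) (norm_nonneg _))) (Eventually.of_forall hF)
        (Eventually.of_forall hG) (hr hf) (hr hg) hFf hGg
  have hFu1 : ∀ n, ContDiff ℝ 1 (Fu n) := fun n => (hFu n).of_le (by exact_mod_cast le_top)
  have hFv1 : ∀ n, ContDiff ℝ 1 (Fv n) := fun n => (hFv n).of_le (by exact_mod_cast le_top)
  have hφ1 : ContDiff ℝ 1 φ := hφ.of_le (by exact_mod_cast le_top)
  have mFu : ∀ n, MemLp (Fu n) 2 (volume.restrict K) := fun n =>
    memLp_of_continuous_hasCompactSupport (hFu n).continuous (hFuc n) K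
  have mFv : ∀ n, MemLp (Fv n) 2 (volume.restrict K) := fun n =>
    memLp_of_continuous_hasCompactSupport (hFv n).continuous (hFvc n) K
  have mdFu : ∀ n, MemLp (fun x => fderiv ℝ (Fu n) x e) 2 (volume.restrict K) := fun n =>
    memLp_of_continuous_hasCompactSupport (((hFu1 n).continuous_fderiv (by norm_num)).clm_apply
      continuous_const) ((hFuc n).fderiv_apply ℝ e) K
  have mdFv : ∀ n, MemLp (fun x => fderiv ℝ (Fv n) x e) 2 (volume.restrict K) := fun n =>
    memLp_of_continuous_hasCompactSupport (((hFv1 n).continuous_fderiv (by norm_num)).clm_apply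
      continuous_const) ((hFvc n).fderiv_apply ℝ e) K
  have hintK : ∀ {m : V → ℝ} {C : ℝ}, Continuous m → (∀ x, ‖m x‖ ≤ C) →
      ∀ {f g : V → H}, MemLp f 2 (volume.restrict K) → MemLp g 2 (volume.restrict K) →
      IntegrableOn (fun x => m x * ⟪f x, g x⟫) K := fun {m C} hm hmC {f g} hf hg =>
    integrable_bilin (B := fun x => m x • innerBilin H) (C := C * M)
        (hm.aestronglyMeasurable.smul_const _)
        (fun x => (ContinuousLinearMap.opNorm_smul_le _ _).trans 
          (mul_le_mul_of_nonneg_right (hmC x) (norm_nonneg _))) hf hg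
  -- For the smooth approximants the three terms add up to the integral of the derivative of φ ⟨Fv,
  -- Fu⟩, which has compact support.
  have ident : ∀ n, (∫ x in K, fderiv ℝ φ x e * ⟪Fv n x, Fu n x⟫) +
      ((∫ x in K, φ x * ⟪fderiv ℝ (Fv n) x e, Fu n x⟫) +
        ∫ x in K, φ x * ⟪Fv n x, fderiv ℝ (Fu n) x e⟫) = 0 := fun n => by
    have hs : HasCompactSupport fun x => φ x * ⟪Fv n x, Fu n x⟫ := hφc.mul_right
    have h0 := integral_fderiv_eq_zero_of_hasCompactSupport
      (hφ1.mul ((hFv1 n).inner ℝ (hFu1 n))) hs e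
    have hfd : ∀ x, fderiv ℝ (fun x => φ x * ⟪Fv n x, Fu n x⟫) x e =
        fderiv ℝ φ x e * ⟪Fv n x, Fu n x⟫ + (φ x * ⟪fderiv ℝ (Fv n) x e, Fu n x⟫ +
          φ x * ⟪Fv n x, fderiv ℝ (Fu n) x e⟫) := fun x => by
      have d1 := hφ1.differentiable (by norm_num) x
      have d2 := (hFv1 n).differentiable (by norm_num) x
      have d3 := (hFu1 n).differentiable (by norm_num) x
      rw [fderiv_fun_mul d1 (d2.inner ℝ d3)]
      simp only [add_apply, smul_apply, smul_eq_mul, fderiv_inner_apply ℝ d2 d3]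
      ring
    have hz : ∀ x, x ∉ K → fderiv ℝ (fun x => φ x * ⟪Fv n x, Fu n x⟫) x e = 0 := fun x hx => by
      rw [hfd, image_eq_zero_of_notMem_tsupport hx, fderiv_of_notMem_tsupport ℝ hx]
      simp
    rw [← setIntegral_eq_integral_of_forall_compl_eq_zero hz] at h0
    simp only [hfd] at h0
    have hi2 : IntegrableOn (fun x => φ x * ⟪fderiv ℝ (Fv n) x e, Fu n x⟫ +
        φ x * ⟪Fv n x, fderiv ℝ (Fu n) x e⟫) K :=
      (hintK hφ.continuous hC₂ (mdFv n) (mFu n)).add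
        (hintK hφ.continuous hC₂ (mFv n) (mdFu n))
    rwa [integral_add (hintK hφ' hC₁ (mFv n) (mFu n)) hi2,
      integral_add (hintK hφ.continuous hC₂ (mdFv n) (mFu n))
        (hintK hφ.continuous hC₂ (mFv n) (mdFu n))] at h0
  have L := (lim hφ' hC₁ mFv mFu hv hu hFvl hFul).add
    ((lim hφ.continuous hC₂ mdFv mFu hgv hu (hFvd e gv hgv hwv) hFul).add
      (lim hφ.continuous hC₂ mFv mdFu hv hgu hFvl (hFud e gu hgu hwu)))
  simp only [ident] at L
  have L0 := tendsto_nhds_unique tendsto_const_nhds L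
  have hUK : ∀ {m : V → ℝ}, (∀ x, x ∉ K → m x = 0) →
      ∫ x in U, m x = ∫ x in K, m x := fun {m} hm => by
    rw [setIntegral_eq_integral_of_forall_compl_eq_zero hm,
      setIntegral_eq_integral_of_forall_compl_eq_zero fun x hx => hm x fun h => hx (hφU h)]
  rw [hUK (fun x hx => by rw [fderiv_of_notMem_tsupport ℝ hx]; simp),
    hUK (fun x hx => by rw [image_eq_zero_of_notMem_tsupport hx]; simp)]
  simp only [smul_eq_mul, mul_add]
  rw [integral_add (hintK hφ.continuous hC₂ (hr hgv) (hr hu))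
        (hintK hφ.continuous hC₂ (hr hv) (hr hgu))]
  linarith

end ProductRule

end MovingDomain

namespace MovingDomain

/-! ### Families of functions which are Lipschitz in time -/

instance : (volume : Measure (ℝ × R3)).IsAddHaarMeasure :=
  inferInstanceAs ((volume : Measure ℝ).prod (volume : Measure R3)).IsAddHaarMeasure

/-- The projection of `ℝ` onto `[0,T]`. -/
noncomputable def clamp (T t : ℝ) : ℝ := max 0 (min T t)

theorem clamp_mem {T : ℝ} (hT : 0 ≤ T) (t : ℝ) : clamp T t ∈ Icc 0 T :=
  ⟨le_max_left _ _, max_le hT (min_le_left _ _)⟩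

theorem clamp_of_mem {T t : ℝ} (ht : t ∈ Icc 0 T) : clamp T t = t := by
  rw [clamp, min_eq_right ht.2, max_eq_right ht.1]

theorem abs_clamp_sub_le (T t s : ℝ) : |clamp T t - clamp T s| ≤ |t - s| := by
  unfold clamp
  rw [max_comm 0, max_comm 0]
  refine (abs_max_sub_max_le_abs _ _ _).trans ?_
  exact (abs_min_sub_min_le_max _ _ _ _).trans (by simp)

/-- A family of functions on `ℝ³` which vanish off `Ω`, are continuous on `Ω`, and depend on time in
a uniformly Lipschitz way. -/
structure IsLipschitzFamily {F : Type*} [NormedAddCommGroup F] (Ω : Set R3) (K : NNReal)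
    (f : ℝ → R3 → F) : Prop where
  lip : ∀ y, LipschitzWith K fun t => f t y
  zero : ∀ t, ∀ y ∉ Ω, f t y = 0
  cont : ∀ t, ContinuousOn (f t) Ω

namespace IsLipschitzFamily

variable {F : Type*} [NormedAddCommGroup F] [NormedSpace ℝ F] [FiniteDimensional ℝ F]
  [MeasurableSpace F] [BorelSpace F] {Ω : Set R3} {K : NNReal} {f : ℝ → R3 → F}

/-- Continuity in space at a fixed time and a Lipschitz bound in time that is uniform in space give
joint continuity. The restriction to Ω is needed because the functions jump to zero at its boundary.
-/
theorem continuous_restrict (hf : IsLipschitzFamily Ω K f) :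
    Continuous (Function.uncurry fun (y : Ω) (t : ℝ) => f t y) := by
  rw [continuous_iff_continuousAt]
  rintro ⟨y, t⟩
  rw [ContinuousAt, tendsto_iff_dist_tendsto_zero]
  have h1 : Tendsto (fun p : Ω × ℝ => (K : ℝ) * dist p.2 t + dist (f t p.1) (f t y)) (𝓝 (y, t))
      (𝓝 (K * dist t t + dist (f t y) (f t y))) := by
    apply Tendsto.add
    · exact (continuous_const.mul (continuous_snd.dist continuous_const)).tendsto _
    · have := ((continuousOn_iff_continuous_domRestrict.1 (hf.cont t)).comp
        (continuous_fst (X := Ω) (Y := ℝ))).dist (continuous_const (y := f t y))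
      exact this.tendsto (y, t)
  simp only [dist_self, mul_zero, add_zero] at h1
  refine squeeze_zero (fun _ => dist_nonneg) (fun p => ?_) h1
  exact (dist_triangle _ (f t p.1) _).trans (add_le_add_left ((hf.lip p.1).dist_le_mul p.2 t) _)

theorem measurable_of_restrict_of_zero {g : ℝ × R3 → F} (hΩ : MeasurableSet Ω)
    (h1 : Measurable fun p : Ω × ℝ => g (p.2, p.1)) (h0 : ∀ t, ∀ y ∉ Ω, g (t, y) = 0) :
    Measurable g := by
  have hs : MeasurableSet (univ ×ˢ Ω : Set (ℝ × R3)) := MeasurableSet.univ.prod hΩ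
  refine measurable_of_restrict_of_restrict_compl hs ?_ ?_
  · have hm : Measurable fun p : (univ ×ˢ Ω : Set (ℝ × R3)) => ((⟨p.1.2, p.2.2⟩ : Ω), p.1.1) :=
      (Measurable.subtype_mk (measurable_snd.comp measurable_subtype_coe)).prodMk
        (measurable_fst.comp measurable_subtype_coe)
    exact h1.comp hm
  · have : domRestrict (univ ×ˢ Ω : Set (ℝ × R3))ᶜ g = fun _ => 0 := by
      funext ⟨⟨t, y⟩, hp⟩
      exact h0 t y fun h => hp ⟨mem_univ _, h⟩
    rw [this]
    exact measurable_const

theorem measurable_uncurry (hf : IsLipschitzFamily Ω K f) (hΩ : MeasurableSet Ω) :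
    Measurable fun p : ℝ × R3 => f p.1 p.2 :=
  measurable_of_restrict_of_zero hΩ hf.continuous_restrict.measurable fun t y hy => hf.zero t y hy

theorem deriv_zero (hf : IsLipschitzFamily Ω K f) (t : ℝ) {y : R3} (hy : y ∉ Ω) :
    deriv (fun s => f s y) t = 0 := by
  simp [hf.zero _ y hy]

theorem measurable_deriv (hf : IsLipschitzFamily Ω K f) (hΩ : MeasurableSet Ω) :
    Measurable fun p : ℝ × R3 => deriv (fun s => f s p.2) p.1 :=
  haveI := FiniteDimensional.complete ℝ F
  measurable_of_restrict_of_zero hΩ (measurable_deriv_with_param hf.continuous_restrict)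
    fun t _ hy => hf.deriv_zero t hy

theorem norm_deriv_le (hf : IsLipschitzFamily Ω K f) (t : ℝ) (y : R3) :
    ‖deriv (fun s => f s y) t‖ ≤ K :=
  norm_deriv_le_of_lipschitz (hf.lip y)

/-- Rademacher's theorem in the time variable for each fixed y, followed by Fubini. The
measurability of the set of differentiability is what allows Fubini. -/
theorem ae_hasDerivAt (hf : IsLipschitzFamily Ω K f) (hΩ : MeasurableSet Ω) :
    ∀ᵐ p : ℝ × R3, HasDerivAt (fun s => f s p.2) (deriv (fun s => f s p.2) p.1) p.1 := by
  haveI := FiniteDimensional.complete ℝ F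
  have hm : MeasurableSet {p : ℝ × R3 | DifferentiableAt ℝ (fun s => f s p.2) p.1} := by
    have h1 := measurableSet_of_differentiableAt_with_param ℝ hf.continuous_restrict
    -- The set of non-differentiability is encoded by its indicator, which vanishes off Ω, so the
    -- criterion for functions that vanish off Ω applies to it.
    have h2 : Measurable fun p : ℝ × R3 =>
        ({p : ℝ × R3 | DifferentiableAt ℝ (fun s => f s p.2) p.1}ᶜ).indicator (fun _ => (1 : ℝ)) p := by
      refine measurable_of_restrict_of_zero hΩ ?_ ?_
      · exact measurable_const.indicator h1.compl
      · intro t y hy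
        apply indicator_of_notMem
        simp [hf.zero _ y hy]
    have h3 := measurableSet_preimage h2 (measurableSet_singleton 0)
    convert h3 using 1
    ext p
    by_cases h : DifferentiableAt ℝ (fun s => f s p.2) p.1 <;> simp [h]
  have : ∀ᵐ p : R3 × ℝ, DifferentiableAt ℝ (fun s => f s p.1) p.2 := by
    have hm' : MeasurableSet {p : R3 × ℝ | DifferentiableAt ℝ (fun s => f s p.1) p.2} :=
      measurable_swap hm
    rw [Measure.volume_eq_prod, Measure.ae_prod_iff_ae_ae hm']
    exact ae_of_all _ fun y => (hf.lip y).ae_differentiableAt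
  have hs : MeasurePreserving (Prod.swap : ℝ × R3 → R3 × ℝ) volume volume :=
    Measure.measurePreserving_swap
  filter_upwards [hs.quasiMeasurePreserving.ae this] with p hp
  exact hp.hasDerivAt

end IsLipschitzFamily

end MovingDomain

namespace MovingDomain

/-! ### Volume-preserving transformations -/

/-- The transformation, for times projected to `[0,T]` and set to zero off `Ω`. -/
noncomputable def extPos (T : ℝ) (Ω : Set R3) (X : ℝ → R3 → R3) (t : ℝ) : R3 → R3 :=
  Ω.indicator (X (clamp T t))

/-- The gradient `∇X`, for times projected to `[0,T]` and set to zero off `Ω`. -/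
noncomputable def extGrad (T : ℝ) (Ω : Set R3) (X : ℝ → R3 → R3) (t : ℝ) : R3 → R3 →L[ℝ] R3 :=
  Ω.indicator (fderiv ℝ (X (clamp T t)))

/-- The second derivative `∇²X`, for times projected to `[0,T]` and set to zero off `Ω`. -/
noncomputable def extHess (T : ℝ) (Ω : Set R3) (X : ℝ → R3 → R3) (t : ℝ) :
    R3 → R3 →L[ℝ] R3 →L[ℝ] R3 :=
  Ω.indicator (fderiv ℝ (fderiv ℝ (X (clamp T t))))

/-- The inverse of `∇X`, for times projected to `[0,T]` and set to zero off `Ω`. -/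
noncomputable def extInv (T : ℝ) (Ω : Set R3) (X : ℝ → R3 → R3) (t : ℝ) : R3 → R3 →L[ℝ] R3 :=
  Ω.indicator fun y => Ring.inverse (fderiv ℝ (X (clamp T t)) y)

/-- `∂_t X` in Lagrangian variables. -/
noncomputable def extVel (T : ℝ) (Ω : Set R3) (X : ℝ → R3 → R3) (t : ℝ) (y : R3) : R3 :=
  deriv (fun s => extPos T Ω X s y) t

/-- `∂_t ∇X` in Lagrangian variables. -/
noncomputable def extGradRate (T : ℝ) (Ω : Set R3) (X : ℝ → R3 → R3) (t : ℝ) (y : R3) :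
    R3 →L[ℝ] R3 :=
  deriv (fun s => extGrad T Ω X s y) t

theorem isUnit_of_abs_det_eq_one {A : R3 →L[ℝ] R3} (h : |A.det| = 1) : IsUnit A := by
  have h0 : A.det ≠ 0 := by
    intro h'
    simp [h'] at h
  refine ⟨(ContinuousLinearEquiv.unitsEquiv ℝ R3).symm (A.toContinuousLinearEquivOfDetNeZero h0), ?_⟩
  ext1 x
  rfl

/-- Matrices of bounded norm with |det| = 1 form a compact set on which inversion is continuous.
This is how volume preservation makes (∇X)⁻¹ bounded. -/
theorem exists_norm_inverse_le (C : ℝ) :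
    ∃ C' : ℝ, ∀ A : R3 →L[ℝ] R3, ‖A‖ ≤ C → |A.det| = 1 → ‖Ring.inverse A‖ ≤ C' := by
  have hc : IsCompact (Metric.closedBall (0 : R3 →L[ℝ] R3) C ∩ {A | |A.det| = 1}) := by
    haveI : ProperSpace (R3 →L[ℝ] R3) := FiniteDimensional.proper_real _
    refine (isCompact_closedBall _ _).inter_right ?_
    exact isClosed_eq ContinuousLinearMap.continuous_det.abs continuous_const
  have hcont : ContinuousOn (Ring.inverse : (R3 →L[ℝ] R3) → _)
      (Metric.closedBall (0 : R3 →L[ℝ] R3) C ∩ {A | |A.det| = 1}) := fun A hA => by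
    obtain ⟨U, hU⟩ := isUnit_of_abs_det_eq_one hA.2
    rw [← hU]
    exact (NormedRing.inverse_continuousAt U).continuousWithinAt
  obtain ⟨C', hC'⟩ := hc.exists_bound_of_continuousOn hcont
  exact ⟨C', fun A h1 h2 => hC' A ⟨by simpa using h1, h2⟩⟩

namespace IsVolumePreservingTransformation

variable {T : ℝ} {Ω : Set R3} {X : ℝ → R3 → R3}

theorem contDiffAt (hX : IsVolumePreservingTransformation T Ω X) (hΩ : IsOpen Ω) {t : ℝ}
    (ht : t ∈ Icc 0 T) {y : R3} (hy : y ∈ Ω) : ContDiffAt ℝ ∞ (X t) y :=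
  (hX.smooth t ht).contDiffAt (hΩ.mem_nhds hy)

theorem hasFDerivAt (hX : IsVolumePreservingTransformation T Ω X) (hΩ : IsOpen Ω) {t : ℝ}
    (ht : t ∈ Icc 0 T) {y : R3} (hy : y ∈ Ω) : HasFDerivAt (X t) (fderiv ℝ (X t) y) y :=
  ((hX.contDiffAt hΩ ht hy).differentiableAt (by norm_num)).hasFDerivAt

theorem contDiffAt_fderiv (hX : IsVolumePreservingTransformation T Ω X) (hΩ : IsOpen Ω) {t : ℝ}
    (ht : t ∈ Icc 0 T) {y : R3} (hy : y ∈ Ω) : ContDiffAt ℝ ∞ (fderiv ℝ (X t)) y :=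
  (hX.contDiffAt hΩ ht hy).fderiv_right (m := ∞) (by norm_num)

theorem isUnit_fderiv (hX : IsVolumePreservingTransformation T Ω X) {t : ℝ}
    (ht : t ∈ Icc 0 T) {y : R3} (hy : y ∈ Ω) : IsUnit (fderiv ℝ (X t) y) :=
  isUnit_of_abs_det_eq_one (hX.volume_preserving t ht y hy)

/-- Since ∇X is invertible, X(t) is an open map near each point of Ω. -/
theorem isOpen_domainAt (hX : IsVolumePreservingTransformation T Ω X) (hΩ : IsOpen Ω) {t : ℝ}
    (ht : t ∈ Icc 0 T) : IsOpen (domainAt Ω X t) := by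
  rw [isOpen_iff_mem_nhds]
  rintro _ ⟨y, hy, rfl⟩
  have hs : HasStrictFDerivAt (X t) (fderiv ℝ (X t) y) y :=
    (hX.contDiffAt hΩ ht hy).hasStrictFDerivAt (by norm_num)
  obtain ⟨U, hU⟩ := hX.isUnit_fderiv ht hy
  have hr : (fderiv ℝ (X t) y).range = ⊤ := by
    rw [← hU]
    exact LinearMap.range_eq_top.2 ((ContinuousLinearEquiv.unitsEquiv ℝ R3 U).surjective)
  rw [← hs.map_nhds_eq_of_surj hr]
  exact image_mem_map (hΩ.mem_nhds hy)

theorem inverseMap_apply (hX : IsVolumePreservingTransformation T Ω X) {t : ℝ}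
    (ht : t ∈ Icc 0 T) {y : R3} (hy : y ∈ Ω) : inverseMap Ω X t (X t y) = y :=
  (hX.injective t ht).leftInvOn_invFunOn hy

theorem inverseMap_mem {t : ℝ} {x : R3} (hx : x ∈ domainAt Ω X t) : inverseMap Ω X t x ∈ Ω :=
  Function.invFunOn_mem hx

theorem apply_inverseMap {t : ℝ} {x : R3} (hx : x ∈ domainAt Ω X t) :
    X t (inverseMap Ω X t x) = x :=
  Function.invFunOn_eq hx

theorem fderiv_inverseMap (hX : IsVolumePreservingTransformation T Ω X) (hΩ : IsOpen Ω) {t : ℝ}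
    (ht : t ∈ Icc 0 T) {y : R3} (hy : y ∈ Ω) :
    fderiv ℝ (inverseMap Ω X t) (X t y) = Ring.inverse (fderiv ℝ (X t) y) := by
  have h1 : HasFDerivAt (inverseMap Ω X t) (fderiv ℝ (inverseMap Ω X t) (X t y)) (X t y) :=
    (((hX.smooth_inverse t ht).contDiffAt
      ((hX.isOpen_domainAt hΩ ht).mem_nhds ⟨y, hy, rfl⟩)).differentiableAt (by norm_num)).hasFDerivAt
  have h2 := h1.comp y (hX.hasFDerivAt hΩ ht hy)
  have h3 : HasFDerivAt (inverseMap Ω X t ∘ X t) (ContinuousLinearMap.id ℝ R3) y :=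
    (hasFDerivAt_id y).congr_of_eventuallyEq
      ((hΩ.eventually_mem hy).mono fun z hz => hX.inverseMap_apply ht hz)
  have h4 : fderiv ℝ (inverseMap Ω X t) (X t y) * fderiv ℝ (X t) y = 1 := h2.unique h3
  obtain ⟨U, hU⟩ := hX.isUnit_fderiv ht hy
  rw [← hU] at h4 ⊢
  rw [Ring.inverse_unit]
  exact Units.eq_inv_of_mul_eq_one_right h4

/-- Only derivatives of X up to order two enter the argument; a single constant bounds them, the
inverse gradient, and all their Lipschitz constants in time. -/
theorem exists_bound (hX : IsVolumePreservingTransformation T Ω X) (hΩ : IsOpen Ω) :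
    ∃ K : NNReal, (∀ t ∈ Icc 0 T, ∀ y ∈ Ω, ‖X t y‖ ≤ K ∧ ‖fderiv ℝ (X t) y‖ ≤ K ∧
        ‖fderiv ℝ (fderiv ℝ (X t)) y‖ ≤ K ∧ ‖Ring.inverse (fderiv ℝ (X t) y)‖ ≤ K) ∧
      ∀ t ∈ Icc 0 T, ∀ s ∈ Icc 0 T, ∀ y ∈ Ω, ‖X t y - X s y‖ ≤ K * |t - s| ∧
        ‖fderiv ℝ (X t) y - fderiv ℝ (X s) y‖ ≤ K * |t - s| ∧
        ‖fderiv ℝ (fderiv ℝ (X t)) y - fderiv ℝ (fderiv ℝ (X s)) y‖ ≤ K * |t - s| ∧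
        ‖Ring.inverse (fderiv ℝ (X t) y) - Ring.inverse (fderiv ℝ (X s) y)‖ ≤ K * |t - s| := by
  obtain ⟨C0, h0⟩ := hX.bounded 0
  obtain ⟨C1, h1⟩ := hX.bounded 1
  obtain ⟨C2, h2⟩ := hX.bounded 2
  obtain ⟨D0, d0⟩ := hX.bounded_time 0
  obtain ⟨D1, d1⟩ := hX.bounded_time 1
  obtain ⟨D2, d2⟩ := hX.bounded_time 2
  obtain ⟨B, hB⟩ := exists_norm_inverse_le C1
  have h1' : ∀ t ∈ Icc 0 T, ∀ y ∈ Ω, ‖fderiv ℝ (X t) y‖ ≤ C1 := fun t ht y hy => by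
    simpa [← norm_iteratedFDeriv_one] using h1 t ht y hy
  have h2' : ∀ t ∈ Icc 0 T, ∀ y ∈ Ω, ‖fderiv ℝ (fderiv ℝ (X t)) y‖ ≤ C2 := fun t ht y hy => by
    rw [← norm_iteratedFDeriv_one, norm_iteratedFDeriv_fderiv]; exact h2 t ht y hy
  have hB' : ∀ t ∈ Icc 0 T, ∀ y ∈ Ω, ‖Ring.inverse (fderiv ℝ (X t) y)‖ ≤ B := fun t ht y hy =>
    hB _ (h1' t ht y hy) (hX.volume_preserving t ht y hy)
  have sub : ∀ k : ℕ, ∀ t ∈ Icc 0 T, ∀ s ∈ Icc 0 T, ∀ y ∈ Ω,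
      iteratedFDeriv ℝ k (X t - X s) y = iteratedFDeriv ℝ k (X t) y - iteratedFDeriv ℝ k (X s) y :=
    fun k t ht s hs y hy => iteratedFDeriv_sub_apply
      ((hX.contDiffAt hΩ ht hy).of_le (by exact_mod_cast le_top))
      ((hX.contDiffAt hΩ hs hy).of_le (by exact_mod_cast le_top))
  have fsub : ∀ t ∈ Icc 0 T, ∀ s ∈ Icc 0 T, ∀ y ∈ Ω,
      fderiv ℝ (X t - X s) y = fderiv ℝ (X t) y - fderiv ℝ (X s) y := fun t ht s hs y hy =>
    ((hX.hasFDerivAt hΩ ht hy).sub (hX.hasFDerivAt hΩ hs hy)).fderiv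
  have d0' : ∀ t ∈ Icc 0 T, ∀ s ∈ Icc 0 T, ∀ y ∈ Ω, ‖X t y - X s y‖ ≤ D0 * |t - s| :=
    fun t ht s hs y hy => by
      have := d0 t ht s hs y hy
      rw [← sub 0 t ht s hs y hy, norm_iteratedFDeriv_zero] at this
      exact this
  have d1' : ∀ t ∈ Icc 0 T, ∀ s ∈ Icc 0 T, ∀ y ∈ Ω,
      ‖fderiv ℝ (X t) y - fderiv ℝ (X s) y‖ ≤ D1 * |t - s| := fun t ht s hs y hy => by
    have := d1 t ht s hs y hy
    rw [← sub 1 t ht s hs y hy, norm_iteratedFDeriv_one, fsub t ht s hs y hy] at this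
    exact this
  have d2' : ∀ t ∈ Icc 0 T, ∀ s ∈ Icc 0 T, ∀ y ∈ Ω,
      ‖fderiv ℝ (fderiv ℝ (X t)) y - fderiv ℝ (fderiv ℝ (X s)) y‖ ≤ D2 * |t - s| :=
    fun t ht s hs y hy => by
      have := d2 t ht s hs y hy
      rw [← sub 2 t ht s hs y hy, ← norm_iteratedFDeriv_fderiv, norm_iteratedFDeriv_one] at this
      have e : fderiv ℝ (X t - X s) =ᶠ[𝓝 y] fderiv ℝ (X t) - fderiv ℝ (X s) :=
        (hΩ.eventually_mem hy).mono fun z hz => fsub t ht s hs z hz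
      rw [e.fderiv_eq, fderiv_sub ((hX.contDiffAt_fderiv hΩ ht hy).differentiableAt (by norm_num))
        ((hX.contDiffAt_fderiv hΩ hs hy).differentiableAt (by norm_num))] at this
      exact this
  have dB : ∀ t ∈ Icc 0 T, ∀ s ∈ Icc 0 T, ∀ y ∈ Ω,
      ‖Ring.inverse (fderiv ℝ (X t) y) - Ring.inverse (fderiv ℝ (X s) y)‖ ≤ |B| * |D1| * |B| * |t - s| :=
    fun t ht s hs y hy => by
      -- The resolvent identity A⁻¹ - B⁻¹ = A⁻¹ (B - A) B⁻¹ transfers the Lipschitz bound in time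
      -- from ∇X to its inverse.
      have e : Ring.inverse (fderiv ℝ (X t) y) - Ring.inverse (fderiv ℝ (X s) y) =
          Ring.inverse (fderiv ℝ (X t) y) * (fderiv ℝ (X s) y - fderiv ℝ (X t) y) *
            Ring.inverse (fderiv ℝ (X s) y) := by
        rw [mul_sub, sub_mul, Ring.inverse_mul_cancel _ (hX.isUnit_fderiv ht hy), one_mul, mul_assoc,
          Ring.mul_inverse_cancel _ (hX.isUnit_fderiv hs hy), mul_one]
      rw [e]
      have b1 := (hB' t ht y hy).trans (le_abs_self B)
      have b2 := (hB' s hs y hy).trans (le_abs_self B)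
      have b3 := (d1' s hs t ht y hy).trans
        (mul_le_mul_of_nonneg_right (le_abs_self D1) (abs_nonneg _))
      rw [abs_sub_comm] at b3
      calc _ ≤ ‖Ring.inverse (fderiv ℝ (X t) y)‖ * ‖fderiv ℝ (X s) y - fderiv ℝ (X t) y‖ *
            ‖Ring.inverse (fderiv ℝ (X s) y)‖ :=
            (norm_mul_le _ _).trans (mul_le_mul_of_nonneg_right (norm_mul_le _ _) (norm_nonneg _))
        _ ≤ |B| * (|D1| * |t - s|) * |B| := by gcongr
        _ = _ := by ring
  let M : ℝ := |C0| + |C1| + |C2| + |B| + |D0| + |D1| + |D2| + |B| * |D1| * |B|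
  have hM : 0 ≤ M := by positivity
  refine ⟨M.toNNReal, fun t ht y hy => ?_, fun t ht s hs y hy => ?_⟩
  · have p : 0 ≤ |B| * |D1| * |B| := by positivity
    have i0 : ‖X t y‖ ≤ C0 := by simpa using h0 t ht y hy
    refine ⟨i0.trans ?_, (h1' t ht y hy).trans ?_, (h2' t ht y hy).trans ?_,
      (hB' t ht y hy).trans ?_⟩ <;> rw [Real.coe_toNNReal _ hM] <;>
      linarith [le_abs_self C0, le_abs_self C1, le_abs_self C2, le_abs_self B, abs_nonneg C0,
        abs_nonneg C1, abs_nonneg C2, abs_nonneg B, abs_nonneg D0, abs_nonneg D1, abs_nonneg D2]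
  · have p : 0 ≤ |B| * |D1| * |B| := by positivity
    refine ⟨(d0' t ht s hs y hy).trans ?_, (d1' t ht s hs y hy).trans ?_,
      (d2' t ht s hs y hy).trans ?_, (dB t ht s hs y hy).trans ?_⟩ <;>
      refine mul_le_mul_of_nonneg_right ?_ (abs_nonneg _) <;> rw [Real.coe_toNNReal _ hM] <;>
      linarith [le_abs_self D0, le_abs_self D1, le_abs_self D2, abs_nonneg C0,
        abs_nonneg C1, abs_nonneg C2, abs_nonneg B, abs_nonneg D0, abs_nonneg D1, abs_nonneg D2]

/-- The bounds and regularity in time of the extended quantities. -/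
structure ExtBound (T : ℝ) (Ω : Set R3) (X : ℝ → R3 → R3) (K : NNReal) : Prop where
  pos : IsLipschitzFamily Ω K (extPos T Ω X)
  grad : IsLipschitzFamily Ω K (extGrad T Ω X)
  hess : IsLipschitzFamily Ω K (extHess T Ω X)
  inv : IsLipschitzFamily Ω K (extInv T Ω X)
  norm_grad : ∀ t y, ‖extGrad T Ω X t y‖ ≤ K
  norm_hess : ∀ t y, ‖extHess T Ω X t y‖ ≤ K
  norm_inv : ∀ t y, ‖extInv T Ω X t y‖ ≤ K
  norm_pos : ∀ t y, ‖extPos T Ω X t y‖ ≤ K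

theorem exists_extBound (hX : IsVolumePreservingTransformation T Ω X) (hΩ : IsOpen Ω)
    (hT : 0 ≤ T) : ∃ K, ExtBound T Ω X K := by
  obtain ⟨K, hb, hl⟩ := hX.exists_bound hΩ
  have lip : ∀ {F : Type} [NormedAddCommGroup F] {g : ℝ → R3 → F},
      (∀ t ∈ Icc 0 T, ∀ s ∈ Icc 0 T, ∀ y ∈ Ω, ‖g t y - g s y‖ ≤ K * |t - s|) →
      (∀ t ∈ Icc 0 T, ContinuousOn (g t) Ω) →
      IsLipschitzFamily Ω K (fun t => Ω.indicator (g (clamp T t))) := fun {F} _ {g} hg hc => by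
    refine ⟨fun y => LipschitzWith.of_dist_le_mul fun t s => ?_, fun t y hy => ?_, fun t => ?_⟩
    · by_cases hy : y ∈ Ω
      · simp only [indicator_of_mem hy, dist_eq_norm, Real.norm_eq_abs]
        refine (hg _ (clamp_mem hT t) _ (clamp_mem hT s) y hy).trans ?_
        exact mul_le_mul_of_nonneg_left (abs_clamp_sub_le T t s) K.2
      · simp only [indicator_of_notMem hy, dist_self]; positivity
    · exact indicator_of_notMem hy _
    · exact (hc _ (clamp_mem hT t)).congr fun y hy => indicator_of_mem hy _
  have bd : ∀ {F : Type} [NormedAddCommGroup F] {g : ℝ → R3 → F},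
      (∀ t ∈ Icc 0 T, ∀ y ∈ Ω, ‖g t y‖ ≤ K) → ∀ t y, ‖Ω.indicator (g (clamp T t)) y‖ ≤ K :=
    fun {F} _ {g} hg t y => by
      by_cases hy : y ∈ Ω
      · simpa only [indicator_of_mem hy] using hg _ (clamp_mem hT t) y hy
      · simp [indicator_of_notMem hy]
  refine ⟨K, lip (fun t ht s hs y hy => (hl t ht s hs y hy).1) fun t ht => (hX.smooth t ht).continuousOn,
    lip (fun t ht s hs y hy => (hl t ht s hs y hy).2.1) fun t ht y hy =>
      (hX.contDiffAt_fderiv hΩ ht hy).continuousAt.continuousWithinAt,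
    lip (g := fun t => fderiv ℝ (fderiv ℝ (X t)))
      (fun t ht s hs y hy => (hl t ht s hs y hy).2.2.1) fun t ht y hy =>
      ((hX.contDiffAt_fderiv hΩ ht hy).fderiv_right (m := ∞)
        (by norm_num)).continuousAt.continuousWithinAt,
    lip (g := fun t y => Ring.inverse (fderiv ℝ (X t) y))
      (fun t ht s hs y hy => (hl t ht s hs y hy).2.2.2) fun t ht y hy => ?_,
    bd fun t ht y hy => (hb t ht y hy).2.1,
    bd (g := fun t => fderiv ℝ (fderiv ℝ (X t))) fun t ht y hy => (hb t ht y hy).2.2.1,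
    bd (g := fun t y => Ring.inverse (fderiv ℝ (X t) y)) fun t ht y hy => (hb t ht y hy).2.2.2,
    bd fun t ht y hy => (hb t ht y hy).1⟩
  obtain ⟨U, hU⟩ := hX.isUnit_fderiv ht hy
  refine ContinuousAt.continuousWithinAt ?_
  refine ContinuousAt.comp (g := Ring.inverse) ?_ (hX.contDiffAt_fderiv hΩ ht hy).continuousAt
  rw [← hU]
  exact NormedRing.inverse_continuousAt U

end IsVolumePreservingTransformation

end MovingDomain

namespace MovingDomain

/-! ### The space-time domain -/

/-- The map `(t, y) ↦ (t, X(t, y))`. -/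
def lagrangeMap (X : ℝ → R3 → R3) (p : ℝ × R3) : ℝ × R3 := (p.1, X p.1 p.2)

/-- The map `(t, x) ↦ (t, Y(t, x))`. -/
noncomputable def eulerMap (Ω : Set R3) (X : ℝ → R3 → R3) (p : ℝ × R3) : ℝ × R3 :=
  (p.1, inverseMap Ω X p.1 p.2)

namespace IsVolumePreservingTransformation

variable {T : ℝ} {Ω : Set R3} {X : ℝ → R3 → R3}

/-- Near `X(τ₀, y₀)`, points have a preimage close to `y₀`, uniformly in time. -/
theorem exists_preimage_near (hX : IsVolumePreservingTransformation T Ω X) (hΩ : IsOpen Ω)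
    {τ₀ : ℝ} (hτ₀ : τ₀ ∈ Icc 0 T) {y₀ : R3} (hy₀ : y₀ ∈ Ω) {ρ : ℝ} (hρ : 0 < ρ) :
    ∃ δ > 0, ∀ τ ∈ Icc 0 T, |τ - τ₀| < δ → ∀ x, dist x (X τ₀ y₀) < δ →
      ∃ y ∈ Ω, dist y y₀ ≤ ρ ∧ X τ y = x := by
  obtain ⟨K, -, hl⟩ := hX.exists_bound hΩ
  have hs : HasStrictFDerivAt (X τ₀) (fderiv ℝ (X τ₀) y₀) y₀ :=
    (hX.contDiffAt hΩ hτ₀ hy₀).hasStrictFDerivAt (by norm_num)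
  obtain ⟨U, hU⟩ := hX.isUnit_fderiv hτ₀ hy₀
  set A : R3 ≃L[ℝ] R3 := ContinuousLinearEquiv.unitsEquiv ℝ R3 U
  have hA : (A : R3 →L[ℝ] R3) = fderiv ℝ (X τ₀) y₀ := by rw [← hU]; rfl
  rw [← hA] at hs
  set N := A.toNonlinearRightInverse.nnnorm
  have hN : 0 < N := A.nnnorm_symm_pos
  -- N is the norm of A⁻¹. The error of X τ₀ against A is at most c, and moving to time τ costs
  -- another c; the quantitative inverse theorem then has the margin N⁻¹ - 2c = 2c.
  set c : NNReal := N⁻¹ / 4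
  have hc : 0 < c := by positivity
  obtain ⟨s, hsn, hsa⟩ := hs.approximates_deriv_on_nhds (Or.inr hc)
  obtain ⟨r₀, hr₀, hr₀s⟩ := Metric.nhds_basis_closedBall.mem_iff.1
    (Filter.inter_mem hsn (hΩ.mem_nhds hy₀))
  set r := min r₀ ρ
  have hr : 0 < r := lt_min hr₀ hρ
  set b := Metric.closedBall y₀ r
  have hbs : b ⊆ s ∩ Ω := (Metric.closedBall_subset_closedBall (min_le_left _ _)).trans hr₀s
  have hcr : (0 : ℝ) < c := hc
  -- The first entry keeps the change of ∇X between the times τ₀ and τ below c. The second gives (1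
  -- + K) δ ≤ 2 c r, which places x in the ball around X τ y₀ that is known to be covered.
  set δ : ℝ := min (c / (K + 1)) (c * r / (K + 2))
  have hK0 : (0 : ℝ) ≤ K := K.2
  have hδ : 0 < δ := lt_min (by positivity) (by positivity)
  refine ⟨δ, hδ, fun τ hτ hττ x hx => ?_⟩
  have hKτ : K * |τ - τ₀| ≤ c := by
    have h1 : |τ - τ₀| ≤ c / (K + 1) := hττ.le.trans (min_le_left _ _)
    rw [le_div_iff₀ (by positivity)] at h1
    nlinarith [abs_nonneg (τ - τ₀)]
  have happ : ApproximatesLinearOn (X τ) (A : R3 →L[ℝ] R3) b (2 * c) := by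
    intro y hy z hz
    have h1 := (hsa.mono_set (fun w hw => (hbs hw).1)) y hy z hz
    -- The mean value inequality requires a convex set, hence the closed ball instead of the
    -- neighbourhood s.
    have h2 : ‖(X τ - X τ₀) y - (X τ - X τ₀) z‖ ≤ c * ‖y - z‖ := by
      have := (convex_closedBall y₀ r).norm_image_sub_le_of_norm_hasFDerivWithin_le
        (f := X τ - X τ₀) (f' := fun w => fderiv ℝ (X τ) w - fderiv ℝ (X τ₀) w) (C := c)
        (fun w hw => ((hX.hasFDerivAt hΩ hτ (hbs hw).2).sub
          (hX.hasFDerivAt hΩ hτ₀ (hbs hw).2)).hasFDerivWithinAt)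
        (fun w hw => ((hl τ hτ τ₀ hτ₀ w (hbs hw).2).2.1).trans hKτ) hz hy
      exact this
    have e : X τ y - X τ z - (A : R3 →L[ℝ] R3) (y - z) =
        (X τ₀ y - X τ₀ z - (A : R3 →L[ℝ] R3) (y - z)) +
          ((X τ - X τ₀) y - (X τ - X τ₀) z) := by
      simp only [Pi.sub_apply]; abel
    rw [e]
    refine (norm_add_le _ _).trans ?_
    rw [NNReal.coe_mul, NNReal.coe_ofNat]
    linarith
  have hsurj := happ.surjOn_closedBall_of_nonlinearRightInverse A.toNonlinearRightInverse hr.le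
    (Subset.refl b)
  have hcN : ((N : ℝ)⁻¹ - ((2 * c : NNReal) : ℝ)) = 2 * c := by
    simp only [c]; push_cast; ring
  rw [show ((A.toNonlinearRightInverse.nnnorm : ℝ)⁻¹ - ((2 * c : NNReal) : ℝ)) = 2 * c from hcN] at hsurj
  have hxm : x ∈ Metric.closedBall (X τ y₀) (2 * c * r) := by
    have h1 := (hl τ₀ hτ₀ τ hτ y₀ hy₀).1
    rw [abs_sub_comm] at h1
    have h2 : dist x (X τ y₀) ≤ δ + K * δ := by
      refine (dist_triangle _ (X τ₀ y₀) _).trans ?_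
      rw [dist_eq_norm (X τ₀ y₀)]
      have := mul_le_mul_of_nonneg_left hττ.le hK0
      linarith
    have h3 : δ ≤ c * r / (K + 2) := min_le_right _ _
    rw [le_div_iff₀ (by positivity)] at h3
    rw [Metric.mem_closedBall]
    nlinarith
  obtain ⟨y, hy, rfl⟩ := hsurj hxm
  exact ⟨y, (hbs hy).2, (Metric.mem_closedBall.1 hy).trans (min_le_right _ _), rfl⟩

theorem isOpen_spaceTime (hX : IsVolumePreservingTransformation T Ω X) (hΩ : IsOpen Ω)
    {t : ℝ} (ht : t ≤ T) : IsOpen (spaceTime Ω X t) := by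
  rw [Metric.isOpen_iff]
  rintro ⟨τ₀, x₀⟩ ⟨hτ₀, y₀, hy₀, hx₀⟩
  replace hτ₀ : τ₀ ∈ Ioo 0 t := hτ₀
  obtain rfl : X τ₀ y₀ = x₀ := hx₀
  have hI : ∀ {τ}, τ ∈ Ioo 0 t → τ ∈ Icc 0 T := fun h => ⟨h.1.le, h.2.le.trans ht⟩
  obtain ⟨δ, hδ, h⟩ := hX.exists_preimage_near hΩ (hI hτ₀) hy₀ one_pos
  obtain ⟨ε, hε, hε'⟩ := Metric.isOpen_iff.1 isOpen_Ioo τ₀ hτ₀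
  refine ⟨min δ ε, lt_min hδ hε, fun ⟨τ, x⟩ hp => ?_⟩
  rw [Metric.mem_ball, Prod.dist_eq, max_lt_iff] at hp
  have hτ := hε' (Metric.mem_ball.2 (hp.1.trans_le (min_le_right _ _)))
  obtain ⟨y, hy, -, hyx⟩ := h τ (hI hτ) (hp.1.trans_le (min_le_left _ _)) x
    (hp.2.trans_le (min_le_left _ _))
  exact ⟨hτ, y, hy, hyx⟩

/-- Injectivity identifies Y(τ, x) with the preimage found near y₀, and that preimage is close to y₀
uniformly in τ. -/
theorem continuousOn_eulerMap (hX : IsVolumePreservingTransformation T Ω X) (hΩ : IsOpen Ω)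
    {t : ℝ} (ht : t ≤ T) : ContinuousOn (eulerMap Ω X) (spaceTime Ω X t) := by
  refine continuousOn_fst.prodMk ?_
  rintro ⟨τ₀, x₀⟩ ⟨hτ₀, y₀, hy₀, hx₀⟩
  replace hτ₀ : τ₀ ∈ Ioo 0 t := hτ₀
  obtain rfl : X τ₀ y₀ = x₀ := hx₀
  have hI : ∀ {τ}, τ ∈ Ioo 0 t → τ ∈ Icc 0 T := fun h => ⟨h.1.le, h.2.le.trans ht⟩
  rw [Metric.continuousWithinAt_iff]
  intro ε hε
  obtain ⟨δ, hδ, h⟩ := hX.exists_preimage_near hΩ (hI hτ₀) hy₀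
    (half_pos hε)
  refine ⟨δ, hδ, ?_⟩
  rintro ⟨τ, x⟩ ⟨hτ, -⟩ hp
  rw [Prod.dist_eq, max_lt_iff] at hp
  obtain ⟨y, hy, hyy, rfl⟩ := h τ (hI hτ) hp.1 x hp.2
  simp only [hX.inverseMap_apply (hI hτ) hy, hX.inverseMap_apply (hI hτ₀) hy₀]
  linarith

theorem mapsTo_eulerMap (t : ℝ) :
    MapsTo (eulerMap Ω X) (spaceTime Ω X t) (Ioo 0 t ×ˢ Ω) :=
  fun _ hp => ⟨hp.1, inverseMap_mem hp.2⟩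

theorem eulerMap_lagrangeMap (hX : IsVolumePreservingTransformation T Ω X) {t : ℝ} (ht : t ≤ T)
    {p : ℝ × R3} (hp : p ∈ Ioo 0 t ×ˢ Ω) : eulerMap Ω X (lagrangeMap X p) = p :=
  Prod.ext rfl (hX.inverseMap_apply ⟨hp.1.1.le, hp.1.2.le.trans ht⟩ hp.2)

theorem extPos_eq {t : ℝ} (ht : t ∈ Icc 0 T) {y : R3} (hy : y ∈ Ω) : extPos T Ω X t y = X t y := by
  rw [extPos, indicator_of_mem hy, clamp_of_mem ht]

theorem extGrad_eq {t : ℝ} (ht : t ∈ Icc 0 T) {y : R3} (hy : y ∈ Ω) :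
    extGrad T Ω X t y = fderiv ℝ (X t) y := by
  rw [extGrad, indicator_of_mem hy, clamp_of_mem ht]

theorem extHess_eq {t : ℝ} (ht : t ∈ Icc 0 T) {y : R3} (hy : y ∈ Ω) :
    extHess T Ω X t y = fderiv ℝ (fderiv ℝ (X t)) y := by
  rw [extHess, indicator_of_mem hy, clamp_of_mem ht]

theorem extInv_eq {t : ℝ} (ht : t ∈ Icc 0 T) {y : R3} (hy : y ∈ Ω) :
    extInv T Ω X t y = Ring.inverse (fderiv ℝ (X t) y) := by
  rw [extInv, indicator_of_mem hy, clamp_of_mem ht]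

theorem extGrad_extInv (hX : IsVolumePreservingTransformation T Ω X) {t : ℝ} (ht : t ∈ Icc 0 T)
    {y : R3} (hy : y ∈ Ω) (e : R3) : extGrad T Ω X t y (extInv T Ω X t y e) = e := by
  rw [extGrad_eq ht hy, extInv_eq ht hy]
  exact congrArg (fun L : R3 →L[ℝ] R3 => L e) (Ring.mul_inverse_cancel _ (hX.isUnit_fderiv ht hy))

/-! ### Change of variables -/

theorem lintegral_domainAt (hX : IsVolumePreservingTransformation T Ω X) (hΩ : IsOpen Ω) {t : ℝ}
    (ht : t ∈ Icc 0 T) (f : R3 → ENNReal) :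
    ∫⁻ x in domainAt Ω X t, f x = ∫⁻ y in Ω, f (X t y) := by
  rw [domainAt, lintegral_image_eq_lintegral_abs_det_fderiv_mul volume hΩ.measurableSet
    (fun y hy => (hX.hasFDerivAt hΩ ht hy).hasFDerivWithinAt) (hX.injective t ht)]
  refine setLIntegral_congr_fun hΩ.measurableSet fun y hy => ?_
  simp [hX.volume_preserving t ht y hy]

theorem integral_domainAt (hX : IsVolumePreservingTransformation T Ω X) (hΩ : IsOpen Ω) {t : ℝ}
    (ht : t ∈ Icc 0 T) {F : Type*} [NormedAddCommGroup F] [NormedSpace ℝ F] (f : R3 → F) :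
    ∫ x in domainAt Ω X t, f x = ∫ y in Ω, f (X t y) := by
  rw [domainAt, integral_image_eq_integral_abs_det_fderiv_smul volume hΩ.measurableSet
    (fun y hy => (hX.hasFDerivAt hΩ ht hy).hasFDerivWithinAt) (hX.injective t ht)]
  refine setIntegral_congr_fun hΩ.measurableSet fun y hy => ?_
  simp [hX.volume_preserving t ht y hy]

theorem aemeasurable_apply (hX : IsVolumePreservingTransformation T Ω X) (hΩ : IsOpen Ω) {t : ℝ}
    (ht : t ∈ Icc 0 T) : AEMeasurable (X t) (volume.restrict Ω) :=
  (hX.smooth t ht).continuousOn.aemeasurable hΩ.measurableSet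

theorem map_apply (hX : IsVolumePreservingTransformation T Ω X) (hΩ : IsOpen Ω) {t : ℝ}
    (ht : t ∈ Icc 0 T) :
    Measure.map (X t) (volume.restrict Ω) = volume.restrict (domainAt Ω X t) := by
  ext E hE
  have h := hX.lintegral_domainAt hΩ ht (E.indicator 1)
  rw [lintegral_indicator_one hE] at h
  rw [h, ← lintegral_indicator_one hE,
    lintegral_map' (measurable_one.indicator hE).aemeasurable (hX.aemeasurable_apply hΩ ht)]

theorem memLp_comp_apply (hX : IsVolumePreservingTransformation T Ω X) (hΩ : IsOpen Ω) {t : ℝ}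
    (ht : t ∈ Icc 0 T) {F : Type*} [NormedAddCommGroup F] {f : R3 → F}
    (hf : MemLp f 2 (volume.restrict (domainAt Ω X t))) :
    MemLp (fun y => f (X t y)) 2 (volume.restrict Ω) := by
  rw [← hX.map_apply hΩ ht] at hf
  exact hf.comp_of_map (hX.aemeasurable_apply hΩ ht)

theorem aemeasurable_lagrangeMap (hX : IsVolumePreservingTransformation T Ω X) (hΩ : IsOpen Ω)
    {t : ℝ} (ht : t ≤ T) :
    AEMeasurable (lagrangeMap X) (volume.restrict (Ioo 0 t ×ˢ Ω)) := by
  by_cases hT : 0 ≤ T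
  · obtain ⟨K, hK⟩ := hX.exists_extBound hΩ hT
    have hm : Measurable fun p : ℝ × R3 => (p.1, extPos T Ω X p.1 p.2) :=
      measurable_fst.prodMk (hK.pos.measurable_uncurry hΩ.measurableSet)
    refine hm.aemeasurable.congr ?_
    filter_upwards [ae_restrict_mem (measurableSet_Ioo.prod hΩ.measurableSet)] with p hp
    rw [extPos_eq ⟨hp.1.1.le, hp.1.2.le.trans ht⟩ hp.2, lagrangeMap]
  · have : Ioo 0 t = ∅ := Ioo_eq_empty (by linarith)
    simp [this]

/-- Volume preservation at each time, integrated over time by Fubini. From here on, L² norms and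
integrals move between the space-time domain and the cylinder without Jacobians. -/
theorem map_lagrangeMap (hX : IsVolumePreservingTransformation T Ω X) (hΩ : IsOpen Ω)
    {t : ℝ} (ht : t ≤ T) :
    Measure.map (lagrangeMap X) (volume.restrict (Ioo 0 t ×ˢ Ω)) =
      volume.restrict (spaceTime Ω X t) := by
  have hQ : MeasurableSet (spaceTime Ω X t) := (hX.isOpen_spaceTime hΩ ht).measurableSet
  ext E hE
  have e1 : Measure.map (lagrangeMap X) (volume.restrict (Ioo 0 t ×ˢ Ω)) E =
      ∫⁻ τ in Ioo 0 t, ∫⁻ y in Ω, E.indicator 1 (τ, X τ y) := by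
    rw [← lintegral_indicator_one hE, lintegral_map' (measurable_one.indicator hE).aemeasurable
      (hX.aemeasurable_lagrangeMap hΩ ht), Measure.volume_eq_prod, ← Measure.prod_restrict,
      lintegral_prod]
    · rfl
    · rw [Measure.prod_restrict, ← Measure.volume_eq_prod]
      exact (measurable_one.indicator hE).comp_aemeasurable (hX.aemeasurable_lagrangeMap hΩ ht)
  rw [e1, Measure.restrict_apply hE, Measure.volume_eq_prod, Measure.prod_apply (hE.inter hQ),
    ← lintegral_indicator measurableSet_Ioo]
  congr 1
  funext τ
  by_cases hτ : τ ∈ Ioo 0 t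
  · rw [indicator_of_mem hτ, ← hX.lintegral_domainAt hΩ ⟨hτ.1.le, hτ.2.le.trans ht⟩
      (fun x => E.indicator 1 (τ, x))]
    have hEτ : MeasurableSet (Prod.mk τ ⁻¹' E) := measurable_prodMk_left hE
    have : (fun x : R3 => E.indicator (1 : ℝ × R3 → ENNReal) (τ, x)) =
        (Prod.mk τ ⁻¹' E).indicator 1 := rfl
    rw [this, lintegral_indicator_one hEτ, Measure.restrict_apply hEτ]
    congr 1
    ext x
    simp [spaceTime, hτ.1, hτ.2]
  · rw [indicator_of_notMem hτ]
    have : Prod.mk τ ⁻¹' (E ∩ spaceTime Ω X t) = ∅ := by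
      ext x
      simp only [mem_preimage, mem_inter_iff, mem_empty_iff_false, iff_false, not_and]
      exact fun _ h => hτ h.1
    rw [this, measure_empty]

theorem aemeasurable_eulerMap (hX : IsVolumePreservingTransformation T Ω X) (hΩ : IsOpen Ω)
    {t : ℝ} (ht : t ≤ T) :
    AEMeasurable (eulerMap Ω X) (volume.restrict (spaceTime Ω X t)) :=
  (hX.continuousOn_eulerMap hΩ ht).aemeasurable (hX.isOpen_spaceTime hΩ ht).measurableSet

theorem map_eulerMap (hX : IsVolumePreservingTransformation T Ω X) (hΩ : IsOpen Ω)
    {t : ℝ} (ht : t ≤ T) :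
    Measure.map (eulerMap Ω X) (volume.restrict (spaceTime Ω X t)) =
      volume.restrict (Ioo 0 t ×ˢ Ω) := by
  have h := hX.aemeasurable_eulerMap hΩ ht
  rw [← hX.map_lagrangeMap hΩ ht] at h ⊢
  rw [AEMeasurable.map_map_of_aemeasurable h (hX.aemeasurable_lagrangeMap hΩ ht)]
  have : eulerMap Ω X ∘ lagrangeMap X =ᵐ[volume.restrict (Ioo 0 t ×ˢ Ω)] id := by
    filter_upwards [ae_restrict_mem (measurableSet_Ioo.prod hΩ.measurableSet)] with p hp
    exact hX.eulerMap_lagrangeMap ht hp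
  rw [Measure.map_congr this, Measure.map_id]

section

variable {F : Type*} [NormedAddCommGroup F]

theorem memLp_comp_lagrangeMap (hX : IsVolumePreservingTransformation T Ω X) (hΩ : IsOpen Ω)
    {t : ℝ} (ht : t ≤ T) {f : ℝ × R3 → F} {p : ENNReal}
    (hf : MemLp f p (volume.restrict (spaceTime Ω X t))) :
    MemLp (fun q => f (lagrangeMap X q)) p (volume.restrict (Ioo 0 t ×ˢ Ω)) := by
  rw [← hX.map_lagrangeMap hΩ ht] at hf
  exact hf.comp_of_map (hX.aemeasurable_lagrangeMap hΩ ht)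

theorem memLp_comp_eulerMap (hX : IsVolumePreservingTransformation T Ω X) (hΩ : IsOpen Ω)
    {t : ℝ} (ht : t ≤ T) {f : ℝ × R3 → F} {p : ENNReal}
    (hf : MemLp f p (volume.restrict (Ioo 0 t ×ˢ Ω))) :
    MemLp (fun q => f (eulerMap Ω X q)) p (volume.restrict (spaceTime Ω X t)) := by
  rw [← hX.map_eulerMap hΩ ht] at hf
  exact hf.comp_of_map (hX.aemeasurable_eulerMap hΩ ht)

theorem ae_comp_lagrangeMap (hX : IsVolumePreservingTransformation T Ω X) (hΩ : IsOpen Ω)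
    {t : ℝ} (ht : t ≤ T) {P : ℝ × R3 → Prop} (h : ∀ᵐ q ∂(volume.restrict (spaceTime Ω X t)), P q) :
    ∀ᵐ q ∂(volume.restrict (Ioo 0 t ×ˢ Ω)), P (lagrangeMap X q) := by
  rw [← hX.map_lagrangeMap hΩ ht] at h
  exact ae_of_ae_map (hX.aemeasurable_lagrangeMap hΩ ht) h

variable [NormedSpace ℝ F]

theorem integral_spaceTime (hX : IsVolumePreservingTransformation T Ω X) (hΩ : IsOpen Ω)
    {t : ℝ} (ht : t ≤ T) {f : ℝ × R3 → F}
    (hf : AEStronglyMeasurable f (volume.restrict (spaceTime Ω X t))) :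
    ∫ q in spaceTime Ω X t, f q = ∫ q in Ioo 0 t ×ˢ Ω, f (lagrangeMap X q) := by
  rw [← hX.map_lagrangeMap hΩ ht] at hf ⊢
  exact integral_map (hX.aemeasurable_lagrangeMap hΩ ht) hf

theorem intervalIntegral_domainAt (hX : IsVolumePreservingTransformation T Ω X) (hΩ : IsOpen Ω)
    {t : ℝ} (ht0 : 0 ≤ t) (ht : t ≤ T) {f : ℝ × R3 → F}
    (hf : IntegrableOn f (spaceTime Ω X t)) :
    ∫ τ in (0 : ℝ)..t, ∫ x in domainAt Ω X τ, f (τ, x) =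
      ∫ q in Ioo 0 t ×ˢ Ω, f (lagrangeMap X q) := by
  have hi : IntegrableOn (fun q => f (lagrangeMap X q)) (Ioo 0 t ×ˢ Ω) := by
    have := hX.memLp_comp_lagrangeMap hΩ ht (memLp_one_iff_integrable.2 hf)
    exact memLp_one_iff_integrable.1 this
  rw [Measure.volume_eq_prod, setIntegral_prod _ hi, intervalIntegral.integral_of_le ht0,
    integral_Ioc_eq_integral_Ioo]
  refine setIntegral_congr_fun measurableSet_Ioo fun τ hτ => ?_
  exact hX.integral_domainAt hΩ ⟨hτ.1.le, hτ.2.le.trans ht⟩ _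

end

end IsVolumePreservingTransformation

end MovingDomain

/-! ### Weak gradients in Lagrangian coordinates. -/

namespace MovingDomain

theorem locallyIntegrableOn_of_memLp {V E : Type*} [NormedAddCommGroup V] [MeasureSpace V]
    [BorelSpace V] [IsLocallyFiniteMeasure (volume : Measure V)] [NormedAddCommGroup E]
    {U : Set V} {f : V → E} (hf : MemLp f 2 (volume.restrict U)) : LocallyIntegrableOn f U :=
  locallyIntegrableOn_of_locallyIntegrable_restrict (hf.locallyIntegrable (by norm_num))

theorem memLp_apply_const {α V E : Type*} [MeasurableSpace α] {μ : Measure α}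
    [NormedAddCommGroup V] [NormedSpace ℝ V] [NormedAddCommGroup E] [NormedSpace ℝ E]
    {G : α → V →L[ℝ] E} {p : ENNReal} (hG : MemLp G p μ) (e : V) : MemLp (fun x => G x e) p μ :=
  hG.of_le_mul (c := ‖e‖) (aestronglyMeasurable_clm_apply hG.1 aestronglyMeasurable_const)
    (ae_of_all _ fun x => ((G x).le_opNorm e).trans_eq (mul_comm _ _))

/-- In finite dimensions the operator norm is controlled by the values on a basis, so convergence of
all directional derivatives gives convergence of the full gradient. -/
theorem tendsto_eLpNorm_clm {α V E ι : Type*} [MeasurableSpace α] {μ : Measure α}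
    [NormedAddCommGroup V] [NormedSpace ℝ V] [FiniteDimensional ℝ V] [NormedAddCommGroup E]
    [NormedSpace ℝ E] {l : Filter ι} {L : ι → α → V →L[ℝ] E}
    (hm : ∀ n, AEStronglyMeasurable (L n) μ)
    (h : ∀ e, Tendsto (fun n => eLpNorm (fun x => L n x e) 2 μ) l (𝓝 0)) :
    Tendsto (fun n => eLpNorm (L n) 2 μ) l (𝓝 0) := by
  let b := Module.finBasis ℝ V
  obtain ⟨C, hC, hb⟩ := b.exists_opNorm_le (F := E)
  have hle : ∀ n, eLpNorm (L n) 2 μ ≤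
      ENNReal.ofReal C * ∑ i, eLpNorm (fun x => L n x (b i)) 2 μ := fun n => by
    have h1 : eLpNorm (L n) 2 μ ≤
        ENNReal.ofReal C * eLpNorm (∑ i, fun x => ‖L n x (b i)‖) 2 μ := by
      refine eLpNorm_le_mul_eLpNorm_of_ae_le_mul (ae_of_all _ fun x => ?_) 2
      rw [Finset.sum_apply, Real.norm_of_nonneg (Finset.sum_nonneg fun i _ => norm_nonneg _)]
      refine hb (Finset.sum_nonneg fun i _ => norm_nonneg _) fun i => ?_
      exact Finset.single_le_sum (f := fun i => ‖L n x (b i)‖) (fun i _ => norm_nonneg _)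
        (Finset.mem_univ i)
    refine h1.trans ?_
    gcongr
    refine (eLpNorm_sum_le (fun i _ => ?_) (by norm_num)).trans_eq ?_
    · exact (aestronglyMeasurable_clm_apply (hm n) aestronglyMeasurable_const).norm
    · simp only [eLpNorm_norm]
  have lim : Tendsto (fun n => ENNReal.ofReal C * ∑ i, eLpNorm (fun x => L n x (b i)) 2 μ) l
      (𝓝 (ENNReal.ofReal C * ∑ _i, 0)) :=
    ENNReal.Tendsto.const_mul (tendsto_finsetSum _ fun i _ => h (b i)) (Or.inr (by simp))
  simp only [Finset.sum_const_zero, mul_zero] at lim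
  exact tendsto_of_tendsto_of_tendsto_of_le_of_le tendsto_const_nhds lim (fun _ => zero_le) hle

theorem exists_smooth_approx_grad {V E : Type*} [NormedAddCommGroup V] [NormedSpace ℝ V]
    [FiniteDimensional ℝ V] [MeasureSpace V] [BorelSpace V] [(volume : Measure V).IsAddHaarMeasure]
    [NormedAddCommGroup E] [NormedSpace ℝ E] [CompleteSpace E] {U K : Set V} (hU : IsOpen U)
    (hK : IsCompact K) (hKU : K ⊆ U) {f : V → E} (hf : MemLp f 2 (volume.restrict U))
    {G : V → V →L[ℝ] E} (hG : MemLp G 2 (volume.restrict U)) (hfG : HasWeakGradient U f G) :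
    ∃ F : ℕ → V → E, (∀ n, ContDiff ℝ ∞ (F n)) ∧ (∀ n, HasCompactSupport (F n)) ∧
      Tendsto (fun n => eLpNorm (fun x => F n x - f x) 2 (volume.restrict K)) atTop (𝓝 0) ∧
      Tendsto (fun n => eLpNorm (fun x => fderiv ℝ (F n) x - G x) 2 (volume.restrict K))
        atTop (𝓝 0) := by
  obtain ⟨F, h1, h2, h3, h4⟩ := exists_smooth_approx hU hK hKU hf
  refine ⟨F, h1, h2, h3, tendsto_eLpNorm_clm (fun n => ?_) fun e => ?_⟩
  · exact ((h1 n).continuous_fderiv (by norm_num)).aestronglyMeasurable.sub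
      (hG.1.mono_measure (Measure.restrict_mono hKU le_rfl))
  · exact h4 e (fun x => G x e) (memLp_apply_const hG e) (hfG e)

namespace IsVolumePreservingTransformation

variable {T : ℝ} {Ω : Set R3} {X : ℝ → R3 → R3}

theorem map_restrict_apply (hX : IsVolumePreservingTransformation T Ω X) (hΩ : IsOpen Ω) {t : ℝ}
    (ht : t ∈ Icc 0 T) {S : Set R3} (hS : MeasurableSet S) (hSΩ : S ⊆ Ω) :
    Measure.map (X t) (volume.restrict S) = volume.restrict (X t '' S) := by
  ext E hE
  rw [← lintegral_indicator_one hE, ← lintegral_indicator_one hE,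
    lintegral_map' (measurable_one.indicator hE).aemeasurable
      (((hX.smooth t ht).continuousOn.mono hSΩ).aemeasurable hS),
    lintegral_image_eq_lintegral_abs_det_fderiv_mul volume hS
      (fun y hy => (hX.hasFDerivAt hΩ ht (hSΩ hy)).hasFDerivWithinAt)
      ((hX.injective t ht).mono hSΩ)]
  refine setLIntegral_congr_fun hS fun y hy => ?_
  simp [hX.volume_preserving t ht y (hSΩ hy)]

/-- The derivative of inversion, -A⁻¹ (dA) A⁻¹, explains the second-derivative term in `pullGrad`.
-/
theorem hasFDerivAt_inverse (hX : IsVolumePreservingTransformation T Ω X) (hΩ : IsOpen Ω) {t : ℝ}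
    (ht : t ∈ Icc 0 T) {y : R3} (hy : y ∈ Ω) :
    ∃ D : R3 →L[ℝ] R3 →L[ℝ] R3,
      HasFDerivAt (fun y => Ring.inverse (fderiv ℝ (X t) y)) D y ∧ ∀ e, D e =
      -((extInv T Ω X t y).comp ((extHess T Ω X t y e).comp (extInv T Ω X t y))) := by
  obtain ⟨U, hU⟩ := hX.isUnit_fderiv ht hy
  have h1 := hasFDerivAt_ringInverse (𝕜 := ℝ) U
  rw [hU] at h1
  have h2 := h1.comp y ((hX.contDiffAt_fderiv hΩ ht hy).differentiableAt (by norm_num)).hasFDerivAt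
  refine ⟨_, h2, fun e => ?_⟩
  rw [extInv_eq ht hy, extHess_eq ht hy, ← hU, Ring.inverse_unit]
  ext1 w
  simp [ContinuousLinearMap.mulLeftRight_apply, ContinuousLinearMap.mul_def]

/-- The gradient in Lagrangian coordinates of `(∇X)⁻¹ f ∘ X`, where `f` and its gradient take the
values `w` and `g` at `X(t, y)`. -/
noncomputable def _root_.MovingDomain.pullGrad (T : ℝ) (Ω : Set R3) (X : ℝ → R3 → R3) (t : ℝ)
    (y w : R3) (g : R3 →L[ℝ] R3) : R3 →L[ℝ] R3 :=
  (extInv T Ω X t y).comp (g.comp (extGrad T Ω X t y) -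
    (extHess T Ω X t y).flip (extInv T Ω X t y w))

theorem contDiffOn_inverse (hX : IsVolumePreservingTransformation T Ω X) (hΩ : IsOpen Ω) {t : ℝ}
    (ht : t ∈ Icc 0 T) : ContDiffOn ℝ ∞ (fun y => Ring.inverse (fderiv ℝ (X t) y)) Ω := by
  intro y hy
  obtain ⟨U, hU⟩ := hX.isUnit_fderiv ht hy
  have h1 : ContDiffAt ℝ ∞ Ring.inverse (fderiv ℝ (X t) y) := by
    rw [← hU]; exact contDiffAt_ringInverse ℝ U
  exact (h1.comp y (hX.contDiffAt_fderiv hΩ ht hy)).contDiffWithinAt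

/-- The integrand is the derivative in direction e of ψ (∇X)⁻¹ F∘X, a smooth compactly supported
field. -/
theorem integral_pullback_smooth (hX : IsVolumePreservingTransformation T Ω X) (hΩ : IsOpen Ω)
    {t : ℝ} (ht : t ∈ Icc 0 T) {ψ : R3 → ℝ} (hψ : ContDiff ℝ ∞ ψ) (hψc : HasCompactSupport ψ)
    (hψΩ : tsupport ψ ⊆ Ω) {F : R3 → R3} (hF : ContDiff ℝ ∞ F) (e : R3) :
    ∫ y in tsupport ψ, (fderiv ℝ ψ y e • extInv T Ω X t y (F (X t y)) +
      ψ y • pullGrad T Ω X t y (F (X t y)) (fderiv ℝ F (X t y)) e) = 0 := by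
  set η : R3 → R3 := fun y => ψ y • Ring.inverse (fderiv ℝ (X t) y) (F (X t y))
  have hts : tsupport η ⊆ tsupport ψ := tsupport_smul_subset_left _ _
  have hη : ContDiff ℝ ∞ η := contDiff_of_tsupport_subset hΩ
    (hψ.contDiffOn.smul ((hX.contDiffOn_inverse hΩ ht).clm_apply
      (hF.comp_contDiffOn (hX.smooth t ht)))) (hts.trans hψΩ)
  have hηc : HasCompactSupport η := hψc.mono' ((subset_tsupport _).trans hts)
  have h0 := integral_fderiv_eq_zero_of_hasCompactSupport
    (hη.of_le (by exact_mod_cast le_top)) hηc e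
  rw [← setIntegral_eq_integral_of_forall_compl_eq_zero (s := tsupport ψ) (fun y hy => by
    rw [fderiv_of_notMem_tsupport ℝ (fun h => hy (hts h))]; simp)] at h0
  rw [← h0]
  refine setIntegral_congr_fun hψc.isCompact.measurableSet fun y hy => ?_
  obtain ⟨D, hD, hDe⟩ := hX.hasFDerivAt_inverse hΩ ht (hψΩ hy)
  have hFX : HasFDerivAt (fun y => F (X t y)) ((fderiv ℝ F (X t y)).comp (fderiv ℝ (X t) y)) y :=
    ((hF.differentiable (by norm_num)) (X t y)).hasFDerivAt.comp y (hX.hasFDerivAt hΩ ht (hψΩ hy))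
  have h := ((hψ.differentiable (by norm_num)) y).hasFDerivAt.smul (hD.clm_apply hFX)
  have h' : fderiv ℝ η y e = _ := congrArg (fun L : R3 →L[ℝ] R3 => L e) h.fderiv
  rw [h']
  simp only [pullGrad, extGrad_eq ht (hψΩ hy), ← extInv_eq ht (hψΩ hy)]
  simp only [add_apply, smul_apply, ContinuousLinearMap.smulRight_apply,
    ContinuousLinearMap.flip_apply, ContinuousLinearMap.comp_apply, hDe, neg_apply, sub_apply,
    map_sub]
  rw [add_comm, sub_eq_add_neg]

end IsVolumePreservingTransformation

end MovingDomain

namespace MovingDomain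

theorem memLp_two_of_bound {V E : Type*} [NormedAddCommGroup V] [MeasureSpace V]
    [BorelSpace V] [IsFiniteMeasureOnCompacts (volume : Measure V)] [NormedAddCommGroup E]
    {K : Set V} (hK : IsCompact K) {f : V → E} (hf : AEStronglyMeasurable f (volume.restrict K))
    (C : ℝ) (hC : ∀ x, ‖f x‖ ≤ C) : MemLp f 2 (volume.restrict K) :=
  haveI : IsFiniteMeasure ((volume : Measure V).restrict K) :=
    ⟨by simpa using hK.measure_lt_top⟩
  MemLp.of_bound hf C (ae_of_all _ hC)

namespace IsVolumePreservingTransformation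

variable {T : ℝ} {Ω : Set R3} {X : ℝ → R3 → R3}

theorem ExtBound.norm_pullGrad_le {K : NNReal} (hK : ExtBound T Ω X K) (t : ℝ) (y w : R3)
    (g : R3 →L[ℝ] R3) : ‖pullGrad T Ω X t y w g‖ ≤ K * (‖g‖ * K + K * (K * ‖w‖)) := by
  refine (ContinuousLinearMap.opNorm_comp_le _ _).trans ?_
  refine mul_le_mul (hK.norm_inv t y) ?_ (norm_nonneg _) K.2
  refine (norm_sub_le _ _).trans (add_le_add ?_ ?_)
  · exact (ContinuousLinearMap.opNorm_comp_le _ _).trans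
      (mul_le_mul_of_nonneg_left (hK.norm_grad t y) (norm_nonneg _))
  · refine (ContinuousLinearMap.le_opNorm _ _).trans ?_
    rw [ContinuousLinearMap.opNorm_flip]
    refine mul_le_mul (hK.norm_hess t y) ?_ (norm_nonneg _) K.2
    exact (ContinuousLinearMap.le_opNorm _ _).trans
      (mul_le_mul_of_nonneg_right (hK.norm_inv t y) (norm_nonneg _))

theorem aestronglyMeasurable_pullGrad {K : NNReal} (hK : ExtBound T Ω X K) (hΩ : IsOpen Ω)
    {α : Type*} [MeasurableSpace α] {μ : Measure α} {τ : α → ℝ} {z w : α → R3}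
    {g : α → R3 →L[ℝ] R3} (hτ : AEMeasurable τ μ) (hz : AEMeasurable z μ)
    (hw : AEStronglyMeasurable w μ) (hg : AEStronglyMeasurable g μ) :
    AEStronglyMeasurable (fun a => pullGrad T Ω X (τ a) (z a) (w a) (g a)) μ := by
  have hp : AEMeasurable (fun a => (τ a, z a)) μ := hτ.prodMk hz
  have hA := ((hK.grad.measurable_uncurry hΩ.measurableSet).comp_aemeasurable hp).aestronglyMeasurable
  have hB := ((hK.inv.measurable_uncurry hΩ.measurableSet).comp_aemeasurable hp).aestronglyMeasurable
  have hH := ((hK.hess.measurable_uncurry hΩ.measurableSet).comp_aemeasurable hp).aestronglyMeasurable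
  have hH' := (ContinuousLinearMap.flipₗᵢ ℝ R3 R3 R3).continuous.comp_aestronglyMeasurable hH
  have c1 := (ContinuousLinearMap.compL ℝ R3 R3 R3).aestronglyMeasurable_comp₂ hg hA
  have c2 := aestronglyMeasurable_clm_apply hH' (aestronglyMeasurable_clm_apply hB hw)
  exact (ContinuousLinearMap.compL ℝ R3 R3 R3).aestronglyMeasurable_comp₂ hB (c1.sub c2)

theorem memLp_pullGrad {K : NNReal} (hK : ExtBound T Ω X K) (hΩ : IsOpen Ω)
    {α : Type*} [MeasurableSpace α] {μ : Measure α} {τ : α → ℝ} {z w : α → R3}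
    {g : α → R3 →L[ℝ] R3} (hτ : AEMeasurable τ μ) (hz : AEMeasurable z μ)
    (hw : MemLp w 2 μ) (hg : MemLp g 2 μ) :
    MemLp (fun a => pullGrad T Ω X (τ a) (z a) (w a) (g a)) 2 μ := by
  have h : MemLp (fun a => K * (‖g a‖ * K + K * (K * ‖w a‖))) 2 μ :=
    ((hg.norm.mul_const _).add ((hw.norm.const_mul _).const_mul _)).const_mul _
  exact h.mono (aestronglyMeasurable_pullGrad hK hΩ hτ hz hw.1 hg.1)
    (ae_of_all _ fun a => (hK.norm_pullGrad_le _ _ _ _).trans (le_abs_self _))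

/-- Chain rule: `(∇X)⁻¹ f ∘ X(t)` is weakly differentiable on `Ω` when `f` is on `Ω(t)`. -/
theorem hasWeakGradient_pullback (hX : IsVolumePreservingTransformation T Ω X) (hΩ : IsOpen Ω)
    (hT : 0 ≤ T) {t : ℝ} (ht : t ∈ Icc 0 T) {f : R3 → R3} {G : R3 → R3 →L[ℝ] R3}
    (hf : MemLp f 2 (volume.restrict (domainAt Ω X t)))
    (hG : MemLp G 2 (volume.restrict (domainAt Ω X t)))
    (hfG : HasWeakGradient (domainAt Ω X t) f G) :
    HasWeakGradient Ω (fun y => extInv T Ω X t y (f (X t y)))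
      (fun y => pullGrad T Ω X t y (f (X t y)) (G (X t y))) := by
  obtain ⟨K, hK⟩ := hX.exists_extBound hΩ hT
  have hfX := hX.memLp_comp_apply hΩ ht hf
  have hGX := hX.memLp_comp_apply hΩ ht hG
  have hBm : Measurable fun y => extInv T Ω X t y :=
    (hK.inv.measurable_uncurry hΩ.measurableSet).comp measurable_prodMk_left
  have hAm : Measurable fun y => extGrad T Ω X t y :=
    (hK.grad.measurable_uncurry hΩ.measurableSet).comp measurable_prodMk_left
  have hHm : Measurable fun y => extHess T Ω X t y :=
    (hK.hess.measurable_uncurry hΩ.measurableSet).comp measurable_prodMk_left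
  have m1 : MemLp (fun y => extInv T Ω X t y (f (X t y))) 2 (volume.restrict Ω) :=
    memLp_clm_apply_of_bound hBm.aestronglyMeasurable (hK.norm_inv t) hfX
  have m2 : MemLp (fun y => pullGrad T Ω X t y (f (X t y)) (G (X t y))) 2 (volume.restrict Ω) :=
    memLp_pullGrad hK hΩ aemeasurable_const aemeasurable_id hfX hGX
  intro e
  have m2e := memLp_apply_const m2 e
  refine ⟨locallyIntegrableOn_of_memLp m1, locallyIntegrableOn_of_memLp m2e,
    fun ψ hψ hψc hψΩ => ?_⟩
  set S := tsupport ψ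
  have hS : IsCompact S := hψc
  have hXS : IsCompact (X t '' S) := hS.image_of_continuousOn ((hX.smooth t ht).continuousOn.mono hψΩ)
  have hXSΩ : X t '' S ⊆ domainAt Ω X t := image_mono hψΩ
  -- Approximation takes place on the Eulerian side, on the compact image of the support of ψ.
  -- Volume preservation carries the L² convergence back to that support with equal norms.
  obtain ⟨F, hF, hFc, hFl, hFd⟩ := exists_smooth_approx_grad (hX.isOpen_domainAt hΩ ht) hXS hXSΩ hf
    hG hfG
  have hmap := hX.map_restrict_apply hΩ ht hS.measurableSet hψΩ
  have hXm : AEMeasurable (X t) (volume.restrict S) :=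
    ((hX.smooth t ht).continuousOn.mono hψΩ).aemeasurable hS.measurableSet
  have hr : (volume.restrict (X t '' S)) ≤ volume.restrict (domainAt Ω X t) :=
    Measure.restrict_mono hXSΩ le_rfl
  have mF : ∀ n, MemLp (F n) 2 (volume.restrict (X t '' S)) := fun n =>
    memLp_of_continuous_hasCompactSupport (hF n).continuous (hFc n) _
  have mdF : ∀ n, MemLp (fderiv ℝ (F n)) 2 (volume.restrict (X t '' S)) := fun n =>
    memLp_of_continuous_hasCompactSupport ((hF n).continuous_fderiv (by norm_num))
      ((hFc n).fderiv ℝ) _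
  have comp : ∀ {E : Type} [NormedAddCommGroup E] {g : R3 → E},
      MemLp g 2 (volume.restrict (X t '' S)) → MemLp (fun y => g (X t y)) 2 (volume.restrict S) ∧
        eLpNorm (fun y => g (X t y)) 2 (volume.restrict S) =
          eLpNorm g 2 (volume.restrict (X t '' S)) := fun {E} _ {g} hg => by
    rw [← hmap] at hg ⊢
    exact ⟨hg.comp_of_map hXm, (eLpNorm_map_measure hg.1 hXm).symm⟩
  have c1 : Tendsto (fun n => eLpNorm (fun y => F n (X t y) - f (X t y)) 2 (volume.restrict S))
      atTop (𝓝 0) :=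
    hFl.congr fun n => (comp (g := fun x => F n x - f x) ((mF n).sub (hf.mono_measure hr))).2.symm
  have c2 : Tendsto (fun n => eLpNorm (fun y => fderiv ℝ (F n) (X t y) - G (X t y)) 2
      (volume.restrict S)) atTop (𝓝 0) :=
    hFd.congr fun n => (comp (g := fun x => fderiv ℝ (F n) x - G x)
      ((mdF n).sub (hG.mono_measure hr))).2.symm
  have rS : (volume.restrict S) ≤ volume.restrict Ω := Measure.restrict_mono hψΩ le_rfl
  have hψ' : Continuous fun y => fderiv ℝ ψ y e :=
    (hψ.continuous_fderiv (by norm_num)).clm_apply continuous_const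
  obtain ⟨C₁, hC₁⟩ := hψ'.bounded_above_of_compact_support (hψc.fderiv_apply ℝ e)
  obtain ⟨C₂, hC₂⟩ := hψ.continuous.bounded_above_of_compact_support hψc
  have hC₂0 : 0 ≤ C₂ := (norm_nonneg _).trans (hC₂ 0)
  -- the three coefficients
  let ℓ₁ : R3 → R3 →L[ℝ] R3 := fun y => fderiv ℝ ψ y e • extInv T Ω X t y
  let ℓ₂ : R3 → R3 →L[ℝ] R3 := fun y => ψ y • (extInv T Ω X t y).comp
    ((extHess T Ω X t y e).comp (extInv T Ω X t y))
  let ℓ₃ : R3 → (R3 →L[ℝ] R3) →L[ℝ] R3 := fun y => ψ y • (extInv T Ω X t y).comp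
    (ContinuousLinearMap.apply ℝ R3 (extGrad T Ω X t y e))
  have hHe : Measurable fun y => extHess T Ω X t y e :=
    (ContinuousLinearMap.apply ℝ (R3 →L[ℝ] R3) e).continuous.measurable.comp hHm
  have hAe : Measurable fun y => extGrad T Ω X t y e :=
    (ContinuousLinearMap.apply ℝ R3 e).continuous.measurable.comp hAm
  have M₁ : MemLp ℓ₁ 2 (volume.restrict S) := by
    refine memLp_two_of_bound hS (hψ'.aestronglyMeasurable.smul hBm.aestronglyMeasurable) (C₁ * K)
      fun y => ?_
    rw [norm_smul]
    exact mul_le_mul (hC₁ y) (hK.norm_inv t y) (norm_nonneg _) ((norm_nonneg _).trans (hC₁ y))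
  have M₂ : MemLp ℓ₂ 2 (volume.restrict S) := by
    refine memLp_two_of_bound hS (hψ.continuous.aestronglyMeasurable.smul ?_)
      (C₂ * (K * ((K * ‖e‖) * K))) fun y => ?_
    · exact (ContinuousLinearMap.compL ℝ R3 R3 R3).aestronglyMeasurable_comp₂
        hBm.aestronglyMeasurable ((ContinuousLinearMap.compL ℝ R3 R3 R3).aestronglyMeasurable_comp₂
          hHe.aestronglyMeasurable hBm.aestronglyMeasurable)
    · rw [norm_smul]
      refine mul_le_mul (hC₂ y) ?_ (norm_nonneg _) hC₂0
      refine (ContinuousLinearMap.opNorm_comp_le _ _).trans ?_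
      refine mul_le_mul (hK.norm_inv t y) ?_ (norm_nonneg _) K.2
      refine (ContinuousLinearMap.opNorm_comp_le _ _).trans ?_
      refine mul_le_mul ?_ (hK.norm_inv t y) (norm_nonneg _) (by positivity)
      exact ((extHess T Ω X t y).le_opNorm e).trans
        (mul_le_mul_of_nonneg_right (hK.norm_hess t y) (norm_nonneg _))
  have M₃ : MemLp ℓ₃ 2 (volume.restrict S) := by
    have aux : AEStronglyMeasurable (fun y => (extInv T Ω X t y).comp
        (ContinuousLinearMap.apply ℝ R3 (extGrad T Ω X t y e))) (volume.restrict S) :=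
      (continuous_fst.clm_comp continuous_snd).comp_aestronglyMeasurable
      (hBm.aestronglyMeasurable.prodMk ((ContinuousLinearMap.apply ℝ R3 :
          R3 →L[ℝ] (R3 →L[ℝ] R3) →L[ℝ] R3).continuous.comp_aestronglyMeasurable
            hAe.aestronglyMeasurable))
    refine memLp_two_of_bound hS (f := ℓ₃) (AEStronglyMeasurable.smul
      hψ.continuous.aestronglyMeasurable aux) (C₂ * (K * (K * ‖e‖))) fun y => ?_
    · refine (ContinuousLinearMap.opNorm_smul_le _ _).trans ?_
      refine mul_le_mul (hC₂ y) ?_ (ContinuousLinearMap.opNorm_nonneg _) hC₂0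
      refine (ContinuousLinearMap.opNorm_comp_le _ _).trans ?_
      refine mul_le_mul (hK.norm_inv t y) ?_ (ContinuousLinearMap.opNorm_nonneg _) K.2
      refine (ContinuousLinearMap.opNorm_le_bound _ (by positivity) fun L => ?_)
      rw [ContinuousLinearMap.apply_apply, mul_comm]
      refine (L.le_opNorm _).trans (mul_le_mul_of_nonneg_left ?_ (norm_nonneg _))
      exact ((extGrad T Ω X t y).le_opNorm e).trans
        (mul_le_mul_of_nonneg_right (hK.norm_grad t y) (norm_nonneg _))
  have mFX : ∀ n, MemLp (fun y => F n (X t y)) 2 (volume.restrict S) := fun n => (comp (mF n)).1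
  have mdFX : ∀ n, MemLp (fun y => fderiv ℝ (F n) (X t y)) 2 (volume.restrict S) := fun n =>
    (comp (mdF n)).1
  have hfS := hfX.mono_measure rS
  have hGS := hGX.mono_measure rS
  have L₁ := tendsto_integral_clm_apply M₁ (Eventually.of_forall mFX) hfS c1
  have L₂ := tendsto_integral_clm_apply M₂ (Eventually.of_forall mFX) hfS c1
  have L₃ := tendsto_integral_clm_apply M₃ (Eventually.of_forall mdFX) hGS c2
  -- The integrand is linear in the value and the gradient of the field, with bounded coefficients;
  -- each coefficient is paired separately so that the limit can be taken.
  have split : ∀ {a : R3 → R3} {b : R3 → R3 →L[ℝ] R3}, MemLp a 2 (volume.restrict S) →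
      MemLp b 2 (volume.restrict S) →
      ∫ y in S, (fderiv ℝ ψ y e • extInv T Ω X t y (a y) + ψ y • pullGrad T Ω X t y (a y) (b y) e) =
      (∫ y in S, ℓ₁ y (a y)) + ((∫ y in S, ℓ₃ y (b y)) - ∫ y in S, ℓ₂ y (a y)) :=
    fun {a b} ha hb => by
      have i1 := integrable_clm_apply M₁ ha
      have i2 := integrable_clm_apply M₂ ha
      have i3 := integrable_clm_apply M₃ hb
      have i32 : Integrable (fun y => ℓ₃ y (b y) - ℓ₂ y (a y)) (volume.restrict S) := i3.sub i2
      rw [← integral_sub i3 i2, ← integral_add i1 i32]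
      refine integral_congr_ae (ae_of_all _ fun y => ?_)
      simp [ℓ₁, ℓ₂, ℓ₃, pullGrad, smul_sub]
  have lim := L₁.add (L₃.sub L₂)
  have id0 := fun n => hX.integral_pullback_smooth hΩ ht hψ hψc hψΩ (hF n) e
  simp only [← split (mFX _) (mdFX _), ← split hfS hGS] at lim
  simp only [S, id0] at lim
  have h0 := tendsto_nhds_unique tendsto_const_nhds lim
  rw [integral_add] at h0
  · rw [setIntegral_eq_integral_of_forall_compl_eq_zero fun y hy => by
        rw [fderiv_of_notMem_tsupport ℝ (fun h => hy (hψΩ h))]; simp,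
      setIntegral_eq_integral_of_forall_compl_eq_zero fun y hy => by
        rw [image_eq_zero_of_notMem_tsupport (fun h => hy (hψΩ h))]; simp]
    rw [setIntegral_eq_integral_of_forall_compl_eq_zero fun y hy => by
        rw [fderiv_of_notMem_tsupport ℝ hy]; simp,
      setIntegral_eq_integral_of_forall_compl_eq_zero fun y hy => by
        rw [image_eq_zero_of_notMem_tsupport hy]; simp] at h0
    exact eq_neg_of_add_eq_zero_left h0.symm
  · exact integrable_clm_apply M₁ hfS
  · have := (memLp_two_of_bound hS (f := ψ) hψ.continuous.aestronglyMeasurable C₂ hC₂)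
    exact memLp_one_iff_integrable.1 ((m2e.mono_measure rS).smul (r := 1) this)

end IsVolumePreservingTransformation

end MovingDomain

/-! ### Two vanishing integrals: derivatives in time, and transport by a divergence-free velocity.
-/

namespace MovingDomain

theorem exists_norm_bilin_sub_le {ι E₁ E₂ E₃ : Type*} [NormedAddCommGroup E₁] [NormedSpace ℝ E₁]
    [NormedAddCommGroup E₂] [NormedSpace ℝ E₂] [NormedAddCommGroup E₃] [NormedSpace ℝ E₃]
    (L : E₁ →L[ℝ] E₂ →L[ℝ] E₃) {f : ℝ → ι → E₁} {g : ℝ → ι → E₂} {Kf Kg : NNReal} {Cf Cg : ℝ}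
    (hf : ∀ i, LipschitzWith Kf fun s => f s i) (hg : ∀ i, LipschitzWith Kg fun s => g s i)
    (hfC : ∀ s i, ‖f s i‖ ≤ Cf) (hgC : ∀ s i, ‖g s i‖ ≤ Cg) :
    ∃ K : NNReal, ∀ i, LipschitzWith K fun s => L (f s i) (g s i) := by
  refine ⟨(‖L‖ * (Kf * |Cg| + |Cf| * Kg)).toNNReal, fun i =>
    LipschitzWith.of_dist_le_mul fun s t => ?_⟩
  have h1 := (hf i).dist_le_mul s t
  have h2 := (hg i).dist_le_mul s t
  rw [dist_eq_norm] at h1 h2 ⊢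
  rw [Real.coe_toNNReal _ (by positivity)]
  have e : L (f s i) (g s i) - L (f t i) (g t i) =
      L (f s i - f t i) (g s i) + L (f t i) (g s i - g t i) := by
    simp only [map_sub, sub_apply]; abel
  rw [e]
  calc _ ≤ ‖L‖ * ‖f s i - f t i‖ * ‖g s i‖ + ‖L‖ * ‖f t i‖ * ‖g s i - g t i‖ :=
        (norm_add_le _ _).trans (add_le_add (L.le_opNorm₂ _ _) (L.le_opNorm₂ _ _))
    _ ≤ ‖L‖ * (Kf * dist s t) * |Cg| + ‖L‖ * |Cf| * (Kg * dist s t) := by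
        gcongr
        · exact (hgC s i).trans (le_abs_self _)
        · exact (hfC t i).trans (le_abs_self _)
    _ = _ := by ring

/-- The integral of a time translate of f does not depend on the translation. Its derivative at zero
translation is the integral of f', and the Lipschitz bound justifies differentiating under the
integral although f' exists only almost everywhere. -/
theorem integral_deriv_eq_zero_of_lipschitz {E : Type*} [NormedAddCommGroup E] [NormedSpace ℝ E]
    {Ω : Set R3} (hΩ : MeasurableSet Ω) (hΩf : volume Ω ≠ ⊤) {t : ℝ} {K : NNReal} {f : ℝ → R3 → E}
    {f' : ℝ × R3 → E}
    (hm : StronglyMeasurable fun p : ℝ × R3 => f p.1 p.2) (hlip : ∀ y, LipschitzWith K fun s => f s y)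
    (h0 : ∀ s y, f s y ≠ 0 → s ∈ Ioo 0 t ∧ y ∈ Ω) (hm' : AEStronglyMeasurable f')
    (hd : ∀ᵐ p : ℝ × R3, HasDerivAt (fun s => f s p.2) (f' p) p.1) :
    IntegrableOn f' (Ioo 0 t ×ˢ Ω) ∧ ∫ p in Ioo 0 t ×ˢ Ω, f' p = 0 := by
  -- This set of finite measure contains the supports of all translates by less than one, and so
  -- carries an integrable dominating function.
  let S : Set (ℝ × R3) := Icc (-1) (t + 1) ×ˢ Ω
  have hS : MeasurableSet S := measurableSet_Icc.prod hΩ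
  have hSf : volume S ≠ ⊤ := by
    rw [Measure.volume_eq_prod, Measure.prod_prod]
    exact ENNReal.mul_ne_top (by simp) hΩf
  let F : ℝ → ℝ × R3 → E := fun s p => f (p.1 + s) p.2
  have hFm : ∀ s, StronglyMeasurable (F s) := fun s =>
    hm.comp_measurable ((measurable_fst.add_const s).prodMk measurable_snd)
  have hzero : ∀ p ∉ S, ∀ s ∈ Metric.ball (0 : ℝ) 1, F s p = 0 := fun p hp s hs => by
    by_contra h
    have := h0 _ _ h
    rw [Metric.mem_ball, dist_zero_right, Real.norm_eq_abs, abs_lt] at hs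
    exact hp ⟨⟨by linarith [this.1.1], by linarith [this.1.2]⟩, this.2⟩
  have hb : ∀ s y, ‖f s y‖ ≤ K * |s| := fun s y => by
    have h1 : f 0 y = 0 := by
      by_contra h
      exact lt_irrefl _ (h0 _ _ h).1.1
    have := (hlip y).dist_le_mul s 0
    rwa [h1, dist_zero_right, dist_zero_right] at this
  have hF0 : Integrable (F 0) := by
    have : IntegrableOn (F 0) S :=
      Measure.integrableOn_of_bounded (M := K * (|t| + 1)) hSf
        (hFm 0).aestronglyMeasurable ((ae_restrict_iff' hS).2 (ae_of_all _ fun p hp => by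
          by_cases h : F 0 p = 0
          · rw [h, norm_zero]; positivity
          · have h1 := (h0 _ _ h).1
            refine (hb _ _).trans (mul_le_mul_of_nonneg_left ?_ K.2)
            rw [abs_of_pos h1.1]; linarith [h1.2, le_abs_self t]))
    rw [← integrableOn_iff_integrable_of_support_subset (s := S)]
    · exact this
    · intro p hp
      by_contra h
      exact hp (hzero p h 0 (by simp))
  have hl : ∀ p, LipschitzOnWith (Real.nnabs (S.indicator (fun _ => (K : ℝ)) p)) (fun s => F s p)
      (Metric.ball 0 1) := fun p => by
    by_cases hp : p ∈ S
    · rw [indicator_of_mem hp, Real.nnabs_coe]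
      refine LipschitzWith.lipschitzOnWith (LipschitzWith.of_dist_le_mul fun a b => ?_)
      simpa using (hlip p.2).dist_le_mul (p.1 + a) (p.1 + b)
    · rw [indicator_of_notMem hp]
      intro a ha b hb
      simp [hzero p hp a ha, hzero p hp b hb]
  have hd' : ∀ᵐ p : ℝ × R3, HasDerivAt (fun s => F s p) (f' p) 0 := by
    filter_upwards [hd] with p hp
    have h1 : HasDerivAt (fun s => f s p.2) (f' p) (p.1 + 0) := by rwa [add_zero]
    exact h1.comp_const_add _ _
  obtain ⟨hi, hder⟩ := hasDerivAt_integral_of_dominated_loc_of_lip (μ := volume) (F := F) (F' := f')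
    (x₀ := (0 : ℝ)) (bound := S.indicator fun _ => (K : ℝ)) (Metric.ball_mem_nhds 0 one_pos)
    (Eventually.of_forall fun s => (hFm s).aestronglyMeasurable) hF0 hm'
    (ae_of_all _ hl) ((integrable_indicator_iff hS).2 (integrableOn_const hSf)) hd'
  refine ⟨hi.integrableOn, ?_⟩
  have hc : ∀ s, ∫ p, F s p = ∫ p, F 0 p := fun s => by
    have := integral_add_right_eq_self (μ := (volume : Measure (ℝ × R3)))
      (fun p => f p.1 p.2) (s, (0 : R3))
    simpa [F] using this
  simp only [hc] at hder
  rw [← hder.unique (hasDerivAt_const _ _)]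
  -- Off the cylinder, and off the null set of the times 0 and t, f vanishes for nearby times, so
  -- its derivative there is zero.
  refine setIntegral_eq_integral_of_ae_compl_eq_zero ?_
  have hnull : ∀ᵐ p : ℝ × R3, p.1 ≠ 0 ∧ p.1 ≠ t := by
    have : ∀ a : ℝ, ∀ᵐ p : ℝ × R3, p.1 ≠ a := fun a =>
      Measure.quasiMeasurePreserving_fst.ae (ae_iff.2 (by simp) : ∀ᵐ s : ℝ, s ≠ a)
    exact (this 0).and (this t)
  filter_upwards [hd, hnull] with p hp hn hpS
  have hev : (fun s => f s p.2) =ᶠ[𝓝 p.1] fun _ => 0 := by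
    have hcase : p.2 ∉ Ω ∨ p.1 ∈ (Icc 0 t)ᶜ := by
      by_contra! h
      have h2 : p.1 ∈ Icc 0 t := by simpa using h.2
      exact hpS ⟨⟨lt_of_le_of_ne h2.1 (Ne.symm hn.1), lt_of_le_of_ne h2.2 hn.2⟩, h.1⟩
    rcases hcase with h | h
    · exact Eventually.of_forall fun s => by
        by_contra h'; exact h (h0 _ _ h').2
    · filter_upwards [isClosed_Icc.isOpen_compl.mem_nhds h] with s hs
      by_contra h'
      exact hs (Ioo_subset_Icc_self (h0 _ _ h').1)
  exact hp.unique ((hasDerivAt_const p.1 (0 : E)).congr_of_eventuallyEq hev)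

namespace IsVolumePreservingTransformation

variable {T : ℝ} {Ω : Set R3} {X : ℝ → R3 → R3}

/-- X(0) is bounded, so Ω(0) is bounded; Ω has the same volume. Finiteness makes constants
integrable in the domination arguments below. -/
theorem volume_ne_top (hX : IsVolumePreservingTransformation T Ω X) (hΩ : IsOpen Ω)
    (hT : 0 ≤ T) : volume Ω ≠ ⊤ := by
  obtain ⟨K, hK⟩ := hX.exists_extBound hΩ hT
  have h := hX.lintegral_domainAt hΩ (left_mem_Icc.2 hT) fun _ => 1
  simp only [lintegral_const, Measure.restrict_apply_univ, one_mul] at h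
  rw [← h]
  refine ((measure_mono (t := Metric.closedBall 0 K) ?_).trans_lt measure_closedBall_lt_top).ne
  rintro _ ⟨y, hy, rfl⟩
  have := hK.norm_pos 0 y
  rw [extPos_eq (left_mem_Icc.2 hT) hy] at this
  simpa using this

theorem eventually_subset_domainAt (hX : IsVolumePreservingTransformation T Ω X) (hΩ : IsOpen Ω)
    {τ : ℝ} (hτ : τ ∈ Ioo 0 T) {S : Set R3} (hS : IsCompact S) (hSΩ : S ⊆ domainAt Ω X τ) :
    ∀ᶠ s in 𝓝 τ, S ⊆ domainAt Ω X s := by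
  obtain ⟨u, v, hu, -, hτu, hSv, huv⟩ := generalized_tube_lemma (isCompact_singleton (x := τ)) hS
    (hX.isOpen_spaceTime hΩ le_rfl) (n := spaceTime Ω X T) (by
      rintro ⟨a, x⟩ ⟨rfl, hx⟩
      exact ⟨hτ, hSΩ hx⟩)
  filter_upwards [hu.mem_nhds (hτu rfl)] with s hs x hx
  exact (huv ⟨hs, hSv hx⟩ : (s, x) ∈ spaceTime Ω X T).2

/-- The velocity field of a volume-preserving transformation is weakly divergence free. -/
theorem integral_fderiv_extVel (hX : IsVolumePreservingTransformation T Ω X) (hΩ : IsOpen Ω)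
    {τ : ℝ} (hτ : τ ∈ Ioo 0 T)
    (hd : ∀ᵐ y : R3, HasDerivAt (fun s => extPos T Ω X s y) (extVel T Ω X τ y) τ)
    {F : Type*} [NormedAddCommGroup F] [NormedSpace ℝ F]
    {θ : R3 → F} (hθ : ContDiff ℝ 1 θ) (hθc : HasCompactSupport θ)
    (hθs : tsupport θ ⊆ domainAt Ω X τ) :
    ∫ y in Ω, fderiv ℝ θ (X τ y) (extVel T Ω X τ y) = 0 := by
  have hT : 0 ≤ T := (hτ.1.trans hτ.2).le
  obtain ⟨K, hK⟩ := hX.exists_extBound hΩ hT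
  obtain ⟨C, hC⟩ := hθ.lipschitzWith_of_hasCompactSupport hθc (by norm_num)
  haveI : IsFiniteMeasure (volume.restrict Ω : Measure R3) :=
    ⟨by simpa using (hX.volume_ne_top hΩ hT).lt_top⟩
  have hpm : ∀ s, Measurable (extPos T Ω X s) := fun s =>
    (hK.pos.measurable_uncurry hΩ.measurableSet).comp measurable_prodMk_left
  have hvm : Measurable (extVel T Ω X τ) :=
    (hK.pos.measurable_deriv hΩ.measurableSet).comp measurable_prodMk_left
  have hm : ∀ s, AEStronglyMeasurable (fun y => θ (extPos T Ω X s y)) (volume.restrict Ω) := fun s =>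
    (hθ.continuous.stronglyMeasurable.comp_measurable (hpm s)).aestronglyMeasurable
  obtain ⟨M, hM⟩ := hθ.continuous.bounded_above_of_compact_support hθc
  obtain ⟨-, hder⟩ := hasDerivAt_integral_of_dominated_loc_of_lip (μ := volume.restrict Ω)
    (F := fun s y => θ (extPos T Ω X s y))
    (F' := fun y => fderiv ℝ θ (extPos T Ω X τ y) (extVel T Ω X τ y))
    (x₀ := τ) (s := univ) (bound := fun _ => ((C * K : NNReal) : ℝ)) univ_mem
    (Eventually.of_forall hm) (Integrable.of_bound (hm τ) M (ae_of_all _ fun y => hM _))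
    (aestronglyMeasurable_clm_apply (((hθ.continuous_fderiv
      (by norm_num)).stronglyMeasurable.comp_measurable (hpm τ)).aestronglyMeasurable)
        hvm.aestronglyMeasurable)
    (ae_of_all _ fun y => by
      rw [Real.nnabs_coe]
      exact (hC.comp (hK.pos.lip y)).lipschitzOnWith)
    (integrable_const _) (ae_restrict_of_ae (hd.mono fun y hy =>
      ((hθ.differentiable (by norm_num)) _).hasFDerivAt.comp_hasDerivAt τ hy))
  -- For s near τ the domain Ω(s) still contains the support of θ, so volume preservation makes this
  -- integral equal to ∫ θ. Its derivative at τ, computed by the chain rule, is therefore zero.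
  have hev : (fun s => ∫ y in Ω, θ (extPos T Ω X s y)) =ᶠ[𝓝 τ] fun _ => ∫ x, θ x := by
    filter_upwards [hX.eventually_subset_domainAt hΩ hτ hθc.isCompact hθs,
      Ioo_mem_nhds hτ.1 hτ.2] with s hs hs'
    have hs'' := Ioo_subset_Icc_self hs'
    rw [← setIntegral_eq_integral_of_forall_compl_eq_zero (s := domainAt Ω X s) (fun x hx =>
      image_eq_zero_of_notMem_tsupport fun h => hx (hs h)), hX.integral_domainAt hΩ hs'']
    exact setIntegral_congr_fun hΩ.measurableSet fun y hy => by
      simp only [extPos_eq hs'' hy]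
  have := hder.unique ((hasDerivAt_const τ _).congr_of_eventuallyEq hev)
  rw [← this]
  exact setIntegral_congr_fun hΩ.measurableSet fun y hy => by
    simp only [extPos_eq (Ioo_subset_Icc_self hτ) hy]

end IsVolumePreservingTransformation

end MovingDomain

/-! ### The weak time derivative of a push-forward. -/

namespace MovingDomain

/-- The pulled-back velocity `(∇X)⁻¹ ∂_t X`. -/
noncomputable def extPull (T : ℝ) (Ω : Set R3) (X : ℝ → R3 → R3) (t : ℝ) (y : R3) : R3 :=
  extInv T Ω X t y (extVel T Ω X t y)

/-- The Eulerian time derivative, in Lagrangian variables, of the push-forward by `X` of a field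
which has the value `w` and the space-time gradient `G` at `(t, y)`. -/
noncomputable def timeRate (T : ℝ) (Ω : Set R3) (X : ℝ → R3 → R3) (t : ℝ) (y w : R3)
    (G : ℝ × R3 →L[ℝ] R3) : R3 :=
  (extGradRate T Ω X t y - extHess T Ω X t y (extPull T Ω X t y)) w +
    extGrad T Ω X t y (G (1, -extPull T Ω X t y))

namespace IsVolumePreservingTransformation

variable {T : ℝ} {Ω : Set R3} {X : ℝ → R3 → R3}

namespace ExtBound

variable {K : NNReal}

theorem norm_vel (hK : ExtBound T Ω X K) (t : ℝ) (y : R3) : ‖extVel T Ω X t y‖ ≤ K :=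
  hK.pos.norm_deriv_le t y

theorem norm_gradRate (hK : ExtBound T Ω X K) (t : ℝ) (y : R3) : ‖extGradRate T Ω X t y‖ ≤ K :=
  hK.grad.norm_deriv_le t y

theorem norm_pull (hK : ExtBound T Ω X K) (t : ℝ) (y : R3) : ‖extPull T Ω X t y‖ ≤ K * K :=
  (ContinuousLinearMap.le_opNorm _ _).trans
    (mul_le_mul (hK.norm_inv t y) (hK.norm_vel t y) (norm_nonneg _) K.2)

theorem measurable_vel (hK : ExtBound T Ω X K) (hΩ : IsOpen Ω) :
    Measurable fun p : ℝ × R3 => extVel T Ω X p.1 p.2 :=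
  hK.pos.measurable_deriv hΩ.measurableSet

theorem measurable_gradRate (hK : ExtBound T Ω X K) (hΩ : IsOpen Ω) :
    Measurable fun p : ℝ × R3 => extGradRate T Ω X p.1 p.2 :=
  hK.grad.measurable_deriv hΩ.measurableSet

theorem measurable_pull (hK : ExtBound T Ω X K) (hΩ : IsOpen Ω) :
    Measurable fun p : ℝ × R3 => extPull T Ω X p.1 p.2 :=
  ((ContinuousLinearMap.id ℝ (R3 →L[ℝ] R3)).continuous₂).measurable.comp
    ((hK.inv.measurable_uncurry hΩ.measurableSet).prodMk (hK.measurable_vel hΩ))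

theorem measurable_rate (hK : ExtBound T Ω X K) (hΩ : IsOpen Ω) :
    Measurable fun p : ℝ × R3 => extGradRate T Ω X p.1 p.2 -
      extHess T Ω X p.1 p.2 (extPull T Ω X p.1 p.2) :=
  (hK.measurable_gradRate hΩ).sub
    ((show Continuous fun q : (R3 →L[ℝ] R3 →L[ℝ] R3) × R3 => q.1 q.2 from
      continuous_fst.clm_apply continuous_snd).measurable.comp ((hK.hess.measurable_uncurry hΩ.measurableSet).prodMk (hK.measurable_pull hΩ)))

theorem norm_rate (hK : ExtBound T Ω X K) (t : ℝ) (y : R3) :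
    ‖extGradRate T Ω X t y - extHess T Ω X t y (extPull T Ω X t y)‖ ≤ K + K * (K * K) :=
  (norm_sub_le _ _).trans (add_le_add (hK.norm_gradRate t y)
    ((ContinuousLinearMap.le_opNorm _ _).trans
      (mul_le_mul (hK.norm_hess t y) (hK.norm_pull t y) (norm_nonneg _) K.2)))

theorem measurable_dir (hK : ExtBound T Ω X K) (hΩ : IsOpen Ω) :
    Measurable fun p : ℝ × R3 => ((1 : ℝ), -extPull T Ω X p.1 p.2) :=
  measurable_const.prodMk (hK.measurable_pull hΩ).neg

theorem norm_dir (hK : ExtBound T Ω X K) (t : ℝ) (y : R3) :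
    ‖((1 : ℝ), -extPull T Ω X t y)‖ ≤ 1 + K * K := by
  rw [Prod.norm_def, norm_neg]
  refine max_le ?_ ((hK.norm_pull t y).trans ?_)
  · simp; positivity
  · simp

theorem memLp_timeRate (hK : ExtBound T Ω X K) (hΩ : IsOpen Ω) {μ : Measure (ℝ × R3)}
    {w : ℝ × R3 → R3} {G : ℝ × R3 → ℝ × R3 →L[ℝ] R3} (hw : MemLp w 2 μ) (hG : MemLp G 2 μ) :
    MemLp (fun p => timeRate T Ω X p.1 p.2 (w p) (G p)) 2 μ := by
  have h1 := memLp_clm_apply_of_bound (hK.measurable_rate hΩ).aestronglyMeasurable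
    (fun p : ℝ × R3 => hK.norm_rate p.1 p.2) hw
  have h2 : MemLp (fun p => G p ((1 : ℝ), -extPull T Ω X p.1 p.2)) 2 μ :=
    hG.of_le_mul (c := 1 + K * K)
      (aestronglyMeasurable_clm_apply hG.1 (hK.measurable_dir hΩ).aestronglyMeasurable)
      (ae_of_all _ fun p => ((G p).le_opNorm _).trans ((mul_comm _ _).trans_le
        (mul_le_mul_of_nonneg_right (hK.norm_dir _ _) (norm_nonneg _))))
  exact h1.add (memLp_clm_apply_of_bound
    (hK.grad.measurable_uncurry hΩ.measurableSet).aestronglyMeasurable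
    (fun p : ℝ × R3 => hK.norm_grad p.1 p.2) h2)

end ExtBound

/-- The divergence-free identity applied to θ = φ(τ,·) (∇X w)∘Y. Since ∇X maps `extPull` to the
velocity, the derivative of θ along the velocity is the derivative of θ∘X along `extPull`, which the
product rule expands. -/
theorem integral_slice_smooth (hX : IsVolumePreservingTransformation T Ω X) (hΩ : IsOpen Ω)
    {t τ : ℝ} (ht : t ≤ T) (hτ : τ ∈ Ioo 0 t)
    (hd : ∀ᵐ y : R3, HasDerivAt (fun s => extPos T Ω X s y) (extVel T Ω X τ y) τ)
    {φ : ℝ × R3 → ℝ} (hφ : ContDiff ℝ ∞ φ) (hφc : HasCompactSupport φ)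
    (hφs : tsupport φ ⊆ spaceTime Ω X t) {w : ℝ × R3 → R3} (hw : ContDiff ℝ ∞ w) :
    ∫ y in Ω, (fderiv ℝ φ (τ, extPos T Ω X τ y) (0, extVel T Ω X τ y) • extGrad T Ω X τ y (w (τ, y)) +
      φ (τ, extPos T Ω X τ y) • (extHess T Ω X τ y (extPull T Ω X τ y) (w (τ, y)) +
        extGrad T Ω X τ y (fderiv ℝ w (τ, y) (0, extPull T Ω X τ y)))) = 0 := by
  have hτT : τ ∈ Ioo 0 T := ⟨hτ.1, hτ.2.trans_le ht⟩
  have hτ' := Ioo_subset_Icc_self hτT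
  -- θ is defined through Y only on Ω(τ); the factor φ cuts it off inside Ω(τ), which makes it
  -- smooth on the whole space.
  let θ : R3 → R3 := fun x => φ (τ, x) •
    fderiv ℝ (X τ) (inverseMap Ω X τ x) (w (τ, inverseMap Ω X τ x))
  have hemb : ContDiff ℝ ∞ fun x : R3 => (τ, x) := contDiff_const.prodMk contDiff_id
  have hsub : tsupport θ ⊆ (fun x : R3 => (τ, x)) ⁻¹' tsupport φ := by
    refine closure_minimal (fun x hx => ?_) ((isClosed_tsupport φ).preimage hemb.continuous)
    refine subset_tsupport φ fun h => hx ?_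
    simp [θ, h]
  have hsupp : tsupport θ ⊆ domainAt Ω X τ := fun x hx => (hφs (hsub hx)).2
  have hθc : HasCompactSupport θ := HasCompactSupport.of_support_subset_isCompact
    (hφc.isCompact.image continuous_snd) fun x hx => ⟨(τ, x), hsub (subset_tsupport θ hx), rfl⟩
  have hdX : ContDiffOn ℝ ∞ (fderiv ℝ (X τ)) Ω := fun y hy =>
    (hX.contDiffAt_fderiv hΩ hτ' hy).contDiffWithinAt
  have hmaps : MapsTo (inverseMap Ω X τ) (domainAt Ω X τ) Ω := fun x hx => inverseMap_mem hx
  have hθ : ContDiff ℝ ∞ θ := contDiff_of_tsupport_subset (hX.isOpen_domainAt hΩ hτ')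
    ((hφ.comp hemb).contDiffOn.smul ((hdX.comp (hX.smooth_inverse τ hτ') hmaps).clm_apply
      ((hw.comp hemb).comp_contDiffOn (hX.smooth_inverse τ hτ')))) hsupp
  rw [← hX.integral_fderiv_extVel hΩ hτT hd (hθ.of_le (by exact_mod_cast le_top)) hθc hsupp]
  refine setIntegral_congr_fun hΩ.measurableSet fun y hy => ?_
  have hXy := hX.hasFDerivAt hΩ hτ' hy
  have h1 : HasFDerivAt (fun y => φ (τ, X τ y) • fderiv ℝ (X τ) y (w (τ, y)))
      ((fderiv ℝ θ (X τ y)).comp (fderiv ℝ (X τ) y)) y := by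
    refine (((hθ.differentiable (by norm_num)) (X τ y)).hasFDerivAt.comp y hXy).congr_of_eventuallyEq
      ((hΩ.eventually_mem hy).mono fun z hz => ?_)
    simp [θ, hX.inverseMap_apply hτ' hz]
  have hemb' : HasFDerivAt (fun y : R3 => (τ, y)) (ContinuousLinearMap.inr ℝ ℝ R3) y :=
    hasFDerivAt_prodMk_right τ y
  have hφ' : HasFDerivAt (fun y => φ (τ, X τ y)) ((fderiv ℝ φ (τ, X τ y)).comp
      ((ContinuousLinearMap.inr ℝ ℝ R3).comp (fderiv ℝ (X τ) y))) y :=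
    ((hφ.differentiable (by norm_num)) (τ, X τ y)).hasFDerivAt.comp y
      ((hasFDerivAt_prodMk_right τ (X τ y)).comp y hXy)
  have h2 := hφ'.smul ((((hX.contDiffAt_fderiv hΩ hτ' hy).differentiableAt
    (by norm_num)).hasFDerivAt).clm_apply
      (((hw.differentiable (by norm_num)) (τ, y)).hasFDerivAt.comp y hemb'))
  have hA := hX.extGrad_extInv hτ' hy (extVel T Ω X τ y)
  rw [extGrad_eq hτ' hy] at hA
  have h3 := congrArg (fun L : R3 →L[ℝ] R3 => L (extPull T Ω X τ y)) (h1.unique h2)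
  simp only [ContinuousLinearMap.comp_apply, extPull, hA, add_apply, smul_apply,
    ContinuousLinearMap.smulRight_apply, ContinuousLinearMap.flip_apply,
    ContinuousLinearMap.inr_apply, Function.comp_apply] at h3
  simp only [h3, extPos_eq hτ' hy, extGrad_eq hτ' hy, extHess_eq hτ' hy, extPull]
  simp only [smul_add]
  abel

end IsVolumePreservingTransformation

end MovingDomain

namespace MovingDomain
namespace IsVolumePreservingTransformation

variable {T : ℝ} {Ω : Set R3} {X : ℝ → R3 → R3}

theorem volume_prod_ne_top (hX : IsVolumePreservingTransformation T Ω X) (hΩ : IsOpen Ω)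
    (hT : 0 ≤ T) (t : ℝ) : volume (Ioo 0 t ×ˢ Ω) ≠ ⊤ := by
  rw [Measure.volume_eq_prod, Measure.prod_prod]
  exact ENNReal.mul_ne_top (by simp) (hX.volume_ne_top hΩ hT)

/-- `timeRate` is the derivative along trajectories minus transport. With E₁ the derivative along
trajectories of φ(t, X) ∇X w and E₂ the transport of the same quantity, the integrand is E₁ - E₂,
and each of the two integrates to zero. -/
theorem integral_timeRate_smooth (hX : IsVolumePreservingTransformation T Ω X) (hΩ : IsOpen Ω)
    (hT : 0 ≤ T) {t : ℝ} (ht : t ≤ T) {φ : ℝ × R3 → ℝ} (hφ : ContDiff ℝ ∞ φ)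
    (hφc : HasCompactSupport φ) (hφs : tsupport φ ⊆ spaceTime Ω X t) {w : ℝ × R3 → R3}
    (hw : ContDiff ℝ ∞ w) (hwc : HasCompactSupport w) :
    ∫ p in Ioo 0 t ×ˢ Ω, (fderiv ℝ φ (p.1, extPos T Ω X p.1 p.2) (1, 0) •
      extGrad T Ω X p.1 p.2 (w p) +
      φ (p.1, extPos T Ω X p.1 p.2) • timeRate T Ω X p.1 p.2 (w p) (fderiv ℝ w p)) = 0 := by
  obtain ⟨K, hK⟩ := hX.exists_extBound hΩ hT
  have hΩm := hΩ.measurableSet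
  have hpos := hK.pos.measurable_uncurry hΩm
  have hgrad := hK.grad.measurable_uncurry hΩm
  have hhess := hK.hess.measurable_uncurry hΩm
  have hpos' : Measurable fun p : ℝ × R3 => (p.1, extPos T Ω X p.1 p.2) := measurable_fst.prodMk hpos
  have hφ1 : ContDiff ℝ 1 φ := hφ.of_le (by exact_mod_cast le_top)
  have hw1 : ContDiff ℝ 1 w := hw.of_le (by exact_mod_cast le_top)
  have hφd : Continuous (fderiv ℝ φ) := hφ1.continuous_fderiv (by norm_num)
  have hwd : Continuous (fderiv ℝ w) := hw1.continuous_fderiv (by norm_num)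
  obtain ⟨Lφ, hLφ⟩ := hφ1.lipschitzWith_of_hasCompactSupport hφc (by norm_num)
  obtain ⟨Lw, hLw⟩ := hw1.lipschitzWith_of_hasCompactSupport hwc (by norm_num)
  obtain ⟨Cφ, hCφ⟩ := hφ.continuous.bounded_above_of_compact_support hφc
  obtain ⟨Cw, hCw⟩ := hw.continuous.bounded_above_of_compact_support hwc
  obtain ⟨Dφ, hDφ⟩ := hφd.bounded_above_of_compact_support (hφc.fderiv ℝ)
  obtain ⟨Dw, hDw⟩ := hwd.bounded_above_of_compact_support (hwc.fderiv ℝ)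
  have clm : ∀ {E : Type} [NormedAddCommGroup E] [NormedSpace ℝ E],
      Continuous fun q : (E →L[ℝ] R3) × E => q.1 q.2 := fun {E} _ _ =>
    continuous_fst.clm_apply continuous_snd
  let f : ℝ → R3 → R3 := fun s y => φ (s, extPos T Ω X s y) • extGrad T Ω X s y (w (s, y))
  have hfm : Measurable fun p : ℝ × R3 => f p.1 p.2 :=
    (hφ.continuous.measurable.comp hpos').smul (clm.measurable.comp (hgrad.prodMk hw.continuous.measurable))
  have lw : ∀ y : R3, LipschitzWith Lw fun s : ℝ => w (s, y) := fun y =>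
    LipschitzWith.of_dist_le_mul fun a b => (hLw.dist_le_mul _ _).trans_eq (by simp [Prod.dist_eq])
  have lφ : ∀ y : R3, LipschitzWith (Lφ * max 1 K) fun s : ℝ => φ (s, extPos T Ω X s y) := fun y => by
    have := LipschitzWith.id.prodMk (hK.pos.lip y)
    exact hLφ.comp this
  -- The quantity differentiated along trajectories is only Lipschitz in time, because X is; a
  -- product of bounded Lipschitz factors stays Lipschitz with a constant uniform in y.
  obtain ⟨K₁, hK₁⟩ := exists_norm_bilin_sub_le (ContinuousLinearMap.id ℝ (R3 →L[ℝ] R3))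
    hK.grad.lip lw hK.norm_grad (fun s y => hCw (s, y))
  obtain ⟨K₂, hK₂⟩ := exists_norm_bilin_sub_le (ContinuousLinearMap.lsmul ℝ ℝ (E := R3)) lφ
    hK₁ (fun s y => hCφ _) (fun s y => ((extGrad T Ω X s y).le_opNorm _).trans
      (mul_le_mul (hK.norm_grad s y) (hCw (s, y)) (norm_nonneg _) K.2))
  let E₁ : ℝ × R3 → R3 := fun p =>
    fderiv ℝ φ (p.1, extPos T Ω X p.1 p.2) (1, extVel T Ω X p.1 p.2) • extGrad T Ω X p.1 p.2 (w p) +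
    φ (p.1, extPos T Ω X p.1 p.2) • (extGradRate T Ω X p.1 p.2 (w p) +
      extGrad T Ω X p.1 p.2 (fderiv ℝ w p (1, 0)))
  let E₂ : ℝ × R3 → R3 := fun p =>
    fderiv ℝ φ (p.1, extPos T Ω X p.1 p.2) (0, extVel T Ω X p.1 p.2) • extGrad T Ω X p.1 p.2 (w p) +
    φ (p.1, extPos T Ω X p.1 p.2) • (extHess T Ω X p.1 p.2 (extPull T Ω X p.1 p.2) (w p) +
      extGrad T Ω X p.1 p.2 (fderiv ℝ w p (0, extPull T Ω X p.1 p.2)))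
  have hφm := hφ.continuous.measurable.comp hpos'
  have hφdm : ∀ {v : ℝ × R3 → ℝ × R3}, Measurable v →
      Measurable fun p : ℝ × R3 => fderiv ℝ φ (p.1, extPos T Ω X p.1 p.2) (v p) := fun hv =>
    (show Continuous fun q : (ℝ × R3 →L[ℝ] ℝ) × (ℝ × R3) => q.1 q.2 from
      continuous_fst.clm_apply continuous_snd).measurable.comp
        ((hφd.measurable.comp hpos').prodMk hv)
  have hwdm : ∀ {v : ℝ × R3 → ℝ × R3}, Measurable v →
      Measurable fun p : ℝ × R3 => fderiv ℝ w p (v p) := fun hv =>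
    clm.measurable.comp (hwd.measurable.prodMk hv)
  have hAw := clm.measurable.comp (hgrad.prodMk hw.continuous.measurable)
  have hE₁ : Measurable E₁ := by
    refine ((hφdm (measurable_const.prodMk (hK.measurable_vel hΩ))).smul hAw).add (hφm.smul ?_)
    exact (clm.measurable.comp ((hK.measurable_gradRate hΩ).prodMk hw.continuous.measurable)).add
      (clm.measurable.comp (hgrad.prodMk (hwdm measurable_const)))
  have hE₂ : Measurable E₂ := by
    refine ((hφdm (measurable_const.prodMk (hK.measurable_vel hΩ))).smul hAw).add (hφm.smul ?_)
    refine (clm.measurable.comp (Measurable.prodMk ?_ hw.continuous.measurable)).add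
      (clm.measurable.comp (hgrad.prodMk (hwdm (measurable_const.prodMk (hK.measurable_pull hΩ)))))
    exact (show Continuous fun q : (R3 →L[ℝ] R3 →L[ℝ] R3) × R3 => q.1 q.2 from
      continuous_fst.clm_apply continuous_snd).measurable.comp (hhess.prodMk (hK.measurable_pull hΩ))
  have hder : ∀ᵐ p : ℝ × R3, HasDerivAt (fun s => f s p.2) (E₁ p) p.1 := by
    filter_upwards [hK.pos.ae_hasDerivAt hΩm, hK.grad.ae_hasDerivAt hΩm] with p hp1 hp2
    have a1 : HasDerivAt (fun s => φ (s, extPos T Ω X s p.2))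
        (fderiv ℝ φ (p.1, extPos T Ω X p.1 p.2) (1, extVel T Ω X p.1 p.2)) p.1 :=
      ((hφ1.differentiable (by norm_num)) _).hasFDerivAt.comp_hasDerivAt p.1
        ((hasDerivAt_id p.1).prodMk hp1)
    have a2 : HasDerivAt (fun s => w (s, p.2)) (fderiv ℝ w p (1, 0)) p.1 :=
      HasFDerivAt.comp_hasDerivAt (f := fun s => (s, p.2)) p.1
        ((hw1.differentiable (by norm_num)) _).hasFDerivAt
        ((hasDerivAt_id p.1).prodMk (hasDerivAt_const p.1 p.2))
    exact (a1.smul (hp2.clm_apply a2)).congr_deriv (add_comm _ _)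
  obtain ⟨i₁, I₁⟩ := integral_deriv_eq_zero_of_lipschitz (t := t) hΩm (hX.volume_ne_top hΩ hT)
    hfm.stronglyMeasurable hK₂ (fun s y h => by
      have h1 : φ (s, extPos T Ω X s y) ≠ 0 := fun h' => h (by
        change φ (s, extPos T Ω X s y) • _ = _
        rw [h', zero_smul])
      have h2 : y ∈ Ω := by
        by_contra h'
        refine h ?_
        change φ (s, extPos T Ω X s y) • extGrad T Ω X s y (w (s, y)) = 0
        rw [hK.grad.zero s y h', zero_apply, smul_zero]
      exact ⟨(hφs (subset_tsupport φ h1)).1, h2⟩) hE₁.aestronglyMeasurable hder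
  have i₂ : IntegrableOn E₂ (Ioo 0 t ×ˢ Ω) := by
    refine Measure.integrableOn_of_bounded (M := Dφ * K * (K * Cw) +
      Cφ * (K * (K * K) * Cw + K * (Dw * (K * K)))) (hX.volume_prod_ne_top hΩ hT t)
      hE₂.aestronglyMeasurable (ae_of_all _ fun p => ?_)
    have n1 : ∀ e : R3, ‖((0 : ℝ), e)‖ = ‖e‖ := fun e => by simp [Prod.norm_def]
    have hCw0 : 0 ≤ Cw := (norm_nonneg _).trans (hCw p)
    have hDw0 : 0 ≤ Dw := (norm_nonneg _).trans (hDw p)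
    have hCφ0 : 0 ≤ Cφ := (norm_nonneg _).trans (hCφ p)
    have hDφ0 : 0 ≤ Dφ := (norm_nonneg _).trans (hDφ p)
    have b1 : ‖extGrad T Ω X p.1 p.2 (w p)‖ ≤ K * Cw := ((extGrad T Ω X p.1 p.2).le_opNorm _).trans
      (mul_le_mul (hK.norm_grad _ _) (hCw p) (norm_nonneg _) K.2)
    have b2 : ‖fderiv ℝ φ (p.1, extPos T Ω X p.1 p.2) (0, extVel T Ω X p.1 p.2)‖ ≤ Dφ * K :=
      (ContinuousLinearMap.le_opNorm _ _).trans (mul_le_mul (hDφ _)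
        ((n1 _).trans_le (hK.norm_vel _ _)) (norm_nonneg _) hDφ0)
    have b3 : ‖extHess T Ω X p.1 p.2 (extPull T Ω X p.1 p.2) (w p)‖ ≤ K * (K * K) * Cw :=
      (ContinuousLinearMap.le_opNorm _ _).trans (mul_le_mul ((ContinuousLinearMap.le_opNorm _ _).trans
        (mul_le_mul (hK.norm_hess _ _) (hK.norm_pull _ _) (norm_nonneg _) K.2)) (hCw p)
        (norm_nonneg _) (by positivity))
    have b4 : ‖extGrad T Ω X p.1 p.2 (fderiv ℝ w p (0, extPull T Ω X p.1 p.2))‖ ≤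
        K * (Dw * (K * K)) :=
      (ContinuousLinearMap.le_opNorm _ _).trans (mul_le_mul (hK.norm_grad _ _)
        ((ContinuousLinearMap.le_opNorm _ _).trans (mul_le_mul (hDw _)
          ((n1 _).trans_le (hK.norm_pull _ _)) (norm_nonneg _) hDw0)) (norm_nonneg _) K.2)
    refine (norm_add_le _ _).trans (add_le_add ?_ ?_)
    · rw [norm_smul]
      exact mul_le_mul b2 b1 (norm_nonneg _) (by positivity)
    · rw [norm_smul]
      exact mul_le_mul (hCφ _) ((norm_add_le _ _).trans (add_le_add b3 b4)) (norm_nonneg _) hCφ0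
  have I₂ : ∫ p in Ioo 0 t ×ˢ Ω, E₂ p = 0 := by
    -- The transport term vanishes slice by slice, at every time for which the trajectories are
    -- differentiable for almost every y.
    rw [Measure.volume_eq_prod, setIntegral_prod _ i₂]
    have hd := hK.pos.ae_hasDerivAt hΩm
    rw [Measure.volume_eq_prod] at hd
    have hd' := Measure.ae_ae_of_ae_prod hd
    refine setIntegral_eq_zero_of_ae_eq_zero ?_
    filter_upwards [hd'] with τ hτ hτt
    exact hX.integral_slice_smooth hΩ ht hτt hτ hφ hφc hφs hw
  have := integral_sub i₁ i₂
  rw [I₁, I₂, sub_zero] at this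
  refine (integral_congr_ae (ae_of_all _ fun p => ?_)).trans this
  -- The derivative of φ is taken at fixed x and that of w along (1, -`extPull`); these two
  -- splittings express both through the directions occurring in E₁ and E₂.
  have d1 : ∀ (L : ℝ × R3 →L[ℝ] ℝ) (c : R3), L (1, 0) = L (1, c) - L (0, c) := fun L c => by
    rw [← map_sub]; simp
  have d2 : ∀ (L : ℝ × R3 →L[ℝ] R3) (c : R3), L (1, -c) = L (1, 0) - L (0, c) := fun L c => by
    rw [← map_sub]; simp
  simp only [E₁, E₂, timeRate, d1 _ (extVel T Ω X p.1 p.2), d2 _ (extPull T Ω X p.1 p.2), map_sub,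
    sub_apply, smul_add, smul_sub, sub_smul]
  abel

end IsVolumePreservingTransformation

end MovingDomain

namespace MovingDomain
namespace IsVolumePreservingTransformation

variable {T : ℝ} {Ω : Set R3} {X : ℝ → R3 → R3}

theorem lagrangeMap_eq {t : ℝ} (ht : t ≤ T) {p : ℝ × R3} (hp : p ∈ Ioo 0 t ×ˢ Ω) :
    lagrangeMap X p = (p.1, extPos T Ω X p.1 p.2) := by
  rw [extPos_eq ⟨hp.1.1.le, hp.1.2.le.trans ht⟩ hp.2, lagrangeMap]

/-- The smooth identity is linear in the field and its gradient with bounded coefficients, hence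
stable under L² convergence of both on the part of the cylinder where φ(t, X) is supported. -/
theorem integral_timeRate (hX : IsVolumePreservingTransformation T Ω X) (hΩ : IsOpen Ω)
    (hT : 0 ≤ T) {t : ℝ} (ht : t ≤ T) {φ : ℝ × R3 → ℝ} (hφ : ContDiff ℝ ∞ φ)
    (hφc : HasCompactSupport φ) (hφs : tsupport φ ⊆ spaceTime Ω X t) {w : ℝ × R3 → R3}
    {G : ℝ × R3 → ℝ × R3 →L[ℝ] R3} (hw : MemLp w 2 (volume.restrict (Ioo 0 t ×ˢ Ω)))
    (hG : MemLp G 2 (volume.restrict (Ioo 0 t ×ˢ Ω))) (hwG : HasWeakGradient (Ioo 0 t ×ˢ Ω) w G) :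
    ∫ p in Ioo 0 t ×ˢ Ω, (fderiv ℝ φ (p.1, extPos T Ω X p.1 p.2) (1, 0) •
      extGrad T Ω X p.1 p.2 (w p) +
      φ (p.1, extPos T Ω X p.1 p.2) • timeRate T Ω X p.1 p.2 (w p) (G p)) = 0 := by
  obtain ⟨K, hK⟩ := hX.exists_extBound hΩ hT
  have hΩm := hΩ.measurableSet
  have hpos' : Measurable fun p : ℝ × R3 => (p.1, extPos T Ω X p.1 p.2) :=
    measurable_fst.prodMk (hK.pos.measurable_uncurry hΩm)
  have hgrad := hK.grad.measurable_uncurry hΩm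
  have hφd : Continuous (fderiv ℝ φ) := hφ.continuous_fderiv (by norm_num)
  have hφd1 : Continuous fun q => fderiv ℝ φ q (1, 0) := hφd.clm_apply continuous_const
  obtain ⟨Cφ, hCφ⟩ := hφ.continuous.bounded_above_of_compact_support hφc
  obtain ⟨Dφ, hDφ⟩ := hφd1.bounded_above_of_compact_support (hφc.fderiv_apply ℝ _)
  have hCφ0 : 0 ≤ Cφ := (norm_nonneg _).trans (hCφ 0)
  have hDφ0 : 0 ≤ Dφ := (norm_nonneg _).trans (hDφ 0)
  -- Continuity of the Euler map makes this a compact subset of the open cylinder, which is what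
  -- local approximation requires.
  let S : Set (ℝ × R3) := eulerMap Ω X '' tsupport φ
  have hS : IsCompact S :=
    hφc.isCompact.image_of_continuousOn ((hX.continuousOn_eulerMap hΩ ht).mono hφs)
  have hSP : S ⊆ Ioo 0 t ×ˢ Ω := by
    rintro _ ⟨q, hq, rfl⟩
    exact mapsTo_eulerMap t (hφs hq)
  have hPm : MeasurableSet (Ioo 0 t ×ˢ Ω) := measurableSet_Ioo.prod hΩm
  have hnot : ∀ p ∈ (Ioo 0 t ×ˢ Ω) \ S, (p.1, extPos T Ω X p.1 p.2) ∉ tsupport φ := by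
    rintro p ⟨hp, hpS⟩ hpφ
    rw [← lagrangeMap_eq ht hp] at hpφ
    exact hpS ⟨_, hpφ, hX.eulerMap_lagrangeMap ht hp⟩
  have red : ∀ (a : ℝ × R3 → R3) (b : ℝ × R3 → ℝ × R3 →L[ℝ] R3),
      ∫ p in Ioo 0 t ×ˢ Ω, (fderiv ℝ φ (p.1, extPos T Ω X p.1 p.2) (1, 0) •
        extGrad T Ω X p.1 p.2 (a p) +
        φ (p.1, extPos T Ω X p.1 p.2) • timeRate T Ω X p.1 p.2 (a p) (b p)) =
      ∫ p in S, (fderiv ℝ φ (p.1, extPos T Ω X p.1 p.2) (1, 0) • extGrad T Ω X p.1 p.2 (a p) +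
        φ (p.1, extPos T Ω X p.1 p.2) • timeRate T Ω X p.1 p.2 (a p) (b p)) := fun a b =>
    setIntegral_eq_of_subset_of_forall_sdiff_eq_zero hPm hSP fun p hp => by
      rw [fderiv_of_notMem_tsupport ℝ (hnot p hp), image_eq_zero_of_notMem_tsupport (hnot p hp)]
      simp
  obtain ⟨F, hF, hFc, hFl, hFd⟩ := exists_smooth_approx_grad (isOpen_Ioo.prod hΩ) hS hSP hw hG hwG
  have rS : volume.restrict S ≤ volume.restrict (Ioo 0 t ×ˢ Ω) := Measure.restrict_mono hSP le_rfl
  let ℓ₁ : ℝ × R3 → R3 →L[ℝ] R3 := fun p =>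
    fderiv ℝ φ (p.1, extPos T Ω X p.1 p.2) (1, 0) • extGrad T Ω X p.1 p.2 +
      φ (p.1, extPos T Ω X p.1 p.2) • (extGradRate T Ω X p.1 p.2 -
        extHess T Ω X p.1 p.2 (extPull T Ω X p.1 p.2))
  let ℓ₂ : ℝ × R3 → (ℝ × R3 →L[ℝ] R3) →L[ℝ] R3 := fun p =>
    φ (p.1, extPos T Ω X p.1 p.2) • (extGrad T Ω X p.1 p.2).comp
      (ContinuousLinearMap.apply ℝ R3 ((1 : ℝ), -extPull T Ω X p.1 p.2))
  have mφ := hφ.continuous.measurable.comp hpos'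
  have M₁ : MemLp ℓ₁ 2 (volume.restrict S) := by
    refine memLp_two_of_bound hS (((hφd1.measurable.comp hpos').smul hgrad).add
      (mφ.smul (hK.measurable_rate hΩ))).aestronglyMeasurable
      (Dφ * K + Cφ * (K + K * (K * K))) fun p => ?_
    refine (norm_add_le _ _).trans (add_le_add ?_ ?_)
    · rw [norm_smul]
      exact mul_le_mul (hDφ _) (hK.norm_grad _ _) (norm_nonneg _) hDφ0
    · rw [norm_smul]
      exact mul_le_mul (hCφ _) (hK.norm_rate _ _) (norm_nonneg _) hCφ0
  have M₂ : MemLp ℓ₂ 2 (volume.restrict S) := by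
    have aux : AEStronglyMeasurable (fun p : ℝ × R3 => (extGrad T Ω X p.1 p.2).comp
        (ContinuousLinearMap.apply ℝ R3 ((1 : ℝ), -extPull T Ω X p.1 p.2))) (volume.restrict S) :=
      (continuous_fst.clm_comp continuous_snd).comp_aestronglyMeasurable
        (hgrad.aestronglyMeasurable.prodMk ((ContinuousLinearMap.apply ℝ R3 :
          (ℝ × R3) →L[ℝ] (ℝ × R3 →L[ℝ] R3) →L[ℝ] R3).continuous.comp_aestronglyMeasurable
            (hK.measurable_dir hΩ).aestronglyMeasurable))
    refine memLp_two_of_bound hS (f := ℓ₂) (AEStronglyMeasurable.smul mφ.aestronglyMeasurable aux)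
      (Cφ * (K * (1 + K * K))) fun p => ?_
    refine (ContinuousLinearMap.opNorm_smul_le _ _).trans ?_
    refine mul_le_mul (hCφ _) ?_ (ContinuousLinearMap.opNorm_nonneg _) hCφ0
    refine (ContinuousLinearMap.opNorm_comp_le _ _).trans ?_
    refine mul_le_mul (hK.norm_grad _ _) ?_ (ContinuousLinearMap.opNorm_nonneg _) K.2
    refine (ContinuousLinearMap.opNorm_le_bound _ (by positivity) fun L => ?_)
    rw [ContinuousLinearMap.apply_apply, mul_comm]
    exact (L.le_opNorm _).trans (mul_le_mul_of_nonneg_left (hK.norm_dir _ _) (norm_nonneg _))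
  have mF : ∀ n, MemLp (F n) 2 (volume.restrict S) := fun n =>
    memLp_of_continuous_hasCompactSupport (hF n).continuous (hFc n) _
  have mdF : ∀ n, MemLp (fderiv ℝ (F n)) 2 (volume.restrict S) := fun n =>
    memLp_of_continuous_hasCompactSupport ((hF n).continuous_fderiv (by norm_num))
      ((hFc n).fderiv ℝ) _
  have hwS := hw.mono_measure rS
  have hGS := hG.mono_measure rS
  have lim := (tendsto_integral_clm_apply M₁ (Eventually.of_forall mF) hwS hFl).add
    (tendsto_integral_clm_apply M₂ (Eventually.of_forall mdF) hGS hFd)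
  have split : ∀ {a : ℝ × R3 → R3} {b : ℝ × R3 → ℝ × R3 →L[ℝ] R3}, MemLp a 2 (volume.restrict S) →
      MemLp b 2 (volume.restrict S) →
      ∫ p in S, (fderiv ℝ φ (p.1, extPos T Ω X p.1 p.2) (1, 0) • extGrad T Ω X p.1 p.2 (a p) +
        φ (p.1, extPos T Ω X p.1 p.2) • timeRate T Ω X p.1 p.2 (a p) (b p)) =
      (∫ p in S, ℓ₁ p (a p)) + ∫ p in S, ℓ₂ p (b p) := fun {a b} ha hb => by
    rw [← integral_add (integrable_clm_apply M₁ ha) (integrable_clm_apply M₂ hb)]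
    refine integral_congr_ae (ae_of_all _ fun p => ?_)
    simp only [ℓ₁, ℓ₂, timeRate, add_apply, smul_apply, ContinuousLinearMap.comp_apply,
      ContinuousLinearMap.apply_apply, smul_add]
    abel
  rw [red, split hwS hGS]
  refine tendsto_nhds_unique lim (tendsto_const_nhds.congr fun n => ?_)
  rw [← split (mF n) (mdF n), ← red]
  exact (hX.integral_timeRate_smooth hΩ hT ht hφ hφc hφs (hF n) (hFc n)).symm

/-- The weak time derivative of the push-forward `(∇X w) ∘ X⁻¹`. -/
theorem hasL2TimeDeriv_push (hX : IsVolumePreservingTransformation T Ω X) (hΩ : IsOpen Ω)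
    (hT : 0 ≤ T) {t : ℝ} (ht : t ≤ T) {w : ℝ × R3 → R3}
    {G : ℝ × R3 → ℝ × R3 →L[ℝ] R3} (hw : MemLp w 2 (volume.restrict (Ioo 0 t ×ˢ Ω)))
    (hG : MemLp G 2 (volume.restrict (Ioo 0 t ×ˢ Ω))) (hwG : HasWeakGradient (Ioo 0 t ×ˢ Ω) w G)
    {f : ℝ → R3 → R3}
    (hf : ∀ p ∈ Ioo 0 t ×ˢ Ω, f p.1 (X p.1 p.2) = extGrad T Ω X p.1 p.2 (w p)) :
    HasL2TimeDeriv Ω X t f fun τ x => timeRate T Ω X τ (inverseMap Ω X τ x)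
      (w (τ, inverseMap Ω X τ x)) (G (τ, inverseMap Ω X τ x)) := by
  obtain ⟨K, hK⟩ := hX.exists_extBound hΩ hT
  have hQ := hX.isOpen_spaceTime hΩ ht
  have mD := hX.memLp_comp_eulerMap hΩ ht (hK.memLp_timeRate hΩ hw hG)
  have mA : MemLp (fun p => extGrad T Ω X p.1 p.2 (w p)) 2 (volume.restrict (Ioo 0 t ×ˢ Ω)) :=
    memLp_clm_apply_of_bound (hK.grad.measurable_uncurry hΩ.measurableSet).aestronglyMeasurable
      (fun p : ℝ × R3 => hK.norm_grad p.1 p.2) hw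
  have mf : MemLp (fun p : ℝ × R3 => f p.1 p.2) 2 (volume.restrict (spaceTime Ω X t)) := by
    refine (memLp_congr_ae ?_).1 (hX.memLp_comp_eulerMap hΩ ht mA)
    refine (ae_restrict_iff' hQ.measurableSet).2 (ae_of_all _ fun q hq => ?_)
    have := hf _ (mapsTo_eulerMap t hq)
    refine this.symm.trans ?_
    change f q.1 (X q.1 (inverseMap Ω X q.1 q.2)) = _
    rw [apply_inverseMap hq.2]
  refine ⟨⟨locallyIntegrableOn_of_memLp mf, locallyIntegrableOn_of_memLp mD,
    fun φ hφ hφc hφs => ?_⟩, mD⟩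
  have hφd1 : Continuous fun q => fderiv ℝ φ q (1, 0) :=
    (hφ.continuous_fderiv (by norm_num)).clm_apply continuous_const
  have i1 : IntegrableOn (fun q : ℝ × R3 => fderiv ℝ φ q (1, 0) • f q.1 q.2) (spaceTime Ω X t) :=
    memLp_one_iff_integrable.1 (mf.smul (r := 1)
      (memLp_of_continuous_hasCompactSupport hφd1 (hφc.fderiv_apply ℝ _) _))
  have i2 : IntegrableOn (fun q : ℝ × R3 => φ q • timeRate T Ω X q.1 (inverseMap Ω X q.1 q.2)
      (w (q.1, inverseMap Ω X q.1 q.2)) (G (q.1, inverseMap Ω X q.1 q.2))) (spaceTime Ω X t) :=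
    memLp_one_iff_integrable.1 (mD.smul (r := 1)
      (memLp_of_continuous_hasCompactSupport hφ.continuous hφc _))
  rw [eq_neg_iff_add_eq_zero, ← integral_add i1 i2]
  refine (hX.integral_spaceTime hΩ ht (i1.add i2).aestronglyMeasurable).trans
    (Eq.trans ?_ (hX.integral_timeRate hΩ hT ht hφ hφc hφs hw hG hwG))
  refine setIntegral_congr_fun (measurableSet_Ioo.prod hΩ.measurableSet) fun p hp => ?_
  have hY : inverseMap Ω X p.1 (X p.1 p.2) = p.2 :=
    hX.inverseMap_apply ⟨hp.1.1.le, hp.1.2.le.trans ht⟩ hp.2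
  simp only [Pi.add_apply, ← lagrangeMap_eq ht hp, ← hf p hp]
  simp only [lagrangeMap, hY]

end IsVolumePreservingTransformation

end MovingDomain

namespace MovingDomain

/-! ### Convolution in time -/

section TimeConv

variable {E E₁ E₂ E₃ : Type*} [NormedAddCommGroup E] [NormedSpace ℝ E]
  [NormedAddCommGroup E₁] [NormedSpace ℝ E₁] [NormedAddCommGroup E₂] [NormedSpace ℝ E₂]
  [NormedAddCommGroup E₃] [NormedSpace ℝ E₃]

/-- Convolution in the time variable. -/
noncomputable def timeConv (k : ℝ → ℝ) (z : ℝ × R3 → E) (p : ℝ × R3) : E :=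
  ∫ r, k r • z (p - (r, 0))

theorem measurable_timeShift : Measurable fun r : ℝ => (r, (0 : R3)) := by fun_prop

theorem memLp_timeConv {k : ℝ → ℝ} (hk : Continuous k) (hkc : HasCompactSupport k)
    {z : ℝ × R3 → E} (hz : MemLp z 2) : MemLp (timeConv k z) 2 :=
  memLp_average hz measurable_timeShift hk.measurable (hk.integrable_of_hasCompactSupport hkc)

theorem ae_memLp_slice {z : ℝ × R3 → E} (hz : MemLp z 2) :
    ∀ᵐ y : R3, MemLp (fun s : ℝ => z (s, y)) 2 := by
  have h1 := hz.1
  have h2 := (memLp_two_iff_integrable_sq_norm hz.1).1 hz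
  rw [Measure.volume_eq_prod] at h1 h2
  have h3 : ∀ᵐ y : R3, AEStronglyMeasurable (fun s : ℝ => z (s, y)) := h1.prod_swap.prodMk_left
  filter_upwards [h3, h2.prod_left_ae] with y hy1 hy2
  exact (memLp_two_iff_integrable_sq_norm hy1).2 hy2

/-- The exceptional set of points y does not depend on τ: once the time slice at y is square
integrable, the convolution integral converges absolutely at every time. -/
theorem ae_integrable_timeConv {k : ℝ → ℝ} (hk : Continuous k) (hkc : HasCompactSupport k)
    {z : ℝ × R3 → E} (hz : MemLp z 2) :
    ∀ᵐ y : R3, ∀ τ : ℝ, Integrable fun r : ℝ => k r • z ((τ, y) - (r, 0)) := by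
  filter_upwards [ae_memLp_slice hz] with y hy τ
  have h1 : MemLp (fun r : ℝ => z (τ - r, y)) 2 :=
    hy.comp_measurePreserving (Measure.measurePreserving_sub_left volume τ)
  have h2 : MemLp k 2 := hk.memLp_of_hasCompactSupport hkc
  have := memLp_one_iff_integrable.1 (h1.smul (r := 1) h2)
  simp only [Prod.mk_sub_mk, sub_zero]
  exact this

/-- Fubini moves the mollifier onto the scalar function r ↦ ∫ L(a(p), z(p - (r, 0))) dp. All limits
with j_h' become statements about the behaviour of such functions at r = 0. -/
theorem integral_bilin_timeConv [CompleteSpace E₂] [CompleteSpace E₃] (L : E₁ →L[ℝ] E₂ →L[ℝ] E₃)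
    {k : ℝ → ℝ} (hk : Continuous k) (hkc : HasCompactSupport k) {a : ℝ × R3 → E₁}
    {z : ℝ × R3 → E₂} (ha : MemLp a 2) (hz : MemLp z 2) :
    ∫ p, L (a p) (timeConv k z p) = ∫ r, k r • ∫ p, L (a p) (z (p - (r, 0))) := by
  have hm : AEStronglyMeasurable (fun q : (ℝ × R3) × ℝ => k q.2 • L (a q.1) (z (q.1 - (q.2, 0))))
      ((volume : Measure (ℝ × R3)).prod volume) :=
    (hk.aestronglyMeasurable.comp_snd).smul (L.aestronglyMeasurable_comp₂ ha.1.comp_fst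
      (aestronglyMeasurable_comp_sub hz.1 measurable_timeShift))
  have hi : Integrable (fun q : (ℝ × R3) × ℝ => k q.2 • L (a q.1) (z (q.1 - (q.2, 0))))
      ((volume : Measure (ℝ × R3)).prod volume) := by
    refine ⟨hm, ?_⟩
    rw [hasFiniteIntegral_iff_enorm, lintegral_prod_symm _ hm.enorm]
    have hb : ∀ r : ℝ, ∫⁻ p : ℝ × R3, ‖k r • L (a p) (z (p - (r, 0)))‖ₑ ≤
        ‖k r‖ₑ * (ENNReal.ofReal ‖L‖ * (eLpNorm a 2 volume * eLpNorm z 2 volume)) := fun r => by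
      simp only [enorm_smul]
      rw [lintegral_const_mul' _ _ enorm_ne_top, ← eLpNorm_one_eq_lintegral_enorm]
      gcongr
      have h := eLpNorm_one_bilin_le (B := fun _ : ℝ × R3 => L) (fun _ => le_rfl)
        ha.1 (memLp_translate hz (r, 0)).1
      have e := eLpNorm_comp_measurePreserving (p := 2) hz.1
        (measurePreserving_sub_right volume (r, (0 : R3)))
      rw [← e]
      exact h
    refine (lintegral_mono hb).trans_lt ?_
    rw [lintegral_mul_const' _ _ (by
      exact ENNReal.mul_ne_top ENNReal.ofReal_ne_top (ENNReal.mul_ne_top ha.2.ne hz.2.ne))]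
    refine ENNReal.mul_lt_top ?_ (ENNReal.mul_lt_top ENNReal.ofReal_lt_top
      (ENNReal.mul_lt_top ha.2 hz.2))
    exact (hk.integrable_of_hasCompactSupport hkc).2
  have h1 : ∫ p, L (a p) (timeConv k z p) = ∫ p, ∫ r, k r • L (a p) (z (p - (r, 0))) := by
    refine integral_congr_ae ?_
    have hq : ∀ᵐ p : ℝ × R3, ∀ τ : ℝ, Integrable fun r : ℝ => k r • z ((τ, p.2) - (r, 0)) :=
      Measure.quasiMeasurePreserving_snd.ae (ae_integrable_timeConv hk hkc hz)
    filter_upwards [hq] with p hp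
    have := (L (a p)).integral_comp_comm (hp p.1)
    simp only [map_smul] at this
    rw [timeConv, ← this]
  rw [h1, integral_integral_swap hi]
  refine integral_congr_ae (ae_of_all _ fun r => ?_)
  exact integral_smul _ _

/-- By Fubini and a translation the convolution passes to the test function; integration by parts in
the single variable r then moves the derivative onto k. No regularity of z in time is needed. -/
theorem hasWeakDerivAlong_time [CompleteSpace E] {k : ℝ → ℝ} (hk : ContDiff ℝ 1 k)
    (hkc : HasCompactSupport k) {z : ℝ × R3 → E} (hz : MemLp z 2) {U : Set (ℝ × R3)} :
    HasWeakDerivAlong U (timeConv k z) ((1 : ℝ), (0 : R3)) (timeConv (deriv k) z) := by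
  have hk' : Continuous (deriv k) := hk.continuous_deriv le_rfl
  have m1 := memLp_timeConv hk.continuous hkc hz
  have m2 := memLp_timeConv hk' hkc.deriv hz
  refine ⟨(m1.locallyIntegrable (by norm_num)).locallyIntegrableOn _,
    (m2.locallyIntegrable (by norm_num)).locallyIntegrableOn _, fun φ hφ hφc hφU => ?_⟩
  have hφ1 : ContDiff ℝ 1 φ := hφ.of_le (by exact_mod_cast le_top)
  have hφd : Continuous fun p => fderiv ℝ φ p (1, 0) :=
    (hφ1.continuous_fderiv (by norm_num)).clm_apply continuous_const
  have hφdc : HasCompactSupport fun p => fderiv ℝ φ p ((1 : ℝ), (0 : R3)) := hφc.fderiv_apply ℝ _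
  rw [setIntegral_eq_integral_of_forall_compl_eq_zero fun y hy => by
      rw [fderiv_of_notMem_tsupport ℝ (fun h => hy (hφU h))]; simp,
    setIntegral_eq_integral_of_forall_compl_eq_zero fun y hy => by
      rw [image_eq_zero_of_notMem_tsupport (fun h => hy (hφU h))]; simp]
  -- move the convolution to the test function
  have adj : ∀ {κ : ℝ → ℝ} {a : ℝ × R3 → ℝ}, Continuous κ → HasCompactSupport κ → Continuous a →
      HasCompactSupport a → ∫ p, a p • timeConv κ z p =
        ∫ p, (∫ r, κ r * a (p + (r, 0))) • z p := fun {κ a} hκ hκc ha hac => by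
    have hma : MemLp a 2 := ha.memLp_of_hasCompactSupport hac
    have h := integral_bilin_timeConv (ContinuousLinearMap.lsmul ℝ ℝ (E := E)) hκ hκc hma hz
    simp only [ContinuousLinearMap.lsmul_apply] at h
    rw [h]
    have h2 := integral_bilin_timeConv (ContinuousLinearMap.lsmul ℝ ℝ (E := E)).flip
      (k := fun r => κ (-r)) (hκ.comp continuous_neg)
      (hκc.comp_homeomorph (Homeomorph.neg ℝ)) hz hma
    simp only [ContinuousLinearMap.flip_apply, ContinuousLinearMap.lsmul_apply] at h2
    have e1 : ∀ p, timeConv (fun r => κ (-r)) a p = ∫ r, κ r * a (p + (r, 0)) := fun p => by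
      rw [timeConv, ← integral_neg_eq_self]
      refine integral_congr_ae (ae_of_all _ fun r => ?_)
      have : p - (-r, (0 : R3)) = p + (r, 0) := by ext <;> simp
      simp [this]
    simp only [e1] at h2
    rw [h2, ← integral_neg_eq_self]
    refine integral_congr_ae (ae_of_all _ fun r => ?_)
    simp only
    congr 1
    refine Eq.trans (integral_congr_ae (ae_of_all _ fun p => ?_))
      (integral_sub_right_eq_self (fun p => a (p - (r, 0)) • z p) ((-r, 0) : ℝ × R3))
    have : p - (-r, (0 : R3)) - (r, 0) = p := by ext <;> simp
    simp only [this]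
  rw [adj hk.continuous hkc hφd hφdc, adj hk' hkc.deriv hφ1.continuous hφc, ← integral_neg]
  refine integral_congr_ae (ae_of_all _ fun p => ?_)
  simp only
  rw [← neg_smul]
  congr 1
  have hd1 : ∀ r, HasDerivAt (fun r => φ (p + (r, 0))) (fderiv ℝ φ (p + (r, 0)) (1, 0)) r := fun r =>
    HasFDerivAt.comp_hasDerivAt (f := fun r : ℝ => p + (r, (0 : R3))) r
      ((hφ1.differentiable (by norm_num)) _).hasFDerivAt
      (((hasDerivAt_id r).prodMk (hasDerivAt_const r (0 : R3))).const_add p)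
  have hd2 : ∀ r, HasDerivAt k (deriv k r) r := fun r =>
    ((hk.differentiable (by norm_num)) r).hasDerivAt
  have cs : Continuous fun r : ℝ => p + (r, (0 : R3)) := by fun_prop
  have ic : ∀ {κ a : ℝ → ℝ}, Continuous κ → HasCompactSupport κ → Continuous a →
      Integrable (fun r => κ r * a r) := fun hκ hκc ha =>
    (hκ.mul ha).integrable_of_hasCompactSupport hκc.mul_right
  exact integral_mul_deriv_eq_deriv_mul_of_integrable (u := k) (fun r _ => hd2 r)
    (fun r _ => hd1 r)
    (ic hk.continuous hkc (hφd.comp cs)) (ic hk' hkc.deriv (hφ1.continuous.comp cs))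
    (ic hk.continuous hkc (hφ1.continuous.comp cs))

/-- A time average does not interact with spatial derivatives: the weak gradient at almost every
time is tested with the slices of φ and integrated. -/
theorem hasWeakDerivAlong_space [CompleteSpace E] {k : ℝ → ℝ} (hk : Continuous k)
    (hkc : HasCompactSupport k) {z : ℝ × R3 → E} (hz : MemLp z 2) {g : ℝ × R3 → R3 →L[ℝ] E}
    (hg : MemLp g 2) {Ω : Set R3} (hzg : ∀ᵐ s : ℝ, HasWeakGradient Ω (fun y => z (s, y)) fun y => g (s, y))
    (I : Set ℝ) (e : R3) :
    HasWeakDerivAlong (I ×ˢ Ω) (timeConv k z) ((0 : ℝ), e) (fun p => timeConv k g p e) := by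
  have m1 := memLp_timeConv hk hkc hz
  have m2 := memLp_apply_const (memLp_timeConv hk hkc hg) e
  refine ⟨(m1.locallyIntegrable (by norm_num)).locallyIntegrableOn _,
    (m2.locallyIntegrable (by norm_num)).locallyIntegrableOn _, fun φ hφ hφc hφU => ?_⟩
  have hφd : Continuous fun p => fderiv ℝ φ p ((0 : ℝ), e) :=
    (hφ.continuous_fderiv (by norm_num)).clm_apply continuous_const
  have hφdc : HasCompactSupport fun p => fderiv ℝ φ p ((0 : ℝ), e) := hφc.fderiv_apply ℝ _
  have mφ : MemLp φ 2 := hφ.continuous.memLp_of_hasCompactSupport hφc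
  have mφd : MemLp (fun p => fderiv ℝ φ p ((0 : ℝ), e)) 2 := hφd.memLp_of_hasCompactSupport hφdc
  rw [setIntegral_eq_integral_of_forall_compl_eq_zero fun y hy => by
      rw [fderiv_of_notMem_tsupport ℝ (fun h => hy (hφU h))]; simp,
    setIntegral_eq_integral_of_forall_compl_eq_zero fun y hy => by
      rw [image_eq_zero_of_notMem_tsupport (fun h => hy (hφU h))]; simp]
  have h1 := integral_bilin_timeConv (ContinuousLinearMap.lsmul ℝ ℝ (E := E)) hk hkc mφd hz
  have h2 := integral_bilin_timeConv ((ContinuousLinearMap.id ℝ ℝ).smulRight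
    (ContinuousLinearMap.apply ℝ E e)) hk hkc mφ hg
  simp only [ContinuousLinearMap.lsmul_apply, ContinuousLinearMap.smulRight_apply,
    ContinuousLinearMap.id_apply, smul_apply, ContinuousLinearMap.apply_apply] at h1 h2
  rw [h1, h2, ← integral_neg]
  refine integral_congr_ae (ae_of_all _ fun r => ?_)
  simp only
  rw [← smul_neg]
  congr 1
  have i1 : Integrable fun p : ℝ × R3 => fderiv ℝ φ p ((0 : ℝ), e) • z (p - (r, 0)) :=
    memLp_one_iff_integrable.1 ((memLp_translate hz (r, 0)).smul (r := 1) mφd)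
  have i2 : Integrable fun p : ℝ × R3 => φ p • g (p - (r, 0)) e :=
    memLp_one_iff_integrable.1 ((memLp_apply_const (memLp_translate hg (r, 0)) e).smul (r := 1) mφ)
  rw [Measure.volume_eq_prod] at i1 i2 ⊢
  rw [integral_prod _ i1, integral_prod _ i2, ← integral_neg]
  refine integral_congr_ae ?_
  filter_upwards [(measurePreserving_sub_right volume r).quasiMeasurePreserving.ae hzg] with τ hτ
  have hemb : ContDiff ℝ ∞ fun y : R3 => (τ, y) := contDiff_const.prodMk contDiff_id
  have hsub : tsupport (fun y => φ (τ, y)) ⊆ (fun y : R3 => (τ, y)) ⁻¹' tsupport φ :=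
    closure_minimal (fun y hy => subset_tsupport φ hy)
      ((isClosed_tsupport φ).preimage hemb.continuous)
  have hsΩ : tsupport (fun y => φ (τ, y)) ⊆ Ω := fun y hy => (hφU (hsub hy)).2
  have hc : HasCompactSupport fun y => φ (τ, y) := HasCompactSupport.of_support_subset_isCompact
    (hφc.isCompact.image continuous_snd) fun y hy => ⟨(τ, y), subset_tsupport φ hy, rfl⟩
  have hfd : ∀ y, fderiv ℝ (fun y => φ (τ, y)) y e = fderiv ℝ φ (τ, y) (0, e) := fun y => by
    have := ((hφ.differentiable (by norm_num)) (τ, y)).hasFDerivAt.comp y (hasFDerivAt_prodMk_right τ y)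
    have h' : fderiv ℝ (fun y => φ (τ, y)) y = _ := this.fderiv
    rw [h']
    simp
  have := (hτ e).2.2 (fun y => φ (τ, y)) (hφ.comp hemb) hc hsΩ
  rw [setIntegral_eq_integral_of_forall_compl_eq_zero fun y hy => by
      rw [fderiv_of_notMem_tsupport ℝ (fun h => hy (hsΩ h))]; simp,
    setIntegral_eq_integral_of_forall_compl_eq_zero fun y hy => by
      rw [image_eq_zero_of_notMem_tsupport (f := fun y => φ (τ, y)) (fun h => hy (hsΩ h))]; simp] at this
  simp only [hfd] at this
  simpa using this

/-- The space-time gradient built from a time derivative and a spatial gradient. -/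
noncomputable def joinGrad (a : E) (g : R3 →L[ℝ] E) : ℝ × R3 →L[ℝ] E :=
  (ContinuousLinearMap.toSpanSingleton ℝ a).coprod g

theorem joinGrad_apply (a : E) (g : R3 →L[ℝ] E) (q : ℝ × R3) : joinGrad a g q = q.1 • a + g q.2 := by
  simp [joinGrad]

theorem memLp_joinGrad {α : Type*} [MeasurableSpace α] {μ : Measure α} {a : α → E}
    {g : α → R3 →L[ℝ] E} (ha : MemLp a 2 μ) (hg : MemLp g 2 μ) :
    MemLp (fun p => joinGrad (a p) (g p)) 2 μ := by
  have h1 := (ContinuousLinearMap.smulRightL ℝ (ℝ × R3) E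
    (ContinuousLinearMap.fst ℝ ℝ R3)).comp_memLp' ha
  have h2 := ((ContinuousLinearMap.compL ℝ (ℝ × R3) R3 E).flip
    (ContinuousLinearMap.snd ℝ ℝ R3)).comp_memLp' hg
  refine (h1.add h2).ae_eq (ae_of_all _ fun p => ?_)
  ext q <;> simp [joinGrad]

/-- Every direction is a multiple of (1, 0) plus a spatial direction, and weak derivatives are
linear in the direction. -/
theorem hasWeakGradient_joinGrad {U : Set (ℝ × R3)} {f a : ℝ × R3 → E} {g : ℝ × R3 → R3 →L[ℝ] E}
    (hf : MemLp f 2 (volume.restrict U)) (ha : MemLp a 2 (volume.restrict U))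
    (hg : MemLp g 2 (volume.restrict U)) (h1 : HasWeakDerivAlong U f ((1 : ℝ), (0 : R3)) a)
    (h2 : ∀ e, HasWeakDerivAlong U f ((0 : ℝ), e) fun p => g p e) :
    HasWeakGradient U f fun p => joinGrad (a p) (g p) := by
  intro q
  refine ⟨h1.1, locallyIntegrableOn_of_memLp (memLp_apply_const (memLp_joinGrad ha hg) q),
    fun φ hφ hφc hφU => ?_⟩
  have e1 := h1.2.2 φ hφ hφc hφU
  have e2 := (h2 q.2).2.2 φ hφ hφc hφU
  have mφ : MemLp φ 2 (volume.restrict U) :=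
    memLp_of_continuous_hasCompactSupport hφ.continuous hφc _
  have md : ∀ v, MemLp (fun p => fderiv ℝ φ p v) 2 (volume.restrict U) := fun v =>
    memLp_of_continuous_hasCompactSupport
      ((hφ.continuous_fderiv (by norm_num)).clm_apply continuous_const) (hφc.fderiv_apply ℝ v) _
  have int : ∀ {b : ℝ × R3 → ℝ} {c : ℝ × R3 → E}, MemLp b 2 (volume.restrict U) →
      MemLp c 2 (volume.restrict U) → Integrable (fun p => b p • c p) (volume.restrict U) :=
    fun hb hc => memLp_one_iff_integrable.1 (hc.smul (r := 1) hb)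
  have s1 : ∀ p, fderiv ℝ φ p q • f p = q.1 • fderiv ℝ φ p (1, 0) • f p + fderiv ℝ φ p (0, q.2) • f p :=
    fun p => by
      rw [smul_smul, ← smul_eq_mul, ← map_smul, ← add_smul, ← map_add]
      simp
  have s2 : ∀ p, φ p • joinGrad (a p) (g p) q = q.1 • φ p • a p + φ p • g p q.2 := fun p => by
    rw [joinGrad_apply, smul_add, smul_comm]
  simp only [s1, s2]
  have i1 : Integrable (fun p => q.1 • fderiv ℝ φ p (1, 0) • f p) (volume.restrict U) :=
    (int (md _) hf).smul q.1
  have i2 : Integrable (fun p => q.1 • φ p • a p) (volume.restrict U) := (int mφ ha).smul q.1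
  rw [integral_add i1 (int (md _) hf), integral_add i2 (int mφ (memLp_apply_const hg _)),
    integral_smul, integral_smul, e1, e2, smul_neg, neg_add]

end TimeConv

end MovingDomain

/-! ### Lagrangian fields, and the time derivative of the regularization for initial values in H¹.
-/

namespace MovingDomain

theorem HasWeakDerivAlong.const_smul {V F : Type*} [NormedAddCommGroup V] [NormedSpace ℝ V]
    [MeasureSpace V] [NormedAddCommGroup F] [NormedSpace ℝ F] {U : Set V} {f g : V → F} {e : V}
    (h : HasWeakDerivAlong U f e g) (c : ℝ) :
    HasWeakDerivAlong U (fun x => c • f x) e (fun x => c • g x) := by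
  refine ⟨h.1.smul c, h.2.1.smul c, fun φ h1 h2 h3 => ?_⟩
  simp only [smul_comm _ c]
  rw [integral_smul, integral_smul, h.2.2 φ h1 h2 h3, smul_neg]

theorem HasWeakGradient.const_smul {V F : Type*} [NormedAddCommGroup V] [NormedSpace ℝ V]
    [MeasureSpace V] [NormedAddCommGroup F] [NormedSpace ℝ F] {U : Set V} {f : V → F}
    {G : V → V →L[ℝ] F} (h : HasWeakGradient U f G) (c : ℝ) :
    HasWeakGradient U (fun x => c • f x) (fun x => c • G x) :=
  fun e => (h e).const_smul c

theorem memLp_of_restrict_of_zero {α E : Type*} [MeasurableSpace α] [NormedAddCommGroup E]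
    {μ : Measure α} {s : Set α} (hs : MeasurableSet s) {f : α → E} {p : ENNReal}
    (h : MemLp f p (μ.restrict s)) (h0 : ∀ x ∉ s, f x = 0) : MemLp f p μ := by
  have e : s.indicator f = f := indicator_eq_self.2 fun x hx => by_contra fun h => hx (h0 x h)
  rw [← e]
  exact (memLp_indicator_iff_restrict hs).2 h

theorem ae_memLp_slice_right {α β E : Type*} [MeasurableSpace α] [MeasurableSpace β]
    [NormedAddCommGroup E] {μ : Measure α} {ν : Measure β} [SFinite μ] [SFinite ν] {z : α × β → E}
    (hz : MemLp z 2 (μ.prod ν)) : ∀ᵐ x ∂μ, MemLp (fun y => z (x, y)) 2 ν := by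
  have h2 := (memLp_two_iff_integrable_sq_norm hz.1).1 hz
  filter_upwards [hz.1.prodMk_left, h2.prod_right_ae] with x hx1 hx2
  exact (memLp_two_iff_integrable_sq_norm hx1).2 hx2

theorem memLp_smul_prod {E : Type*} [NormedAddCommGroup E] [NormedSpace ℝ E] {a : ℝ → ℝ}
    {b : R3 → E} (ha : MemLp a 2) (hb : MemLp b 2) :
    MemLp (fun p : ℝ × R3 => a p.1 • b p.2) 2 := by
  have hm : AEStronglyMeasurable (fun p : ℝ × R3 => a p.1 • b p.2)
      ((volume : Measure ℝ).prod (volume : Measure R3)) := ha.1.comp_fst.smul hb.1.comp_snd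
  rw [Measure.volume_eq_prod]
  rw [memLp_two_iff_integrable_sq_norm hm]
  have := ((memLp_two_iff_integrable_sq_norm ha.1).1 ha).mul_prod
    ((memLp_two_iff_integrable_sq_norm hb.1).1 hb)
  simpa only [norm_smul, mul_pow] using this

/-- The Lagrangian field, set to zero off `Ω`. -/
noncomputable def lagr (T : ℝ) (Ω : Set R3) (X : ℝ → R3 → R3) (u : ℝ → R3 → R3) (p : ℝ × R3) : R3 :=
  extInv T Ω X p.1 p.2 (u p.1 (X p.1 p.2))

/-- The gradient of the Lagrangian field, set to zero off `Ω`. -/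
noncomputable def lagrGrad (T : ℝ) (Ω : Set R3) (X : ℝ → R3 → R3) (u : ℝ → R3 → R3)
    (G : ℝ → R3 → R3 →L[ℝ] R3) (p : ℝ × R3) : R3 →L[ℝ] R3 :=
  pullGrad T Ω X p.1 p.2 (u p.1 (X p.1 p.2)) (G p.1 (X p.1 p.2))

namespace IsVolumePreservingTransformation

variable {T : ℝ} {Ω : Set R3} {X : ℝ → R3 → R3} {u : ℝ → R3 → R3}

theorem extInv_zero {t : ℝ} {y : R3} (hy : y ∉ Ω) : extInv T Ω X t y = 0 := indicator_of_notMem hy _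

theorem lagr_zero {p : ℝ × R3} (hp : p.2 ∉ Ω) : lagr T Ω X u p = 0 := by
  rw [lagr, extInv_zero hp, zero_apply]

theorem lagrGrad_zero {G : ℝ → R3 → R3 →L[ℝ] R3} {p : ℝ × R3} (hp : p.2 ∉ Ω) :
    lagrGrad T Ω X u G p = 0 := by
  rw [lagrGrad, pullGrad, extInv_zero hp, ContinuousLinearMap.zero_comp]

theorem lagrangian_eq (hX : IsVolumePreservingTransformation T Ω X) (hΩ : IsOpen Ω) {t : ℝ}
    (ht : t ∈ Icc 0 T) {y : R3} (hy : y ∈ Ω) : lagrangian Ω X u t y = lagr T Ω X u (t, y) := by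
  rw [lagrangian, lagr, hX.fderiv_inverseMap hΩ ht hy, extInv_eq ht hy]

theorem extGrad_lagr (hX : IsVolumePreservingTransformation T Ω X) {t : ℝ}
    (ht : t ∈ Icc 0 T) {y : R3} (hy : y ∈ Ω) :
    extGrad T Ω X t y (lagr T Ω X u (t, y)) = u t (X t y) :=
  hX.extGrad_extInv ht hy _

theorem memLp_lagr (hX : IsVolumePreservingTransformation T Ω X) (hΩ : IsOpen Ω) (hT : 0 ≤ T)
    (hu : MemLp (fun p : ℝ × R3 => u p.1 p.2) 2 (volume.restrict (spaceTime Ω X T))) :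
    MemLp (lagr T Ω X u) 2 (volume.restrict (Ioo 0 T ×ˢ Ω)) := by
  obtain ⟨K, hK⟩ := hX.exists_extBound hΩ hT
  exact memLp_clm_apply_of_bound (hK.inv.measurable_uncurry hΩ.measurableSet).aestronglyMeasurable
    (fun p : ℝ × R3 => hK.norm_inv p.1 p.2) (hX.memLp_comp_lagrangeMap hΩ le_rfl hu)

theorem memLp_lagrGrad (hX : IsVolumePreservingTransformation T Ω X) (hΩ : IsOpen Ω) (hT : 0 ≤ T)
    (hu : MemLp (fun p : ℝ × R3 => u p.1 p.2) 2 (volume.restrict (spaceTime Ω X T)))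
    {G : ℝ → R3 → R3 →L[ℝ] R3}
    (hG : MemLp (fun p : ℝ × R3 => G p.1 p.2) 2 (volume.restrict (spaceTime Ω X T))) :
    MemLp (lagrGrad T Ω X u G) 2 (volume.restrict (Ioo 0 T ×ˢ Ω)) := by
  obtain ⟨K, hK⟩ := hX.exists_extBound hΩ hT
  exact memLp_pullGrad hK hΩ measurable_fst.aemeasurable measurable_snd.aemeasurable
    (hX.memLp_comp_lagrangeMap hΩ le_rfl hu) (hX.memLp_comp_lagrangeMap hΩ le_rfl hG)

theorem memLp_lagr_slice (hX : IsVolumePreservingTransformation T Ω X) (hΩ : IsOpen Ω)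
    {t : ℝ} (ht : t ∈ Icc 0 T) (hu : MemLp (u t) 2 (volume.restrict (domainAt Ω X t))) :
    MemLp (fun y => lagr T Ω X u (t, y)) 2 := by
  obtain ⟨K, hK⟩ := hX.exists_extBound hΩ (ht.1.trans ht.2)
  have h : MemLp (fun y => lagr T Ω X u (t, y)) 2 (volume.restrict Ω) :=
    memLp_clm_apply_of_bound ((hK.inv.measurable_uncurry hΩ.measurableSet).comp
      measurable_prodMk_left).aestronglyMeasurable (fun y => hK.norm_inv t y)
      (hX.memLp_comp_apply hΩ ht hu)
  exact memLp_of_restrict_of_zero hΩ.measurableSet h fun y hy => lagr_zero (p := (t, y)) hy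

theorem memLp_lagrGrad_slice (hX : IsVolumePreservingTransformation T Ω X) (hΩ : IsOpen Ω)
    {t : ℝ} (ht : t ∈ Icc 0 T) (hu : MemLp (u t) 2 (volume.restrict (domainAt Ω X t)))
    {G : ℝ → R3 → R3 →L[ℝ] R3} (hG : MemLp (G t) 2 (volume.restrict (domainAt Ω X t))) :
    MemLp (fun y => lagrGrad T Ω X u G (t, y)) 2 := by
  obtain ⟨K, hK⟩ := hX.exists_extBound hΩ (ht.1.trans ht.2)
  have h : MemLp (fun y => lagrGrad T Ω X u G (t, y)) 2 (volume.restrict Ω) :=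
    memLp_pullGrad hK hΩ aemeasurable_const aemeasurable_id
      (hX.memLp_comp_apply hΩ ht hu) (hX.memLp_comp_apply hΩ ht hG)
  exact memLp_of_restrict_of_zero hΩ.measurableSet h fun y hy => lagrGrad_zero (p := (t, y)) hy

theorem memLp_of_comp_apply (hX : IsVolumePreservingTransformation T Ω X) (hΩ : IsOpen Ω) {t : ℝ}
    (ht : t ∈ Icc 0 T) {F : Type*} [NormedAddCommGroup F] {f : R3 → F}
    (hf : MemLp (fun y => f (X t y)) 2 (volume.restrict Ω)) :
    MemLp f 2 (volume.restrict (domainAt Ω X t)) := by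
  have hYm : AEMeasurable (inverseMap Ω X t) (volume.restrict (domainAt Ω X t)) :=
    (hX.smooth_inverse t ht).continuousOn.aemeasurable (hX.isOpen_domainAt hΩ ht).measurableSet
  have hmap : Measure.map (inverseMap Ω X t) (volume.restrict (domainAt Ω X t)) =
      volume.restrict Ω := by
    rw [← hX.map_apply hΩ ht] at hYm ⊢
    rw [AEMeasurable.map_map_of_aemeasurable hYm (hX.aemeasurable_apply hΩ ht)]
    refine (Measure.map_congr ?_).trans Measure.map_id
    exact (ae_restrict_iff' hΩ.measurableSet).2 (ae_of_all _ fun y hy => hX.inverseMap_apply ht hy)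
  rw [← hmap] at hf
  refine (memLp_congr_ae ?_).1 (hf.comp_of_map hYm)
  refine (ae_restrict_iff' (hX.isOpen_domainAt hΩ ht).measurableSet).2 (ae_of_all _ fun x hx => ?_)
  simp only [Function.comp_apply, apply_inverseMap hx]

/-- Square integrability of the gradient on the space-time domain gives it on almost every slice, so
the chain rule applies at almost every time. -/
theorem ae_hasWeakGradient_lagr (hX : IsVolumePreservingTransformation T Ω X) (hΩ : IsOpen Ω)
    (hT : 0 ≤ T) (hu2 : ∀ t ∈ Icc 0 T, MemLp (u t) 2 (volume.restrict (domainAt Ω X t)))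
    {G : ℝ → R3 → R3 →L[ℝ] R3}
    (hG : MemLp (fun p : ℝ × R3 => G p.1 p.2) 2 (volume.restrict (spaceTime Ω X T)))
    (hw : ∀ᵐ t ∂(volume.restrict (Ioo 0 T)), HasWeakGradient (domainAt Ω X t) (u t) (G t)) :
    ∀ᵐ t ∂(volume.restrict (Ioo 0 T)), MemLp (G t) 2 (volume.restrict (domainAt Ω X t)) ∧
      HasWeakGradient Ω (fun y => lagr T Ω X u (t, y)) fun y => lagrGrad T Ω X u G (t, y) := by
  have hGl := hX.memLp_comp_lagrangeMap hΩ le_rfl hG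
  rw [Measure.volume_eq_prod, ← Measure.prod_restrict] at hGl
  filter_upwards [hw, ae_memLp_slice_right hGl, ae_restrict_mem measurableSet_Ioo] with t
    ht1 ht2 ht
  have ht' := Ioo_subset_Icc_self ht
  have hGt : MemLp (G t) 2 (volume.restrict (domainAt Ω X t)) := hX.memLp_of_comp_apply hΩ ht' ht2
  refine ⟨hGt, ?_⟩
  have h := hX.hasWeakGradient_pullback hΩ hT ht' (hu2 t ht') hGt ht1
  simpa only [lagr, lagrGrad] using h

theorem memLp_indicator_smul {E : Type*} [NormedAddCommGroup E] [NormedSpace ℝ E]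
    (hΩ : IsOpen Ω) {F : ℝ × R3 → E} (hF : MemLp F 2 (volume.restrict (Ioo 0 T ×ˢ Ω)))
    (h0 : ∀ p : ℝ × R3, p.2 ∉ Ω → F p = 0) {ξ : ℝ → ℝ} (hξ : Continuous ξ) {C : ℝ}
    (hC : ∀ s, ‖ξ s‖ ≤ C) : MemLp (fun p => (Ioo 0 T).indicator ξ p.1 • F p) 2 := by
  have hm : MeasurableSet (Ioo 0 T ×ˢ Ω) := measurableSet_Ioo.prod hΩ.measurableSet
  have h1 : MemLp (fun p : ℝ × R3 => ξ p.1 • F p) 2 (volume.restrict (Ioo 0 T ×ˢ Ω)) :=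
    hF.of_le_mul (c := C) ((hξ.comp continuous_fst).aestronglyMeasurable.smul hF.1)
      (ae_of_all _ fun p => by rw [norm_smul]; exact mul_le_mul_of_nonneg_right (hC _) (norm_nonneg _))
  have e : (fun p : ℝ × R3 => (Ioo 0 T).indicator ξ p.1 • F p) =
      (Ioo 0 T ×ˢ Ω).indicator fun p => ξ p.1 • F p := ?_
  · rw [e]
    exact (memLp_indicator_iff_restrict hm).2 h1
  funext p
  by_cases hp : p.1 ∈ Ioo 0 T
  · by_cases hp2 : p.2 ∈ Ω
    · rw [indicator_of_mem hp, indicator_of_mem (show p ∈ Ioo 0 T ×ˢ Ω from ⟨hp, hp2⟩)]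
    · rw [h0 p hp2, smul_zero, indicator_of_notMem fun h : p ∈ Ioo 0 T ×ˢ Ω => hp2 h.2]
  · rw [indicator_of_notMem hp, zero_smul, indicator_of_notMem fun h : p ∈ Ioo 0 T ×ˢ Ω => hp h.1]

/-- For initial values in `H¹` the regularization has a square integrable time derivative. -/
theorem exists_hasL2TimeDeriv_reg (hX : IsVolumePreservingTransformation T Ω X) (hΩ : IsOpen Ω)
    (hT : 0 < T) {ξ : ℝ → ℝ} (hξ : IsCutoff T ξ) {j : ℝ → ℝ → ℝ} (hj : IsMollifierFamily j)
    (hu : MemL2H1 T Ω X u)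
    (hu2 : ∀ t ∈ Icc 0 T, MemLp (u t) 2 (volume.restrict (domainAt Ω X t)))
    (h0 : MemH1 (domainAt Ω X 0) (u 0)) {t : ℝ} (ht : t ∈ Ioo 0 T) {h : ℝ} (hh : h ∈ Ioo 0 (T - t)) :
    ∃ D : ℝ → R3 → R3, HasL2TimeDeriv Ω X t (reg T Ω X ξ j u h) D := by
  obtain ⟨hu1, G, hG, hwG⟩ := hu
  obtain ⟨-, G₀, hG₀, hwG₀⟩ := h0
  have h0T : (0 : ℝ) ∈ Icc 0 T := left_mem_Icc.2 hT.le
  obtain ⟨C, hC⟩ := hξ.smooth.continuous.bounded_above_of_compact_support hξ.compact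
  have hsl := hX.ae_hasWeakGradient_lagr hΩ hT.le hu2 hG hwG
  let g₀ : R3 → R3 →L[ℝ] R3 := fun y => lagrGrad T Ω X u (fun _ => G₀) (0, y)
  have hw0 : HasWeakGradient Ω (fun y => lagr T Ω X u (0, y)) g₀ :=
    hX.hasWeakGradient_pullback hΩ hT.le h0T (hu2 0 h0T) hG₀ hwG₀
  -- The weights α and β describe the extended field for times below T: initial value in the past,
  -- the field itself on (0,T). The part after T is dropped, because h < T - t keeps the kernel from
  -- reaching it.
  let α : ℝ → ℝ := (Iic 0).indicator ξ
  let β : ℝ → ℝ := (Ioo 0 T).indicator ξ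
  let z : ℝ × R3 → R3 := fun p => α p.1 • lagr T Ω X u (0, p.2) + β p.1 • lagr T Ω X u p
  let g : ℝ × R3 → R3 →L[ℝ] R3 := fun p => α p.1 • g₀ p.2 + β p.1 • lagrGrad T Ω X u G p
  have hα : MemLp α 2 :=
    (hξ.smooth.continuous.memLp_of_hasCompactSupport hξ.compact).indicator measurableSet_Iic
  have hz : MemLp z 2 := (memLp_smul_prod hα (hX.memLp_lagr_slice hΩ h0T (hu2 0 h0T))).add
    (memLp_indicator_smul hΩ (hX.memLp_lagr hΩ hT.le hu1) (fun p hp => lagr_zero hp)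
      hξ.smooth.continuous hC)
  have hg : MemLp g 2 := (memLp_smul_prod hα (hX.memLp_lagrGrad_slice hΩ h0T (hu2 0 h0T)
    (G := fun _ => G₀) hG₀)).add
    (memLp_indicator_smul hΩ (hX.memLp_lagrGrad hΩ hT.le hu1 hG) (fun p hp => lagrGrad_zero hp)
      hξ.smooth.continuous hC)
  have hzg : ∀ᵐ s : ℝ, HasWeakGradient Ω (fun y => z (s, y)) fun y => g (s, y) := by
    filter_upwards [(ae_restrict_iff' measurableSet_Ioo).1 hsl] with s hs
    by_cases hs0 : s ∈ Ioo 0 T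
    · have e1 : α s = 0 := indicator_of_notMem (s := Iic 0) (fun h => absurd hs0.1 (not_lt.2 h)) _
      have e2 : (fun y => z (s, y)) = fun y => β s • lagr T Ω X u (s, y) := by simp [z, e1]
      have e3 : (fun y => g (s, y)) = fun y => β s • lagrGrad T Ω X u G (s, y) := by
        simp only [g, e1]; ext; simp
      rw [e2, e3]
      exact (hs hs0).2.const_smul (β s)
    · have e1 : β s = 0 := indicator_of_notMem hs0 _
      have e2 : (fun y => z (s, y)) = fun y => α s • lagr T Ω X u (0, y) := by simp [z, e1]
      have e3 : (fun y => g (s, y)) = fun y => α s • g₀ y := by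
        simp only [g, e1]; ext; simp
      rw [e2, e3]
      exact hw0.const_smul (α s)
  have hjs := (hj.smooth h hh.1).of_le (show (1 : WithTop ℕ∞) ≤ ∞ by exact_mod_cast le_top)
  have hjc : HasCompactSupport (j h) := HasCompactSupport.of_support_subset_isCompact isCompact_Icc
    ((hj.support h hh.1).trans Ioo_subset_Icc_self)
  have m1 := (memLp_timeConv hjs.continuous hjc hz).restrict (Ioo 0 t ×ˢ Ω)
  have m2 := (memLp_timeConv (hjs.continuous_deriv le_rfl) hjc.deriv hz).restrict (Ioo 0 t ×ˢ Ω)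
  have m3 := (memLp_timeConv hjs.continuous hjc hg).restrict (Ioo 0 t ×ˢ Ω)
  refine ⟨_, hX.hasL2TimeDeriv_push hΩ hT.le ht.2.le m1 (memLp_joinGrad m2 m3)
    (hasWeakGradient_joinGrad m1 m2 m3 (hasWeakDerivAlong_time hjs hjc hz)
      fun e => hasWeakDerivAlong_space hjs.continuous hjc hz hg hzg _ e) fun p hp => ?_⟩
  have hp' : p.1 ∈ Icc 0 T := ⟨hp.1.1.le, (hp.1.2.trans ht.2).le⟩
  rw [reg, hX.inverseMap_apply hp' hp.2, extGrad_eq hp' hp.2]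
  congr 1
  -- Where the kernel does not vanish, the argument p.1 - r is below T, and there z agrees with the
  -- prescribed extension.
  rw [lagrangianReg, timeConv, ← integral_sub_left_eq_self _ volume p.1]
  refine integral_congr_ae (ae_of_all _ fun r => ?_)
  simp only [sub_sub_cancel]
  by_cases hr : j h r = 0
  · simp [hr]
  congr 1
  have hr' := hj.support h hh.1 hr
  have hlt : p.1 - r < T := by linarith [hr'.1, hh.2, hp.1.2]
  have e : p - (r, (0 : R3)) = (p.1 - r, p.2) := by ext <;> simp
  rw [extendTime, e]
  by_cases h1 : p.1 - r ≤ 0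
  · have e2 : β (p.1 - r) = 0 := indicator_of_notMem (fun h => absurd h.1 (not_lt.2 h1)) _
    have e3 : α (p.1 - r) = ξ (p.1 - r) := indicator_of_mem (show p.1 - r ∈ Iic 0 from h1) _
    simp only [z, e2, e3, h1, if_true, zero_smul, add_zero, hX.lagrangian_eq hΩ h0T hp.2]
  · have hm : p.1 - r ∈ Ioo 0 T := ⟨not_le.1 h1, hlt⟩
    have e2 : β (p.1 - r) = ξ (p.1 - r) := indicator_of_mem hm _
    have e3 : α (p.1 - r) = 0 := indicator_of_notMem (s := Iic 0) h1 _
    simp only [z, e2, e3, h1, hlt, if_true, if_false, zero_smul, zero_add,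
      hX.lagrangian_eq hΩ (Ioo_subset_Icc_self hm) hp.2]

end IsVolumePreservingTransformation

end MovingDomain

namespace MovingDomain

/-! ### Mollifiers -/

/-- The mass `∫_τ^∞ j` of an even mollifier. -/
noncomputable def tailMass (j : ℝ → ℝ) (τ : ℝ) : ℝ := 1 / 2 - ∫ s in (0 : ℝ)..τ, j s

namespace IsMollifierFamily

variable {j : ℝ → ℝ → ℝ} {h : ℝ}

theorem contDiff_one (hj : IsMollifierFamily j) (hh : 0 < h) : ContDiff ℝ 1 (j h) :=
  (hj.smooth h hh).of_le (by exact_mod_cast le_top)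

theorem continuous (hj : IsMollifierFamily j) (hh : 0 < h) : Continuous (j h) := (hj.smooth h hh).continuous

theorem continuous_deriv (hj : IsMollifierFamily j) (hh : 0 < h) : Continuous (deriv (j h)) :=
  (hj.contDiff_one hh).continuous_deriv le_rfl

theorem hasCompactSupport (hj : IsMollifierFamily j) (hh : 0 < h) : HasCompactSupport (j h) :=
  HasCompactSupport.of_support_subset_isCompact isCompact_Icc
    ((hj.support h hh).trans Ioo_subset_Icc_self)

theorem eq_zero (hj : IsMollifierFamily j) (hh : 0 < h) {r : ℝ} (hr : h ≤ |r|) : j h r = 0 := by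
  by_contra h0
  have := hj.support h hh h0
  exact absurd (abs_lt.2 this) (not_lt.2 hr)

theorem deriv_eq_zero (hj : IsMollifierFamily j) (hh : 0 < h) {r : ℝ} (hr : r ∉ Icc (-h) h) : deriv (j h) r = 0 := by
  have h1 : tsupport (j h) ⊆ Icc (-h) h :=
    closure_minimal ((hj.support h hh).trans Ioo_subset_Icc_self) isClosed_Icc
  by_contra h0
  exact hr (h1 (support_deriv_subset h0))

theorem integrable (hj : IsMollifierFamily j) (hh : 0 < h) : Integrable (j h) :=
  (hj.continuous hh).integrable_of_hasCompactSupport (hj.hasCompactSupport hh)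

/-- Evenness of the mollifier puts exactly half of its mass on each side of zero. -/
theorem integral_Ioi (hj : IsMollifierFamily j) (hh : 0 < h) : ∫ s in Ioi 0, j h s = 1 / 2 := by
  have h1 := integral_comp_abs (f := j h)
  have h2 : ∀ s, j h |s| = j h s := fun s => by
    rcases abs_choice s with h | h <;> rw [h]
    exact hj.even _ hh s
  simp only [h2] at h1
  rw [hj.integral h hh] at h1
  linarith

theorem intervalIntegral_of_le (hj : IsMollifierFamily j) (hh : 0 < h) {τ : ℝ} (hτ : h ≤ τ) :
    ∫ s in (0 : ℝ)..τ, j h s = 1 / 2 := by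
  rw [intervalIntegral.integral_of_le (hh.le.trans hτ), ← hj.integral_Ioi hh]
  refine (setIntegral_eq_of_subset_of_forall_sdiff_eq_zero measurableSet_Ioi Ioc_subset_Ioi_self
    fun s hs => hj.eq_zero hh ?_).symm
  have h1 : τ < s := by
    by_contra hc
    exact hs.2 ⟨hs.1, not_lt.1 hc⟩
  exact (hτ.trans h1.le).trans (le_abs_self s)

theorem tailMass_eq_zero (hj : IsMollifierFamily j) (hh : 0 < h) {τ : ℝ} (hτ : h ≤ τ) : tailMass (j h) τ = 0 := by
  rw [tailMass, hj.intervalIntegral_of_le hh hτ, sub_self]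

theorem hasDerivAt_tailMass (hj : IsMollifierFamily j) (hh : 0 < h) (τ : ℝ) : HasDerivAt (tailMass (j h)) (-j h τ) τ :=
  (intervalIntegral.integral_hasDerivAt_right ((hj.continuous hh).intervalIntegrable _ _)
    (hj.continuous hh).stronglyMeasurable.stronglyMeasurableAtFilter
    (hj.continuous hh).continuousAt).const_sub _

theorem contDiff_tailMass (hj : IsMollifierFamily j) (hh : 0 < h) : ContDiff ℝ ∞ (tailMass (j h)) := by
  rw [contDiff_infty_iff_deriv]
  refine ⟨fun τ => (hj.hasDerivAt_tailMass hh τ).differentiableAt, ?_⟩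
  have : deriv (tailMass (j h)) = fun τ => -j h τ :=
    funext fun τ => (hj.hasDerivAt_tailMass hh τ).deriv
  rw [this]
  exact (hj.smooth h hh).neg

theorem tailMass_nonneg (hj : IsMollifierFamily j) (hh : 0 < h) (τ : ℝ) :
    0 ≤ tailMass (j h) τ := by
  have ha : Antitone (tailMass (j h)) := antitone_of_deriv_nonpos
    (fun τ => (hj.hasDerivAt_tailMass hh τ).differentiableAt) fun τ => by
      rw [(hj.hasDerivAt_tailMass hh τ).deriv]
      exact neg_nonpos.2 (hj.nonneg h hh τ)
  rw [← hj.tailMass_eq_zero hh (le_max_left h τ)]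
  exact ha (le_max_right h τ)

theorem tailMass_le (hj : IsMollifierFamily j) (hh : 0 < h) (τ : ℝ) (hτ : 0 ≤ τ) : tailMass (j h) τ ≤ 1 / 2 := by
  have := intervalIntegral.integral_nonneg (μ := volume) hτ fun s _ => hj.nonneg h hh s
  rw [tailMass]
  linarith

theorem integral_mul_indicator_Ioc {κ : ℝ → ℝ} (τ : ℝ) :
    ∫ r, κ r * (Ioc (-1 : ℝ) 0).indicator 1 (τ - r) = ∫ r in τ..(τ + 1), κ r := by
  rw [intervalIntegral.integral_of_le (by linarith), ← integral_Ico_eq_integral_Ioc,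
    ← integral_indicator measurableSet_Ico]
  refine integral_congr_ae (ae_of_all _ fun r => ?_)
  by_cases hr : r ∈ Ico τ (τ + 1)
  · have : τ - r ∈ Ioc (-1 : ℝ) 0 := ⟨by linarith [hr.2], by linarith [hr.1]⟩
    simp only [indicator_of_mem this, indicator_of_mem hr, Pi.one_apply, mul_one]
  · have : τ - r ∉ Ioc (-1 : ℝ) 0 := fun h => hr ⟨by linarith [h.2], by linarith [h.1]⟩
    simp only [indicator_of_notMem this, indicator_of_notMem hr, mul_zero]

/-- The indicator of (-1, 0] models a constant past. The length one is arbitrary: for h < 1 the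
kernel at a time τ ≥ 0 does not see the cut at -1, so the result is the full tail. -/
theorem integral_mul_indicator (hj : IsMollifierFamily j) (hh : 0 < h) (h1 : h < 1) {τ : ℝ} (hτ : 0 ≤ τ) :
    ∫ r, j h r * (Ioc (-1 : ℝ) 0).indicator 1 (τ - r) = tailMass (j h) τ := by
  rw [integral_mul_indicator_Ioc, tailMass, ← hj.intervalIntegral_of_le hh
    (show h ≤ τ + 1 by linarith)]
  have hi := fun a b => (hj.continuous hh).intervalIntegrable (μ := volume) a b
  rw [← intervalIntegral.integral_interval_sub_left (hi 0 (τ + 1)) (hi 0 τ)]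

theorem integral_deriv_mul_indicator (hj : IsMollifierFamily j) (hh : 0 < h) (h1 : h < 1) {τ : ℝ} (hτ : 0 ≤ τ) :
    ∫ r, deriv (j h) r * (Ioc (-1 : ℝ) 0).indicator 1 (τ - r) = -j h τ := by
  rw [integral_mul_indicator_Ioc, intervalIntegral.integral_deriv_eq_sub
    (fun x _ => (hj.contDiff_one hh).differentiable (by norm_num) x)
    ((hj.continuous_deriv hh).intervalIntegrable _ _), hj.eq_zero hh, zero_sub]
  rw [abs_of_nonneg (by linarith)]
  linarith

theorem deriv_neg_arg (hj : IsMollifierFamily j) (hh : 0 < h) (r : ℝ) : deriv (j h) (-r) = -deriv (j h) r := by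
  have h1 : (fun s => j h (-s)) = j h := funext fun s => hj.even h hh s
  have h2 := deriv_comp_neg (f := j h) r
  rw [h1] at h2
  rw [h2, neg_neg]

theorem integral_deriv_mul_self (hj : IsMollifierFamily j) (hh : 0 < h) : ∫ r, deriv (j h) r * r = -1 := by
  have h1 := integral_mul_deriv_eq_deriv_mul_of_integrable (u := fun r : ℝ => r) (v := j h)
    (u' := fun _ => 1) (v' := deriv (j h)) (fun r _ => hasDerivAt_id r)
    (fun r _ => ((hj.contDiff_one hh).differentiable (by norm_num) r).hasDerivAt)
    ((continuous_id.mul (hj.continuous_deriv hh)).integrable_of_hasCompactSupport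
      (hj.hasCompactSupport hh).deriv.mul_left)
    (by simpa [Pi.mul_def] using hj.integrable hh)
    ((continuous_id.mul (hj.continuous hh)).integrable_of_hasCompactSupport
      (hj.hasCompactSupport hh).mul_left)
  simp only [one_mul, hj.integral h hh] at h1
  simpa only [mul_comm] using h1

theorem integral_deriv_mul_abs (hj : IsMollifierFamily j) (hh : 0 < h) : ∫ r, deriv (j h) r * |r| = 0 := by
  have h1 := integral_neg_eq_self (fun r => deriv (j h) r * |r|) volume
  simp only [hj.deriv_neg_arg hh, abs_neg, neg_mul, integral_neg] at h1
  linarith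

/-- The derivatives of the mollifiers detect one-sided derivatives at zero. -/
theorem tendsto_integral_deriv_mul (hj : IsMollifierFamily j) {κ : ℝ → ℝ} (hκ : AEStronglyMeasurable κ) {a b : ℝ}
    (ha : Tendsto (fun r => κ r / r) (𝓝[>] 0) (𝓝 a))
    (hb : Tendsto (fun r => κ r / r) (𝓝[<] 0) (𝓝 b)) :
    Tendsto (fun h => ∫ r, deriv (j h) r * κ r) (𝓝[>] 0) (𝓝 (-((a + b) / 2))) := by
  obtain ⟨C, hC⟩ := hj.deriv_bound
  -- The piecewise linear function with slope a on the right and b on the left, written as odd part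
  -- plus even part. The odd derivative j_h' annihilates |r| and gives -1 on r.
  let κ₀ : ℝ → ℝ := fun r => (a + b) / 2 * r + (a - b) / 2 * |r|
  have hκ₀ : Continuous κ₀ := by fun_prop
  rw [Metric.tendsto_nhds]
  intro ε hε
  have hC0 : 0 ≤ |C| := abs_nonneg C
  -- The remainder is at most η |r|. With |j_h'| ≤ |C|/h² on an interval of length 2h, the error is
  -- at most 2 |C| η < ε, independently of h.
  set η : ℝ := ε / (2 * |C| + 1)
  have hη : 0 < η := by positivity
  obtain ⟨δ, hδ, hd⟩ : ∃ δ > 0, ∀ r ≠ 0, |r| < δ → |κ r - κ₀ r| ≤ η * |r| := by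
    rw [Metric.tendsto_nhds] at ha hb
    obtain ⟨δ₁, hδ₁, h1⟩ := (mem_nhdsGT_iff_exists_Ioo_subset).1 (ha η hη)
    obtain ⟨δ₂, hδ₂, h2⟩ := (mem_nhdsLT_iff_exists_Ioo_subset).1 (hb η hη)
    refine ⟨min δ₁ (-δ₂), lt_min hδ₁ (neg_pos.2 hδ₂), fun r hr0 hr => ?_⟩
    have fin : ∀ c : ℝ, κ₀ r = c * r → |κ r / r - c| < η → |κ r - κ₀ r| ≤ η * |r| :=
      fun c e hc => by
        have : κ r - κ₀ r = (κ r / r - c) * r := by rw [e]; field_simp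
        rw [this, abs_mul]
        exact mul_le_mul_of_nonneg_right hc.le (abs_nonneg r)
    have hr1 := abs_lt.1 (hr.trans_le (min_le_left _ _))
    have hr2 := abs_lt.1 (hr.trans_le (min_le_right _ _))
    rcases lt_or_gt_of_ne hr0 with h | h
    · exact fin b (by simp only [κ₀, abs_of_neg h]; ring) (h2 ⟨by linarith [hr2.1], h⟩)
    · exact fin a (by simp only [κ₀, abs_of_pos h]; ring) (h1 ⟨h, hr1.2⟩)
  filter_upwards [Ioo_mem_nhdsGT hδ] with h hh
  have hh0 := hh.1
  have hbound : ∀ r, r ≠ 0 → |deriv (j h) r * (κ r - κ₀ r)| ≤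
      (Icc (-h) h).indicator (fun _ => |C| / h * η) r := fun r hr0 => by
    by_cases hr : r ∈ Icc (-h) h
    · rw [indicator_of_mem hr, abs_mul]
      have hr' : |r| ≤ h := abs_le.2 hr
      calc |deriv (j h) r| * |κ r - κ₀ r| ≤ |C| / h ^ 2 * (η * h) := by
            refine mul_le_mul ?_ ?_ (abs_nonneg _) (by positivity)
            · exact (hC h hh0 r).trans (by gcongr; exact le_abs_self C)
            · exact (hd r hr0 (hr'.trans_lt hh.2)).trans (by gcongr)
        _ = |C| / h * η := by field_simp
    · rw [indicator_of_notMem hr, hj.deriv_eq_zero hh0 hr, zero_mul, abs_zero]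
  have hae : ∀ᵐ r : ℝ, r ≠ 0 := ae_iff.2 (by simp)
  have hbi : Integrable ((Icc (-h) h).indicator fun _ : ℝ => |C| / h * η) :=
    (integrable_indicator_iff measurableSet_Icc).2 (integrableOn_const (by simp))
  have i1 : Integrable fun r => deriv (j h) r * (κ r - κ₀ r) :=
    hbi.mono' ((hj.continuous_deriv hh0).aestronglyMeasurable.mul
      (hκ.sub hκ₀.aestronglyMeasurable)) (hae.mono fun r hr => hbound r hr)
  have ig : ∀ {f : ℝ → ℝ}, Continuous f → Integrable fun r => deriv (j h) r * f r := fun hf =>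
    ((hj.continuous_deriv hh0).mul hf).integrable_of_hasCompactSupport
      (hj.hasCompactSupport hh0).deriv.mul_right
  have e0 : ∫ r, deriv (j h) r * κ₀ r = -((a + b) / 2) := by
    have : ∀ r, deriv (j h) r * κ₀ r =
        (a + b) / 2 * (deriv (j h) r * r) + (a - b) / 2 * (deriv (j h) r * |r|) := fun r => by
      simp only [κ₀]; ring
    simp only [this]
    rw [integral_add ((ig (f := fun r => r) continuous_id).const_mul _)
      ((ig continuous_abs).const_mul _),
      integral_const_mul, integral_const_mul, hj.integral_deriv_mul_self hh0,
      hj.integral_deriv_mul_abs hh0]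
    ring
  have e1 : ∫ r, deriv (j h) r * κ r = (∫ r, deriv (j h) r * (κ r - κ₀ r)) + -((a + b) / 2) := by
    rw [← e0, ← integral_add i1 (ig hκ₀)]
    refine integral_congr_ae (ae_of_all _ fun r => ?_)
    simp only; ring
  rw [e1, Real.dist_eq, add_sub_cancel_right]
  calc |∫ r, deriv (j h) r * (κ r - κ₀ r)| ≤ ∫ r, (Icc (-h) h).indicator (fun _ => |C| / h * η) r :=
        by
        rw [← Real.norm_eq_abs]
        exact norm_integral_le_of_norm_le hbi (hae.mono fun r hr => hbound r hr)
    _ = 2 * |C| * η := by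
        rw [integral_indicator measurableSet_Icc, setIntegral_const]
        simp only [measureReal_def, Real.volume_Icc, smul_eq_mul]
        rw [ENNReal.toReal_ofReal (by linarith)]
        field_simp
        ring
    _ < ε := by
        have : η * (2 * |C| + 1) = ε := div_mul_cancel₀ _ (by positivity)
        linarith

theorem tendsto_timeConv (hj : IsMollifierFamily j) {E : Type*} [NormedAddCommGroup E] [NormedSpace ℝ E] [CompleteSpace E]
    {z : ℝ × R3 → E} (hz : MemLp z 2) :
    Tendsto (fun h => eLpNorm (fun p => timeConv (j h) z p - z p) 2 volume) (𝓝[>] 0) (𝓝 0) := by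
  refine tendsto_eLpNorm_average_sub hz measurable_timeShift ?_ fun ε hε => ?_
  · filter_upwards [self_mem_nhdsWithin] with h hh
    exact ⟨(hj.continuous hh).measurable, hj.nonneg h hh, hj.integrable hh, hj.integral h hh⟩
  · filter_upwards [Ioo_mem_nhdsGT hε] with h hh r hr
    have := hj.support h hh.1 hr
    rw [Prod.norm_def, norm_zero, max_eq_left (norm_nonneg _), Real.norm_eq_abs]
    exact (abs_lt.2 this).trans hh.2

end IsMollifierFamily

end MovingDomain

/-! ### Interior contribution to the symmetrized pairing. -/

namespace MovingDomain

theorem tendsto_zero_of_sq {ι : Type*} {l : Filter ι} {f : ι → ENNReal}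
    (h : Tendsto (fun n => f n ^ 2) l (𝓝 0)) : Tendsto f l (𝓝 0) := by
  have h1 := (ENNReal.continuous_rpow_const (y := (1 / 2 : ℝ))).continuousAt.tendsto.comp h
  have e : ∀ x : ENNReal, (x ^ 2) ^ (1 / 2 : ℝ) = x := fun x => by
    rw [← ENNReal.rpow_natCast, ← ENNReal.rpow_mul]; norm_num
  simp only [Function.comp_def, e] at h1
  simpa using h1

theorem tendsto_eLpNorm_two_of_dominated {α E ι : Type*} [MeasurableSpace α] {μ : Measure α}
    [NormedAddCommGroup E] {l : Filter ι} [l.IsCountablyGenerated] {F : ι → α → E} {f : α → E}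
    {g : α → ℝ} (hF : ∀ᶠ n in l, AEStronglyMeasurable (F n) μ) (hf : AEStronglyMeasurable f μ)
    (hg : MemLp g 2 μ) (hb : ∀ᶠ n in l, ∀ᵐ x ∂μ, ‖F n x - f x‖ ≤ g x)
    (hl : ∀ᵐ x ∂μ, Tendsto (fun n => F n x) l (𝓝 (f x))) :
    Tendsto (fun n => eLpNorm (fun x => F n x - f x) 2 μ) l (𝓝 0) := by
  have hfin : ∫⁻ x, ‖g x‖ₑ ^ 2 ∂μ ≠ ⊤ := by
    rw [← eLpNorm_two_sq]
    exact (ENNReal.pow_lt_top hg.2).ne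
  have key : Tendsto (fun n => ∫⁻ x, ‖F n x - f x‖ₑ ^ 2 ∂μ) l (𝓝 (∫⁻ _, 0 ∂μ)) := by
    refine tendsto_lintegral_filter_of_dominated_convergence' (fun x => ‖g x‖ₑ ^ 2)
      (hF.mono fun n hn => (hn.sub hf).enorm.pow_const _) (hb.mono fun n hn => ?_) hfin ?_
    · filter_upwards [hn] with x hx
      gcongr
      rw [enorm_le_iff_norm_le]
      exact hx.trans (le_abs_self _)
    · filter_upwards [hl] with x hx
      have h1 : Tendsto (fun n => F n x - f x) l (𝓝 0) := by
        simpa using hx.sub (tendsto_const_nhds (x := f x))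
      have h2 := (ENNReal.continuous_pow 2).continuousAt.tendsto.comp h1.enorm
      simpa [Function.comp_def] using h2
  simp only [lintegral_zero, ← eLpNorm_two_sq] at key
  exact tendsto_zero_of_sq key

section Shift

variable {E : Type*} [NormedAddCommGroup E] [NormedSpace ℝ E]

/-- Continuity of translations at an arbitrary time shift, reduced to the shift zero by translating
the function first. -/
theorem tendsto_eLpNorm_shift {b : ℝ × R3 → E} (hb : MemLp b 2) (r₀ : ℝ) :
    Tendsto (fun r : ℝ => eLpNorm (fun p => b (p - (r, 0)) - b (p - (r₀, 0))) 2 volume) (𝓝 r₀)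
      (𝓝 0) := by
  have h1 := lintegral_translate_sub_tendsto (memLp_translate hb (r₀, (0 : R3)))
  have h2 : Tendsto (fun r : ℝ => (r - r₀, (0 : R3))) (𝓝 r₀) (𝓝 0) := by
    have : Continuous fun r : ℝ => (r - r₀, (0 : R3)) := by fun_prop
    simpa [Prod.zero_eq_mk] using this.tendsto r₀
  have h3 := h1.comp h2
  have e1 : ∀ (p : ℝ × R3) (r : ℝ), p - (r - r₀, 0) - (r₀, 0) = p - (r, 0) := fun p r => by
    rw [sub_sub, Prod.mk_add_mk, sub_add_cancel, add_zero]
  simp only [Function.comp_def, e1, ← eLpNorm_two_sq] at h3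
  exact tendsto_zero_of_sq h3

end Shift

theorem continuous_integral_inner_shift {a b : ℝ × R3 → R3} (ha : MemLp a 2) (hb : MemLp b 2) :
    Continuous fun r : ℝ => ∫ p, ⟪a p, b (p - (r, 0))⟫ := by
  rw [continuous_iff_continuousAt]
  intro r₀
  exact tendsto_integral_bilin (B := fun _ => innerBilin R3) (C := ‖innerBilin R3‖)
    aestronglyMeasurable_const (fun _ => le_rfl) (Eventually.of_forall fun _ => ha)
    (Eventually.of_forall fun r => memLp_translate hb (r, 0)) ha (memLp_translate hb (r₀, 0))
    (by simp only [sub_self, eLpNorm_zero_fun, tendsto_const_nhds]) (tendsto_eLpNorm_shift hb r₀)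

section Symmetric

variable {Ω : Set R3} {K : NNReal} {M : ℝ → R3 → R3 →L[ℝ] R3}

theorem IsLipschitzFamily.measurable_shift (hM : IsLipschitzFamily Ω K M) (hΩ : MeasurableSet Ω)
    (r : ℝ) : Measurable fun p : ℝ × R3 => M (p.1 - r) p.2 :=
  (hM.measurable_uncurry hΩ).comp ((measurable_fst.sub_const r).prodMk measurable_snd)

/-- The whole difference quotient falls on M: it is bounded by the Lipschitz constant and converges
almost everywhere, so dominated convergence gives L² convergence of its product with a. The factor b
is only translated, so neither a nor b needs regularity in time. -/
theorem tendsto_integral_diffQuot (hM : IsLipschitzFamily Ω K M) (hΩ : MeasurableSet Ω)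
    {a b : ℝ × R3 → R3} (ha : MemLp a 2) (hb : MemLp b 2) :
    Tendsto (fun r : ℝ => (∫ p : ℝ × R3, ⟪(M p.1 p.2 - M (p.1 - r) p.2) (a p), b (p - (r, 0))⟫) / r)
      (𝓝[≠] 0) (𝓝 (∫ p : ℝ × R3, ⟪deriv (fun s => M s p.2) p.1 (a p), b p⟫)) := by
  let Q : ℝ → ℝ × R3 → R3 := fun r p => r⁻¹ • (M p.1 p.2 - M (p.1 - r) p.2) (a p)
  have hQm : ∀ r, AEStronglyMeasurable (Q r) := fun r =>
    (aestronglyMeasurable_clm_apply (A := fun p : ℝ × R3 => M p.1 p.2 - M (p.1 - r) p.2)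
      ((hM.measurable_uncurry hΩ).sub (hM.measurable_shift hΩ r)).aestronglyMeasurable
      ha.1).const_smul r⁻¹
  have hQb : ∀ r, r ≠ 0 → ∀ p, ‖Q r p‖ ≤ K * ‖a p‖ := fun r hr p => by
    have h1 := (hM.lip p.2).dist_le_mul p.1 (p.1 - r)
    rw [dist_eq_norm, Real.dist_eq, sub_sub_cancel] at h1
    rw [norm_smul, norm_inv, Real.norm_eq_abs]
    have h2 := ((M p.1 p.2 - M (p.1 - r) p.2).le_opNorm (a p)).trans
      (mul_le_mul_of_nonneg_right h1 (norm_nonneg _))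
    rw [inv_mul_le_iff₀ (abs_pos.2 hr)]
    linarith
  have hd0 := hM.norm_deriv_le
  have hdm : AEStronglyMeasurable fun p : ℝ × R3 => deriv (fun s => M s p.2) p.1 (a p) :=
    aestronglyMeasurable_clm_apply (hM.measurable_deriv hΩ).aestronglyMeasurable ha.1
  have hlim : ∀ᵐ p : ℝ × R3, Tendsto (fun r => Q r p) (𝓝[≠] 0)
      (𝓝 (deriv (fun s => M s p.2) p.1 (a p))) := by
    filter_upwards [hM.ae_hasDerivAt hΩ] with p hp
    have h1 := hasDerivAt_iff_tendsto_slope_zero.1 hp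
    have h2 : Tendsto (fun r : ℝ => -r) (𝓝[≠] 0) (𝓝[≠] 0) := by
      have := (continuous_neg (G := ℝ)).tendsto 0
      rw [neg_zero] at this
      refine tendsto_nhdsWithin_iff.2 ⟨this.mono_left nhdsWithin_le_nhds, ?_⟩
      filter_upwards [self_mem_nhdsWithin] with r hr
      exact neg_ne_zero.2 hr
    have h3 := ((ContinuousLinearMap.apply ℝ R3 (a p)).continuous.tendsto _).comp (h1.comp h2)
    refine h3.congr fun r => ?_
    simp only [Function.comp_apply, ContinuousLinearMap.apply_apply, smul_apply, Q, inv_neg, neg_smul,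
      ← sub_eq_add_neg, neg_apply]
    rw [← smul_neg, ← neg_apply, neg_sub]
  have hQl : Tendsto (fun r => eLpNorm (fun p => Q r p - deriv (fun s => M s p.2) p.1 (a p)) 2 volume)
      (𝓝[≠] 0) (𝓝 0) := by
    refine tendsto_eLpNorm_two_of_dominated (g := fun p => 2 * K * ‖a p‖)
      (Eventually.of_forall hQm) hdm (ha.norm.const_mul _) ?_ hlim
    filter_upwards [self_mem_nhdsWithin] with r hr
    refine ae_of_all _ fun p => (norm_sub_le _ _).trans ?_
    have h1 := hQb r hr p
    have h2 := ((deriv (fun s => M s p.2) p.1).le_opNorm (a p)).trans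
      (mul_le_mul_of_nonneg_right (hd0 p.1 p.2) (norm_nonneg _))
    linarith
  have hbl := (tendsto_eLpNorm_shift hb 0).mono_left (nhdsWithin_le_nhds (s := {0}ᶜ))
  have e0 : ∀ p : ℝ × R3, p - ((0 : ℝ), (0 : R3)) = p := fun p => by ext <;> simp
  simp only [e0] at hbl
  have := tendsto_integral_bilin (B := fun _ => innerBilin R3) (C := ‖innerBilin R3‖)
    aestronglyMeasurable_const (fun _ => le_rfl) (l := 𝓝[≠] (0 : ℝ)) (F := Q)
    (G := fun r p => b (p - (r, 0)))
    (by
      filter_upwards [self_mem_nhdsWithin] with r hr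
      exact (ha.norm.const_mul (K : ℝ)).mono (hQm r) (ae_of_all _ fun p =>
        (hQb r hr p).trans (le_abs_self _)))
    (Eventually.of_forall fun r => memLp_translate hb (r, 0))
    (ha.of_le_mul hdm (c := K) (ae_of_all _ fun p => ((deriv (fun s => M s p.2) p.1).le_opNorm
      (a p)).trans (mul_le_mul_of_nonneg_right (hd0 p.1 p.2) (norm_nonneg _)))) hb hQl hbl
  refine this.congr fun r => ?_
  simp only [innerBilin_apply, Q, real_inner_smul_left]
  rw [integral_const_mul, div_eq_inv_mul]

/-- Let α and β be the two correlation functions. Since j_h' is odd, the sum equals ∫ j_h'(r) (α(r)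
- β(-r)) dr. A time translation and the symmetry of M turn the difference into the correlation with
M(t) - M(t - r), whose slope at zero involves ∂_t M alone. -/
theorem tendsto_integral_symmetric {j : ℝ → ℝ → ℝ} (hj : IsMollifierFamily j)
    (hM : IsLipschitzFamily Ω K M) (hΩ : MeasurableSet Ω) {C : ℝ} (hMC : ∀ t y, ‖M t y‖ ≤ C)
    (hMs : ∀ t y v w, ⟪M t y v, w⟫ = ⟪M t y w, v⟫) {a b : ℝ × R3 → R3} (ha : MemLp a 2)
    (hb : MemLp b 2) :
    Tendsto (fun h => (∫ r, deriv (j h) r * ∫ p : ℝ × R3, ⟪M p.1 p.2 (a p), b (p - (r, 0))⟫) +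
      ∫ r, deriv (j h) r * ∫ p : ℝ × R3, ⟪M p.1 p.2 (b p), a (p - (r, 0))⟫) (𝓝[>] 0)
      (𝓝 (-∫ p : ℝ × R3, ⟪deriv (fun s => M s p.2) p.1 (a p), b p⟫)) := by
  have hMm := (hM.measurable_uncurry hΩ).aestronglyMeasurable (μ := volume)
  have hMa := memLp_clm_apply_of_bound hMm (fun p => hMC p.1 p.2) ha
  have hMb := memLp_clm_apply_of_bound hMm (fun p => hMC p.1 p.2) hb
  have c1 := continuous_integral_inner_shift hMa hb
  have c2 := continuous_integral_inner_shift hMb ha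
  set α : ℝ → ℝ := fun r => ∫ p : ℝ × R3, ⟪M p.1 p.2 (a p), b (p - (r, 0))⟫
  set β : ℝ → ℝ := fun r => ∫ p : ℝ × R3, ⟪M p.1 p.2 (b p), a (p - (r, 0))⟫
  -- Translating p by (r, 0) removes the shift from a and puts it on both M and b; the symmetry of M
  -- then restores the order of the arguments.
  have hβ : ∀ r, β (-r) = ∫ p : ℝ × R3, ⟪M (p.1 - r) p.2 (a p), b (p - (r, 0))⟫ := fun r => by
    have := integral_sub_right_eq_self (μ := (volume : Measure (ℝ × R3)))
      (fun p => ⟪M p.1 p.2 (b p), a (p - (-r, 0))⟫) (r, (0 : R3))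
    refine this.symm.trans (integral_congr_ae (ae_of_all _ fun p => ?_))
    have e : p - (r, (0 : R3)) - (-r, 0) = p := by ext <;> simp
    simp only [e, Prod.fst_sub, Prod.snd_sub, sub_zero]
    rw [hMs]
  have hm : ∀ r, α r - β (-r) =
      ∫ p : ℝ × R3, ⟪(M p.1 p.2 - M (p.1 - r) p.2) (a p), b (p - (r, 0))⟫ := fun r => by
    have ib : ∀ {c : ℝ × R3 → R3}, MemLp c 2 → Integrable fun p => ⟪c p, b (p - (r, 0))⟫ := fun hc =>
      integrable_bilin (B := fun _ => innerBilin R3) aestronglyMeasurable_const (fun _ => le_rfl) hc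
        (memLp_translate hb (r, 0))
    rw [hβ, ← integral_sub (ib hMa) (ib (memLp_clm_apply_of_bound
      (hM.measurable_shift hΩ r).aestronglyMeasurable (fun p => hMC _ _) ha))]
    refine integral_congr_ae (ae_of_all _ fun p => ?_)
    simp only [sub_apply, inner_sub_left]
  have lim := tendsto_integral_diffQuot hM hΩ ha hb
  simp only [← hm] at lim
  have cm : Continuous fun r => α r - β (-r) := c1.sub (c2.comp continuous_neg)
  have main := hj.tendsto_integral_deriv_mul cm.aestronglyMeasurable
    (lim.mono_left (nhdsWithin_mono _ fun r (hr : 0 < r) => hr.ne'))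
    (lim.mono_left (nhdsWithin_mono _ fun r (hr : r < 0) => hr.ne))
  rw [add_self_div_two] at main
  refine main.congr' ?_
  filter_upwards [self_mem_nhdsWithin] with h hh
  have ig : ∀ {f : ℝ → ℝ}, Continuous f → Integrable fun r => deriv (j h) r * f r := fun hf =>
    ((hj.continuous_deriv hh).mul hf).integrable_of_hasCompactSupport
      (hj.hasCompactSupport hh).deriv.mul_right
  simp only [mul_sub]
  rw [integral_sub (ig c1) (ig (f := fun r => β (-r)) (c2.comp continuous_neg)), sub_eq_add_neg]
  congr 1
  rw [← integral_neg, ← integral_neg_eq_self]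
  refine integral_congr_ae (ae_of_all _ fun r => ?_)
  simp only [hj.deriv_neg_arg hh, neg_neg, neg_mul, β]

end Symmetric

end MovingDomain

/-! ### Lebesgue points in time with values in L². -/

namespace MovingDomain

theorem enorm_sub_sq_le {E : Type*} [NormedAddCommGroup E] (a b c : E) :
    ‖a - c‖ₑ ^ 2 ≤ 2 * (‖a - b‖ₑ ^ 2 + ‖b - c‖ₑ ^ 2) := by
  have h1 : ‖a - c‖ ^ 2 ≤ 2 * (‖a - b‖ ^ 2 + ‖b - c‖ ^ 2) := by
    have := norm_sub_le_norm_sub_add_norm_sub a b c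
    nlinarith [sq_nonneg (‖a - b‖ - ‖b - c‖), norm_nonneg (a - c), norm_nonneg (a - b),
      norm_nonneg (b - c)]
  have h2 : ‖a - c‖₊ ^ 2 ≤ 2 * (‖a - b‖₊ ^ 2 + ‖b - c‖₊ ^ 2) := by exact_mod_cast h1
  simp only [enorm_eq_nnnorm]
  exact_mod_cast h2

/-- Almost every time is a Lebesgue point, in the space `L²`, of a square integrable function of
time and space. -/
theorem ae_tendsto_lintegral_slice_div {T : ℝ} {z : ℝ × R3 → R3} (hz : MemLp z 2)
    (hzt : ∀ t ∈ Ioo 0 T, MemLp (fun y => z (t, y)) 2) :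
    ∀ᵐ t ∂(volume.restrict (Ioo 0 T)),
      Tendsto (fun ε => (∫⁻ τ in Metric.closedBall t ε, ∫⁻ y, ‖z (τ, y) - z (t, y)‖ₑ ^ 2) /
        volume (Metric.closedBall t ε)) (𝓝[>] 0) (𝓝 0) := by
  haveI : Fact ((1 : ENNReal) ≤ 2) := ⟨by norm_num⟩
  haveI : Fact ((2 : ENNReal) ≠ ⊤) := ⟨by norm_num⟩
  -- By separability of L² it suffices to know the scalar Lebesgue points of the countably many
  -- functions τ ↦ ‖z(τ) - d i‖². This avoids treating z as a measurable map into L².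
  let d : ℕ → Lp R3 2 (volume : Measure R3) := TopologicalSpace.denseSeq _
  let N : ℕ → ℝ → ENNReal := fun i τ => ∫⁻ y, ‖z (τ, y) - d i y‖ₑ ^ 2
  have hNm : ∀ i, AEMeasurable (N i) := fun i => by
    have h1 : AEMeasurable (fun p : ℝ × R3 => ‖z p - d i p.2‖ₑ ^ 2)
        ((volume : Measure ℝ).prod volume) := by
      refine AEMeasurable.pow_const (AEStronglyMeasurable.enorm ?_) _
      exact (hz.1.sub (Lp.memLp (d i)).1.comp_snd)
    exact h1.lintegral_prod_right'
  have hNf : ∀ i, ∫⁻ τ in Ioo 0 T, N i τ ≠ ⊤ := fun i => by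
    have h2 : ∫⁻ τ in Ioo 0 T, N i τ ≤
        ∫⁻ τ in Ioo 0 T, 2 * ((∫⁻ y, ‖z (τ, y)‖ₑ ^ 2) + ∫⁻ y, ‖d i y‖ₑ ^ 2) := by
      refine lintegral_mono fun τ => ?_
      rw [← lintegral_add_right' _ ((Lp.memLp (d i)).1.enorm.pow_const _),
        ← lintegral_const_mul' _ _ (by norm_num)]
      refine lintegral_mono fun y => ?_
      simpa using enorm_sub_sq_le (z (τ, y)) 0 (d i y)
    refine (h2.trans_lt ?_).ne
    rw [lintegral_const_mul' _ _ (by norm_num), lintegral_add_right _ measurable_const]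
    refine ENNReal.mul_lt_top (by norm_num) (ENNReal.add_lt_top.2 ⟨?_, ?_⟩)
    · refine (setLIntegral_le_lintegral _ _).trans_lt ?_
      have h3 : ∫⁻ τ, ∫⁻ y, ‖z (τ, y)‖ₑ ^ 2 = ∫⁻ p, ‖z p‖ₑ ^ 2 := by
        rw [Measure.volume_eq_prod, lintegral_prod _ (hz.1.enorm.pow_const _)]
      rw [h3, ← eLpNorm_two_sq]
      exact ENNReal.pow_lt_top hz.2
    · rw [setLIntegral_const, ← eLpNorm_two_sq]
      exact ENNReal.mul_lt_top (ENNReal.pow_lt_top (Lp.memLp (d i)).2) (by simp)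
  have hleb : ∀ i, ∀ᵐ t : ℝ, Tendsto (fun ε => (∫⁻ τ in Metric.closedBall t ε,
      (Ioo 0 T).indicator (N i) τ) / volume (Metric.closedBall t ε)) (𝓝[>] 0)
      (𝓝 ((Ioo 0 T).indicator (N i) t)) := fun i => by
    have h1 := (Besicovitch.vitaliFamily (volume : Measure ℝ)).ae_tendsto_lintegral_div
      ((hNm i).indicator measurableSet_Ioo) (by rw [lintegral_indicator measurableSet_Ioo]; exact hNf i)
    filter_upwards [h1] with t ht
    exact ht.comp (Besicovitch.tendsto_filterAt _ t)
  rw [ae_restrict_iff' measurableSet_Ioo]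
  filter_upwards [ae_all_iff.2 hleb] with t ht htT
  rw [ENNReal.tendsto_nhds_zero]
  intro ε hε
  have hε4 : 0 < ε / 4 := ENNReal.div_pos hε.ne' (by norm_num)
  -- The element d i is chosen within min(1, ε/4) of z(t). The bound by one makes the squared
  -- distance no larger than the distance itself.
  obtain ⟨i, hi⟩ : ∃ i, N i t < ε / 4 := by
    obtain ⟨i, hi⟩ := (TopologicalSpace.denseRange_denseSeq
      (Lp R3 2 (volume : Measure R3))).exists_mem_open (Metric.isOpen_eball (x := (hzt t htT).toLp _)
        (ε := min 1 (ε / 4))) ⟨_, Metric.mem_eball_self (lt_min one_pos hε4)⟩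
    refine ⟨i, ?_⟩
    rw [Metric.mem_eball, edist_comm, Lp.edist_def] at hi
    have e : eLpNorm (fun y => z (t, y) - d i y) 2 volume < min 1 (ε / 4) := by
      refine (eLpNorm_congr_ae ?_).trans_lt hi
      filter_upwards [(hzt t htT).coeFn_toLp] with y hy
      simp only [Pi.sub_apply, hy, d]
    have e2 : N i t = eLpNorm (fun y => z (t, y) - d i y) 2 volume ^ 2 := (eLpNorm_two_sq _).symm
    rw [e2]
    refine lt_of_le_of_lt ?_ (e.trans_le (min_le_right _ _))
    rw [sq]
    exact mul_le_of_le_one_left' (e.le.trans (min_le_left _ _))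
  have hti := ht i
  rw [indicator_of_mem htT] at hti
  filter_upwards [hti.eventually_lt_const hi, Ioo_mem_nhdsGT (lt_min htT.1 (sub_pos.2 htT.2))]
    with η hη hη'
  have hsub : Metric.closedBall t η ⊆ Ioo 0 T := fun τ hτ => by
    rw [Real.closedBall_eq_Icc] at hτ
    have h1 := hη'.2.trans_le (min_le_left _ _)
    have h2 := hη'.2.trans_le (min_le_right _ _)
    exact ⟨by linarith [hτ.1], by linarith [hτ.2]⟩
  have hv0 : volume (Metric.closedBall t η) ≠ 0 := by
    rw [Real.volume_closedBall]; simp [hη'.1]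
  have hvt : volume (Metric.closedBall t η) ≠ ⊤ := measure_closedBall_lt_top.ne
  -- Here z(τ) - z(t) is compared through d i. Each of the two averaged parts is below ε/4 and the
  -- quadratic inequality contributes the factor 2.
  have hle : ∫⁻ τ in Metric.closedBall t η, ∫⁻ y, ‖z (τ, y) - z (t, y)‖ₑ ^ 2 ≤
      2 * ((∫⁻ τ in Metric.closedBall t η, (Ioo 0 T).indicator (N i) τ) +
        N i t * volume (Metric.closedBall t η)) := by
    rw [← setLIntegral_const, ← lintegral_add_right _ measurable_const,
      ← lintegral_const_mul' _ _ (by norm_num)]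
    refine setLIntegral_mono' measurableSet_closedBall fun τ hτ => ?_
    rw [indicator_of_mem (hsub hτ)]
    have hm : AEMeasurable fun y => ‖z (t, y) - d i y‖ₑ ^ 2 :=
      ((hzt t htT).1.sub (Lp.memLp (d i)).1).enorm.pow_const _
    simp only [N]
    rw [← lintegral_add_right' _ hm, ← lintegral_const_mul' _ _ (by norm_num)]
    refine lintegral_mono fun y => ?_
    have := enorm_sub_sq_le (z (τ, y)) (d i y) (z (t, y))
    rwa [← neg_sub (z (t, y)) (d i y), enorm_neg] at this
  calc _ ≤ 2 * ((∫⁻ τ in Metric.closedBall t η, (Ioo 0 T).indicator (N i) τ) +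
        N i t * volume (Metric.closedBall t η)) / volume (Metric.closedBall t η) := by gcongr
    _ = 2 * ((∫⁻ τ in Metric.closedBall t η, (Ioo 0 T).indicator (N i) τ) /
        volume (Metric.closedBall t η) + N i t) := by
        rw [mul_div_assoc, ENNReal.add_div, ENNReal.mul_div_cancel_right hv0 hvt]
    _ ≤ 2 * (ε / 4 + ε / 4) := by gcongr
    _ = ε := by
        rw [← two_mul, ← mul_assoc, show (2 * 2 : ENNReal) = 4 by norm_num,
          ENNReal.mul_div_cancel (by norm_num) (by norm_num)]

end MovingDomain

/-! ### The jump at the final time t. -/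

namespace MovingDomain

/-- Continuity of the `L²` pairing along a family of measures. -/
theorem tendsto_integral_inner_sub {ι α H : Type*} [MeasurableSpace α] [NormedAddCommGroup H]
    [InnerProductSpace ℝ H] {l : Filter ι} {μ : ι → Measure α} {F G f g : ι → α → H}
    (hF : ∀ᶠ i in l, MemLp (F i) 2 (μ i)) (hG : ∀ᶠ i in l, MemLp (G i) 2 (μ i))
    (hf : ∀ᶠ i in l, MemLp (f i) 2 (μ i)) (hg : ∀ᶠ i in l, MemLp (g i) 2 (μ i))
    {Cf Cg : ENNReal} (hCf : Cf ≠ ⊤) (hCg : Cg ≠ ⊤)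
    (hfb : ∀ᶠ i in l, eLpNorm (f i) 2 (μ i) ≤ Cf) (hgb : ∀ᶠ i in l, eLpNorm (g i) 2 (μ i) ≤ Cg)
    (hFf : Tendsto (fun i => eLpNorm (F i - f i) 2 (μ i)) l (𝓝 0))
    (hGg : Tendsto (fun i => eLpNorm (G i - g i) 2 (μ i)) l (𝓝 0)) :
    Tendsto (fun i => ∫ x, ⟪F i x, G i x⟫ ∂μ i - ∫ x, ⟪f i x, g i x⟫ ∂μ i) l (𝓝 0) := by
  set c := ENNReal.ofReal ‖innerBilin H‖
  have lim : Tendsto (fun i => c * (eLpNorm (F i - f i) 2 (μ i) *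
      (eLpNorm (G i - g i) 2 (μ i) + Cg)) + c * (Cf * eLpNorm (G i - g i) 2 (μ i))) l (𝓝 0) := by
    have h1 : Tendsto (fun i => eLpNorm (F i - f i) 2 (μ i) *
        (eLpNorm (G i - g i) 2 (μ i) + Cg)) l (𝓝 (0 * (0 + Cg))) :=
      ENNReal.Tendsto.mul hFf (Or.inr (by simpa using hCg)) (hGg.add_const _) (Or.inr (by simp))
    have h2 : Tendsto (fun i => Cf * eLpNorm (G i - g i) 2 (μ i)) l (𝓝 (Cf * 0)) :=
      ENNReal.Tendsto.const_mul hGg (Or.inr hCf)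
    have := (ENNReal.Tendsto.const_mul (a := c) h1 (Or.inr (by simp [c]))).add
      (ENNReal.Tendsto.const_mul (a := c) h2 (Or.inr (by simp [c])))
    simpa using this
  rw [tendsto_zero_iff_enorm_tendsto_zero]
  refine tendsto_of_tendsto_of_tendsto_of_le_of_le' tendsto_const_nhds lim
    (Eventually.of_forall fun _ => zero_le) ?_
  filter_upwards [hF, hG, hf, hg, hfb, hgb] with i hF hG hf hg hfb hgb
  have hi : ∀ {p q : α → H}, MemLp p 2 (μ i) → MemLp q 2 (μ i) →
      Integrable (fun x => ⟪p x, q x⟫) (μ i) := fun hp hq =>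
    integrable_bilin (B := fun _ => innerBilin H) aestronglyMeasurable_const (fun _ => le_rfl) hp hq
  have hn : ∀ {p q : α → H}, MemLp p 2 (μ i) → MemLp q 2 (μ i) →
      ‖∫ x, ⟪p x, q x⟫ ∂μ i‖ₑ ≤ c * (eLpNorm p 2 (μ i) * eLpNorm q 2 (μ i)) := fun hp hq => by
    refine (enorm_integral_le_lintegral_enorm _).trans ?_
    rw [← eLpNorm_one_eq_lintegral_enorm]
    exact eLpNorm_one_bilin_le (B := fun _ => innerBilin H) (C := ‖innerBilin H‖)
      (fun _ => le_rfl) hp.1 hq.1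
  have e : ∫ x, ⟪F i x, G i x⟫ ∂μ i - ∫ x, ⟪f i x, g i x⟫ ∂μ i =
      ∫ x, ⟪(F i - f i) x, G i x⟫ ∂μ i + ∫ x, ⟪f i x, (G i - g i) x⟫ ∂μ i := by
    rw [← integral_sub (hi hF hG) (hi hf hg), ← integral_add (hi (hF.sub hf) hG) (hi hf (hG.sub hg))]
    refine integral_congr_ae (ae_of_all _ fun x => ?_)
    simp only [Pi.sub_apply, inner_sub_left, inner_sub_right]
    ring
  rw [e]
  refine (enorm_add_le _ _).trans (add_le_add ((hn (hF.sub hf) hG).trans ?_)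
    ((hn hf (hG.sub hg)).trans ?_))
  · have : eLpNorm (G i) 2 (μ i) ≤ eLpNorm (G i - g i) 2 (μ i) + Cg := by
      calc eLpNorm (G i) 2 (μ i) = eLpNorm ((G i - g i) + g i) 2 (μ i) := by simp
        _ ≤ _ := (eLpNorm_add_le (hG.1.sub hg.1) hg.1 (by norm_num)).trans (by gcongr)
    gcongr
  · gcongr

section Cross

/-- The average over the time interval `[t - ε, t)`, on space-time. -/
noncomputable def sliceMeasure (t ε : ℝ) : Measure (ℝ × R3) :=
  ((ENNReal.ofReal ε)⁻¹ • (volume : Measure ℝ).restrict (Ico (t - ε) t)).prod volume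

theorem sliceMeasure_eq {t ε : ℝ} : sliceMeasure t ε =
    (ENNReal.ofReal ε)⁻¹ • (volume : Measure (ℝ × R3)).restrict (Ico (t - ε) t ×ˢ univ) := by
  rw [sliceMeasure, Measure.prod_smul_left, Measure.volume_eq_prod ℝ R3, ← Measure.prod_restrict,
    Measure.restrict_univ]

theorem memLp_sliceMeasure {t ε : ℝ} (hε : 0 < ε) {f : ℝ × R3 → R3} (hf : MemLp f 2) :
    MemLp f 2 (sliceMeasure t ε) := by
  rw [sliceMeasure_eq]
  exact (hf.restrict _).smul_measure (by simpa using hε)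

theorem isProbabilityMeasure_average {t ε : ℝ} (hε : 0 < ε) : IsProbabilityMeasure
    ((ENNReal.ofReal ε)⁻¹ • (volume : Measure ℝ).restrict (Ico (t - ε) t)) := by
  refine ⟨?_⟩
  simp only [Measure.smul_apply, Measure.restrict_apply MeasurableSet.univ, univ_inter,
    Real.volume_Ico, smul_eq_mul, sub_sub_cancel]
  exact ENNReal.inv_mul_cancel (by simpa using hε) (by simp)

theorem measurePreserving_snd_sliceMeasure {t ε : ℝ} (hε : 0 < ε) :
    MeasurePreserving (Prod.snd : ℝ × R3 → R3) (sliceMeasure t ε) volume := by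
  haveI := isProbabilityMeasure_average (t := t) hε
  exact measurePreserving_snd

theorem memLp_snd_sliceMeasure {t ε : ℝ} (hε : 0 < ε) {f : R3 → R3} (hf : MemLp f 2) :
    MemLp (fun p : ℝ × R3 => f p.2) 2 (sliceMeasure t ε) :=
  hf.comp_measurePreserving (measurePreserving_snd_sliceMeasure hε)

theorem eLpNorm_snd_sliceMeasure {t ε : ℝ} (hε : 0 < ε) {f : R3 → R3} (hf : MemLp f 2) :
    eLpNorm (fun p : ℝ × R3 => f p.2) 2 (sliceMeasure t ε) = eLpNorm f 2 :=
  eLpNorm_comp_measurePreserving hf.1 (measurePreserving_snd_sliceMeasure hε)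

theorem integral_snd_sliceMeasure {t ε : ℝ} (hε : 0 < ε) {f : R3 → ℝ} (hf : Integrable f) :
    ∫ p : ℝ × R3, f p.2 ∂sliceMeasure t ε = ∫ y, f y := by
  have hm := measurePreserving_snd_sliceMeasure (t := t) hε
  have := integral_map hm.measurable.aemeasurable (hm.map_eq.symm ▸ hf.1)
  rw [hm.map_eq] at this
  exact this.symm

theorem eLpNorm_sliceMeasure_sq {t ε : ℝ} {f : ℝ × R3 → R3}
    (hf : AEStronglyMeasurable f (sliceMeasure t ε)) :
    eLpNorm f 2 (sliceMeasure t ε) ^ 2 =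
      (ENNReal.ofReal ε)⁻¹ * ∫⁻ τ in Ico (t - ε) t, ∫⁻ y, ‖f (τ, y)‖ₑ ^ 2 := by
  rw [eLpNorm_two_sq]
  rw [sliceMeasure] at hf ⊢
  rw [lintegral_prod _ (hf.enorm.pow_const _), lintegral_smul_measure, smul_eq_mul]

/-- The centred interval has length 2ε and the one-sided average divides by ε, hence the factor 2.
-/
theorem setLIntegral_Ico_div_le {t ε : ℝ} {N : ℝ → ENNReal} {s : Set ℝ}
    (hs : s ⊆ Metric.closedBall t ε) :
    (ENNReal.ofReal ε)⁻¹ * ∫⁻ τ in s, N τ ≤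
      2 * ((∫⁻ τ in Metric.closedBall t ε, N τ) / volume (Metric.closedBall t ε)) := by
  rw [Real.volume_closedBall, ENNReal.ofReal_mul (by norm_num), ENNReal.ofReal_ofNat,
    ENNReal.div_eq_inv_mul, ENNReal.mul_inv (by simp) (by simp), ← mul_assoc, ← mul_assoc,
    ENNReal.mul_inv_cancel (by norm_num) (by norm_num), one_mul]
  gcongr

variable {t : ℝ} {A B : ℝ × R3 → R3}

theorem tendsto_eLpNorm_sliceMeasure (hA : MemLp A 2) (hAt : MemLp (fun y => A (t, y)) 2)
    (hAl : Tendsto (fun ε => (∫⁻ τ in Metric.closedBall t ε, ∫⁻ y, ‖A (τ, y) - A (t, y)‖ₑ ^ 2) /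
        volume (Metric.closedBall t ε)) (𝓝[>] 0) (𝓝 0)) :
    Tendsto (fun ε => eLpNorm (A - fun p => A (t, p.2)) 2 (sliceMeasure t ε)) (𝓝[>] 0) (𝓝 0) := by
  have lim := ENNReal.Tendsto.const_mul (a := 2) hAl (Or.inr (by norm_num))
  rw [mul_zero] at lim
  refine tendsto_zero_of_sq (tendsto_of_tendsto_of_tendsto_of_le_of_le' tendsto_const_nhds lim
    (Eventually.of_forall fun _ => zero_le) ?_)
  filter_upwards [self_mem_nhdsWithin] with ε hε
  rw [eLpNorm_sliceMeasure_sq ((memLp_sliceMeasure hε hA).1.sub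
    (memLp_snd_sliceMeasure hε hAt).1)]
  refine setLIntegral_Ico_div_le ?_
  rw [Real.closedBall_eq_Icc]
  exact fun τ hτ => ⟨hτ.1, hτ.2.le.trans (by linarith [mem_Ioi.1 hε])⟩

/-- Shifted by ε, the average over [t - ε, t) becomes the average of B over [t, t + ε), which the
Lebesgue point property also controls. -/
theorem tendsto_eLpNorm_sliceMeasure_shift (hB : MemLp B 2) (hBt : MemLp (fun y => B (t, y)) 2)
    (hBl : Tendsto (fun ε => (∫⁻ τ in Metric.closedBall t ε, ∫⁻ y, ‖B (τ, y) - B (t, y)‖ₑ ^ 2) /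
        volume (Metric.closedBall t ε)) (𝓝[>] 0) (𝓝 0)) :
    Tendsto (fun ε => eLpNorm ((fun p => B (p - (-ε, 0))) - fun p => B (t, p.2)) 2
      (sliceMeasure t ε)) (𝓝[>] 0) (𝓝 0) := by
  have lim := ENNReal.Tendsto.const_mul (a := 2) hBl (Or.inr (by norm_num))
  rw [mul_zero] at lim
  refine tendsto_zero_of_sq (tendsto_of_tendsto_of_tendsto_of_le_of_le' tendsto_const_nhds lim
    (Eventually.of_forall fun _ => zero_le) ?_)
  filter_upwards [self_mem_nhdsWithin] with ε hε
  rw [eLpNorm_sliceMeasure_sq ((memLp_sliceMeasure hε (memLp_translate hB (-ε, 0))).1.sub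
    (memLp_snd_sliceMeasure hε hBt).1)]
  have e := (measurePreserving_add_right volume ε).setLIntegral_comp_preimage_emb
    (measurableEmbedding_addRight ε) (fun τ => ∫⁻ y, ‖B (τ, y) - B (t, y)‖ₑ ^ 2) (Ico t (t + ε))
  have e2 : (fun x => x + ε) ⁻¹' Ico t (t + ε) = Ico (t - ε) t := by
    ext x; simp
  rw [e2] at e
  simp only [Pi.sub_apply, Prod.mk_sub_mk, sub_neg_eq_add, sub_zero]
  rw [e]
  refine setLIntegral_Ico_div_le ?_
  rw [Real.closedBall_eq_Icc]
  exact fun τ hτ => ⟨by linarith [hτ.1, mem_Ioi.1 hε], hτ.2.le⟩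

/-- The jump at time `t` of the pairing of a function before `t` with a function after `t`. -/
theorem tendsto_integral_deriv_mul_cross {j : ℝ → ℝ → ℝ} (hj : IsMollifierFamily j)
    (hA : MemLp A 2) (hB : MemLp B 2) (hAt : MemLp (fun y => A (t, y)) 2)
    (hBt : MemLp (fun y => B (t, y)) 2)
    (hAl : Tendsto (fun ε => (∫⁻ τ in Metric.closedBall t ε, ∫⁻ y, ‖A (τ, y) - A (t, y)‖ₑ ^ 2) /
        volume (Metric.closedBall t ε)) (𝓝[>] 0) (𝓝 0))
    (hBl : Tendsto (fun ε => (∫⁻ τ in Metric.closedBall t ε, ∫⁻ y, ‖B (τ, y) - B (t, y)‖ₑ ^ 2) /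
        volume (Metric.closedBall t ε)) (𝓝[>] 0) (𝓝 0)) :
    Tendsto (fun h => ∫ r, deriv (j h) r * ∫ p : ℝ × R3, ⟪(Iio t ×ˢ univ).indicator A p,
      (Ici t ×ˢ univ).indicator B (p - (r, 0))⟫) (𝓝[>] 0)
      (𝓝 ((∫ y, ⟪A (t, y), B (t, y)⟫) / 2)) := by
  set κ : ℝ → ℝ := fun r => ∫ p : ℝ × R3, ⟪(Iio t ×ˢ univ).indicator A p,
      (Ici t ×ˢ univ).indicator B (p - (r, 0))⟫
  set q := ∫ y, ⟪A (t, y), B (t, y)⟫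
  have hκ : Continuous κ := continuous_integral_inner_shift
    (hA.indicator (measurableSet_Iio.prod .univ)) (hB.indicator (measurableSet_Ici.prod .univ))
  -- For r > 0 a time below t cannot be the r-translate of a time at or after t, so the two supports
  -- are disjoint.
  have h0 : Tendsto (fun r => κ r / r) (𝓝[>] 0) (𝓝 0) := by
    refine tendsto_const_nhds.congr' ?_
    filter_upwards [self_mem_nhdsWithin] with r hr
    have : κ r = 0 := by
      refine integral_eq_zero_of_ae (ae_of_all _ fun p => ?_)
      beta_reduce
      by_cases hp : p.1 < t
      · rw [indicator_of_notMem (s := Ici t ×ˢ univ), inner_zero_right, Pi.zero_apply]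
        simp only [mem_prod, mem_Ici, Prod.fst_sub, not_and_or, not_le]
        exact Or.inl (by linarith [mem_Ioi.1 hr])
      · rw [indicator_of_notMem (s := Iio t ×ˢ univ), inner_zero_left, Pi.zero_apply]
        simp [hp]
    rw [this, zero_div]
  -- For r = -ε the supports meet exactly in the times [t - ε, t), so the quotient is an average
  -- over that interval.
  have hκε : ∀ ε > 0, κ (-ε) / ε = ∫ p, ⟪A p, B (p - (-ε, 0))⟫ ∂sliceMeasure t ε := fun ε hε => by
    rw [sliceMeasure_eq, integral_smul_measure, ← integral_indicator (measurableSet_Ico.prod .univ),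
      ENNReal.toReal_inv, ENNReal.toReal_ofReal hε.le, smul_eq_mul, div_eq_inv_mul]
    congr 1
    refine integral_congr_ae (ae_of_all _ fun p => ?_)
    beta_reduce
    by_cases hp : p.1 < t
    · by_cases hp2 : t - ε ≤ p.1
      · rw [indicator_of_mem (s := Iio t ×ˢ univ) ⟨hp, trivial⟩,
          indicator_of_mem (s := Ici t ×ˢ univ), indicator_of_mem (s := Ico _ _ ×ˢ univ) ⟨⟨hp2, hp⟩, trivial⟩]
        simp only [mem_prod, mem_Ici, Prod.fst_sub, mem_univ, and_true]
        linarith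
      · rw [indicator_of_notMem (s := Ici t ×ˢ univ), indicator_of_notMem (s := Ico _ _ ×ˢ univ),
          inner_zero_right]
        · simp [hp2]
        · simp only [mem_prod, mem_Ici, Prod.fst_sub, mem_univ, and_true]
          intro h; exact hp2 (by linarith)
    · rw [indicator_of_notMem (s := Iio t ×ˢ univ), indicator_of_notMem (s := Ico _ _ ×ˢ univ),
        inner_zero_left] <;> simp [hp]
  have hlim : Tendsto (fun ε => κ (-ε) / ε) (𝓝[>] 0) (𝓝 q) := by
    have hpos : ∀ᶠ ε : ℝ in 𝓝[>] 0, 0 < ε := self_mem_nhdsWithin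
    have h1 := tendsto_integral_inner_sub (μ := sliceMeasure t) (F := fun _ => A)
      (G := fun ε p => B (p - (-ε, 0))) (f := fun _ p => A (t, p.2)) (g := fun _ p => B (t, p.2))
      (hpos.mono fun ε hε => memLp_sliceMeasure hε hA)
      (hpos.mono fun ε hε => memLp_sliceMeasure hε (memLp_translate hB (-ε, 0)))
      (hpos.mono fun ε hε => memLp_snd_sliceMeasure hε hAt) (hpos.mono fun ε hε => memLp_snd_sliceMeasure hε hBt)
      hAt.2.ne hBt.2.ne (hpos.mono fun ε hε => (eLpNorm_snd_sliceMeasure hε hAt).le) (hpos.mono fun ε hε => (eLpNorm_snd_sliceMeasure hε hBt).le)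
      (tendsto_eLpNorm_sliceMeasure hA hAt hAl) (tendsto_eLpNorm_sliceMeasure_shift hB hBt hBl)
    have h2 := h1.add_const q
    rw [zero_add] at h2
    refine h2.congr' ?_
    filter_upwards [hpos] with ε hε
    have e : ∫ p, ⟪A (t, p.2), B (t, p.2)⟫ ∂sliceMeasure t ε = q := by
      have hi : Integrable (fun y => ⟪A (t, y), B (t, y)⟫) :=
        integrable_bilin (B := fun _ => innerBilin R3) aestronglyMeasurable_const
          (fun _ => le_rfl) hAt hBt
      exact integral_snd_sliceMeasure hε hi
    rw [hκε ε hε, e]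
    ring
  -- The slopes are 0 from the right and -q from the left; minus their mean is q/2.
  have hneg : Tendsto (fun r => κ r / r) (𝓝[<] 0) (𝓝 (-q)) := by
    have h1 : Tendsto (fun r : ℝ => -r) (𝓝[<] 0) (𝓝[>] 0) := by
      simpa using tendsto_neg_nhdsLT (a := (0 : ℝ))
    refine (hlim.comp h1).neg.congr fun r => ?_
    simp only [Function.comp, neg_neg, div_neg]
  have := hj.tendsto_integral_deriv_mul hκ.aestronglyMeasurable h0 hneg
  rwa [zero_add, neg_div, neg_neg] at this

end Cross

end MovingDomain

/-! ### The contribution of the initial value. -/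

namespace MovingDomain

theorem memLp_indicator_one_Ioc {a b : ℝ} :
    MemLp ((Ioc a b).indicator (1 : ℝ → ℝ)) 2 :=
  memLp_indicator_const 2 measurableSet_Ioc (1 : ℝ) (Or.inr (by simp))

theorem integrable_inner {α H : Type*} [MeasurableSpace α] [NormedAddCommGroup H]
    [InnerProductSpace ℝ H] {μ : Measure α} {f g : α → H} (hf : MemLp f 2 μ) (hg : MemLp g 2 μ) :
    Integrable (fun x => ⟪f x, g x⟫) μ :=
  integrable_bilin (B := fun _ => innerBilin H) aestronglyMeasurable_const (fun _ => le_rfl) hf hg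

/-- The contribution at time `0` of the constant extension to negative times. -/
theorem tendsto_integral_deriv_mul_initial {j : ℝ → ℝ → ℝ} (hj : IsMollifierFamily j)
    {t : ℝ} (ht : 0 < t) {F : ℝ × R3 → R3} {W : R3 → R3} (hF : MemLp F 2) (hW : MemLp W 2) {q : ℝ}
    (hq : Tendsto (fun r : ℝ => r⁻¹ * ∫ p : ℝ × R3, ⟪(Ioc 0 r ×ˢ univ).indicator F p, W p.2⟫)
      (𝓝[>] 0) (𝓝 q)) :
    Tendsto (fun h => ∫ r, deriv (j h) r * ∫ p : ℝ × R3, ⟪(Ioo 0 t ×ˢ univ).indicator F p,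
      (Ioc (-1) 0).indicator (1 : ℝ → ℝ) (p.1 - r) • W p.2⟫) (𝓝[>] 0) (𝓝 (-q / 2)) := by
  set κ : ℝ → ℝ := fun r => ∫ p : ℝ × R3, ⟪(Ioo 0 t ×ˢ univ).indicator F p,
      (Ioc (-1) 0).indicator (1 : ℝ → ℝ) (p.1 - r) • W p.2⟫
  have hκ : Continuous κ := by
    have := continuous_integral_inner_shift (hF.indicator (s := Ioo 0 t ×ˢ univ)
      (measurableSet_Ioo.prod .univ)) (memLp_smul_prod (memLp_indicator_one_Ioc (a := -1) (b := 0)) hW)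
    simpa only [Prod.fst_sub, Prod.snd_sub, sub_zero] using this
  -- For 0 < r < min(t, 1), positive times shifted by r into the past interval (-1, 0] are exactly
  -- those in (0, r], so the quotient is an initial average of F. For r < 0 no positive time
  -- qualifies.
  have hpos : Tendsto (fun r => κ r / r) (𝓝[>] 0) (𝓝 q) := by
    refine hq.congr' ?_
    filter_upwards [Ioo_mem_nhdsGT (lt_min ht one_pos)] with r hr
    have h1 := hr.2.trans_le (min_le_left _ _)
    have h2 := hr.2.trans_le (min_le_right _ _)
    rw [div_eq_inv_mul]
    congr 1
    refine integral_congr_ae (ae_of_all _ fun p => ?_)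
    beta_reduce
    by_cases hp : p.1 ∈ Ioc 0 r
    · rw [indicator_of_mem (s := Ioc 0 r ×ˢ univ) ⟨hp, trivial⟩,
        indicator_of_mem (s := Ioo 0 t ×ˢ univ) ⟨⟨hp.1, hp.2.trans_lt h1⟩, trivial⟩,
        indicator_of_mem (s := Ioc (-1) 0) ⟨by linarith [hp.1], by linarith [hp.2]⟩,
        Pi.one_apply, one_smul]
    · rw [indicator_of_notMem (s := Ioc 0 r ×ˢ univ) (fun h => hp h.1), inner_zero_left]
      by_cases hp2 : p.1 ∈ Ioo 0 t
      · rw [indicator_of_notMem (s := Ioc (-1) 0), zero_smul, inner_zero_right]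
        exact fun h => hp ⟨hp2.1, by linarith [h.2]⟩
      · rw [indicator_of_notMem (s := Ioo 0 t ×ˢ univ) (fun h => hp2 h.1), inner_zero_left]
  have hneg : Tendsto (fun r => κ r / r) (𝓝[<] 0) (𝓝 0) := by
    refine tendsto_const_nhds.congr' ?_
    filter_upwards [self_mem_nhdsWithin] with r hr
    have : κ r = 0 := by
      refine integral_eq_zero_of_ae (ae_of_all _ fun p => ?_)
      beta_reduce
      by_cases hp2 : p.1 ∈ Ioo 0 t
      · rw [indicator_of_notMem (s := Ioc (-1) 0), zero_smul, inner_zero_right, Pi.zero_apply]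
        exact fun h => absurd h.2 (by linarith [hp2.1, mem_Iio.1 hr])
      · rw [indicator_of_notMem (s := Ioo 0 t ×ˢ univ) (fun h => hp2 h.1), inner_zero_left,
          Pi.zero_apply]
    rw [this, zero_div]
  have := hj.tendsto_integral_deriv_mul hκ.aestronglyMeasurable hpos hneg
  rwa [add_zero, ← neg_div] at this

variable {Ω : Set R3} {K : NNReal} {M : ℝ → R3 → R3 →L[ℝ] R3}

/-- Initial averages are not changed by a Lipschitz continuous coefficient. -/
theorem tendsto_average_initial (hM : IsLipschitzFamily Ω K M) (hΩ : MeasurableSet Ω) {C : ℝ}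
    (hMC : ∀ t y, ‖M t y‖ ≤ C) (hMs : ∀ t y v w, ⟪M t y v, w⟫ = ⟪M t y w, v⟫)
    {F : ℝ × R3 → R3} {U W : R3 → R3} (hF : MemLp F 2) (hW : MemLp W 2)
    (hq : ∀ w : R3 → R3, MemLp w 2 → Tendsto (fun r : ℝ => r⁻¹ *
      ∫ p : ℝ × R3, ⟪(Ioc 0 r ×ˢ univ).indicator F p, w p.2⟫) (𝓝[>] 0) (𝓝 (∫ y, ⟪U y, w y⟫))) :
    Tendsto (fun r : ℝ => r⁻¹ * ∫ p : ℝ × R3,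
      ⟪(Ioc 0 r ×ˢ univ).indicator (fun p => M p.1 p.2 (F p)) p, W p.2⟫)
      (𝓝[>] 0) (𝓝 (∫ y, ⟪M 0 y (U y), W y⟫)) := by
  have hMm := hM.measurable_uncurry hΩ
  have hM0 : AEStronglyMeasurable (M 0) volume :=
    (hMm.comp measurable_prodMk_left).aestronglyMeasurable
  -- With M frozen at time zero, its symmetry allows it to be absorbed into the test function, so
  -- weak convergence of the averages suffices.
  have h1 := hq _ (memLp_clm_apply_of_bound hM0 (hMC 0) hW)
  have hFM : MemLp (fun p : ℝ × R3 => M p.1 p.2 (F p)) 2 :=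
    memLp_clm_apply_of_bound hMm.aestronglyMeasurable (fun p => hMC p.1 p.2) hF
  have hFM0 : MemLp (fun p : ℝ × R3 => M 0 p.2 (F p)) 2 :=
    memLp_clm_apply_of_bound (hMm.comp (measurable_const.prodMk measurable_snd)).aestronglyMeasurable
      (fun p => hMC 0 p.2) hF
  have hW1 : MemLp (fun p : ℝ × R3 => (Ioc 0 1).indicator (1 : ℝ → ℝ) p.1 • W p.2) 2 :=
    memLp_smul_prod memLp_indicator_one_Ioc hW
  have hbd : Integrable fun p : ℝ × R3 =>
      K * (‖(Ioc 0 1).indicator (1 : ℝ → ℝ) p.1 • W p.2‖ * ‖F p‖) := by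
    simpa using (integrable_inner hF.norm hW1.norm).const_mul (K : ℝ)
  -- On (0, r] the coefficient differs from its initial value by at most K r, which cancels r⁻¹. The
  -- integrand is then dominated, and for fixed p it vanishes once r is below the time of p.
  have h2 : Tendsto (fun r : ℝ => r⁻¹ * ∫ p : ℝ × R3, ⟪(Ioc 0 r ×ˢ univ).indicator
      (fun p => M p.1 p.2 (F p) - M 0 p.2 (F p)) p, W p.2⟫) (𝓝[>] 0) (𝓝 0) := by
    simp_rw [← integral_const_mul]
    rw [show 𝓝 (0 : ℝ) = 𝓝 (∫ p : ℝ × R3, (0 : ℝ)) by simp]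
    refine tendsto_integral_filter_of_dominated_convergence _ ?_ ?_ hbd ?_
    · refine Eventually.of_forall fun r => ?_
      have hs : MeasurableSet (Ioc 0 r ×ˢ (univ : Set R3)) := measurableSet_Ioc.prod .univ
      exact ((((hFM.sub hFM0).1.indicator hs).inner (𝕜 := ℝ) hW.1.comp_snd).const_mul _ :)
    · filter_upwards [Ioo_mem_nhdsGT one_pos] with r hr
      refine ae_of_all _ fun p => ?_
      by_cases hp : p.1 ∈ Ioc 0 r
      · rw [indicator_of_mem (s := Ioc 0 r ×ˢ univ) ⟨hp, trivial⟩,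
          indicator_of_mem (s := Ioc 0 1) ⟨hp.1, hp.2.trans hr.2.le⟩, Pi.one_apply, one_smul,
          norm_mul, norm_inv, Real.norm_of_nonneg hr.1.le, inv_mul_le_iff₀ hr.1]
        have hl := (hM.lip p.2).dist_le_mul p.1 0
        rw [dist_eq_norm, Real.dist_eq, sub_zero, abs_of_pos hp.1] at hl
        calc ‖⟪M p.1 p.2 (F p) - M 0 p.2 (F p), W p.2⟫‖
            ≤ ‖(M p.1 p.2 - M 0 p.2) (F p)‖ * ‖W p.2‖ := norm_inner_le_norm _ _
          _ ≤ (K * r * ‖F p‖) * ‖W p.2‖ := by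
              gcongr
              refine ((M p.1 p.2 - M 0 p.2).le_opNorm _).trans ?_
              gcongr
              exact hl.trans (by gcongr; exact hp.2)
          _ = _ := by ring
      · rw [indicator_of_notMem (s := Ioc 0 r ×ˢ univ) (fun h => hp h.1), inner_zero_left, mul_zero,
          norm_zero]
        positivity
    · refine ae_of_all _ fun p => ?_
      refine tendsto_const_nhds.congr' ?_
      by_cases hp : 0 < p.1
      · filter_upwards [Ioo_mem_nhdsGT hp] with r hr
        rw [indicator_of_notMem (s := Ioc 0 r ×ˢ univ) (fun h => absurd h.1.2 (not_le.2 hr.2)),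
          inner_zero_left, mul_zero]
      · refine Eventually.of_forall fun r => ?_
        beta_reduce
        rw [indicator_of_notMem (s := Ioc 0 r ×ˢ univ) (fun h => hp h.1.1), inner_zero_left, mul_zero]
  have e0 : ∫ y, ⟪U y, M 0 y (W y)⟫ = ∫ y, ⟪M 0 y (U y), W y⟫ :=
    integral_congr_ae (ae_of_all _ fun y => by
      beta_reduce; rw [hMs, real_inner_comm])
  have h3 := h1.add h2
  rw [add_zero, e0] at h3
  refine h3.congr' ?_
  filter_upwards [Ioo_mem_nhdsGT one_pos] with r hr
  have hs : MeasurableSet (Ioc 0 r ×ˢ (univ : Set R3)) := measurableSet_Ioc.prod .univ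
  have hWr : MemLp (fun p : ℝ × R3 => (Ioc 0 r).indicator (1 : ℝ → ℝ) p.1 • W p.2) 2 :=
    memLp_smul_prod memLp_indicator_one_Ioc hW
  have hMWr : MemLp (fun p : ℝ × R3 => (Ioc 0 r).indicator (1 : ℝ → ℝ) p.1 • M 0 p.2 (W p.2)) 2 :=
    memLp_smul_prod memLp_indicator_one_Ioc (memLp_clm_apply_of_bound hM0 (hMC 0) hW)
  have key : ∀ (H : ℝ × R3 → R3) (w : R3 → R3) (p : ℝ × R3),
      ⟪(Ioc 0 r ×ˢ univ).indicator H p, w p.2⟫ =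
        ⟪H p, (Ioc 0 r).indicator (1 : ℝ → ℝ) p.1 • w p.2⟫ := fun H w p => by
    by_cases hp : p.1 ∈ Ioc 0 r
    · rw [indicator_of_mem (s := Ioc 0 r ×ˢ univ) ⟨hp, trivial⟩, indicator_of_mem hp, Pi.one_apply,
        one_smul]
    · rw [indicator_of_notMem (s := Ioc 0 r ×ˢ univ) (fun h => hp h.1), indicator_of_notMem hp,
        zero_smul, inner_zero_left, inner_zero_right]
  have k1 := fun p => key F (fun y => M 0 y (W y)) p
  have k2 := fun p => key (fun p => M p.1 p.2 (F p) - M 0 p.2 (F p)) W p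
  have k3 := fun p => key (fun p => M p.1 p.2 (F p)) W p
  have hi2 : Integrable fun p : ℝ × R3 => ⟪M p.1 p.2 (F p) - M 0 p.2 (F p),
      (Ioc 0 r).indicator (1 : ℝ → ℝ) p.1 • W p.2⟫ := integrable_inner (hFM.sub hFM0) hWr
  simp only [k1, k2, k3]
  rw [← mul_add, ← integral_add (integrable_inner hF hMWr) hi2]
  congr 1
  refine integral_congr_ae (ae_of_all _ fun p => ?_)
  beta_reduce
  rw [inner_sub_left, inner_smul_right, inner_smul_right, inner_smul_right,
    real_inner_comm _ (F p), hMs 0 p.2 (W p.2) (F p)]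
  ring

end MovingDomain

/-! ### Limit of the symmetrized pairing. -/

namespace MovingDomain

theorem integral_inner_timeConv {k : ℝ → ℝ} (hk : Continuous k) (hkc : HasCompactSupport k)
    {a z : ℝ × R3 → R3} (ha : MemLp a 2) (hz : MemLp z 2) :
    ∫ p, ⟪a p, timeConv k z p⟫ = ∫ r, k r * ∫ p, ⟪a p, z (p - (r, 0))⟫ :=
  integral_bilin_timeConv (innerBilin R3) hk hkc ha hz

theorem integral_inner_timeConv_add {k : ℝ → ℝ} (hk : Continuous k) (hkc : HasCompactSupport k)
    {a z₁ z₂ : ℝ × R3 → R3} (ha : MemLp a 2) (hz₁ : MemLp z₁ 2) (hz₂ : MemLp z₂ 2) :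
    ∫ p, ⟪a p, timeConv k (z₁ + z₂) p⟫ =
      (∫ p, ⟪a p, timeConv k z₁ p⟫) + ∫ p, ⟪a p, timeConv k z₂ p⟫ := by
  have hi : ∀ {z : ℝ × R3 → R3}, MemLp z 2 →
      Integrable fun r => k r * ∫ p, ⟪a p, z (p - (r, 0))⟫ := fun hz =>
    (hk.mul (continuous_integral_inner_shift ha hz)).integrable_of_hasCompactSupport hkc.mul_right
  rw [integral_inner_timeConv hk hkc ha (hz₁.add hz₂), integral_inner_timeConv hk hkc ha hz₁,
    integral_inner_timeConv hk hkc ha hz₂, ← integral_add (hi hz₁) (hi hz₂)]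
  refine integral_congr_ae (ae_of_all _ fun r => ?_)
  beta_reduce
  rw [← mul_add, ← integral_add (integrable_inner ha (memLp_translate hz₁ (r, 0)))
    (integrable_inner ha (memLp_translate hz₂ (r, 0)))]
  simp only [Pi.add_apply, inner_add_right]

/-- The extension of a function on `(0,T)` to negative times by its initial value. -/
noncomputable def extendPast (z : ℝ × R3 → R3) (V : R3 → R3) (p : ℝ × R3) : R3 :=
  z p + (Ioc (-1) 0).indicator (1 : ℝ → ℝ) p.1 • V p.2

theorem memLp_extendPast {z : ℝ × R3 → R3} {V : R3 → R3} (hz : MemLp z 2) (hV : MemLp V 2) :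
    MemLp (extendPast z V) 2 :=
  hz.add (memLp_smul_prod memLp_indicator_one_Ioc hV)

/-- The averages of `F` over short initial time intervals tend weakly to `U`. -/
def TendstoInitial (F : ℝ × R3 → R3) (U : R3 → R3) : Prop :=
  ∀ w : R3 → R3, MemLp w 2 → Tendsto (fun r : ℝ => r⁻¹ *
      ∫ p : ℝ × R3, ⟪(Ioc 0 r ×ˢ univ).indicator F p, w p.2⟫) (𝓝[>] 0) (𝓝 (∫ y, ⟪U y, w y⟫))

/-- `t` is a Lebesgue point of `z`, as a function of time with values in `L²`. -/
structure IsLebesgueTime (z : ℝ × R3 → R3) (t : ℝ) : Prop where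
  memLp : MemLp (fun y => z (t, y)) 2
  tendsto : Tendsto (fun ε => (∫⁻ τ in Metric.closedBall t ε, ∫⁻ y, ‖z (τ, y) - z (t, y)‖ₑ ^ 2) /
    volume (Metric.closedBall t ε)) (𝓝[>] 0) (𝓝 0)

section Pairing

variable {Ω : Set R3} {K : NNReal} {M : ℝ → R3 → R3 →L[ℝ] R3} {C t : ℝ} {j : ℝ → ℝ → ℝ}
  {zU zV : ℝ × R3 → R3} {U V : R3 → R3}

/-- The extended function is cut into its parts on (0, t), from t on, and before 0; each part
produces a correlation function with its own one-sided slopes at zero. -/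
theorem integral_pairing_eq (hj : IsMollifierFamily j) {F : ℝ × R3 → R3}
    (hF : MemLp F 2) (hF0 : ∀ p : ℝ × R3, p.1 ≤ 0 → F p = 0) (hzV : MemLp zV 2)
    (hzV0 : ∀ p : ℝ × R3, p.1 ≤ 0 → zV p = 0) (hV : MemLp V 2) {h : ℝ} (hh : 0 < h) :
    ∫ p, ⟪(Ioo 0 t ×ˢ univ).indicator F p, timeConv (deriv (j h)) (extendPast zV V) p⟫ =
      (∫ r, deriv (j h) r * ∫ p : ℝ × R3, ⟪(Ioo 0 t ×ˢ univ).indicator F p,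
        (Ioo 0 t ×ˢ univ).indicator zV (p - (r, 0))⟫) +
      (∫ r, deriv (j h) r * ∫ p : ℝ × R3, ⟪(Iio t ×ˢ univ).indicator F p,
        (Ici t ×ˢ univ).indicator zV (p - (r, 0))⟫) +
      ∫ r, deriv (j h) r * ∫ p : ℝ × R3, ⟪(Ioo 0 t ×ˢ univ).indicator F p,
        (Ioc (-1) 0).indicator (1 : ℝ → ℝ) (p.1 - r) • V p.2⟫ := by
  have hk := hj.continuous_deriv hh
  have hkc := (hj.hasCompactSupport hh).deriv
  have hs : MeasurableSet (Ioo 0 t ×ˢ (univ : Set R3)) := measurableSet_Ioo.prod .univ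
  have hs2 : MeasurableSet (Ici t ×ˢ (univ : Set R3)) := measurableSet_Ici.prod .univ
  have ha := hF.indicator hs
  have e : extendPast zV V = ((Ioo 0 t ×ˢ univ).indicator zV + (Ici t ×ˢ univ).indicator zV) +
      fun p => (Ioc (-1) 0).indicator (1 : ℝ → ℝ) p.1 • V p.2 := by
    funext p
    rw [extendPast, Pi.add_apply, Pi.add_apply]
    congr 1
    by_cases h0 : 0 < p.1
    · by_cases h1 : p.1 < t
      · rw [indicator_of_mem (s := Ioo 0 t ×ˢ univ) ⟨⟨h0, h1⟩, trivial⟩,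
          indicator_of_notMem (s := Ici t ×ˢ univ) (fun h => absurd h.1 (not_le.2 h1)), add_zero]
      · rw [indicator_of_notMem (s := Ioo 0 t ×ˢ univ) (fun h => h1 h.1.2),
          indicator_of_mem (s := Ici t ×ˢ univ) ⟨not_lt.1 h1, trivial⟩, zero_add]
    · have := hzV0 p (not_lt.1 h0)
      simp only [indicator_apply, this, ite_self, add_zero]
  -- F vanishes for times at most 0, so the lower end of the interval can be dropped, as the jump
  -- statement at t requires.
  have e2 : (Iio t ×ˢ univ).indicator F = (Ioo 0 t ×ˢ univ).indicator F := by
    funext p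
    by_cases h0 : 0 < p.1
    · simp only [indicator_apply, mem_prod, mem_Iio, mem_Ioo, h0, true_and]
    · have := hF0 p (not_lt.1 h0)
      simp only [indicator_apply, this, ite_self]
  have hm := memLp_smul_prod (memLp_indicator_one_Ioc (a := -1) (b := 0)) hV
  rw [e, integral_inner_timeConv_add hk hkc ha ((hzV.indicator hs).add (hzV.indicator hs2)) hm,
    integral_inner_timeConv_add hk hkc ha (hzV.indicator hs) (hzV.indicator hs2),
    integral_inner_timeConv hk hkc ha (hzV.indicator hs),
    integral_inner_timeConv hk hkc ha (hzV.indicator hs2), integral_inner_timeConv hk hkc ha hm, e2]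
  simp only [Prod.fst_sub, Prod.snd_sub, sub_zero]

/-- The limit of the symmetrized pairing with the derivatives of the mollified functions. -/
theorem tendsto_pairing (hj : IsMollifierFamily j) (hM : IsLipschitzFamily Ω K M)
    (hΩ : MeasurableSet Ω) (hMC : ∀ t y, ‖M t y‖ ≤ C)
    (hMs : ∀ t y v w, ⟪M t y v, w⟫ = ⟪M t y w, v⟫) (ht : 0 < t) (hzU : MemLp zU 2)
    (hzV : MemLp zV 2) (hzU0 : ∀ p : ℝ × R3, p.1 ≤ 0 → zU p = 0)
    (hzV0 : ∀ p : ℝ × R3, p.1 ≤ 0 → zV p = 0) (hU : MemLp U 2) (hV : MemLp V 2)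
    (hUi : TendstoInitial zU U) (hVi : TendstoInitial zV V)
    (hUl : IsLebesgueTime zU t) (hVl : IsLebesgueTime zV t)
    (hMUl : IsLebesgueTime (fun p => M p.1 p.2 (zU p)) t)
    (hMVl : IsLebesgueTime (fun p => M p.1 p.2 (zV p)) t) :
    Tendsto (fun h =>
      (∫ p, ⟪(Ioo 0 t ×ˢ univ).indicator (fun p => M p.1 p.2 (zU p)) p,
        timeConv (deriv (j h)) (extendPast zV V) p⟫) +
      ∫ p, ⟪(Ioo 0 t ×ˢ univ).indicator (fun p => M p.1 p.2 (zV p)) p,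
        timeConv (deriv (j h)) (extendPast zU U) p⟫) (𝓝[>] 0)
      (𝓝 (-(∫ p : ℝ × R3, ⟪deriv (fun s => M s p.2) p.1 ((Ioo 0 t ×ˢ univ).indicator zU p),
          (Ioo 0 t ×ˢ univ).indicator zV p⟫) + (∫ y, ⟪M t y (zU (t, y)), zV (t, y)⟫) -
        ∫ y, ⟪M 0 y (U y), V y⟫)) := by
  have hMm := (hM.measurable_uncurry hΩ).aestronglyMeasurable (μ := volume)
  have hs : MeasurableSet (Ioo 0 t ×ˢ (univ : Set R3)) := measurableSet_Ioo.prod .univ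
  have hMU : MemLp (fun p : ℝ × R3 => M p.1 p.2 (zU p)) 2 :=
    memLp_clm_apply_of_bound hMm (fun p => hMC p.1 p.2) hzU
  have hMV : MemLp (fun p : ℝ × R3 => M p.1 p.2 (zV p)) 2 :=
    memLp_clm_apply_of_bound hMm (fun p => hMC p.1 p.2) hzV
  have ind : ∀ z : ℝ × R3 → R3, (Ioo 0 t ×ˢ univ).indicator (fun p => M p.1 p.2 (z p)) =
      fun p => M p.1 p.2 ((Ioo 0 t ×ˢ univ).indicator z p) := fun z => by
    funext p
    by_cases hp : p ∈ Ioo 0 t ×ˢ (univ : Set R3)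
    · simp only [indicator_of_mem hp]
    · simp only [indicator_of_notMem hp, map_zero]
  have l1 := tendsto_integral_symmetric hj hM hΩ hMC hMs (hzU.indicator hs) (hzV.indicator hs)
  have l2 := tendsto_integral_deriv_mul_cross hj hMU hzV hMUl.memLp hVl.memLp hMUl.tendsto
    hVl.tendsto
  have l3 := tendsto_integral_deriv_mul_cross hj hMV hzU hMVl.memLp hUl.memLp hMVl.tendsto
    hUl.tendsto
  have l4 := tendsto_integral_deriv_mul_initial hj ht hMU hV
    (tendsto_average_initial hM hΩ hMC hMs hzU hV hUi)
  have l5 := tendsto_integral_deriv_mul_initial hj ht hMV hU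
    (tendsto_average_initial hM hΩ hMC hMs hzV hU hVi)
  -- The halves from the two orderings add up: twice q/2 at the time t and twice -q/2 at the time 0,
  -- by the symmetry of M.
  have l := ((l1.add l2).add l3).add (l4.add l5)
  refine (l.congr' ?_).trans_eq ?_
  · filter_upwards [self_mem_nhdsWithin] with h hh
    have p1 := integral_pairing_eq (t := t) hj hMU (fun p hp => by rw [hzU0 p hp, map_zero]) hzV
      hzV0 hV hh
    have p2 := integral_pairing_eq (t := t) hj hMV (fun p hp => by rw [hzV0 p hp, map_zero]) hzU
      hzU0 hU hh
    simp only [ind] at p1 p2 ⊢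
    rw [p1, p2]
    ring
  · have e1 : ∫ y, ⟪M t y (zV (t, y)), zU (t, y)⟫ = ∫ y, ⟪M t y (zU (t, y)), zV (t, y)⟫ := by
      simp only [hMs t _ (zV _)]
    have e2 : ∫ y, ⟪M 0 y (V y), U y⟫ = ∫ y, ⟪M 0 y (U y), V y⟫ := by
      simp only [hMs 0 _ (V _)]
    rw [e1, e2]
    ring_nf

end Pairing

end MovingDomain

/-! ### The weak derivative of the part stemming from the initial value. -/

namespace MovingDomain

section Multiplier

variable {V F : Type*} [NormedAddCommGroup V] [NormedSpace ℝ V] [FiniteDimensional ℝ V]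
  [MeasureSpace V] [BorelSpace V] [(volume : Measure V).IsAddHaarMeasure]
  [NormedAddCommGroup F] [NormedSpace ℝ F] [CompleteSpace F] {U : Set V}

/-- Weak derivatives are only assumed locally integrable; products with test functions are
nevertheless integrable, which justifies splitting the integrals below. -/
theorem integrableOn_smul_of_tsupport_subset (hU : IsOpen U) {f : V → F}
    (hf : LocallyIntegrableOn f U) {φ : V → ℝ} (hφ : Continuous φ) (hc : HasCompactSupport φ)
    (hs : tsupport φ ⊆ U) : IntegrableOn (fun x => φ x • f x) U := by
  have h1 : IntegrableOn (fun x => φ x • f x) (tsupport φ) :=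
    (hf.continuousOn_smul hU.isLocallyClosed hφ.continuousOn).integrableOn_compact_subset hs hc
  exact h1.of_forall_sdiff_eq_zero hU.measurableSet fun x hx => by
    rw [image_eq_zero_of_notMem_tsupport hx.2, zero_smul]

theorem HasWeakDerivAlong.sub (hU : IsOpen U) {f₁ f₂ g₁ g₂ : V → F} {e : V}
    (h₁ : HasWeakDerivAlong U f₁ e g₁) (h₂ : HasWeakDerivAlong U f₂ e g₂) :
    HasWeakDerivAlong U (fun x => f₁ x - f₂ x) e fun x => g₁ x - g₂ x := by
  refine ⟨h₁.1.sub h₂.1, h₁.2.1.sub h₂.2.1, fun φ hφ hc hs => ?_⟩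
  have hφ' : Continuous fun x => fderiv ℝ φ x e :=
    (hφ.continuous_fderiv (by norm_num)).clm_apply continuous_const
  have hc' := hc.fderiv_apply ℝ e
  have hs' : tsupport (fun x => fderiv ℝ φ x e) ⊆ U := (tsupport_fderiv_apply_subset ℝ e).trans hs
  simp only [smul_sub]
  rw [integral_sub (integrableOn_smul_of_tsupport_subset hU h₁.1 hφ' hc' hs')
    (integrableOn_smul_of_tsupport_subset hU h₂.1 hφ' hc' hs'),
    integral_sub (integrableOn_smul_of_tsupport_subset hU h₁.2.1 hφ.continuous hc hs)
    (integrableOn_smul_of_tsupport_subset hU h₂.2.1 hφ.continuous hc hs),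
    h₁.2.2 φ hφ hc hs, h₂.2.2 φ hφ hc hs]
  abel

/-- Uniqueness of weak derivatives, and the product rule with a smooth factor. -/
theorem HasWeakDerivAlong.ae_eq_smul (hU : IsOpen U) {f₁ f₂ g₁ g₂ : V → F} {e : V} {a : V → ℝ}
    (ha : ContDiff ℝ ∞ a) (hf : ∀ᵐ x ∂(volume.restrict U), f₁ x = a x • f₂ x)
    (h₁ : HasWeakDerivAlong U f₁ e g₁) (h₂ : HasWeakDerivAlong U f₂ e g₂) :
    ∀ᵐ x ∂(volume.restrict U), g₁ x = a x • g₂ x + fderiv ℝ a x e • f₂ x := by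
  have ha' : Continuous fun x => fderiv ℝ a x e :=
    (ha.continuous_fderiv (by norm_num)).clm_apply continuous_const
  have hl := (h₁.2.1.sub (h₂.2.1.continuousOn_smul hU.isLocallyClosed ha.continuous.continuousOn)).sub
    (h₂.1.continuousOn_smul hU.isLocallyClosed ha'.continuousOn)
  -- The fundamental lemma of the calculus of variations; the weak derivative of f₂ is tested with φ
  -- a in place of φ.
  have key := hU.ae_eq_zero_of_integral_contDiff_smul_eq_zero hl fun φ hφ hc hs => ?_
  · rw [ae_restrict_iff' hU.measurableSet]
    filter_upwards [key] with x hx hxU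
    have := hx hxU
    simp only [Pi.sub_apply] at this
    rw [sub_sub, sub_eq_zero] at this
    exact this
  have hφ' : Continuous fun x => fderiv ℝ φ x e :=
    (hφ.continuous_fderiv (by norm_num)).clm_apply continuous_const
  have hm : ContDiff ℝ ∞ fun x => φ x * a x := hφ.mul ha
  have hmc : HasCompactSupport fun x => φ x * a x := hc.mul_right
  have hms : tsupport (fun x => φ x * a x) ⊆ U := (tsupport_mul_subset_left).trans hs
  have hd : ∀ x, fderiv ℝ (fun x => φ x * a x) x e =
      fderiv ℝ φ x e * a x + φ x * fderiv ℝ a x e := fun x => by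
    rw [fderiv_fun_mul (hφ.differentiable (by norm_num) x) (ha.differentiable (by norm_num) x)]
    simp only [add_apply, smul_apply, smul_eq_mul]
    ring
  have i1 := integrableOn_smul_of_tsupport_subset hU h₁.2.1 hφ.continuous hc hs
  have i2 := integrableOn_smul_of_tsupport_subset hU h₂.2.1 hm.continuous hmc hms
  have i3 : IntegrableOn (fun x => (φ x * fderiv ℝ a x e) • f₂ x) U :=
    integrableOn_smul_of_tsupport_subset hU h₂.1 (hφ.continuous.mul ha') hc.mul_right
    ((tsupport_mul_subset_left).trans hs)
  have i4 : IntegrableOn (fun x => (fderiv ℝ φ x e * a x) • f₂ x) U :=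
    integrableOn_smul_of_tsupport_subset hU h₂.1 (hφ'.mul ha.continuous)
    (hc.fderiv_apply ℝ e).mul_right ((tsupport_mul_subset_left).trans
      ((tsupport_fderiv_apply_subset ℝ e).trans hs))
  have e1 := h₁.2.2 φ hφ hc hs
  have e2 := h₂.2.2 _ hm hmc hms
  have e3 : ∫ x in U, fderiv ℝ φ x e • f₁ x = ∫ x in U, (fderiv ℝ φ x e * a x) • f₂ x := by
    refine integral_congr_ae ?_
    filter_upwards [hf] with x hx
    rw [hx, smul_smul]
  simp only [hd, add_smul] at e2
  rw [integral_add i4 i3, ← e3, e1] at e2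
  rw [← setIntegral_eq_integral_of_forall_compl_eq_zero (s := U) fun x hx => by
    rw [image_eq_zero_of_notMem_tsupport fun h => hx (hs h), zero_smul]]
  have e4 : ∫ x in U, φ x • (((g₁ - fun x => a x • g₂ x) - fun x => fderiv ℝ a x e • f₂ x) x) =
      (∫ x in U, φ x • g₁ x) - (∫ x in U, (φ x * a x) • g₂ x) -
        ∫ x in U, (φ x * fderiv ℝ a x e) • f₂ x := by
    have i5 : IntegrableOn (fun x => φ x • g₁ x - (φ x * a x) • g₂ x) U := i1.sub i2
    rw [← integral_sub i1 i2, ← integral_sub i5 i3]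
    refine integral_congr_ae (ae_of_all _ fun x => ?_)
    simp only [Pi.sub_apply, smul_sub, smul_smul]
  refine e4.trans ?_
  rw [neg_add_eq_iff_eq_add, ← sub_eq_add_neg] at e2
  rw [sub_sub, e2]
  abel

end Multiplier

namespace IsMollifierFamily

variable {j : ℝ → ℝ → ℝ}

theorem antitone_tailMass (hj : IsMollifierFamily j) {h : ℝ} (hh : 0 < h) :
    Antitone (tailMass (j h)) :=
  antitone_of_deriv_nonpos (fun τ => (hj.hasDerivAt_tailMass hh τ).differentiableAt) fun τ => by
    rw [(hj.hasDerivAt_tailMass hh τ).deriv]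
    exact neg_nonpos.2 (hj.nonneg h hh τ)

/-- Quotients of tails of mollifiers, as smooth multipliers. -/
theorem exists_tailMass_quotient (hj : IsMollifierFamily j) {h₀ : ℝ} (h₀pos : 0 < h₀) :
    ∃ κ : ℝ → ℝ → ℝ, (∀ h τ, h ≤ τ → κ h τ = 0) ∧ ∀ᶠ h in 𝓝[>] (0 : ℝ),
      ContDiff ℝ ∞ (κ h) ∧ (∀ τ, 0 ≤ τ → |κ h τ| ≤ 2) ∧
      ∀ τ, tailMass (j h) τ = κ h τ * tailMass (j h₀) τ := by
  have h0 : tailMass (j h₀) 0 = 1 / 2 := by simp [tailMass]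
  -- At zero the tail is 1/2, and it is nonincreasing, so it stays above 1/4 up to some δ > 0. For h
  -- < δ the quotient of the tails is then at most (1/2)/(1/4) = 2 on nonnegative times.
  obtain ⟨δ, hδ, hδ'⟩ : ∃ δ > 0, 1 / 4 < tailMass (j h₀) δ := by
    have hc := (hj.contDiff_tailMass h₀pos).continuous.continuousAt (x := 0)
    have h1 : ∀ᶠ τ in 𝓝[>] 0, 1 / 4 < tailMass (j h₀) τ :=
      (hc.tendsto.mono_left nhdsWithin_le_nhds).eventually_const_lt (by rw [h0]; norm_num)
    obtain ⟨δ, h2, h3⟩ := (h1.and self_mem_nhdsWithin).exists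
    exact ⟨δ, h3, h2⟩
  have hlow : ∀ τ ≤ δ, 1 / 4 < tailMass (j h₀) τ := fun τ hτ =>
    hδ'.trans_le (hj.antitone_tailMass h₀pos hτ)
  -- The numerator vanishes from h on, so the quotient is set to zero there and the possible zeros
  -- of the denominator, which lie beyond δ > h, do no harm.
  let κ : ℝ → ℝ → ℝ := fun h τ => if h ≤ τ then 0 else tailMass (j h) τ / tailMass (j h₀) τ
  have hκ : ∀ h ∈ Ioo 0 δ, κ h = fun τ => tailMass (j h) τ / tailMass (j h₀) τ := fun h hh => by
    funext τ
    by_cases hτ : h ≤ τ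
    · simp only [κ, if_pos hτ, hj.tailMass_eq_zero hh.1 hτ, zero_div]
    · simp only [κ, if_neg hτ]
  refine ⟨κ, fun h τ hτ => if_pos hτ, ?_⟩
  filter_upwards [Ioo_mem_nhdsGT hδ] with h hh
  refine ⟨?_, fun τ hτ => ?_, fun τ => ?_⟩
  · rw [contDiff_iff_contDiffAt]
    intro τ
    rcases lt_or_ge τ δ with hτ | hτ
    · rw [hκ h hh]
      exact (hj.contDiff_tailMass hh.1).contDiffAt.div (hj.contDiff_tailMass h₀pos).contDiffAt
        (by linarith [hlow τ hτ.le])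
    · refine (contDiffAt_const (c := (0 : ℝ))).congr_of_eventuallyEq ?_
      filter_upwards [Ioi_mem_nhds (hh.2.trans_le hτ)] with s hs
      exact if_pos (le_of_lt hs)
  · by_cases hτh : h ≤ τ
    · simp [κ, if_pos hτh]
    · have h1 := hlow τ (by linarith [hh.2])
      simp only [κ, if_neg hτh]
      rw [abs_of_nonneg (div_nonneg (hj.tailMass_nonneg hh.1 τ) (by linarith)),
        div_le_iff₀ (by linarith)]
      linarith [hj.tailMass_le hh.1 τ hτ]
  · by_cases hτh : h ≤ τ
    · simp only [κ, if_pos hτh, zero_mul, hj.tailMass_eq_zero hh.1 hτh]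
    · have h1 := hlow τ (by linarith [hh.2])
      simp only [κ, if_neg hτh]
      rw [div_mul_cancel₀ _ (by linarith)]

/-- If the tails `tailMass (j h) • ζ` have square integrable weak time derivatives, these have the
expected form up to an error supported in `t ≤ h`. -/
theorem exists_weakDeriv_tail (hj : IsMollifierFamily j) {U : Set (ℝ × R3)} (hU : IsOpen U)
    (hU0 : ∀ p ∈ U, 0 < p.1) {ζ : ℝ × R3 → R3} (hζ : MemLp ζ 2 (volume.restrict U))
    {E : ℝ → ℝ × R3 → R3}
    (hE : ∀ᶠ h in 𝓝[>] (0 : ℝ), MemLp (E h) 2 (volume.restrict U) ∧ HasWeakDerivAlong U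
      (fun p => tailMass (j h) p.1 • ζ p) ((1 : ℝ), (0 : R3)) (E h)) :
    ∃ R : ℝ → ℝ × R3 → R3, (∀ᶠ h in 𝓝[>] (0 : ℝ), MemLp (R h) 2 (volume.restrict U) ∧
      ∀ᵐ p ∂(volume.restrict U), E h p = -(j h p.1 • ζ p) + R h p) ∧
      ∀ a : ℝ × R3 → R3, MemLp a 2 (volume.restrict U) →
        Tendsto (fun h => ∫ p in U, ⟪a p, R h p⟫) (𝓝[>] 0) (𝓝 0) := by
  -- One reference value h₀ is fixed, and all smaller h are compared with it through the multiplier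
  -- κ h.
  obtain ⟨h₀, hE₀, hh₀⟩ := (hE.and self_mem_nhdsWithin).exists
  obtain ⟨κ, hκ0, hκ⟩ := hj.exists_tailMass_quotient hh₀
  have hb : ∃ C, ∀ s, ‖j h₀ s‖ ≤ C :=
    (hj.continuous hh₀).bounded_above_of_compact_support (hj.hasCompactSupport hh₀)
  obtain ⟨C, hC⟩ := hb
  have hE1 : MemLp (fun p => j h₀ p.1 • ζ p + E h₀ p) 2 (volume.restrict U) := by
    refine MemLp.add (MemLp.of_le_mul (c := C) hζ ?_ (ae_of_all _ fun p => ?_)) hE₀.1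
    · exact ((hj.continuous hh₀).comp continuous_fst).aestronglyMeasurable.smul hζ.1
    · rw [norm_smul]; gcongr; exact hC _
  -- Formally E₁ is `tailMass (j h₀)` times ∂_t ζ: although ∂_t ζ need not be square integrable,
  -- this product is.
  set E₁ : ℝ × R3 → R3 := fun p => j h₀ p.1 • ζ p + E h₀ p
  have hUm := hU.measurableSet
  have hR : ∀ᶠ h in 𝓝[>] (0 : ℝ), MemLp (fun p => κ h p.1 • E₁ p) 2 (volume.restrict U) := by
    filter_upwards [hκ] with h hκh
    refine MemLp.of_le_mul (c := 2) hE1 ?_ ?_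
    · exact (hκh.1.continuous.comp continuous_fst).aestronglyMeasurable.smul hE1.1
    · rw [ae_restrict_iff' hUm]
      refine ae_of_all _ fun p hp => ?_
      rw [norm_smul]; gcongr; exact hκh.2.1 _ (hU0 p hp).le
  refine ⟨fun h p => κ h p.1 • E₁ p, ?_, fun a ha => ?_⟩
  · filter_upwards [hE, hκ, hR, self_mem_nhdsWithin] with h hEh hκh hRh hh
    refine ⟨hRh, ?_⟩
    have hd : ∀ p : ℝ × R3, fderiv ℝ (fun p : ℝ × R3 => κ h p.1) p ((1 : ℝ), (0 : R3)) =
        deriv (κ h) p.1 := fun p => by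
      have h1 : DifferentiableAt ℝ (κ h) p.1 := hκh.1.differentiable (by norm_num) _
      have h2 := (h1.hasDerivAt.hasFDerivAt.comp p (hasFDerivAt_fst (𝕜 := ℝ) (p := p))).fderiv
      have h3 : (fun p : ℝ × R3 => κ h p.1) = κ h ∘ Prod.fst := rfl
      rw [h3, h2]
      simp
    filter_upwards [HasWeakDerivAlong.ae_eq_smul (a := fun p : ℝ × R3 => κ h p.1) hU
      (hκh.1.comp contDiff_fst) (ae_of_all _ fun p => by rw [smul_smul, ← hκh.2.2]) hEh.2 hE₀.2]
      with p hp
    have e := hκh.2.2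
    -- Differentiating the relation between the two tails shows that the multiplier terms combine to
    -- exactly -j_h ζ, leaving κ_h E₁.
    have hd2 : -j h p.1 = deriv (κ h) p.1 * tailMass (j h₀) p.1 + κ h p.1 * -j h₀ p.1 := by
      rw [← (hj.hasDerivAt_tailMass hh p.1).deriv, ← (hj.hasDerivAt_tailMass hh₀ p.1).deriv,
        show tailMass (j h) = fun τ => κ h τ * tailMass (j h₀) τ from funext e]
      exact deriv_fun_mul (hκh.1.differentiable (by norm_num) _)
        (hj.hasDerivAt_tailMass hh₀ _).differentiableAt
    rw [hp, hd, ← neg_smul, hd2, smul_smul]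
    simp only [E₁, smul_add, add_smul, smul_smul]
    module
  -- The remainder is dominated by 2 |E₁| and vanishes at each p as soon as h is below the time of
  -- p, which is positive on U.
  · rw [show 𝓝 (0 : ℝ) = 𝓝 (∫ p in U, (0 : ℝ)) by simp]
    have hbd : Integrable (fun p => 2 * (‖E₁ p‖ * ‖a p‖)) (volume.restrict U) := by
      simpa using (integrable_inner ha.norm hE1.norm).const_mul 2
    refine tendsto_integral_filter_of_dominated_convergence _ ?_ ?_ hbd ?_
    · filter_upwards [hR] with h hh
      exact ha.1.inner (𝕜 := ℝ) hh.1
    · filter_upwards [hκ] with h hκh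
      rw [ae_restrict_iff' hUm]
      refine ae_of_all _ fun p hp => ?_
      rw [inner_smul_right, norm_mul]
      have := hκh.2.1 _ (hU0 p hp).le
      calc _ ≤ 2 * (‖a p‖ * ‖E₁ p‖) := mul_le_mul this (norm_inner_le_norm _ _)
            (norm_nonneg _) (by norm_num)
        _ = _ := by ring
    · rw [ae_restrict_iff' hUm]
      refine ae_of_all _ fun p hp => tendsto_const_nhds.congr' ?_
      filter_upwards [Ioo_mem_nhdsGT (hU0 p hp)] with h hh
      rw [hκ0 h _ hh.2.le, zero_smul, inner_zero_right]

end IsMollifierFamily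

end MovingDomain

/-! ### Decomposition of the time derivative of the regularization. -/

namespace MovingDomain

theorem ae_timeConv_extendPast {k : ℝ → ℝ} (hk : Continuous k) (hkc : HasCompactSupport k)
    {z : ℝ × R3 → R3} {V : R3 → R3} (hz : MemLp z 2) :
    ∀ᵐ p : ℝ × R3, timeConv k (extendPast z V) p = timeConv k z p +
      (∫ r, k r * (Ioc (-1) 0).indicator (1 : ℝ → ℝ) (p.1 - r)) • V p.2 := by
  have h1 : ∀ᵐ p : ℝ × R3, ∀ τ : ℝ, Integrable fun r : ℝ => k r • z ((τ, p.2) - (r, 0)) :=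
    Measure.quasiMeasurePreserving_snd.ae (ae_integrable_timeConv hk hkc hz)
  filter_upwards [h1] with p hp
  have hi : Integrable fun r => k r * (Ioc (-1) 0).indicator (1 : ℝ → ℝ) (p.1 - r) := by
    refine (hk.integrable_of_hasCompactSupport hkc).mul_bdd (c := 1) ?_ (ae_of_all _ fun r => ?_)
    · exact ((measurable_one.indicator measurableSet_Ioc).comp
        (measurable_const.sub measurable_id)).aestronglyMeasurable
    · rw [Pi.one_def]
      exact (norm_indicator_le_norm_self _ _).trans (by simp)
  rw [← integral_smul_const, timeConv, timeConv, ← integral_add (hp p.1) (hi.smul_const _)]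
  refine integral_congr_ae (ae_of_all _ fun r => ?_)
  simp only [extendPast, Prod.fst_sub, Prod.snd_sub, sub_zero, smul_add, smul_smul]

theorem hasWeakGradient_zero {V F : Type*} [NormedAddCommGroup V] [NormedSpace ℝ V]
    [MeasureSpace V] [NormedAddCommGroup F] [NormedSpace ℝ F] {U : Set V} :
    HasWeakGradient U (fun _ => (0 : F)) fun _ => 0 := fun e =>
  ⟨locallyIntegrableOn_zero, by simpa using locallyIntegrableOn_zero, by simp⟩

theorem HasWeakGradient.congr {V F : Type*} [NormedAddCommGroup V] [NormedSpace ℝ V]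
    [MeasureSpace V] [NormedAddCommGroup F] [NormedSpace ℝ F] {U : Set V} {f f' : V → F}
    {g g' : V → V →L[ℝ] F} (h : HasWeakGradient U f g) (hf : ∀ x, f' x = f x)
    (hg : ∀ x, g' x = g x) : HasWeakGradient U f' g' := by
  obtain rfl : f' = f := funext hf
  obtain rfl : g' = g := funext hg
  exact h

variable {T : ℝ} {Ω : Set R3} {X : ℝ → R3 → R3} {u v : ℝ → R3 → R3} {G : ℝ → R3 → R3 →L[ℝ] R3}

section Cylinder

variable {E : Type*} [NormedAddCommGroup E]

/-- Restriction to the space-time cylinder `(0,T) × Ω`, extended by zero. -/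
noncomputable def onCylinder (T : ℝ) (Ω : Set R3) (f : ℝ × R3 → E) : ℝ × R3 → E :=
  (Ioo 0 T ×ˢ Ω).indicator f

theorem memLp_onCylinder (hΩ : IsOpen Ω) {f : ℝ × R3 → E} {p : ENNReal}
    (hf : MemLp f p (volume.restrict (Ioo 0 T ×ˢ Ω))) : MemLp (onCylinder T Ω f) p :=
  (memLp_indicator_iff_restrict (measurableSet_Ioo.prod hΩ.measurableSet)).2 hf

theorem onCylinder_of_mem {f : ℝ × R3 → E} {p : ℝ × R3} (hf : p.2 ∉ Ω → f p = 0)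
    (hp : p.1 ∈ Ioo 0 T) : onCylinder T Ω f p = f p := by
  by_cases hy : p.2 ∈ Ω
  · exact indicator_of_mem (s := Ioo 0 T ×ˢ Ω) ⟨hp, hy⟩ _
  · rw [onCylinder, indicator_of_notMem (s := Ioo 0 T ×ˢ Ω) fun h => hy h.2, hf hy]

theorem onCylinder_of_notMem {f : ℝ × R3 → E} {p : ℝ × R3} (hp : p.1 ∉ Ioo 0 T) :
    onCylinder T Ω f p = 0 :=
  indicator_of_notMem (s := Ioo 0 T ×ˢ Ω) (fun h => hp h.1) _

end Cylinder

/-- The Lagrangian velocity on `(0,T)`, extended by zero. -/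
noncomputable def lagrIn (T : ℝ) (Ω : Set R3) (X : ℝ → R3 → R3) (u : ℝ → R3 → R3) :
    ℝ × R3 → R3 :=
  onCylinder T Ω (lagr T Ω X u)

/-- The gradient of the Lagrangian velocity on `(0,T)`, extended by zero. -/
noncomputable def lagrGradIn (T : ℝ) (Ω : Set R3) (X : ℝ → R3 → R3) (u : ℝ → R3 → R3)
    (G : ℝ → R3 → R3 →L[ℝ] R3) : ℝ × R3 → R3 →L[ℝ] R3 :=
  onCylinder T Ω (lagrGrad T Ω X u G)

/-- The Lagrangian initial velocity. -/
noncomputable def lagrInit (T : ℝ) (Ω : Set R3) (X : ℝ → R3 → R3) (u : ℝ → R3 → R3) (y : R3) :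
    R3 :=
  lagr T Ω X u (0, y)

/-- The time derivative of the regularized velocity, in Lagrangian variables. -/
noncomputable def regRate (T : ℝ) (Ω : Set R3) (X : ℝ → R3 → R3) (u : ℝ → R3 → R3)
    (G : ℝ → R3 → R3 →L[ℝ] R3) (k : ℝ → ℝ) (p : ℝ × R3) : R3 :=
  timeRate T Ω X p.1 p.2 (timeConv k (lagrIn T Ω X u) p)
    (joinGrad (timeConv (deriv k) (extendPast (lagrIn T Ω X u) (lagrInit T Ω X u)) p)
      (timeConv k (lagrGradIn T Ω X u G) p))

theorem lagrIn_of_mem {p : ℝ × R3} (hp : p.1 ∈ Ioo 0 T) : lagrIn T Ω X u p = lagr T Ω X u p :=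
  onCylinder_of_mem IsVolumePreservingTransformation.lagr_zero hp

theorem lagrGradIn_of_mem {p : ℝ × R3} (hp : p.1 ∈ Ioo 0 T) :
    lagrGradIn T Ω X u G p = lagrGrad T Ω X u G p :=
  onCylinder_of_mem IsVolumePreservingTransformation.lagrGrad_zero hp

theorem lagrIn_of_notMem {p : ℝ × R3} (hp : p.1 ∉ Ioo 0 T) : lagrIn T Ω X u p = 0 :=
  onCylinder_of_notMem hp

theorem lagrGradIn_of_notMem {p : ℝ × R3} (hp : p.1 ∉ Ioo 0 T) : lagrGradIn T Ω X u G p = 0 :=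
  onCylinder_of_notMem hp

namespace IsVolumePreservingTransformation

theorem memLp_lagrIn (hX : IsVolumePreservingTransformation T Ω X) (hΩ : IsOpen Ω) (hT : 0 ≤ T)
    (hu : MemLp (fun p : ℝ × R3 => u p.1 p.2) 2 (volume.restrict (spaceTime Ω X T))) :
    MemLp (lagrIn T Ω X u) 2 :=
  memLp_onCylinder hΩ (hX.memLp_lagr hΩ hT hu)

theorem memLp_lagrGradIn (hX : IsVolumePreservingTransformation T Ω X) (hΩ : IsOpen Ω) (hT : 0 ≤ T)
    (hu : MemLp (fun p : ℝ × R3 => u p.1 p.2) 2 (volume.restrict (spaceTime Ω X T)))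
    (hG : MemLp (fun p : ℝ × R3 => G p.1 p.2) 2 (volume.restrict (spaceTime Ω X T))) :
    MemLp (lagrGradIn T Ω X u G) 2 :=
  memLp_onCylinder hΩ (hX.memLp_lagrGrad hΩ hT hu hG)

theorem ae_hasWeakGradient_lagrIn (hX : IsVolumePreservingTransformation T Ω X) (hΩ : IsOpen Ω)
    (hT : 0 ≤ T) (hu2 : ∀ t ∈ Icc 0 T, MemLp (u t) 2 (volume.restrict (domainAt Ω X t)))
    (hG : MemLp (fun p : ℝ × R3 => G p.1 p.2) 2 (volume.restrict (spaceTime Ω X T)))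
    (hw : ∀ᵐ t ∂(volume.restrict (Ioo 0 T)), HasWeakGradient (domainAt Ω X t) (u t) (G t)) :
    ∀ᵐ s : ℝ, HasWeakGradient Ω (fun y => lagrIn T Ω X u (s, y))
      fun y => lagrGradIn T Ω X u G (s, y) := by
  filter_upwards [(ae_restrict_iff' measurableSet_Ioo).1
    (hX.ae_hasWeakGradient_lagr hΩ hT hu2 hG hw)] with s hs
  by_cases h : s ∈ Ioo 0 T
  · exact HasWeakGradient.congr (hs h).2 (fun y => lagrIn_of_mem (p := (s, y)) h)
      fun y => lagrGradIn_of_mem (p := (s, y)) h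
  · exact HasWeakGradient.congr hasWeakGradient_zero (fun y => lagrIn_of_notMem (p := (s, y)) h)
      fun y => lagrGradIn_of_notMem (p := (s, y)) h

/-- For small h the kernel only reaches past times where ξ = 1 and which lie after -1, and it does
not reach T. The regularization therefore no longer depends on ξ or on the continuation after T. -/
theorem eventually_lagrangianReg_eq (hX : IsVolumePreservingTransformation T Ω X) (hΩ : IsOpen Ω)
    (hT : 0 < T) {ξ : ℝ → ℝ} (hξ : IsCutoff T ξ) {j : ℝ → ℝ → ℝ} (hj : IsMollifierFamily j)
    {t : ℝ} (ht : t ∈ Ioo 0 T) (u : ℝ → R3 → R3) :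
    ∀ᶠ h in 𝓝[>] (0 : ℝ), ∀ p ∈ Ioo 0 t ×ˢ Ω, lagrangianReg T Ω X ξ j u h p.1 p.2 =
      timeConv (j h) (extendPast (lagrIn T Ω X u) (lagrInit T Ω X u)) p := by
  have h0T : (0 : ℝ) ∈ Icc 0 T := left_mem_Icc.2 hT.le
  have hξ0 : ∀ᶠ s in 𝓝 (0 : ℝ), ξ s = 1 := hξ.eq_one.filter_mono (nhds_le_nhdsSet h0T)
  obtain ⟨δ, hδ, hξδ⟩ := Metric.eventually_nhds_iff.1 hξ0
  have hξ1 : ∀ s ∈ Icc 0 T, ξ s = 1 := fun s hs => hξ.eq_one.self_of_nhdsSet s hs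
  filter_upwards [Ioo_mem_nhdsGT (lt_min hδ (lt_min one_pos (sub_pos.2 ht.2)))] with h hh p hp
  have hhδ := hh.2.trans_le (min_le_left _ _)
  have hh1 := (hh.2.trans_le (min_le_right _ _)).trans_le (min_le_left _ _)
  have hhT := (hh.2.trans_le (min_le_right _ _)).trans_le (min_le_right _ _)
  rw [lagrangianReg, timeConv, ← integral_sub_left_eq_self _ volume p.1]
  refine integral_congr_ae (ae_of_all _ fun r => ?_)
  simp only [sub_sub_cancel]
  by_cases hr : j h r = 0
  · simp [hr]
  congr 1
  have hr' := hj.support h hh.1 hr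
  have hlt : p.1 - r < T := by linarith [hr'.1, hp.1.2]
  have e : p - (r, (0 : R3)) = (p.1 - r, p.2) := by ext <;> simp
  rw [extendTime, e, extendPast]
  by_cases h1 : p.1 - r ≤ 0
  · have hm : p.1 - r ∈ Ioc (-1) 0 := ⟨by linarith [hr'.2, hp.1.1], h1⟩
    have hd : dist (p.1 - r) 0 < δ := by
      rw [dist_zero_right, Real.norm_eq_abs, abs_lt]
      constructor <;> linarith [hr'.2, hp.1.1]
    rw [if_pos h1, hξδ hd, one_smul, indicator_of_mem hm, Pi.one_apply, one_smul,
      lagrIn_of_notMem (fun h => absurd h.1 (not_lt.2 h1)), zero_add, hX.lagrangian_eq hΩ h0T hp.2,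
      lagrInit]
  · have hm : p.1 - r ∈ Ioo 0 T := ⟨not_le.1 h1, hlt⟩
    rw [if_neg h1, if_pos hlt, hξ1 _ (Ioo_subset_Icc_self hm), one_smul,
      indicator_of_notMem (s := Ioc (-1) 0) (fun h => h1 h.2), zero_smul, add_zero,
      lagrIn_of_mem hm, hX.lagrangian_eq hΩ (Ioo_subset_Icc_self hm) hp.2]

end IsVolumePreservingTransformation

end MovingDomain

namespace MovingDomain

theorem HasWeakDerivAlong.congr_ae {V F : Type*} [NormedAddCommGroup V] [NormedSpace ℝ V]
    [MeasureSpace V] [NormedAddCommGroup F] [NormedSpace ℝ F] {U : Set V} {f f' g : V → F} {e : V}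
    (h : HasWeakDerivAlong U f e g) (hf : ∀ᵐ x ∂(volume.restrict U), f x = f' x) :
    HasWeakDerivAlong U f' e g := by
  refine ⟨h.1.congr hf, h.2.1, fun φ h1 h2 h3 => ?_⟩
  rw [← h.2.2 φ h1 h2 h3]
  refine integral_congr_ae ?_
  filter_upwards [hf] with x hx
  rw [hx]

theorem joinGrad_sub_apply {E : Type*} [NormedAddCommGroup E] [NormedSpace ℝ E] (a b : E)
    (g : R3 →L[ℝ] E) (q : ℝ × R3) : joinGrad (a - b) g q = joinGrad a g q - q.1 • b := by
  rw [joinGrad_apply, joinGrad_apply, smul_sub]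
  abel

variable {T : ℝ} {Ω : Set R3} {X : ℝ → R3 → R3} {u v : ℝ → R3 → R3} {G : ℝ → R3 → R3 →L[ℝ] R3}

theorem timeRate_joinGrad_sub {t : ℝ} {y w a b : R3} {g : R3 →L[ℝ] R3} :
    timeRate T Ω X t y w (joinGrad (a - b) g) =
      timeRate T Ω X t y w (joinGrad a g) - extGrad T Ω X t y b := by
  rw [timeRate, timeRate, joinGrad_sub_apply, one_smul, map_sub]
  abel

namespace IsVolumePreservingTransformation

theorem ae_comp_eulerMap (hX : IsVolumePreservingTransformation T Ω X) (hΩ : IsOpen Ω)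
    {t : ℝ} (ht : t ≤ T) {P : ℝ × R3 → Prop} (h : ∀ᵐ q ∂(volume.restrict (Ioo 0 t ×ˢ Ω)), P q) :
    ∀ᵐ q ∂(volume.restrict (spaceTime Ω X t)), P (eulerMap Ω X q) := by
  rw [← hX.map_eulerMap hΩ ht] at h
  exact ae_of_ae_map (hX.aemeasurable_eulerMap hΩ ht) h

theorem memLp_initialVelocity (hX : IsVolumePreservingTransformation T Ω X) (hΩ : IsOpen Ω)
    (hT : 0 ≤ T) {t : ℝ} (ht : t ≤ T) {V : R3 → R3} (hV : MemLp V 2) :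
    MemLp (fun p => extGrad T Ω X p.1 (eulerMap Ω X p).2 (V (eulerMap Ω X p).2)) 2
      (volume.restrict (spaceTime Ω X t)) := by
  obtain ⟨K, hK⟩ := hX.exists_extBound hΩ hT
  have hm := measurableSet_Ioo.prod hΩ.measurableSet (s := Ioo 0 t)
  have h1 : MemLp (fun p : ℝ × R3 => V p.2) 2 (volume.restrict (Ioo 0 t ×ˢ Ω)) := by
    refine ((memLp_smul_prod (memLp_indicator_one_Ioc (a := 0) (b := t)) hV).restrict
      (Ioo 0 t ×ˢ Ω)).ae_eq ((ae_restrict_iff' hm).2 (ae_of_all _ fun p hp => ?_))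
    rw [indicator_of_mem (Ioo_subset_Ioc_self hp.1), Pi.one_apply, one_smul]
  exact hX.memLp_comp_eulerMap hΩ ht (memLp_clm_apply_of_bound
    (hK.grad.measurable_uncurry hΩ.measurableSet).aestronglyMeasurable
    (fun p => hK.norm_grad p.1 p.2) h1)

/-- The weak time derivatives of the regularizations, up to an error which tends weakly to zero. -/
theorem exists_regRate_decomposition (hX : IsVolumePreservingTransformation T Ω X) (hΩ : IsOpen Ω)
    (hT : 0 < T) {ξ : ℝ → ℝ} (hξ : IsCutoff T ξ) {j : ℝ → ℝ → ℝ} (hj : IsMollifierFamily j)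
    (hu : MemLp (fun p : ℝ × R3 => u p.1 p.2) 2 (volume.restrict (spaceTime Ω X T)))
    (hG : MemLp (fun p : ℝ × R3 => G p.1 p.2) 2 (volume.restrict (spaceTime Ω X T)))
    (hw : ∀ᵐ t ∂(volume.restrict (Ioo 0 T)), HasWeakGradient (domainAt Ω X t) (u t) (G t))
    (hu2 : ∀ t ∈ Icc 0 T, MemLp (u t) 2 (volume.restrict (domainAt Ω X t)))
    {t : ℝ} (ht : t ∈ Ioo 0 T) {D : ℝ → ℝ → R3 → R3}
    (hD : ∀ᶠ h in 𝓝[>] (0 : ℝ), HasL2TimeDeriv Ω X t (reg T Ω X ξ j u h) (D h)) :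
    ∃ R : ℝ → ℝ × R3 → R3, (∀ᶠ h in 𝓝[>] (0 : ℝ),
      MemLp (R h) 2 (volume.restrict (spaceTime Ω X t)) ∧
      ∀ᵐ p ∂(volume.restrict (Ioo 0 t ×ˢ Ω)),
        D h p.1 (X p.1 p.2) = regRate T Ω X u G (j h) p + R h (lagrangeMap X p)) ∧
      ∀ a : ℝ × R3 → R3, MemLp a 2 (volume.restrict (spaceTime Ω X t)) →
        Tendsto (fun h => ∫ p in spaceTime Ω X t, ⟪a p, R h p⟫) (𝓝[>] 0) (𝓝 0) := by
  set z := lagrIn T Ω X u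
  set g := lagrGradIn T Ω X u G
  set V := lagrInit T Ω X u
  have hz : MemLp z 2 := hX.memLp_lagrIn hΩ hT.le hu
  have hg : MemLp g 2 := hX.memLp_lagrGradIn hΩ hT.le hu hG
  have h0T : (0 : ℝ) ∈ Icc 0 T := left_mem_Icc.2 hT.le
  have hV : MemLp V 2 := hX.memLp_lagr_slice hΩ h0T (hu2 0 h0T)
  have hzg := hX.ae_hasWeakGradient_lagrIn hΩ hT.le hu2 hG hw
  have hQ := hX.isOpen_spaceTime hΩ ht.2.le
  have hPm : MeasurableSet (Ioo 0 t ×ˢ Ω) := measurableSet_Ioo.prod hΩ.measurableSet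
  let ζ : ℝ × R3 → R3 := fun p =>
    extGrad T Ω X p.1 (eulerMap Ω X p).2 (V (eulerMap Ω X p).2)
  have hζ : MemLp ζ 2 (volume.restrict (spaceTime Ω X t)) :=
    hX.memLp_initialVelocity hΩ hT.le ht.2.le hV
  -- The push-forward of the mollified field without its past. The slices of this field have spatial
  -- weak gradients forming an L² function, so its Eulerian time derivative is explicit even when
  -- the initial value is only in L².
  let f₁ : ℝ → ℝ → R3 → R3 := fun h τ x => extGrad T Ω X τ (inverseMap Ω X τ x)
    (timeConv (j h) z (τ, inverseMap Ω X τ x))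
  let r₁ : ℝ → ℝ × R3 → R3 := fun h p => timeRate T Ω X p.1 p.2 (timeConv (j h) z p)
    (joinGrad (timeConv (deriv (j h)) z p) (timeConv (j h) g p))
  let D₁ : ℝ → ℝ → R3 → R3 := fun h τ x => r₁ h (τ, inverseMap Ω X τ x)
  have hD₁ : ∀ᶠ h in 𝓝[>] (0 : ℝ), HasL2TimeDeriv Ω X t (f₁ h) (D₁ h) := by
    filter_upwards [self_mem_nhdsWithin] with h hh
    have hk := hj.continuous hh
    have hkc := hj.hasCompactSupport hh
    have m1 := (memLp_timeConv hk hkc hz).restrict (Ioo 0 t ×ˢ Ω)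
    have m2 := (memLp_timeConv (hj.continuous_deriv hh) hkc.deriv hz).restrict (Ioo 0 t ×ˢ Ω)
    have m3 := (memLp_timeConv hk hkc hg).restrict (Ioo 0 t ×ˢ Ω)
    refine hX.hasL2TimeDeriv_push hΩ hT.le ht.2.le m1 (memLp_joinGrad m2 m3)
      (hasWeakGradient_joinGrad m1 m2 m3 (hasWeakDerivAlong_time (hj.contDiff_one hh) hkc hz)
        fun e => hasWeakDerivAlong_space hk hkc hz hg hzg _ e) fun p hp => ?_
    simp only [f₁, hX.inverseMap_apply ⟨hp.1.1.le, (hp.1.2.trans ht.2).le⟩ hp.2]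
  -- The difference of the assumed and the explicit derivative is a weak derivative of the tail
  -- times ζ, the only part that involves the initial value.
  let E : ℝ → ℝ × R3 → R3 := fun h p => D h p.1 p.2 - D₁ h p.1 p.2
  have hE : ∀ᶠ h in 𝓝[>] (0 : ℝ), MemLp (E h) 2 (volume.restrict (spaceTime Ω X t)) ∧
      HasWeakDerivAlong (spaceTime Ω X t) (fun p => tailMass (j h) p.1 • ζ p)
        ((1 : ℝ), (0 : R3)) (E h) := by
    filter_upwards [hD, hD₁, hX.eventually_lagrangianReg_eq hΩ hT hξ hj ht u,
      Ioo_mem_nhdsGT one_pos] with h hDh hD₁h hreg hh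
    refine ⟨hDh.2.sub hD₁h.2, (HasWeakDerivAlong.sub hQ hDh.1 hD₁h.1).congr_ae ?_⟩
    have hsplit := ae_restrict_of_ae (s := Ioo 0 t ×ˢ Ω)
      (ae_timeConv_extendPast (V := V) (hj.continuous hh.1) (hj.hasCompactSupport hh.1) hz)
    filter_upwards [hX.ae_comp_eulerMap hΩ ht.2.le hsplit, ae_restrict_mem hQ.measurableSet]
      with p hp hpQ
    have hq := mapsTo_eulerMap t hpQ
    have hτ : p.1 ∈ Icc 0 T := ⟨hpQ.1.1.le, (hpQ.1.2.trans ht.2).le⟩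
    have e1 := hreg _ hq
    rw [hp, show (eulerMap Ω X p).1 = p.1 from rfl,
      hj.integral_mul_indicator hh.1 hh.2 hτ.1] at e1
    have e2 : reg T Ω X ξ j u h p.1 p.2 = extGrad T Ω X p.1 (eulerMap Ω X p).2
        (lagrangianReg T Ω X ξ j u h p.1 (eulerMap Ω X p).2) := by
      rw [extGrad_eq hτ hq.2]; rfl
    rw [e2, e1, map_add, map_smul]
    exact add_sub_cancel_left _ _
  obtain ⟨R, hR, hRa⟩ := hj.exists_weakDeriv_tail hQ (fun p hp => hp.1.1) hζ hE
  refine ⟨R, ?_, hRa⟩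
  filter_upwards [hR, Ioo_mem_nhdsGT one_pos] with h hRh hh
  refine ⟨hRh.1, ?_⟩
  have hsplit := ae_restrict_of_ae (s := Ioo 0 t ×ˢ Ω) (ae_timeConv_extendPast (V := V)
    (hj.continuous_deriv hh.1) (hj.hasCompactSupport hh.1).deriv hz)
  filter_upwards [hX.ae_comp_lagrangeMap hΩ ht.2.le hRh.2, hsplit, ae_restrict_mem hPm]
    with p hp hps hpP
  have hinv : inverseMap Ω X p.1 (X p.1 p.2) = p.2 :=
    hX.inverseMap_apply ⟨hpP.1.1.le, (hpP.1.2.trans ht.2).le⟩ hpP.2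
  rw [hj.integral_deriv_mul_indicator hh.1 hh.2 hpP.1.1.le, neg_smul, ← sub_eq_add_neg] at hps
  have e1 : D h p.1 (X p.1 p.2) = D₁ h p.1 (X p.1 p.2) + E h (lagrangeMap X p) := by
    simp only [E, lagrangeMap]
    abel
  have e2 : D₁ h p.1 (X p.1 p.2) = r₁ h p := by
    simp only [D₁, hinv]
  have e3 : ζ (lagrangeMap X p) = extGrad T Ω X p.1 p.2 (V p.2) := by
    simp only [ζ, hX.eulerMap_lagrangeMap ht.2.le hpP]
    rfl
  -- The main part -j_h ζ of the derivative of the tail is exactly the contribution of the past to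
  -- j_h' * ū. Inside `regRate` no spatial derivative of the initial value appears.
  have e4 : regRate T Ω X u G (j h) p = r₁ h p - extGrad T Ω X p.1 p.2 (j h p.1 • V p.2) := by
    rw [regRate, hps, timeRate_joinGrad_sub]
  rw [e1, hp, e2, e3, e4, map_smul]
  simp only [lagrangeMap]
  abel

end IsVolumePreservingTransformation

end MovingDomain

/-! ### The metric tensor, and strong convergence of the terms without time derivatives. -/

namespace MovingDomain

variable {T : ℝ} {Ω : Set R3} {X : ℝ → R3 → R3} {K : NNReal}

/-- The metric tensor `(∇X)ᵀ ∇X`. -/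
noncomputable def metric (T : ℝ) (Ω : Set R3) (X : ℝ → R3 → R3) (t : ℝ) (y : R3) : R3 →L[ℝ] R3 :=
  (ContinuousLinearMap.adjoint (extGrad T Ω X t y)).comp (extGrad T Ω X t y)

theorem metric_inner (t : ℝ) (y v w : R3) :
    ⟪metric T Ω X t y v, w⟫ = ⟪extGrad T Ω X t y v, extGrad T Ω X t y w⟫ := by
  rw [metric, ContinuousLinearMap.comp_apply, ContinuousLinearMap.adjoint_inner_left]

theorem metric_symm (t : ℝ) (y v w : R3) : ⟪metric T Ω X t y v, w⟫ = ⟪metric T Ω X t y w, v⟫ := by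
  rw [metric_inner, metric_inner, real_inner_comm]

namespace IsVolumePreservingTransformation

namespace ExtBound

theorem norm_metric (hK : ExtBound T Ω X K) (t : ℝ) (y : R3) : ‖metric T Ω X t y‖ ≤ K * K := by
  refine (ContinuousLinearMap.opNorm_comp_le _ _).trans ?_
  rw [LinearIsometryEquiv.norm_map]
  exact mul_le_mul (hK.norm_grad t y) (hK.norm_grad t y) (norm_nonneg _) K.2

theorem exists_isLipschitzFamily_metric (hK : ExtBound T Ω X K) :
    ∃ K', IsLipschitzFamily Ω K' (metric T Ω X) := by
  obtain ⟨K', hK'⟩ := exists_norm_bilin_sub_le (ContinuousLinearMap.compL ℝ R3 R3 R3)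
    (f := fun s y => ContinuousLinearMap.adjoint (extGrad T Ω X s y))
    (g := fun s y => extGrad T Ω X s y) (Kf := K) (Kg := K) (Cf := K) (Cg := K)
    (fun y => by
      have := (ContinuousLinearMap.adjoint (𝕜 := ℝ) (E := R3) (F := R3)).isometry.lipschitz.comp
        (hK.grad.lip y)
      rwa [one_mul] at this)
    hK.grad.lip (fun s y => by rw [LinearIsometryEquiv.norm_map]; exact hK.norm_grad s y)
    hK.norm_grad
  refine ⟨K', hK', fun t y hy => ?_, fun t => ?_⟩
  · rw [metric, hK.grad.zero t y hy, ContinuousLinearMap.comp_zero]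
  · exact ((ContinuousLinearMap.adjoint (𝕜 := ℝ) (E := R3) (F := R3)).continuous.comp_continuousOn
      (hK.grad.cont t)).clm_comp (hK.grad.cont t)

/-- The exceptional null set is independent of v and w: on its complement both the metric and ∇X are
differentiable in time, and ⟨M v, w⟩ has two expressions for its derivative. -/
theorem ae_inner_deriv_metric (hK : ExtBound T Ω X K) (hΩ : IsOpen Ω) :
    ∀ᵐ p : ℝ × R3, ∀ v w : R3, ⟪deriv (fun s => metric T Ω X s p.2) p.1 v, w⟫ =
      ⟪extGradRate T Ω X p.1 p.2 v, extGrad T Ω X p.1 p.2 w⟫ +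
        ⟪extGrad T Ω X p.1 p.2 v, extGradRate T Ω X p.1 p.2 w⟫ := by
  obtain ⟨K', hK'⟩ := hK.exists_isLipschitzFamily_metric
  filter_upwards [hK.grad.ae_hasDerivAt hΩ.measurableSet, hK'.ae_hasDerivAt hΩ.measurableSet]
    with p h1 h2 v w
  have d1 : HasDerivAt (fun s => ⟪metric T Ω X s p.2 v, w⟫)
      ⟪deriv (fun s => metric T Ω X s p.2) p.1 v, w⟫ p.1 := by
    have := (h2.clm_apply (hasDerivAt_const p.1 v)).inner ℝ (hasDerivAt_const p.1 w)
    simpa using this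
  have d2 : HasDerivAt (fun s => ⟪extGrad T Ω X s p.2 v, extGrad T Ω X s p.2 w⟫)
      (⟪extGradRate T Ω X p.1 p.2 v, extGrad T Ω X p.1 p.2 w⟫ +
        ⟪extGrad T Ω X p.1 p.2 v, extGradRate T Ω X p.1 p.2 w⟫) p.1 := by
    have := (h1.clm_apply (hasDerivAt_const p.1 v)).inner ℝ (h1.clm_apply (hasDerivAt_const p.1 w))
    rw [add_comm]
    simpa [extGradRate] using this
  simp only [metric_inner] at d1
  exact d1.unique d2

/-- The part of the time derivative without derivatives in time of the velocity. -/
theorem tendsto_eLpNorm_timeRate (hK : ExtBound T Ω X K) {j : ℝ → ℝ → ℝ} (hj : IsMollifierFamily j)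
    (hΩ : IsOpen Ω) {z : ℝ × R3 → R3} {g : ℝ × R3 → R3 →L[ℝ] R3} (hz : MemLp z 2) (hg : MemLp g 2)
    (S : Set (ℝ × R3)) :
    Tendsto (fun h => eLpNorm (fun p =>
      timeRate T Ω X p.1 p.2 (timeConv (j h) z p) (joinGrad 0 (timeConv (j h) g p)) -
        timeRate T Ω X p.1 p.2 (z p) (joinGrad 0 (g p))) 2 (volume.restrict S)) (𝓝[>] 0) (𝓝 0) := by
  set C : ℝ := K + K * (K * K)
  have hC : 0 ≤ C := by positivity
  have hC' : (0 : ℝ) ≤ K * (K * K) := by positivity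
  have lim : Tendsto (fun h => ENNReal.ofReal C * eLpNorm (fun p => timeConv (j h) z p - z p) 2 volume +
      ENNReal.ofReal (K * (K * K)) * eLpNorm (fun p => timeConv (j h) g p - g p) 2 volume)
      (𝓝[>] 0) (𝓝 0) := by
    have := (ENNReal.Tendsto.const_mul (a := ENNReal.ofReal C) (hj.tendsto_timeConv hz)
      (Or.inr ENNReal.ofReal_ne_top)).add (ENNReal.Tendsto.const_mul
      (a := ENNReal.ofReal (K * (K * K))) (hj.tendsto_timeConv hg) (Or.inr ENNReal.ofReal_ne_top))
    rwa [mul_zero, mul_zero, add_zero] at this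
  refine tendsto_of_tendsto_of_tendsto_of_le_of_le' tendsto_const_nhds lim
    (Eventually.of_forall fun _ => zero_le) ?_
  filter_upwards [self_mem_nhdsWithin] with h hh
  have m1 := (memLp_timeConv (hj.continuous hh) (hj.hasCompactSupport hh) hz).sub hz
  have m2 := (memLp_timeConv (hj.continuous hh) (hj.hasCompactSupport hh) hg).sub hg
  refine (eLpNorm_mono_measure _ Measure.restrict_le_self).trans ?_
  let a : ℝ × R3 → R3 := fun p => (extGradRate T Ω X p.1 p.2 - extHess T Ω X p.1 p.2
    (extPull T Ω X p.1 p.2)) (timeConv (j h) z p - z p)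
  let b : ℝ × R3 → R3 := fun p => extGrad T Ω X p.1 p.2
    ((timeConv (j h) g p - g p) (-extPull T Ω X p.1 p.2))
  have e : (fun p : ℝ × R3 => timeRate T Ω X p.1 p.2 (timeConv (j h) z p)
      (joinGrad 0 (timeConv (j h) g p)) - timeRate T Ω X p.1 p.2 (z p) (joinGrad 0 (g p))) =
      a + b := by
    funext p
    simp only [timeRate, joinGrad_apply, smul_zero, zero_add, Pi.add_apply, a, b, map_sub, sub_apply]
    abel
  have ha : AEStronglyMeasurable a volume := aestronglyMeasurable_clm_apply
    (hK.measurable_rate hΩ).aestronglyMeasurable m1.1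
  have hb : AEStronglyMeasurable b volume := aestronglyMeasurable_clm_apply
    (hK.grad.measurable_uncurry hΩ.measurableSet).aestronglyMeasurable
    (aestronglyMeasurable_clm_apply m2.1 (hK.measurable_pull hΩ).neg.aestronglyMeasurable)
  rw [e]
  refine (eLpNorm_add_le ha hb (by norm_num)).trans (add_le_add ?_ ?_)
  · refine eLpNorm_le_mul_eLpNorm_of_ae_le_mul (ae_of_all _ fun p => ?_) 2
    refine (ContinuousLinearMap.le_opNorm _ _).trans ?_
    gcongr
    exact hK.norm_rate _ _
  · refine eLpNorm_le_mul_eLpNorm_of_ae_le_mul (ae_of_all _ fun p => ?_) 2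
    refine (ContinuousLinearMap.le_opNorm _ _).trans ?_
    calc _ ≤ K * (‖timeConv (j h) g p - g p‖ * (K * K)) := by
          gcongr
          · exact hK.norm_grad _ _
          · refine (ContinuousLinearMap.le_opNorm _ _).trans ?_
            gcongr
            rw [norm_neg]
            exact hK.norm_pull _ _
      _ = _ := by ring

end ExtBound

end IsVolumePreservingTransformation

end MovingDomain

/-! ### The limit in Lagrangian coordinates. -/

namespace MovingDomain

variable {T : ℝ} {Ω : Set R3} {X : ℝ → R3 → R3} {u v : ℝ → R3 → R3} {K : NNReal}
  {Gu Gv : ℝ → R3 → R3 →L[ℝ] R3} {j : ℝ → ℝ → ℝ} {t : ℝ}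

theorem timeRate_joinGrad {y w a : R3} {g : R3 →L[ℝ] R3} :
    timeRate T Ω X t y w (joinGrad a g) =
      timeRate T Ω X t y w (joinGrad 0 g) + extGrad T Ω X t y a := by
  have := timeRate_joinGrad_sub (T := T) (Ω := Ω) (X := X) (t := t) (y := y) (w := w) (a := 0)
    (b := -a) (g := g)
  rwa [zero_sub, neg_neg, map_neg, sub_neg_eq_add] at this

/-- The part of the time derivative of a vector field which only involves its values and its
spatial derivatives. -/
noncomputable def spaceRate (T : ℝ) (Ω : Set R3) (X : ℝ → R3 → R3) (z : ℝ × R3 → R3)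
    (g : ℝ × R3 → R3 →L[ℝ] R3) (p : ℝ × R3) : R3 :=
  timeRate T Ω X p.1 p.2 (z p) (joinGrad 0 (g p))

namespace IsVolumePreservingTransformation

namespace ExtBound

theorem memLp_spaceRate (hK : ExtBound T Ω X K) (hΩ : IsOpen Ω) {z : ℝ × R3 → R3}
    {g : ℝ × R3 → R3 →L[ℝ] R3} (hz : MemLp z 2) (hg : MemLp g 2) :
    MemLp (spaceRate T Ω X z g) 2 :=
  hK.memLp_timeRate hΩ hz (memLp_joinGrad (a := fun _ => 0) MemLp.zero' hg)

theorem memLp_extGrad_apply (hK : ExtBound T Ω X K) (hΩ : IsOpen Ω) {z : ℝ × R3 → R3}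
    (hz : MemLp z 2) : MemLp (fun p => extGrad T Ω X p.1 p.2 (z p)) 2 :=
  memLp_clm_apply_of_bound (hK.grad.measurable_uncurry hΩ.measurableSet).aestronglyMeasurable
    (fun p => hK.norm_grad p.1 p.2) hz

theorem memLp_extGradRate_apply (hK : ExtBound T Ω X K) (hΩ : IsOpen Ω) {z : ℝ × R3 → R3}
    (hz : MemLp z 2) : MemLp (fun p => extGradRate T Ω X p.1 p.2 (z p)) 2 :=
  memLp_clm_apply_of_bound (hK.measurable_gradRate hΩ).aestronglyMeasurable
    (fun p => hK.norm_gradRate p.1 p.2) hz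

/-- In `regRate` the time derivative of the field enters only through ∇X (j_h' * v̄). Paired with ∇X
z this becomes a pairing in the metric, the form treated by `tendsto_pairing`; the remainder
converges strongly. -/
theorem integral_inner_regRate (hK : ExtBound T Ω X K) (hΩ : IsOpen Ω) (hj : IsMollifierFamily j)
    {z : ℝ × R3 → R3} (hz : MemLp z 2) (hv : MemLp (lagrIn T Ω X v) 2)
    (hgv : MemLp (lagrGradIn T Ω X v Gv) 2) (hv0 : MemLp (lagrInit T Ω X v) 2) {h : ℝ}
    (hh : 0 < h) :
    ∫ p in Ioo 0 t ×ˢ Ω, ⟪extGrad T Ω X p.1 p.2 (z p), regRate T Ω X v Gv (j h) p⟫ =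
      (∫ p in Ioo 0 t ×ˢ Ω, ⟪extGrad T Ω X p.1 p.2 (z p), spaceRate T Ω X
        (timeConv (j h) (lagrIn T Ω X v)) (timeConv (j h) (lagrGradIn T Ω X v Gv)) p⟫) +
      ∫ p, ⟪(Ioo 0 t ×ˢ univ).indicator (fun p => metric T Ω X p.1 p.2 (z p)) p,
        timeConv (deriv (j h)) (extendPast (lagrIn T Ω X v) (lagrInit T Ω X v)) p⟫ := by
  have hk := hj.continuous hh
  have hkc := hj.hasCompactSupport hh
  have hPm : MeasurableSet (Ioo 0 t ×ˢ Ω) := measurableSet_Ioo.prod hΩ.measurableSet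
  have mz := (hK.memLp_extGrad_apply hΩ hz).restrict (Ioo 0 t ×ˢ Ω)
  have m1 := (hK.memLp_spaceRate hΩ (memLp_timeConv hk hkc hv)
    (memLp_timeConv hk hkc hgv)).restrict (Ioo 0 t ×ˢ Ω)
  have m2 := (hK.memLp_extGrad_apply hΩ (memLp_timeConv (hj.continuous_deriv hh) hkc.deriv
    (memLp_extendPast hv hv0))).restrict (Ioo 0 t ×ˢ Ω)
  have e : ∀ p : ℝ × R3, ⟪extGrad T Ω X p.1 p.2 (z p), regRate T Ω X v Gv (j h) p⟫ =
      ⟪extGrad T Ω X p.1 p.2 (z p), spaceRate T Ω X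
        (timeConv (j h) (lagrIn T Ω X v)) (timeConv (j h) (lagrGradIn T Ω X v Gv)) p⟫ +
      ⟪extGrad T Ω X p.1 p.2 (z p), extGrad T Ω X p.1 p.2 (timeConv (deriv (j h))
        (extendPast (lagrIn T Ω X v) (lagrInit T Ω X v)) p)⟫ := fun p => by
    rw [regRate, timeRate_joinGrad, inner_add_right, spaceRate]
  simp only [e]
  rw [integral_add (integrable_inner mz m1) (integrable_inner mz m2)]
  congr 1
  rw [← integral_indicator hPm]
  refine integral_congr_ae (ae_of_all _ fun p => ?_)
  beta_reduce
  by_cases hp : p.1 ∈ Ioo 0 t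
  · rw [indicator_of_mem (s := Ioo 0 t ×ˢ univ) ⟨hp, trivial⟩, metric_inner]
    by_cases hy : p.2 ∈ Ω
    · rw [indicator_of_mem (s := Ioo 0 t ×ˢ Ω) ⟨hp, hy⟩]
    · rw [indicator_of_notMem (s := Ioo 0 t ×ˢ Ω) (fun h => hy h.2), hK.grad.zero _ _ hy, zero_apply,
        inner_zero_left]
  · rw [indicator_of_notMem (s := Ioo 0 t ×ˢ univ) (fun h => hp h.1),
      indicator_of_notMem (s := Ioo 0 t ×ˢ Ω) (fun h => hp h.1), inner_zero_left]

theorem tendsto_integral_inner_spaceRate (hK : ExtBound T Ω X K) (hΩ : IsOpen Ω)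
    (hj : IsMollifierFamily j) {a z : ℝ × R3 → R3} {g : ℝ × R3 → R3 →L[ℝ] R3} (ha : MemLp a 2)
    (hz : MemLp z 2) (hg : MemLp g 2) (S : Set (ℝ × R3)) :
    Tendsto (fun h => ∫ p in S, ⟪a p, spaceRate T Ω X (timeConv (j h) z) (timeConv (j h) g) p⟫)
      (𝓝[>] 0) (𝓝 (∫ p in S, ⟪a p, spaceRate T Ω X z g p⟫)) :=
  tendsto_integral_bilin (B := fun _ => innerBilin R3) (C := ‖innerBilin R3‖)
    (F := fun _ => a) aestronglyMeasurable_const (fun _ => le_rfl)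
    (Eventually.of_forall fun _ => ha.restrict S)
    (eventually_mem_nhdsWithin.mono fun _ hh => (hK.memLp_spaceRate hΩ
      (memLp_timeConv (hj.continuous hh) (hj.hasCompactSupport hh) hz)
      (memLp_timeConv (hj.continuous hh) (hj.hasCompactSupport hh) hg)).restrict S)
    (ha.restrict S) ((hK.memLp_spaceRate hΩ hz hg).restrict S)
    (by simp only [sub_self, eLpNorm_zero_fun, tendsto_const_nhds])
    (hK.tendsto_eLpNorm_timeRate hj hΩ hz hg S)

/-- The limit of the pairings with the time derivatives of the regularizations. -/
theorem tendsto_integral_regRate (hK : ExtBound T Ω X K) (hΩ : IsOpen Ω) (hj : IsMollifierFamily j)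
    (ht : 0 < t)
    (hu : MemLp (lagrIn T Ω X u) 2) (hgu : MemLp (lagrGradIn T Ω X u Gu) 2)
    (hu0 : MemLp (lagrInit T Ω X u) 2)
    (hv : MemLp (lagrIn T Ω X v) 2) (hgv : MemLp (lagrGradIn T Ω X v Gv) 2)
    (hv0 : MemLp (lagrInit T Ω X v) 2)
    (hui : TendstoInitial (lagrIn T Ω X u) (lagrInit T Ω X u))
    (hvi : TendstoInitial (lagrIn T Ω X v) (lagrInit T Ω X v))
    (hul : IsLebesgueTime (lagrIn T Ω X u) t) (hvl : IsLebesgueTime (lagrIn T Ω X v) t)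
    (hMul : IsLebesgueTime (fun p => metric T Ω X p.1 p.2 (lagrIn T Ω X u p)) t)
    (hMvl : IsLebesgueTime (fun p => metric T Ω X p.1 p.2 (lagrIn T Ω X v p)) t) :
    Tendsto (fun h =>
      (∫ p in Ioo 0 t ×ˢ Ω, ⟪extGrad T Ω X p.1 p.2 (lagrIn T Ω X u p),
        regRate T Ω X v Gv (j h) p⟫) +
      ∫ p in Ioo 0 t ×ˢ Ω, ⟪extGrad T Ω X p.1 p.2 (lagrIn T Ω X v p),
        regRate T Ω X u Gu (j h) p⟫) (𝓝[>] 0)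
      (𝓝 (-(∫ p in Ioo 0 t ×ˢ Ω, (⟪extGrad T Ω X p.1 p.2 (lagrIn T Ω X u p),
          extGradRate T Ω X p.1 p.2 (lagrIn T Ω X v p) -
            spaceRate T Ω X (lagrIn T Ω X v) (lagrGradIn T Ω X v Gv) p⟫ +
        ⟪extGrad T Ω X p.1 p.2 (lagrIn T Ω X v p),
          extGradRate T Ω X p.1 p.2 (lagrIn T Ω X u p) -
            spaceRate T Ω X (lagrIn T Ω X u) (lagrGradIn T Ω X u Gu) p⟫)) +
        (∫ y, ⟪metric T Ω X t y (lagrIn T Ω X u (t, y)), lagrIn T Ω X v (t, y)⟫) -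
        ∫ y, ⟪metric T Ω X 0 y (lagrInit T Ω X u y), lagrInit T Ω X v y⟫)) := by
  obtain ⟨K', hM⟩ := hK.exists_isLipschitzFamily_metric
  have hPm : MeasurableSet (Ioo 0 t ×ˢ Ω) := measurableSet_Ioo.prod hΩ.measurableSet
  set zU := lagrIn T Ω X u
  set zV := lagrIn T Ω X v
  have mU := hK.memLp_extGrad_apply hΩ hu
  have mV := hK.memLp_extGrad_apply hΩ hv
  have z0 : ∀ w : ℝ → R3 → R3, ∀ p : ℝ × R3, p.1 ≤ 0 → lagrIn T Ω X w p = 0 := fun w p hp =>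
    lagrIn_of_notMem fun h => absurd h.1 (not_lt.2 hp)
  have l1 := hK.tendsto_integral_inner_spaceRate hΩ hj mU hv hgv (Ioo 0 t ×ˢ Ω)
  have l2 := hK.tendsto_integral_inner_spaceRate hΩ hj mV hu hgu (Ioo 0 t ×ˢ Ω)
  have l3 := tendsto_pairing hj hM hΩ.measurableSet hK.norm_metric metric_symm ht hu hv (z0 u) (z0 v)
    hu0 hv0 hui hvi hul hvl hMul hMvl
  have l := (l1.add l2).add l3
  refine (l.congr' ?_).trans_eq ?_
  · filter_upwards [self_mem_nhdsWithin] with h hh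
    rw [hK.integral_inner_regRate hΩ hj hu hv hgv hv0 hh,
      hK.integral_inner_regRate hΩ hj hv hu hgu hu0 hh]
    ring
  · have mU' := mU.restrict (Ioo 0 t ×ˢ Ω)
    have mV' := mV.restrict (Ioo 0 t ×ˢ Ω)
    have rU := (hK.memLp_extGradRate_apply hΩ hu).restrict (Ioo 0 t ×ˢ Ω)
    have rV := (hK.memLp_extGradRate_apply hΩ hv).restrict (Ioo 0 t ×ˢ Ω)
    have sU := (hK.memLp_spaceRate hΩ hu hgu).restrict (Ioo 0 t ×ˢ Ω)
    have sV := (hK.memLp_spaceRate hΩ hv hgv).restrict (Ioo 0 t ×ˢ Ω)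
    -- The product rule splits ∂_t M symmetrically into two terms with ∂_t ∇X, one to be combined
    -- with the spatial rate of each field.
    have e1 : ∫ p : ℝ × R3, ⟪deriv (fun s => metric T Ω X s p.2) p.1
          ((Ioo 0 t ×ˢ univ).indicator zU p), (Ioo 0 t ×ˢ univ).indicator zV p⟫ =
        ∫ p in Ioo 0 t ×ˢ Ω, (⟪extGrad T Ω X p.1 p.2 (zU p), extGradRate T Ω X p.1 p.2 (zV p)⟫ +
          ⟪extGrad T Ω X p.1 p.2 (zV p), extGradRate T Ω X p.1 p.2 (zU p)⟫) := by
      rw [← integral_indicator hPm]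
      refine integral_congr_ae ?_
      filter_upwards [hK.ae_inner_deriv_metric hΩ] with p hp
      by_cases h1 : p.1 ∈ Ioo 0 t
      · rw [indicator_of_mem (s := Ioo 0 t ×ˢ univ) ⟨h1, trivial⟩,
          indicator_of_mem (s := Ioo 0 t ×ˢ univ) ⟨h1, trivial⟩, hp]
        by_cases hy : p.2 ∈ Ω
        · rw [indicator_of_mem (s := Ioo 0 t ×ˢ Ω) ⟨h1, hy⟩, add_comm,
            real_inner_comm (extGradRate T Ω X p.1 p.2 (zU p))]
        · rw [indicator_of_notMem (s := Ioo 0 t ×ˢ Ω) (fun h => hy h.2), hK.grad.zero _ _ hy]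
          simp
      · rw [indicator_of_notMem (s := Ioo 0 t ×ˢ univ) (fun h => h1 h.1),
          indicator_of_notMem (s := Ioo 0 t ×ˢ Ω) (fun h => h1 h.1), map_zero, inner_zero_left]
    have e2 : ∫ p in Ioo 0 t ×ˢ Ω, (⟪extGrad T Ω X p.1 p.2 (zU p), extGradRate T Ω X p.1 p.2 (zV p) -
            spaceRate T Ω X zV (lagrGradIn T Ω X v Gv) p⟫ +
        ⟪extGrad T Ω X p.1 p.2 (zV p), extGradRate T Ω X p.1 p.2 (zU p) -
            spaceRate T Ω X zU (lagrGradIn T Ω X u Gu) p⟫) =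
        (∫ p in Ioo 0 t ×ˢ Ω, (⟪extGrad T Ω X p.1 p.2 (zU p), extGradRate T Ω X p.1 p.2 (zV p)⟫ +
          ⟪extGrad T Ω X p.1 p.2 (zV p), extGradRate T Ω X p.1 p.2 (zU p)⟫)) -
        ((∫ p in Ioo 0 t ×ˢ Ω, ⟪extGrad T Ω X p.1 p.2 (zU p),
            spaceRate T Ω X zV (lagrGradIn T Ω X v Gv) p⟫) +
          ∫ p in Ioo 0 t ×ˢ Ω, ⟪extGrad T Ω X p.1 p.2 (zV p),
            spaceRate T Ω X zU (lagrGradIn T Ω X u Gu) p⟫) := by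
      have i1 := integrable_inner mU' rV
      have i2 := integrable_inner mV' rU
      have i3 := integrable_inner mU' sV
      have i4 := integrable_inner mV' sU
      rw [← integral_add i3 i4, ← integral_sub (by exact i1.add i2) (by exact i3.add i4)]
      refine integral_congr_ae (ae_of_all _ fun p => ?_)
      simp only [inner_sub_right]
      ring
    rw [e1, e2]
    congr 1
    ring

end ExtBound

end IsVolumePreservingTransformation

end MovingDomain

/-! ### Return to Eulerian coordinates. -/

namespace MovingDomain

variable {T : ℝ} {Ω : Set R3} {X : ℝ → R3 → R3} {u v : ℝ → R3 → R3} {K : NNReal}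
  {G Gu Gv : ℝ → R3 → R3 →L[ℝ] R3} {t : ℝ}

/-- The gradient of `v · u`. -/
noncomputable def innerGrad (u v : ℝ → R3 → R3) (Gu Gv : ℝ → R3 → R3 →L[ℝ] R3) (τ : ℝ) (x : R3) :
    R3 →L[ℝ] ℝ :=
  (innerBilin R3 (v τ x)).comp (Gu τ x) + (innerBilin R3 (u τ x)).comp (Gv τ x)

theorem innerGrad_apply (τ : ℝ) (x e : R3) :
    innerGrad u v Gu Gv τ x e = ⟪v τ x, Gu τ x e⟫ + ⟪u τ x, Gv τ x e⟫ := rfl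

theorem spaceTime_mono {s t : ℝ} (h : s ≤ t) : spaceTime Ω X s ⊆ spaceTime Ω X t :=
  fun _ hp => ⟨⟨hp.1.1, hp.1.2.trans_le h⟩, hp.2⟩

namespace IsVolumePreservingTransformation

theorem timeDerivX_eq {y : R3} (ht : t ∈ Ioo 0 T) (hy : y ∈ Ω)
    (hX : IsVolumePreservingTransformation T Ω X) :
    timeDerivX Ω X t (X t y) = extVel T Ω X t y := by
  rw [timeDerivX, hX.inverseMap_apply (Ioo_subset_Icc_self ht) hy, extVel]
  refine Filter.EventuallyEq.deriv_eq ?_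
  filter_upwards [Ioo_mem_nhds ht.1 ht.2] with s hs
  rw [extPos_eq (Ioo_subset_Icc_self hs) hy]

/-- Freezing w = v̄, the derivative of ∇X w along trajectories has only the term with ∂_t ∇X, and
`spaceRate` is that term minus transport. The difference is the derivative of v along ∂_t X; in the
formula the second derivatives of X cancel, and ∇X (∇X)⁻¹ = 1. -/
theorem extGradRate_sub_spaceRate (hX : IsVolumePreservingTransformation T Ω X) {p : ℝ × R3}
    (hp : p.1 ∈ Ioo 0 T) (hy : p.2 ∈ Ω) :
    extGradRate T Ω X p.1 p.2 (lagrIn T Ω X v p) -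
        spaceRate T Ω X (lagrIn T Ω X v) (lagrGradIn T Ω X v G) p =
      G p.1 (X p.1 p.2) (extVel T Ω X p.1 p.2) := by
  have hp' := Ioo_subset_Icc_self hp
  have hAB : ∀ w, extGrad T Ω X p.1 p.2 (extInv T Ω X p.1 p.2 w) = w := hX.extGrad_extInv hp' hy
  rw [spaceRate, lagrIn_of_mem hp, lagrGradIn_of_mem hp, timeRate, joinGrad_apply, smul_zero,
    zero_add, map_neg, map_neg, lagrGrad, pullGrad, ContinuousLinearMap.comp_apply, hAB, sub_apply, sub_apply,
    ContinuousLinearMap.comp_apply, ContinuousLinearMap.flip_apply, extPull, hAB, lagr]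
  abel

/-- Both fields and their gradients are square integrable on almost every slice, so the product rule
applies there. -/
theorem ae_hasWeakGradient_inner (hX : IsVolumePreservingTransformation T Ω X) (hΩ : IsOpen Ω)
    (hT : 0 ≤ T)
    (hu2 : ∀ t ∈ Icc 0 T, MemLp (u t) 2 (volume.restrict (domainAt Ω X t)))
    (hv2 : ∀ t ∈ Icc 0 T, MemLp (v t) 2 (volume.restrict (domainAt Ω X t)))
    (hGu : MemLp (fun p : ℝ × R3 => Gu p.1 p.2) 2 (volume.restrict (spaceTime Ω X T)))
    (hGv : MemLp (fun p : ℝ × R3 => Gv p.1 p.2) 2 (volume.restrict (spaceTime Ω X T)))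
    (hwu : ∀ᵐ t ∂(volume.restrict (Ioo 0 T)), HasWeakGradient (domainAt Ω X t) (u t) (Gu t))
    (hwv : ∀ᵐ t ∂(volume.restrict (Ioo 0 T)), HasWeakGradient (domainAt Ω X t) (v t) (Gv t)) :
    ∀ᵐ τ ∂(volume.restrict (Ioo 0 T)), HasWeakGradient (domainAt Ω X τ)
      (fun x => ⟪v τ x, u τ x⟫) (innerGrad u v Gu Gv τ) := by
  filter_upwards [hwu, hwv, hX.ae_hasWeakGradient_lagr hΩ hT hu2 hGu hwu,
    hX.ae_hasWeakGradient_lagr hΩ hT hv2 hGv hwv, ae_restrict_mem measurableSet_Ioo]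
    with τ h1 h2 h3 h4 hτ e
  have hτ' := Ioo_subset_Icc_self hτ
  have h := HasWeakDerivAlong.inner (hX.isOpen_domainAt hΩ hτ') (hu2 τ hτ') (hv2 τ hτ')
    (memLp_apply_const h3.1 e) (memLp_apply_const h4.1 e) (h1 e) (h2 e)
  have hg : (fun x => innerGrad u v Gu Gv τ x e) =
      fun x => ⟪Gv τ x e, u τ x⟫ + ⟪v τ x, Gu τ x e⟫ := funext fun x => by
    rw [innerGrad_apply, add_comm, real_inner_comm]
  rw [hg]
  exact h

theorem integrableOn_innerGrad
    (hu : MemLp (fun p : ℝ × R3 => u p.1 p.2) 2 (volume.restrict (spaceTime Ω X T)))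
    (hv : MemLp (fun p : ℝ × R3 => v p.1 p.2) 2 (volume.restrict (spaceTime Ω X T)))
    (hGu : MemLp (fun p : ℝ × R3 => Gu p.1 p.2) 2 (volume.restrict (spaceTime Ω X T)))
    (hGv : MemLp (fun p : ℝ × R3 => Gv p.1 p.2) 2 (volume.restrict (spaceTime Ω X T))) :
    IntegrableOn (fun p : ℝ × R3 => innerGrad u v Gu Gv p.1 p.2) (spaceTime Ω X T) := by
  let B : R3 →L[ℝ] (R3 →L[ℝ] R3) →L[ℝ] R3 →L[ℝ] ℝ :=
    (ContinuousLinearMap.compL ℝ R3 R3 ℝ).comp (innerBilin R3)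
  exact (integrable_bilin (B := fun _ => B) aestronglyMeasurable_const (fun _ => le_rfl) hv hGu).add
    (integrable_bilin (B := fun _ => B) aestronglyMeasurable_const (fun _ => le_rfl) hu hGv)

theorem integrableOn_innerGrad_timeDerivX (hX : IsVolumePreservingTransformation T Ω X)
    (hΩ : IsOpen Ω) (hT : 0 ≤ T)
    (hu : MemLp (fun p : ℝ × R3 => u p.1 p.2) 2 (volume.restrict (spaceTime Ω X T)))
    (hv : MemLp (fun p : ℝ × R3 => v p.1 p.2) 2 (volume.restrict (spaceTime Ω X T)))
    (hGu : MemLp (fun p : ℝ × R3 => Gu p.1 p.2) 2 (volume.restrict (spaceTime Ω X T)))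
    (hGv : MemLp (fun p : ℝ × R3 => Gv p.1 p.2) 2 (volume.restrict (spaceTime Ω X T))) :
    IntegrableOn (fun p : ℝ × R3 => innerGrad u v Gu Gv p.1 p.2 (timeDerivX Ω X p.1 p.2))
      (spaceTime Ω X T) := by
  obtain ⟨K, hK⟩ := hX.exists_extBound hΩ hT
  have hQ := (hX.isOpen_spaceTime hΩ le_rfl).measurableSet
  let c : ℝ × R3 → R3 := fun p => extVel T Ω X (eulerMap Ω X p).1 (eulerMap Ω X p).2
  have hc : AEStronglyMeasurable c (volume.restrict (spaceTime Ω X T)) :=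
    ((hK.measurable_vel hΩ).comp_aemeasurable
      (hX.aemeasurable_eulerMap hΩ le_rfl)).aestronglyMeasurable
  have hcK : ∀ p, ‖c p‖ ≤ K := fun p => hK.norm_vel _ _
  have hm : ∀ {G : ℝ → R3 → R3 →L[ℝ] R3},
      MemLp (fun p : ℝ × R3 => G p.1 p.2) 2 (volume.restrict (spaceTime Ω X T)) →
      MemLp (fun p : ℝ × R3 => G p.1 p.2 (c p)) 2 (volume.restrict (spaceTime Ω X T)) := fun hG =>
    hG.of_le_mul (c := K) (aestronglyMeasurable_clm_apply hG.1 hc) (ae_of_all _ fun p =>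
      (ContinuousLinearMap.le_opNorm _ _).trans ((mul_comm _ _).trans_le
        (mul_le_mul_of_nonneg_right (hcK p) (norm_nonneg _))))
  refine ((integrable_inner hv (hm hGu)).add (integrable_inner hu (hm hGv))).congr ?_
  filter_upwards [ae_restrict_mem hQ] with p hp
  have hy := (mapsTo_eulerMap T hp).2
  have hx : X p.1 (eulerMap Ω X p).2 = p.2 := apply_inverseMap hp.2
  have e : timeDerivX Ω X p.1 p.2 = c p := by
    rw [← hx, hX.timeDerivX_eq hp.1 hy]; rfl
  rw [innerGrad_apply, e]
  rfl

theorem tendstoInitial_lagrIn (hX : IsVolumePreservingTransformation T Ω X) (hΩ : IsOpen Ω)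
    (hT : 0 < T) (hu : MemLp (fun p : ℝ × R3 => u p.1 p.2) 2 (volume.restrict (spaceTime Ω X T)))
    (h0 : AttainsInitialValue Ω X u) :
    TendstoInitial (lagrIn T Ω X u) (lagrInit T Ω X u) := by
  intro w hw
  have h := h0 w (hw.restrict Ω)
  have hz : ∀ τ y, y ∉ Ω → ⟪lagr T Ω X u (τ, y), w y⟫ = 0 := fun τ y hy => by
    rw [lagr_zero hy, inner_zero_left]
  have hsl : ∀ τ ∈ Icc 0 T, ∫ y in Ω, ⟪lagrangian Ω X u τ y, w y⟫ =
      ∫ y, ⟪lagr T Ω X u (τ, y), w y⟫ := fun τ hτ => by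
    rw [← setIntegral_eq_integral_of_forall_compl_eq_zero (hz τ)]
    exact setIntegral_congr_fun hΩ.measurableSet fun y hy => by
      rw [hX.lagrangian_eq hΩ hτ hy]
  rw [hsl 0 (left_mem_Icc.2 hT.le)] at h
  refine h.congr' ?_
  filter_upwards [Ioo_mem_nhdsGT hT] with r hr
  congr 1
  have hs : MeasurableSet (Ioc 0 r ×ˢ (univ : Set R3)) := measurableSet_Ioc.prod .univ
  have hm := (hX.memLp_lagrIn hΩ hT.le hu)
  have hw1 : MemLp (fun p : ℝ × R3 => (Ioc 0 r).indicator (1 : ℝ → ℝ) p.1 • w p.2) 2 :=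
    memLp_smul_prod memLp_indicator_one_Ioc hw
  have e : ∀ p : ℝ × R3, ⟪(Ioc 0 r ×ˢ univ).indicator (lagrIn T Ω X u) p, w p.2⟫ =
      ⟪lagrIn T Ω X u p, (Ioc 0 r).indicator (1 : ℝ → ℝ) p.1 • w p.2⟫ := fun p => by
    by_cases hp : p.1 ∈ Ioc 0 r
    · rw [indicator_of_mem (s := Ioc 0 r ×ˢ univ) ⟨hp, trivial⟩, indicator_of_mem hp, Pi.one_apply,
        one_smul]
    · rw [indicator_of_notMem (s := Ioc 0 r ×ˢ univ) (fun h => hp h.1), indicator_of_notMem hp,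
        zero_smul, inner_zero_left, inner_zero_right]
  simp only [e]
  have hi := integrable_inner hm hw1
  rw [Measure.volume_eq_prod] at hi ⊢
  rw [integral_prod _ hi, intervalIntegral.integral_of_le hr.1.le,
    ← integral_indicator measurableSet_Ioc]
  refine integral_congr_ae (ae_of_all _ fun τ => ?_)
  beta_reduce
  by_cases hτ : τ ∈ Ioc 0 r
  · have hτ' : τ ∈ Ioo 0 T := ⟨hτ.1, hτ.2.trans_lt hr.2⟩
    rw [indicator_of_mem hτ, hsl τ (Ioo_subset_Icc_self hτ')]
    refine integral_congr_ae (ae_of_all _ fun y => ?_)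
    beta_reduce
    rw [indicator_of_mem hτ, Pi.one_apply, one_smul, lagrIn_of_mem hτ']
  · rw [indicator_of_notMem hτ]
    simp only [indicator_of_notMem hτ, zero_smul, inner_zero_right, integral_zero]

/-- The jump at t pairs M ū with v̄, so Lebesgue times are needed for the field multiplied by the
metric as well. This product is again an L² function, to which the same theorem applies. -/
theorem ae_isLebesgueTime (hX : IsVolumePreservingTransformation T Ω X) (hΩ : IsOpen Ω)
    (hT : 0 ≤ T) (hu : MemLp (fun p : ℝ × R3 => u p.1 p.2) 2 (volume.restrict (spaceTime Ω X T)))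
    (hu2 : ∀ t ∈ Icc 0 T, MemLp (u t) 2 (volume.restrict (domainAt Ω X t))) :
    ∀ᵐ t ∂(volume.restrict (Ioo 0 T)), IsLebesgueTime (lagrIn T Ω X u) t ∧
      IsLebesgueTime (fun p => metric T Ω X p.1 p.2 (lagrIn T Ω X u p)) t := by
  obtain ⟨K, hK⟩ := hX.exists_extBound hΩ hT
  obtain ⟨K', hM⟩ := hK.exists_isLipschitzFamily_metric
  have hMm := hM.measurable_uncurry hΩ.measurableSet
  have hz := hX.memLp_lagrIn hΩ hT hu
  have hMz := memLp_clm_apply_of_bound (A := fun p : ℝ × R3 => metric T Ω X p.1 p.2)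
    hMm.aestronglyMeasurable (fun p => hK.norm_metric p.1 p.2) hz
  have s1 : ∀ t ∈ Ioo 0 T, MemLp (fun y => lagrIn T Ω X u (t, y)) 2 := fun t ht => by
    have e : (fun y => lagrIn T Ω X u (t, y)) = fun y => lagr T Ω X u (t, y) :=
      funext fun y => lagrIn_of_mem (p := (t, y)) ht
    rw [e]
    exact hX.memLp_lagr_slice hΩ (Ioo_subset_Icc_self ht) (hu2 t (Ioo_subset_Icc_self ht))
  have s2 : ∀ t ∈ Ioo 0 T, MemLp (fun y => metric T Ω X t y (lagrIn T Ω X u (t, y))) 2 :=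
    fun t ht => memLp_clm_apply_of_bound (A := metric T Ω X t)
      (hMm.comp measurable_prodMk_left).aestronglyMeasurable (hK.norm_metric t) (s1 t ht)
  filter_upwards [ae_tendsto_lintegral_slice_div hz s1, ae_tendsto_lintegral_slice_div hMz s2,
    ae_restrict_mem measurableSet_Ioo] with t h1 h2 ht
  exact ⟨⟨s1 t ht, h1⟩, ⟨s2 t ht, h2⟩⟩

/-- The metric is the pull-back of the Euclidean inner product, and X(t) preserves volume. -/
theorem integral_metric_lagr (hX : IsVolumePreservingTransformation T Ω X) (hΩ : IsOpen Ω)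
    (ht : t ∈ Icc 0 T) :
    ∫ y, ⟪metric T Ω X t y (lagr T Ω X u (t, y)), lagr T Ω X v (t, y)⟫ =
      ∫ x in domainAt Ω X t, ⟪v t x, u t x⟫ := by
  rw [hX.integral_domainAt hΩ ht, ← setIntegral_eq_integral_of_forall_compl_eq_zero (s := Ω)
    fun y hy => by rw [lagr_zero (u := v) hy, inner_zero_right]]
  refine setIntegral_congr_fun hΩ.measurableSet fun y hy => ?_
  beta_reduce
  rw [metric_inner, hX.extGrad_lagr ht hy, hX.extGrad_lagr ht hy, real_inner_comm]

end IsVolumePreservingTransformation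

end MovingDomain

/-! ### Conclusion: integration by parts in time. -/

namespace MovingDomain

variable {T : ℝ} {Ω : Set R3} {X : ℝ → R3 → R3} {u v : ℝ → R3 → R3}
  {Gu Gv : ℝ → R3 → R3 →L[ℝ] R3} {t : ℝ}

namespace IsVolumePreservingTransformation

/-- The pairing of `u` with the time derivative of a regularization, in Lagrangian variables. -/
theorem integral_inner_timeDeriv (hX : IsVolumePreservingTransformation T Ω X) (hΩ : IsOpen Ω)
    (ht : t ∈ Ioo 0 T) (hu : MemLp (fun p : ℝ × R3 => u p.1 p.2) 2 (volume.restrict (spaceTime Ω X t)))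
    {D : ℝ → R3 → R3} (hD : MemLp (fun p : ℝ × R3 => D p.1 p.2) 2 (volume.restrict (spaceTime Ω X t)))
    {R r : ℝ × R3 → R3} (hR : MemLp R 2 (volume.restrict (spaceTime Ω X t)))
    (hr : ∀ᵐ p ∂(volume.restrict (Ioo 0 t ×ˢ Ω)), D p.1 (X p.1 p.2) = r p + R (lagrangeMap X p)) :
    ∫ p in Ioo 0 t ×ˢ Ω, ⟪u p.1 (X p.1 p.2), D p.1 (X p.1 p.2)⟫ =
      (∫ p in Ioo 0 t ×ˢ Ω, ⟪extGrad T Ω X p.1 p.2 (lagrIn T Ω X u p), r p⟫) +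
        ∫ p in spaceTime Ω X t, ⟪u p.1 p.2, R p⟫ := by
  have hPm : MeasurableSet (Ioo 0 t ×ˢ Ω) := measurableSet_Ioo.prod hΩ.measurableSet
  have hul := hX.memLp_comp_lagrangeMap hΩ ht.2.le hu
  have hDl := hX.memLp_comp_lagrangeMap hΩ ht.2.le hD
  have hRl := hX.memLp_comp_lagrangeMap hΩ ht.2.le hR
  rw [hX.integral_spaceTime hΩ ht.2.le (integrable_inner hu hR).1]
  have e : ∫ p in Ioo 0 t ×ˢ Ω, ⟪extGrad T Ω X p.1 p.2 (lagrIn T Ω X u p), r p⟫ =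
      ∫ p in Ioo 0 t ×ˢ Ω, (⟪u p.1 (X p.1 p.2), D p.1 (X p.1 p.2)⟫ -
        ⟪u p.1 (X p.1 p.2), R (lagrangeMap X p)⟫) := by
    refine integral_congr_ae ?_
    filter_upwards [hr, ae_restrict_mem hPm] with p hp hpP
    have hτ : p.1 ∈ Ioo 0 T := ⟨hpP.1.1, hpP.1.2.trans ht.2⟩
    rw [lagrIn_of_mem hτ, hX.extGrad_lagr (Ioo_subset_Icc_self hτ) hpP.2, hp, inner_add_right,
      add_sub_cancel_right]
  have i₁ : Integrable (fun p : ℝ × R3 => ⟪u p.1 (X p.1 p.2), D p.1 (X p.1 p.2)⟫)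
      (volume.restrict (Ioo 0 t ×ˢ Ω)) := integrable_inner hul hDl
  have i₂ : Integrable (fun p : ℝ × R3 => ⟪u p.1 (X p.1 p.2), R (lagrangeMap X p)⟫)
      (volume.restrict (Ioo 0 t ×ˢ Ω)) := integrable_inner hul hRl
  rw [e, integral_sub i₁ i₂]
  exact (sub_add_cancel _ _).symm

/-- Integration by parts in time for the regularizations. -/
theorem tendsto_integral_timeDeriv (hX : IsVolumePreservingTransformation T Ω X) (hΩ : IsOpen Ω)
    (hT : 0 < T) {ξ : ℝ → ℝ} (hξ : IsCutoff T ξ) {j : ℝ → ℝ → ℝ} (hj : IsMollifierFamily j)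
    (hu : MemLp (fun p : ℝ × R3 => u p.1 p.2) 2 (volume.restrict (spaceTime Ω X T)))
    (hv : MemLp (fun p : ℝ × R3 => v p.1 p.2) 2 (volume.restrict (spaceTime Ω X T)))
    (hGu : MemLp (fun p : ℝ × R3 => Gu p.1 p.2) 2 (volume.restrict (spaceTime Ω X T)))
    (hGv : MemLp (fun p : ℝ × R3 => Gv p.1 p.2) 2 (volume.restrict (spaceTime Ω X T)))
    (hwu : ∀ᵐ t ∂(volume.restrict (Ioo 0 T)), HasWeakGradient (domainAt Ω X t) (u t) (Gu t))
    (hwv : ∀ᵐ t ∂(volume.restrict (Ioo 0 T)), HasWeakGradient (domainAt Ω X t) (v t) (Gv t))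
    (hu2 : ∀ t ∈ Icc 0 T, MemLp (u t) 2 (volume.restrict (domainAt Ω X t)))
    (hv2 : ∀ t ∈ Icc 0 T, MemLp (v t) 2 (volume.restrict (domainAt Ω X t)))
    (hu0 : AttainsInitialValue Ω X u) (hv0 : AttainsInitialValue Ω X v) (ht : t ∈ Ioo 0 T)
    (hul : IsLebesgueTime (lagrIn T Ω X u) t) (hvl : IsLebesgueTime (lagrIn T Ω X v) t)
    (hMul : IsLebesgueTime (fun p => metric T Ω X p.1 p.2 (lagrIn T Ω X u p)) t)
    (hMvl : IsLebesgueTime (fun p => metric T Ω X p.1 p.2 (lagrIn T Ω X v p)) t)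
    {Du Dv : ℝ → ℝ → R3 → R3}
    (hDu : ∀ᶠ h in 𝓝[>] (0 : ℝ), HasL2TimeDeriv Ω X t (reg T Ω X ξ j u h) (Du h))
    (hDv : ∀ᶠ h in 𝓝[>] (0 : ℝ), HasL2TimeDeriv Ω X t (reg T Ω X ξ j v h) (Dv h)) :
    Tendsto (fun h : ℝ => ∫ τ in (0 : ℝ)..t, ∫ x in domainAt Ω X τ,
        (⟪u τ x, Dv h τ x⟫ + ⟪v τ x, Du h τ x⟫)) (𝓝[>] 0)
      (𝓝 (-(∫ τ in (0 : ℝ)..t, ∫ x in domainAt Ω X τ,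
          innerGrad u v Gu Gv τ x (timeDerivX Ω X τ x))
        + (∫ x in domainAt Ω X t, ⟪v t x, u t x⟫) - ∫ x in domainAt Ω X 0, ⟪v 0 x, u 0 x⟫)) := by
  obtain ⟨K, hK⟩ := hX.exists_extBound hΩ hT.le
  have h0T : (0 : ℝ) ∈ Icc 0 T := left_mem_Icc.2 hT.le
  have hPm : MeasurableSet (Ioo 0 t ×ˢ Ω) := measurableSet_Ioo.prod hΩ.measurableSet
  have hsub : spaceTime Ω X t ⊆ spaceTime Ω X T := spaceTime_mono ht.2.le
  have hut := hu.mono_measure (Measure.restrict_mono hsub le_rfl)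
  have hvt := hv.mono_measure (Measure.restrict_mono hsub le_rfl)
  obtain ⟨Ru, hRu, hRu'⟩ := hX.exists_regRate_decomposition hΩ hT hξ hj hu hGu hwu hu2 ht hDu
  obtain ⟨Rv, hRv, hRv'⟩ := hX.exists_regRate_decomposition hΩ hT hξ hj hv hGv hwv hv2 ht hDv
  have lim := (hK.tendsto_integral_regRate hΩ hj ht.1 (hX.memLp_lagrIn hΩ hT.le hu)
    (hX.memLp_lagrGradIn hΩ hT.le hu hGu) (hX.memLp_lagr_slice hΩ h0T (hu2 0 h0T))
    (hX.memLp_lagrIn hΩ hT.le hv) (hX.memLp_lagrGradIn hΩ hT.le hv hGv)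
    (hX.memLp_lagr_slice hΩ h0T (hv2 0 h0T)) (hX.tendstoInitial_lagrIn hΩ hT hu hu0)
    (hX.tendstoInitial_lagrIn hΩ hT hv hv0) hul hvl hMul hMvl).add
    ((hRv' _ hut).add (hRu' _ hvt))
  refine (lim.congr' ?_).trans_eq ?_
  · filter_upwards [hDu, hDv, hRu, hRv] with h hDu hDv hRu hRv
    have hi1 := integrable_inner hut hDv.2
    have hi2 := integrable_inner hvt hDu.2
    have e1 := hX.intervalIntegral_domainAt hΩ ht.1.le ht.2.le
      (f := fun p : ℝ × R3 => ⟪u p.1 p.2, Dv h p.1 p.2⟫ + ⟪v p.1 p.2, Du h p.1 p.2⟫) (hi1.add hi2)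
    have i1 := integrable_inner (hX.memLp_comp_lagrangeMap hΩ ht.2.le hut)
      (hX.memLp_comp_lagrangeMap hΩ ht.2.le hDv.2)
    have i2 := integrable_inner (hX.memLp_comp_lagrangeMap hΩ ht.2.le hvt)
      (hX.memLp_comp_lagrangeMap hΩ ht.2.le hDu.2)
    have e2 := hX.integral_inner_timeDeriv hΩ ht hut hDv.2 hRv.1 hRv.2
    have e3 := hX.integral_inner_timeDeriv hΩ ht hvt hDu.2 hRu.1 hRu.2
    simp only [lagrangeMap] at e1 i1 i2
    rw [e1, integral_add i1 i2, e2, e3]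
    ring
  · have e1 := hX.intervalIntegral_domainAt hΩ ht.1.le ht.2.le
      ((hX.integrableOn_innerGrad_timeDerivX hΩ hT.le hu hv hGu hGv).mono_set hsub)
    have e2 : ∫ p in Ioo 0 t ×ˢ Ω, (⟪extGrad T Ω X p.1 p.2 (lagrIn T Ω X u p),
          extGradRate T Ω X p.1 p.2 (lagrIn T Ω X v p) -
            spaceRate T Ω X (lagrIn T Ω X v) (lagrGradIn T Ω X v Gv) p⟫ +
        ⟪extGrad T Ω X p.1 p.2 (lagrIn T Ω X v p),
          extGradRate T Ω X p.1 p.2 (lagrIn T Ω X u p) -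
            spaceRate T Ω X (lagrIn T Ω X u) (lagrGradIn T Ω X u Gu) p⟫) =
        ∫ q in Ioo 0 t ×ˢ Ω, innerGrad u v Gu Gv (lagrangeMap X q).1 (lagrangeMap X q).2
          (timeDerivX Ω X (lagrangeMap X q).1 (lagrangeMap X q).2) := by
      refine setIntegral_congr_fun hPm fun p hp => ?_
      have hτ : p.1 ∈ Ioo 0 T := ⟨hp.1.1, hp.1.2.trans ht.2⟩
      have hτ' := Ioo_subset_Icc_self hτ
      simp only [lagrangeMap]
      rw [hX.extGradRate_sub_spaceRate hτ hp.2, hX.extGradRate_sub_spaceRate hτ hp.2,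
        lagrIn_of_mem hτ, lagrIn_of_mem hτ, hX.extGrad_lagr hτ' hp.2, hX.extGrad_lagr hτ' hp.2,
        innerGrad_apply, hX.timeDerivX_eq hτ hp.2, add_comm]
    have e3 : ∫ y, ⟪metric T Ω X t y (lagrIn T Ω X u (t, y)), lagrIn T Ω X v (t, y)⟫ =
        ∫ x in domainAt Ω X t, ⟪v t x, u t x⟫ := by
      rw [← hX.integral_metric_lagr hΩ (Ioo_subset_Icc_self ht)]
      refine integral_congr_ae (ae_of_all _ fun y => ?_)
      beta_reduce
      rw [lagrIn_of_mem (p := (t, y)) ht, lagrIn_of_mem (p := (t, y)) ht]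
    have e4 : ∫ y, ⟪metric T Ω X 0 y (lagrInit T Ω X u y), lagrInit T Ω X v y⟫ =
        ∫ x in domainAt Ω X 0, ⟪v 0 x, u 0 x⟫ := hX.integral_metric_lagr hΩ h0T
    -- The two zeros are the limits of the errors Ru and Rv, which are tested with the fixed fields
    -- v and u; weak convergence to zero is enough.
    rw [e1, e2, e3, e4, add_zero, add_zero]

end IsVolumePreservingTransformation

end MovingDomain

theorem mainTheorem7 (T : ℝ) (hT : 0 < T) (Ω : Set MovingDomain.R3) (hΩ : IsOpen Ω)
    (X : ℝ → MovingDomain.R3 → MovingDomain.R3)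
    (hX : MovingDomain.IsVolumePreservingTransformation T Ω X)
    (ξ : ℝ → ℝ) (hξ : MovingDomain.IsCutoff T ξ)
    (j : ℝ → ℝ → ℝ) (hj : MovingDomain.IsMollifierFamily j)
    (u v : ℝ → MovingDomain.R3 → MovingDomain.R3)
    (hu : MovingDomain.MemL2H1 T Ω X u) (hv : MovingDomain.MemL2H1 T Ω X v)
    (hu2 : ∀ t ∈ Icc 0 T, MemLp (u t) 2 (volume.restrict (MovingDomain.domainAt Ω X t)))
    (hv2 : ∀ t ∈ Icc 0 T, MemLp (v t) 2 (volume.restrict (MovingDomain.domainAt Ω X t)))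
    (hu0 : MovingDomain.AttainsInitialValue Ω X u)
    (hv0 : MovingDomain.AttainsInitialValue Ω X v) :
    -- for initial values in `H¹` the regularizations have weak time derivatives in `L²`
    (∀ w : ℝ → MovingDomain.R3 → MovingDomain.R3, (w = u ∨ w = v) →
      MovingDomain.MemH1 (MovingDomain.domainAt Ω X 0) (w 0) →
      ∀ t ∈ Ioo 0 T, ∀ h ∈ Ioo 0 (T - t), ∃ D : ℝ → MovingDomain.R3 → MovingDomain.R3,
        MovingDomain.HasL2TimeDeriv Ω X t (MovingDomain.reg T Ω X ξ j w h) D) ∧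
    -- `g = ∇(v · u)`, and the limit for almost every `t`
    ∃ g : ℝ → MovingDomain.R3 → MovingDomain.R3 →L[ℝ] ℝ,
      (∀ᵐ τ ∂(volume.restrict (Ioo 0 T)),
        MovingDomain.HasWeakGradient (MovingDomain.domainAt Ω X τ) (fun x => ⟪v τ x, u τ x⟫)
          (g τ)) ∧
      IntegrableOn (fun p : ℝ × MovingDomain.R3 => g p.1 p.2) (MovingDomain.spaceTime Ω X T) ∧
      IntegrableOn (fun p : ℝ × MovingDomain.R3 =>
        g p.1 p.2 (MovingDomain.timeDerivX Ω X p.1 p.2)) (MovingDomain.spaceTime Ω X T) ∧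
      ∀ᵐ t ∂(volume.restrict (Ioo 0 T)),
        ∀ Du Dv : ℝ → ℝ → MovingDomain.R3 → MovingDomain.R3,
          (∀ᶠ h in 𝓝[>] (0 : ℝ),
            MovingDomain.HasL2TimeDeriv Ω X t (MovingDomain.reg T Ω X ξ j u h) (Du h) ∧
            MovingDomain.HasL2TimeDeriv Ω X t (MovingDomain.reg T Ω X ξ j v h) (Dv h)) →
          Tendsto
            (fun h : ℝ => ∫ τ in (0 : ℝ)..t, ∫ x in MovingDomain.domainAt Ω X τ,
              (⟪u τ x, Dv h τ x⟫ + ⟪v τ x, Du h τ x⟫))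
            (𝓝[>] 0)
            (𝓝 (-(∫ τ in (0 : ℝ)..t, ∫ x in MovingDomain.domainAt Ω X τ,
                  g τ x (MovingDomain.timeDerivX Ω X τ x))
                + (∫ x in MovingDomain.domainAt Ω X t, ⟪v t x, u t x⟫)
                - ∫ x in MovingDomain.domainAt Ω X 0, ⟪v 0 x, u 0 x⟫)) := by
  refine ⟨?_, ?_⟩
  · rintro w (rfl | rfl) h0 t ht h hh
    · exact hX.exists_hasL2TimeDeriv_reg hΩ hT hξ hj hu hu2 h0 ht hh
    · exact hX.exists_hasL2TimeDeriv_reg hΩ hT hξ hj hv hv2 h0 ht hh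
  · obtain ⟨hu1, Gu, hGu, hwu⟩ := hu
    obtain ⟨hv1, Gv, hGv, hwv⟩ := hv
    refine ⟨MovingDomain.innerGrad u v Gu Gv,
      hX.ae_hasWeakGradient_inner hΩ hT.le hu2 hv2 hGu hGv hwu hwv,
      MovingDomain.IsVolumePreservingTransformation.integrableOn_innerGrad hu1 hv1 hGu hGv,
      hX.integrableOn_innerGrad_timeDerivX hΩ hT.le hu1 hv1 hGu hGv, ?_⟩
    -- The exceptional null set of times depends only on u, v and X, so it can be fixed before the
    -- derivatives Du and Dv are given.
    filter_upwards [hX.ae_isLebesgueTime hΩ hT.le hu1 hu2, hX.ae_isLebesgueTime hΩ hT.le hv1 hv2,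
      ae_restrict_mem measurableSet_Ioo] with t hut hvt ht Du Dv hD
    exact hX.tendsto_integral_timeDeriv hΩ hT hξ hj hu1 hv1 hGu hGv hwu hwv hu2 hv2 hu0 hv0 ht
      hut.1 hvt.1 hut.2 hvt.2 (hD.mono fun _ h => h.1) (hD.mono fun _ h => h.2)
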